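/- Let $d\ge 1$ and let $\mathcal P$ be a simple, locally finite, stationary point process in $\mathbb R^d$ with correlation functions $\rho^{(p)}:(\mathbb R^d)^p\to[0,\infty)$, $p\in\mathbb N$, so that $\mathbb E\sum^{\neq}_{x_1,\dots,x_p\in\mathcal P}F(x_1,\dots,x_p)=\int F\rho^{(p)}\,d\mathbf x$ for all measurable $F\ge 0$. Let $\mathbb P_{\mathbf x}$, with expectation $\mathbb E_{\mathbf x}$, be its (non-reduced) Palm distributions, so that $\mathbb E\sum^{\neq}_{x_1,\dots,x_p\in\mathcal P}F(\mathbf x,\mathcal P)=\int \mathbb E_{\mathbf x}[F(\mathbf x,\mathcal P)]\,\rho^{(p)}(\mathbf x)\,d\mathbf x$. Let $W_n=[-n^{1/d}/2,n^{1/d}/2]^d$ and $\mathcal P_n=\mathcal P\cap W_n$. Write $B_r(x)$ for the closed ball of radius $r$ around $x$. A score function is a measurable map $(x,\mathcal X)\mapsto\xi(x,\mathcal X)\in\mathbb R$, for $\mathcal X\subset\mathbb R^d$ locally finite and $x\in\mathcal X$, with $\xi(x+y,\mathcal X+y)=\xi(x,\mathcal X)$ for all $y\in\mathbb R^d$. Its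 radius of stabilization $R^\xi(x,\mathcal X)$, assumed measurable, is the smallest $r\in\mathbb N_0$ such that $\xi(x,(\mathcal X\cap B_r(x))\cup(\mathcal A\cap B_r(x)^c))=\xi(x,\mathcal X\cap B_r(x))$ for all locally finite $\mathcal A$, and $\infty$ if there is none. Let $0\le a<1$, $\hat a>0$ and $b,\beta,\gamma_1,\gamma_2\ge 0$, and assume that there are a constant $C_0\ge1$ and a nonnegative decreasing function $\Phi$ on $[0,\infty)$ with $\Phi(s)\le C_1e^{-c_1s^{\hat a}}$ for some $C_1,c_1>0$ and all $s\ge0$, such that the following hold. * (exponentially fast decay of correlations, EDC$(a,\hat a)$) $|\rho^{(p+q)}(\mathbf x,\mathbf y)-\rho^{(p)}(\mathbf x)\rho^{(q)}(\mathbf y)|\le C_0^{p+q}(p+q)!^a\,\Phi(\min_{i,j}|x_i-y_j|)$ for all $p,q\ge1$, $\mathbf x\in(\mathbb R^d)^p$ and $\mathbf y\in(\mathbb R^d)^q$ such that $x_1,\dots,x_p,y_1,\dots,y_q$ are pairwise distinct. * (stabilization, ST$(b)$) $\mathbb E_{\mathbf x}[R^\xi(x_i,\mathcal P_n)^N]\le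 C_0^NN!^b$ for all $n,p,N\ge1$, $i\le p$ and $\rho^{(p)}(\mathbf x)d\mathbf x$-almost all $\mathbf x\in W_n^p$. * (moment growth, MG$(\beta)$) $\mathbb E_{\mathbf x}[|\xi(x_i,\mathcal P_n)|^k]\le C_0^kk!^\beta$ for all $n\ge1$, $1\le p\le k$, $i\le p$ and $\rho^{(p)}(\mathbf x)d\mathbf x$-almost all $\mathbf x\in W_n^p$. * (power growth, PG$(\gamma_1,\gamma_2)$) $|\xi(x,\mathcal X\cap B_r(x))|\le C_0\max\{1,r\}^{\gamma_1}\,\#(\mathcal X\cap B_r(x))^{\gamma_2}$ for all locally finite $\mathcal X$, $x\in\mathcal X$ and $r\ge0$. For $\mathbf k\in\mathbb N^p$ put $m_{\mathbf k}(\mathbf x)=\mathbb E_{\mathbf x}\bigl[\prod_{i=1}^p\xi(x_i,\mathcal P)^{k_i}\bigr]\rho^{(p)}(\mathbf x)$ and assume that $$\sigma^2(\xi)=\int_{W_1}m_{(2)}(x)\,dx+\int_{W_1}\int_{\mathbb R^d}\bigl(m_{(1,1)}(x,y)-m_{(1)}(x)m_{(1)}(y)\bigr)\,dy\,dx>0$$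 (by stationarity this is $m_{(2)}(0)+\int_{\mathbb R^d}(m_{(1,1)}(0,z)-m_{(1)}(0)m_{(1)}(z))\,dz$). Let $f:\mathbb R^d\to\mathbb R$ be bounded and measurable with $\int_{W_1}f^2\,dx>0$, and let $$\mu_n^\xi(f)=\sum_{x\in\mathcal P_n}\xi(x,\mathcal P_n)f(n^{-1/d}x),\qquad X_n=\frac{\mu_n^\xi(f)-\mathbb E\mu_n^\xi(f)}{\sqrt{\operatorname{Var}\mu_n^\xi(f)}},$$ $$\gamma=\begin{cases}1+\max\{\gamma_2,\beta\}+\frac{d}{(1-a)\hat a}+\frac{bd^2}{(1-a)\hat a}&\text{if }\frac{(1-a)\hat a}{d}\le1,\\[2pt]1+\max\{\gamma_2,\beta\}+\frac{d}{\hat a}+a+bd&\text{otherwise.}\end{cases}$$ Then there are a constant $c>0$ and an $n_0\in\mathbb N$ such that, with $\Delta_n=c\sqrt n$, for all $n\ge n_0$ the statistic $\mu_n^\xi(f)$ is square integrable with positive variance and, for all $s\ge0$, $$\mathbb P(|X_n|\ge s)\le2\exp\Bigl(-\frac14\min\Bigl\{\frac{s^2}{2^{1+\gamma}},(s\Delta_n)^{1/(1+2\gamma)}\Bigr\}\Bigr).$$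 -/

import Mathlib

open MeasureTheory ProbabilityTheory
open scoped ENNReal Nat

/-- Locally finite subsets of `ℝ^d`: the configurations of a simple point process. -/
@[ext]
structure PointConfig (d : ℕ) where
  carrier : Set (EuclideanSpace ℝ (Fin d))
  finite_inter : ∀ K : Set (EuclideanSpace ℝ (Fin d)),
    Bornology.IsBounded K → (carrier ∩ K).Finite

namespace PointConfig

variable {d : ℕ}

/-- The restriction `X ∩ B`. -/
def restrict (X : PointConfig d) (B : Set (EuclideanSpace ℝ (Fin d))) : PointConfig d where
  carrier := X.carrier ∩ B
  finite_inter K hK := (X.finite_inter K hK).subset fun _ hx => ⟨hx.1.1, hx.2⟩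

/-- The union of two configurations. -/
def union (X Y : PointConfig d) : PointConfig d where
  carrier := X.carrier ∪ Y.carrier
  finite_inter K hK := by
    rw [Set.union_inter_distrib_right]
    exact (X.finite_inter K hK).union (Y.finite_inter K hK)

/-- The translate `X + y`. -/
def translate (y : EuclideanSpace ℝ (Fin d)) (X : PointConfig d) : PointConfig d where
  carrier := (fun x => x + y) '' X.carrier
  finite_inter K hK := by
    have hb : Bornology.IsBounded ((fun x => x + -y) '' K) :=
      (LipschitzWith.of_dist_le_mul (K := 1) (by simp)).isBounded_image hK
    refine ((X.finite_inter _ hb).image (fun x => x + y)).subset ?_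
    rintro _ ⟨⟨x, hx, rfl⟩, hK'⟩
    exact ⟨x, ⟨hx, ⟨x + y, hK', by simp⟩⟩, rfl⟩

/-- The `σ`-algebra generated by the counts `X ↦ #(X ∩ B)`, `B` bounded and measurable. -/
noncomputable instance : MeasurableSpace (PointConfig d) :=
  ⨆ (B : Set (EuclideanSpace ℝ (Fin d))) (_ : MeasurableSet B) (_ : Bornology.IsBounded B),
    MeasurableSpace.comap (fun X : PointConfig d => (X.carrier ∩ B).ncard) ⊤

end PointConfig

noncomputable section

/-- The window `W_n = [-n^{1/d}/2, n^{1/d}/2]^d`, a cube of volume `n`. -/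
def window (d n : ℕ) : Set (EuclideanSpace ℝ (Fin d)) :=
  {x | ∀ i, |x i| ≤ (n : ℝ) ^ (1 / (d : ℝ)) / 2}

/-- The sum of `F` over all `p`-tuples of pairwise distinct points of `X`. -/
def distinctSum {d p : ℕ} (X : PointConfig d)
    (F : (Fin p → EuclideanSpace ℝ (Fin d)) → ℝ≥0∞) : ℝ≥0∞ :=
  ∑' x : {x : Fin p → EuclideanSpace ℝ (Fin d) //
    Function.Injective x ∧ ∀ i, x i ∈ X.carrier}, F x.1

/-- The law `P` of a point process is stationary. -/
def IsStationaryLaw {d : ℕ} (P : Measure (PointConfig d)) : Prop :=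
  ∀ y, MeasurePreserving (PointConfig.translate y) P P

/-- `ρ p` is the `p`-th correlation function of the point process with law `P`, for every `p`. -/
structure IsCorrelationFunction {d : ℕ} (P : Measure (PointConfig d))
    (ρ : (p : ℕ) → (Fin p → EuclideanSpace ℝ (Fin d)) → ℝ) : Prop where
  measurable : ∀ p, Measurable (ρ p)
  nonneg : ∀ p x, 0 ≤ ρ p x
  symm : ∀ p (τ : Equiv.Perm (Fin p)) x, ρ p (x ∘ τ) = ρ p x
  lintegral_distinctSum : ∀ (p : ℕ) (F : (Fin p → EuclideanSpace ℝ (Fin d)) → ℝ≥0∞),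
    Measurable F →
      ∫⁻ X, distinctSum X F ∂P = ∫⁻ x, F x * ENNReal.ofReal (ρ p x)

/-- `Q p x` is the (non-reduced) `p`-fold Palm distribution `P_x` of the point process with law `P`
at `x = (x_1, …, x_p)`, in the sense of the refined Campbell formula. -/
structure IsPalm {d : ℕ} (P : Measure (PointConfig d))
    (ρ : (p : ℕ) → (Fin p → EuclideanSpace ℝ (Fin d)) → ℝ)
    (Q : (p : ℕ) → Kernel (Fin p → EuclideanSpace ℝ (Fin d)) (PointConfig d)) : Prop where
  isMarkovKernel : ∀ p, IsMarkovKernel (Q p)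
  campbell : ∀ (p : ℕ) (F : (Fin p → EuclideanSpace ℝ (Fin d)) → PointConfig d → ℝ≥0∞),
    Measurable (Function.uncurry F) →
      ∫⁻ X, distinctSum X (fun x => F x X) ∂P =
        ∫⁻ x, (∫⁻ X, F x X ∂(Q p x)) * ENNReal.ofReal (ρ p x)

/-- A nonnegative decreasing `Φ` on `[0, ∞)` that decays like `exp (-c s^ahat)`. -/
def ExpFastDecreasing (ahat : ℝ) (Φ : ℝ → ℝ) : Prop :=
  AntitoneOn Φ (Set.Ici 0) ∧ (∀ s, 0 ≤ s → 0 ≤ Φ s) ∧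
    ∃ c C : ℝ, 0 < c ∧ ∀ s, 0 ≤ s → Φ s ≤ C * Real.exp (-c * s ^ ahat)

/-- `EDC(a, ahat)`: exponentially fast decay of the correlation functions. -/
def CondEDC {d : ℕ} (ρ : (p : ℕ) → (Fin p → EuclideanSpace ℝ (Fin d)) → ℝ) (a ahat : ℝ) : Prop :=
  ∃ (C : ℝ) (Φ : ℝ → ℝ), 1 ≤ C ∧ ExpFastDecreasing ahat Φ ∧
    ∀ (p q : ℕ), 1 ≤ p → 1 ≤ q →
      ∀ (x : Fin p → EuclideanSpace ℝ (Fin d)) (y : Fin q → EuclideanSpace ℝ (Fin d)),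
        Function.Injective (Fin.append x y) →
          |ρ (p + q) (Fin.append x y) - ρ p x * ρ q y| ≤
            C ^ (p + q) * ((p + q)! : ℝ) ^ a * Φ (⨅ ij : Fin p × Fin q, dist (x ij.1) (y ij.2))

/-- A measurable, translation invariant score function; only its values `ξ x X` with `x ∈ X`
matter. -/
structure IsScore {d : ℕ} (ξ : EuclideanSpace ℝ (Fin d) → PointConfig d → ℝ) : Prop where
  measurable : Measurable (Function.uncurry ξ)
  translate : ∀ (y x : EuclideanSpace ℝ (Fin d)) (X : PointConfig d), x ∈ X.carrier →
    ξ (x + y) (X.translate y) = ξ x X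

/-- `ξ x X` is not affected by changes of `X` outside of the closed ball of radius `r`
around `x`. -/
def StabilizesAt {d : ℕ} (ξ : EuclideanSpace ℝ (Fin d) → PointConfig d → ℝ)
    (x : EuclideanSpace ℝ (Fin d)) (X : PointConfig d) (r : ℝ) : Prop :=
  ∀ A : PointConfig d,
    ξ x ((X.restrict (Metric.closedBall x r)).union (A.restrict (Metric.closedBall x r)ᶜ)) =
      ξ x (X.restrict (Metric.closedBall x r))

/-- The radius of stabilization `R^ξ(x, X)`: the smallest integer `r` at which `ξ x X`
stabilizes, and `∞` if there is none. -/
def stabRadius {d : ℕ} (ξ : EuclideanSpace ℝ (Fin d) → PointConfig d → ℝ)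
    (x : EuclideanSpace ℝ (Fin d)) (X : PointConfig d) : ℝ≥0∞ :=
  ⨅ (r : ℕ) (_ : StabilizesAt ξ x X r), (r : ℝ≥0∞)

/-- `ST(b)`: the Palm moments of the radius of stabilization satisfy
`E_x[R^ξ(x_i, P_n)^N] ≤ C^N N!^b`. -/
def CondST {d : ℕ} (ρ : (p : ℕ) → (Fin p → EuclideanSpace ℝ (Fin d)) → ℝ)
    (Q : (p : ℕ) → Kernel (Fin p → EuclideanSpace ℝ (Fin d)) (PointConfig d))
    (ξ : EuclideanSpace ℝ (Fin d) → PointConfig d → ℝ) (b : ℝ) : Prop :=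
  ∃ C : ℝ, 1 ≤ C ∧ ∀ n p N : ℕ, 1 ≤ n → 1 ≤ p → 1 ≤ N →
    ∀ᵐ x : Fin p → EuclideanSpace ℝ (Fin d), (∀ i, x i ∈ window d n) → 0 < ρ p x →
      ∀ i, ∫⁻ X, stabRadius ξ (x i) (X.restrict (window d n)) ^ N ∂(Q p x) ≤
        ENNReal.ofReal (C ^ N * (N ! : ℝ) ^ b)

/-- `MG(β)`: the Palm moments of the score satisfy `E_x[|ξ(x_i, P_n)|^k] ≤ C^k k!^β` for
`x = (x_1, …, x_p)` with `p ≤ k`. -/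
def CondMG {d : ℕ} (ρ : (p : ℕ) → (Fin p → EuclideanSpace ℝ (Fin d)) → ℝ)
    (Q : (p : ℕ) → Kernel (Fin p → EuclideanSpace ℝ (Fin d)) (PointConfig d))
    (ξ : EuclideanSpace ℝ (Fin d) → PointConfig d → ℝ) (β : ℝ) : Prop :=
  ∃ C : ℝ, 1 ≤ C ∧ ∀ n p k : ℕ, 1 ≤ n → 1 ≤ p → p ≤ k →
    ∀ᵐ x : Fin p → EuclideanSpace ℝ (Fin d), (∀ i, x i ∈ window d n) → 0 < ρ p x →
      ∀ i, ∫⁻ X, ENNReal.ofReal (|ξ (x i) (X.restrict (window d n))| ^ k) ∂(Q p x) ≤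
        ENNReal.ofReal (C ^ k * (k ! : ℝ) ^ β)

/-- `PG(γ₁, γ₂)`: the power growth condition. -/
def CondPG {d : ℕ} (ξ : EuclideanSpace ℝ (Fin d) → PointConfig d → ℝ) (γ₁ γ₂ : ℝ) : Prop :=
  ∃ C : ℝ, 1 ≤ C ∧ ∀ (X : PointConfig d) (x : EuclideanSpace ℝ (Fin d)) (r : ℝ),
    x ∈ X.carrier → 0 ≤ r →
      |ξ x (X.restrict (Metric.closedBall x r))| ≤
        C * max 1 r ^ γ₁ * ((X.carrier ∩ Metric.closedBall x r).ncard : ℝ) ^ γ₂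

/-- The statistic `μ_n^ξ(f) = ∑_{x ∈ P_n} ξ(x, P_n) f(n^{-1/d} x)`, where `P_n = P ∩ W_n`. -/
def geomStat {d : ℕ} (ξ : EuclideanSpace ℝ (Fin d) → PointConfig d → ℝ)
    (f : EuclideanSpace ℝ (Fin d) → ℝ) (n : ℕ) (X : PointConfig d) : ℝ :=
  ∑ᶠ x ∈ X.carrier ∩ window d n,
    ξ x (X.restrict (window d n)) * f ((n : ℝ) ^ (-(1 / (d : ℝ))) • x)

/-- The normalized statistic `X_n = (μ_n^ξ(f) - E μ_n^ξ(f)) / σ_n^ξ(f)`. -/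
def normStat {d : ℕ} (P : Measure (PointConfig d))
    (ξ : EuclideanSpace ℝ (Fin d) → PointConfig d → ℝ)
    (f : EuclideanSpace ℝ (Fin d) → ℝ) (n : ℕ) (X : PointConfig d) : ℝ :=
  (geomStat ξ f n X - ∫ Y, geomStat ξ f n Y ∂P) / √(variance (geomStat ξ f n) P)

/-- The correlation functions `m_k(x) = E_x[∏ ξ(x_i, P)^{k_i}] ρ^{(p)}(x)` of the `ξ`-weighted
measure on all of `ℝ^d`. -/
def weightedCorrelation {d : ℕ} (ρ : (p : ℕ) → (Fin p → EuclideanSpace ℝ (Fin d)) → ℝ)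
    (Q : (p : ℕ) → Kernel (Fin p → EuclideanSpace ℝ (Fin d)) (PointConfig d))
    (ξ : EuclideanSpace ℝ (Fin d) → PointConfig d → ℝ) {p : ℕ} (k : Fin p → ℕ)
    (x : Fin p → EuclideanSpace ℝ (Fin d)) : ℝ :=
  (∫ X, ∏ i, ξ (x i) X ^ k i ∂(Q p x)) * ρ p x

/-- The asymptotic variance
`σ²(ξ) = m_{(2)}(0) + ∫ (m_{(1,1)}(0, z) - m_{(1)}(0) m_{(1)}(z)) dz`.
Correlation functions and Palm distributions are determined almost everywhere only, so the base
point `0`, which does not matter under stationarity, is averaged over the unit cube `W_1`. -/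
def asympVariance {d : ℕ} (ρ : (p : ℕ) → (Fin p → EuclideanSpace ℝ (Fin d)) → ℝ)
    (Q : (p : ℕ) → Kernel (Fin p → EuclideanSpace ℝ (Fin d)) (PointConfig d))
    (ξ : EuclideanSpace ℝ (Fin d) → PointConfig d → ℝ) : ℝ :=
  (∫ x in window d 1, weightedCorrelation ρ Q ξ ![2] ![x]) +
    ∫ x in window d 1, ∫ y,
      (weightedCorrelation ρ Q ξ ![1, 1] ![x, y] -
        weightedCorrelation ρ Q ξ ![1] ![x] * weightedCorrelation ρ Q ξ ![1] ![y])

/-- The exponent `γ`. -/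
def gammaExponent (d : ℕ) (a ahat b β γ₂ : ℝ) : ℝ :=
  if (1 - a) * ahat / d ≤ 1 then
    1 + max γ₂ β + d / ((1 - a) * ahat) + b * (d : ℝ) ^ 2 / ((1 - a) * ahat)
  else
    1 + max γ₂ β + d / ahat + a + b * d

end

/-! The tail bound comes from a Statulevičius condition on the cumulants of the statistic: with t²
its variance, |κ_j| ≤ t^j j!^(1+2γ) / Δ^(j-2) for j ≥ 3, where Δ is of order √n. This condition has
two ingredients: a bound |κ_j| ≤ const · n · A^j · j!^(1+2γ) for all cumulants
(`IsMixing.exists_cumulant_bound`, with the exponents compared in `le_gammaExponent`), and a lower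
bound of order n for the variance (`IsMixing.exists_variance_lower_bound`). Both rest on a
quantitative decorrelation of the point process.

Decorrelation. A function H of two finite configurations is the sum of its Möbius transform over
pairs of finite subsets. By the Campbell formula the means of H(X ∩ A, X ∩ B), and of H(X ∩ A, Y ∩
B) with Y an independent copy of X, are two series with the same weights, one with the densities
ρ^(l+m), the other with ρ^(l) ρ^(m). Their difference is estimated term by term from the decay of
correlations (`exists_mixing`): it is at most T K exp((K V)^(1/(1-a)) - c δ^ahat) when A and B have
volume at most V and distance at least δ, and H grows at most like T times 3 to the number of
points.

Locality. The statistic is cut into sums over unit cubes. Markov's inequality for N-th moments shows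
that, outside an event of probability of order exp(-N), the scores in a cube have stabilization
radius of order N^b and size of order N^β (`HasScoreMoments.isLocalizable`). Truncated scores are
local and bounded, so decorrelation applies to products of k cube sums as soon as two groups of
cubes are at distance of order k^(1/((1-a) ahat)) N^w with w = `lengthExponent`
(`IsMixing.exists_field_mixing`).

Cumulants. By multilinearity the k-th cumulant is a sum of joint cumulants over k-tuples of cubes. A
joint cumulant is small when the tuple falls into two distant groups
(`abs_jointCumulant_le_of_split`). Tuples that do not are chained, and they are counted by recording
a root, a parent for every other entry, and the increment to the parent
(`card_filter_isChained_le`). The exponent of k! collects β + 1 from the moments of products, 1 from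
the choice of parents, and d/((1-a) ahat) + w d from the number of increments.

Variance. Stationarity makes the truncated pair correlation of the whole-space scores a function of
the offset, which is integrable by decorrelation. Dominated convergence then gives the limit of the
variance per volume for whole-space scores, a positive multiple of ∫ f² over the unit window.
Replacing them by the scores seen in the window changes the variance by o(n): covariances of cubes
are uniformly summable, and cubes deep inside the window hardly notice its boundary.

Tail. Moments are dominated by the exponential generating function of the cumulant bounds
(`abs_moment_le_exp_cumulantSeq`); Markov's inequality for an even moment of well-chosen order gives
the tail (`measureReal_le_of_cumulantSeq_le`). -/

namespace PointConfig

/-! ### Configurations: measurability of restrictions and of sums over points -/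

variable {d : ℕ}

theorem ext_carrier {X Y : PointConfig d} (h : X.carrier = Y.carrier) : X = Y :=
  PointConfig.ext h

@[simp] theorem restrict_carrier (X : PointConfig d) (B : Set (EuclideanSpace ℝ (Fin d))) :
    (X.restrict B).carrier = X.carrier ∩ B := rfl

theorem restrict_restrict (X : PointConfig d) (A B : Set (EuclideanSpace ℝ (Fin d))) :
    (X.restrict A).restrict B = X.restrict (A ∩ B) :=
  ext_carrier (Set.inter_assoc _ _ _)

theorem restrict_restrict_of_subset (X : PointConfig d) {A B : Set (EuclideanSpace ℝ (Fin d))}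
    (h : B ⊆ A) : (X.restrict A).restrict B = X.restrict B := by
  rw [restrict_restrict, Set.inter_eq_self_of_subset_right h]

theorem countable_carrier (X : PointConfig d) : X.carrier.Countable := by
  have : X.carrier = ⋃ n : ℕ, X.carrier ∩ Metric.closedBall 0 n := by
    rw [← Set.inter_iUnion, Metric.iUnion_closedBall_nat, Set.inter_univ]
  rw [this]
  exact Set.countable_iUnion fun n => (X.finite_inter _ Metric.isBounded_closedBall).countable

instance (X : PointConfig d) : Countable X.carrier := X.countable_carrier.to_subtype

theorem measurable_ncard_inter {B : Set (EuclideanSpace ℝ (Fin d))} (hB : MeasurableSet B)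
    (hb : Bornology.IsBounded B) : Measurable fun X : PointConfig d => (X.carrier ∩ B).ncard := by
  rw [measurable_iff_comap_le]
  exact le_iSup_of_le B (le_iSup_of_le hB (le_iSup_of_le hb le_rfl))

theorem measurable_of_ncard {T : Type*} [MeasurableSpace T] {g : T → PointConfig d}
    (h : ∀ B, MeasurableSet B → Bornology.IsBounded B →
      Measurable fun t => ((g t).carrier ∩ B).ncard) : Measurable g := by
  rw [measurable_iff_le_map]
  refine iSup_le fun B => iSup_le fun hB => iSup_le fun hb => ?_
  rw [← measurable_iff_le_map, measurable_comap_iff]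
  exact h B hB hb

theorem measurable_restrict {B : Set (EuclideanSpace ℝ (Fin d))} (hB : MeasurableSet B) :
    Measurable fun X : PointConfig d => X.restrict B := by
  refine measurable_of_ncard fun C hC hb => ?_
  simp only [restrict_carrier, Set.inter_assoc]
  exact measurable_ncard_inter (hB.inter hC) (hb.subset Set.inter_subset_right)

/-- The counting measure of the points of a configuration. -/
noncomputable def pointMeasure (X : PointConfig d) : Measure (EuclideanSpace ℝ (Fin d)) :=
  Measure.sum fun x : X.carrier => Measure.dirac x.1

theorem pointMeasure_apply (X : PointConfig d) {B : Set (EuclideanSpace ℝ (Fin d))}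
    (hB : MeasurableSet B) (hb : Bornology.IsBounded B) :
    X.pointMeasure B = ((X.carrier ∩ B).ncard : ℝ≥0∞) := by
  rw [pointMeasure, Measure.sum_apply _ hB]
  simp only [Measure.dirac_apply' _ hB]
  rw [tsum_subtype X.carrier (B.indicator 1), Set.indicator_indicator,
    ← tsum_subtype (X.carrier ∩ B) (1 : EuclideanSpace ℝ (Fin d) → ℝ≥0∞)]
  simp only [Pi.one_apply]
  rw [ENNReal.tsum_set_one, ← (X.finite_inter B hb).cast_ncard_eq]
  rfl

/-- The sum of `F` over the points of a configuration. -/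
noncomputable def pointSum (X : PointConfig d) (F : EuclideanSpace ℝ (Fin d) → ℝ≥0∞) : ℝ≥0∞ :=
  ∑' x : X.carrier, F x

theorem pointSum_eq_lintegral (X : PointConfig d) (F : EuclideanSpace ℝ (Fin d) → ℝ≥0∞) :
    X.pointSum F = ∫⁻ x, F x ∂X.pointMeasure := by
  simp [pointSum, pointMeasure, lintegral_sum_measure]

theorem pointSum_indicator (X : PointConfig d) {B : Set (EuclideanSpace ℝ (Fin d))}
    (hB : MeasurableSet B) (F : EuclideanSpace ℝ (Fin d) → ℝ≥0∞) :
    X.pointSum (B.indicator F) = ∫⁻ x in B, F x ∂X.pointMeasure := by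
  rw [pointSum_eq_lintegral, lintegral_indicator hB]

/-- The counting measures on B are finite but not uniformly so. Splitting according to the number m
of points in B gives finite kernels, against which integrals are measurable; for each configuration
exactly one m contributes. -/
theorem measurable_pointSum_indicator {T : Type*} [MeasurableSpace T] {g : T → PointConfig d}
    (hg : Measurable g) {F : T → EuclideanSpace ℝ (Fin d) → ℝ≥0∞}
    (hF : Measurable (Function.uncurry F)) {B : Set (EuclideanSpace ℝ (Fin d))}
    (hB : MeasurableSet B) (hb : Bornology.IsBounded B) :
    Measurable fun t => (g t).pointSum (B.indicator (F t)) := by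
  classical
  let K : ℕ → Kernel T (EuclideanSpace ℝ (Fin d)) := fun m =>
    { toFun := fun t => if ((g t).carrier ∩ B).ncard = m then (g t).pointMeasure.restrict B else 0
      measurable' := by
        refine Measure.measurable_of_measurable_coe _ fun s hs => ?_
        have h1 : ∀ t, (if ((g t).carrier ∩ B).ncard = m then
            (g t).pointMeasure.restrict B else 0) s =
            if ((g t).carrier ∩ B).ncard = m then (((g t).carrier ∩ (s ∩ B)).ncard : ℝ≥0∞)
              else 0 := by
          intro t
          split_ifs
          · rw [Measure.restrict_apply hs,
              pointMeasure_apply _ (hs.inter hB) (hb.subset Set.inter_subset_right)]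
          · simp
        simp only [h1]
        refine Measurable.ite ?_ ?_ measurable_const
        · exact ((measurable_ncard_inter hB hb).comp hg) (measurableSet_singleton m)
        · exact (measurable_from_top (f := fun k : ℕ => (k : ℝ≥0∞))).comp
            ((measurable_ncard_inter (hs.inter hB)
              (hb.subset Set.inter_subset_right)).comp hg) }
  have hK : ∀ m t, K m t =
      if ((g t).carrier ∩ B).ncard = m then (g t).pointMeasure.restrict B else 0 := fun m t => rfl
  have hfin : ∀ m, IsFiniteKernel (K m) := fun m =>
    ⟨⟨m, by simp, fun t => by
      rw [hK]
      split_ifs with h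
      · rw [Measure.restrict_apply_univ, pointMeasure_apply _ hB hb, h]
      · simp⟩⟩
  have : (fun t => (g t).pointSum (B.indicator (F t))) =
      fun t => ∑' m, ∫⁻ x, F t x ∂(K m t) := by
    ext t
    rw [tsum_eq_single ((g t).carrier ∩ B).ncard, hK, if_pos rfl, pointSum_indicator _ hB]
    intro m hm
    rw [hK, if_neg (Ne.symm hm)]
    simp
  rw [this]
  exact Measurable.tsum fun m => hF.lintegral_kernel_prod_right

theorem measurable_pointSum {T : Type*} [MeasurableSpace T] {g : T → PointConfig d}
    (hg : Measurable g) {F : T → EuclideanSpace ℝ (Fin d) → ℝ≥0∞}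
    (hF : Measurable (Function.uncurry F)) :
    Measurable fun t => (g t).pointSum (F t) := by
  have : (fun t => (g t).pointSum (F t)) =
      fun t => ⨆ n : ℕ, (g t).pointSum ((Metric.closedBall 0 n).indicator (F t)) := by
    ext t
    simp only [pointSum_indicator _ measurableSet_closedBall]
    rw [pointSum_eq_lintegral, ← setLIntegral_univ, ← Metric.iUnion_closedBall_nat 0,
      setLIntegral_iUnion_of_directed]
    exact Monotone.directed_le fun m n h => Metric.closedBall_subset_closedBall (by exact_mod_cast h)
  rw [this]
  exact Measurable.iSup fun n =>
    measurable_pointSum_indicator hg hF measurableSet_closedBall Metric.isBounded_closedBall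

end PointConfig

open PointConfig

/-! ### Sums over tuples of distinct points -/

section DistinctSum

variable {d : ℕ}

theorem distinctSum_eq_tsum_ite {p : ℕ} (X : PointConfig d)
    (F : (Fin p → EuclideanSpace ℝ (Fin d)) → ℝ≥0∞) :
    distinctSum X F = ∑' x : Fin p → X.carrier,
      {x : Fin p → EuclideanSpace ℝ (Fin d) | Function.Injective x}.indicator F
        (fun i => (x i).1) := by
  let e : {x : Fin p → EuclideanSpace ℝ (Fin d) // Function.Injective x ∧ ∀ i, x i ∈ X.carrier} ≃
      {x : Fin p → X.carrier | Function.Injective fun i => (x i).1} :=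
    { toFun := fun x => ⟨fun i => ⟨x.1 i, x.2.2 i⟩, x.2.1⟩
      invFun := fun x => ⟨fun i => (x.1 i).1, x.2, fun i => (x.1 i).2⟩
      left_inv := fun x => rfl
      right_inv := fun x => rfl }
  rw [distinctSum, ← e.symm.tsum_eq]
  exact tsum_subtype {x : Fin p → X.carrier | Function.Injective fun i => (x i).1}
    fun x => F fun i => (x i).1

theorem distinctSum_zero (X : PointConfig d)
    (F : (Fin 0 → EuclideanSpace ℝ (Fin d)) → ℝ≥0∞) : distinctSum X F = F default := by
  rw [distinctSum_eq_tsum_ite, tsum_eq_single default (fun b hb => absurd (Subsingleton.elim _ _) hb)]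
  rw [Set.indicator_of_mem]
  · congr 1; exact Subsingleton.elim _ _
  · exact Function.injective_of_subsingleton _

/-- Peeling off the first point turns a sum over tuples into iterated point sums; this is how
measurability is proved by induction on the length. -/
theorem distinctSum_succ {p : ℕ} (X : PointConfig d)
    (F : (Fin (p + 1) → EuclideanSpace ℝ (Fin d)) → ℝ≥0∞) :
    distinctSum X F = X.pointSum fun a => distinctSum X fun y =>
      {y : Fin p → EuclideanSpace ℝ (Fin d) | ∀ i, y i ≠ a}.indicator
        (fun y => F (Fin.cons a y)) y := by
  rw [distinctSum_eq_tsum_ite, ← (Fin.consEquiv fun _ : Fin (p + 1) => X.carrier).tsum_eq,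
    ENNReal.summable.tsum_prod' fun _ => ENNReal.summable]
  refine tsum_congr fun a => ?_
  refine Eq.trans ?_ (distinctSum_eq_tsum_ite _ _).symm
  refine tsum_congr fun y => ?_
  have h1 : (fun i => ((Fin.consEquiv fun _ : Fin (p + 1) => X.carrier) (a, y) i).1) =
      (Fin.cons a.1 fun i => (y i).1 : Fin (p + 1) → EuclideanSpace ℝ (Fin d)) := by
    ext i
    refine Fin.cases ?_ (fun j => ?_) i <;> rfl
  rw [h1]
  have h2 : Function.Injective
      (Fin.cons a.1 fun i => (y i).1 : Fin (p + 1) → EuclideanSpace ℝ (Fin d)) ↔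
      Function.Injective (fun i => (y i).1) ∧ ∀ i, (y i).1 ≠ a.1 := by
    rw [Fin.cons_injective_iff]
    simp only [Set.mem_range, not_exists, ne_eq]
    tauto
  by_cases h3 : Function.Injective (fun i => (y i).1) <;>
    by_cases h4 : ∀ i, (y i).1 ≠ a.1 <;>
    simp only [Set.indicator, Set.mem_ofPred_eq, h2, h3, h4] <;> simp

theorem distinctSum_one (X : PointConfig d)
    (F : (Fin 1 → EuclideanSpace ℝ (Fin d)) → ℝ≥0∞) :
    distinctSum X F = X.pointSum fun a => F ![a] := by
  rw [distinctSum_succ]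
  congr 1 with a
  rw [distinctSum_zero, Set.indicator_of_mem]
  · congr 1
    ext i; fin_cases i; rfl
  · intro i; exact i.elim0

theorem measurable_distinctSum {T : Type*} [MeasurableSpace T] {g : T → PointConfig d}
    (hg : Measurable g) {p : ℕ} {F : T → (Fin p → EuclideanSpace ℝ (Fin d)) → ℝ≥0∞}
    (hF : Measurable (Function.uncurry F)) :
    Measurable fun t => distinctSum (g t) (F t) := by
  induction p generalizing T with
  | zero =>
    simp only [distinctSum_zero]
    exact hF.comp (measurable_id.prodMk measurable_const)
  | succ p ih =>
    simp only [distinctSum_succ]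
    refine measurable_pointSum hg ?_
    -- The peeled point joins the parameter, which is why the induction generalizes over the
    -- parameter space.
    have := ih (T := T × EuclideanSpace ℝ (Fin d)) (g := fun t => g t.1) (hg.comp measurable_fst)
      (F := fun t => {y : Fin p → EuclideanSpace ℝ (Fin d) | ∀ i, y i ≠ t.2}.indicator
        (fun y => F t.1 (Fin.cons t.2 y))) ?_
    · exact this
    · have hS : MeasurableSet {q : (T × EuclideanSpace ℝ (Fin d)) ×
          (Fin p → EuclideanSpace ℝ (Fin d)) | ∀ i, q.2 i ≠ q.1.2} := by
        have : ∀ i, MeasurableSet {q : (T × EuclideanSpace ℝ (Fin d)) ×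
            (Fin p → EuclideanSpace ℝ (Fin d)) | q.2 i ≠ q.1.2} := fun i =>
          (measurableSet_eq_fun (by fun_prop) (by fun_prop)).compl
        simpa only [Set.ofPred_forall] using MeasurableSet.iInter this
      have h2 : Measurable fun q : (T × EuclideanSpace ℝ (Fin d)) ×
          (Fin p → EuclideanSpace ℝ (Fin d)) => F q.1.1 (Fin.cons q.1.2 q.2) := by
        refine hF.comp ((measurable_fst.comp measurable_fst).prodMk ?_)
        refine measurable_pi_lambda _ fun i => ?_
        refine Fin.cases ?_ (fun j => ?_) i
        · exact (measurable_snd.comp measurable_fst :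
            Measurable fun q : (T × EuclideanSpace ℝ (Fin d)) ×
              (Fin p → EuclideanSpace ℝ (Fin d)) => q.1.2)
        · exact ((measurable_pi_apply j).comp measurable_snd :
            Measurable fun q : (T × EuclideanSpace ℝ (Fin d)) ×
              (Fin p → EuclideanSpace ℝ (Fin d)) => q.2 j)
      exact (h2.indicator hS)

end DistinctSum

/-! ### Möbius inversion on finite sets, and subsets versus tuples -/

section FiniteSums

/-- After exchanging the sums, the inner alternating sum runs over all subsets of s \ s₂ and
vanishes unless s₂ = s. -/
theorem Finset.sum_powerset_sum_powerset_neg_one {α : Type*} [DecidableEq α] (G : Finset α → ℝ)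
    (s : Finset α) :
    ∑ s₁ ∈ s.powerset, ∑ s₂ ∈ s₁.powerset, (-1 : ℝ) ^ (s₁ \ s₂).card * G s₂ = G s := by
  have h1 : ∑ s₁ ∈ s.powerset, ∑ s₂ ∈ s₁.powerset, (-1 : ℝ) ^ (s₁ \ s₂).card * G s₂ =
      ∑ s₂ ∈ s.powerset, ∑ s₃ ∈ (s \ s₂).powerset, (-1 : ℝ) ^ s₃.card * G s₂ := by
    rw [Finset.sum_sigma', Finset.sum_sigma']
    refine Finset.sum_bij' (fun x _ => ⟨x.2, x.1 \ x.2⟩) (fun x _ => ⟨x.1 ∪ x.2, x.1⟩) ?_ ?_ ?_ ?_ ?_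
    · rintro ⟨s₁, s₂⟩ h
      simp only [Finset.mem_sigma, Finset.mem_powerset] at h ⊢
      exact ⟨h.2.trans h.1, Finset.sdiff_subset_sdiff h.1 le_rfl⟩
    · rintro ⟨s₂, s₃⟩ h
      simp only [Finset.mem_sigma, Finset.mem_powerset] at h ⊢
      exact ⟨Finset.union_subset h.1 (h.2.trans Finset.sdiff_subset), Finset.subset_union_left⟩
    · rintro ⟨s₁, s₂⟩ h
      simp only [Finset.mem_sigma, Finset.mem_powerset] at h ⊢
      rw [Finset.union_sdiff_of_subset h.2]
    · rintro ⟨s₂, s₃⟩ h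
      simp only [Finset.mem_sigma, Finset.mem_powerset] at h ⊢
      rw [Finset.union_sdiff_cancel_left]
      exact (Finset.disjoint_sdiff.mono_right h.2)
    · rintro ⟨s₁, s₂⟩ h
      rfl
  rw [h1]
  have h2 : ∀ s₂ ∈ s.powerset, ∑ s₃ ∈ (s \ s₂).powerset, (-1 : ℝ) ^ s₃.card * G s₂ =
      if s₂ = s then G s else 0 := by
    intro s₂ hs₂
    rw [← Finset.sum_mul]
    have := Finset.sum_powerset_neg_one_pow_card (x := s \ s₂)
    have h3 : ∑ s₃ ∈ (s \ s₂).powerset, (-1 : ℝ) ^ s₃.card = if s \ s₂ = ∅ then 1 else 0 := by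
      exact_mod_cast this
    rw [h3]
    by_cases h : s₂ = s
    · simp [h]
    · rw [if_neg h, if_neg, zero_mul]
      rw [Finset.sdiff_eq_empty_iff_subset]
      exact fun h' => h (Finset.Subset.antisymm (Finset.mem_powerset.1 hs₂) h')
  rw [Finset.sum_congr rfl h2]
  simp

variable {d : ℕ}

/-- Each set with l elements is the range of exactly l! injective tuples. This passes from sums over
subsets, where Möbius inversion lives, to sums over tuples, where the Campbell formula applies. -/
theorem sum_powersetCard_eq_distinctSum [DecidableEq (EuclideanSpace ℝ (Fin d))]
    (X : PointConfig d) (hX : X.carrier.Finite) (l : ℕ)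
    (u : Finset (EuclideanSpace ℝ (Fin d)) → ℝ≥0∞) :
    distinctSum X (fun x : Fin l → _ => u (Finset.univ.image x)) =
      l ! * ∑ s₁ ∈ hX.toFinset.powersetCard l, u s₁ := by
  have key : ∀ (w w' : hX.toFinset.powersetCard l) (f : Fin l ≃ w.1) (g : Fin l ≃ w'.1),
      (∀ i, (f i).1 = (g i).1) →
        (⟨w, f⟩ : Σ w : hX.toFinset.powersetCard l, (Fin l ≃ w.1)) = ⟨w', g⟩ := by
    intro w w' f g h
    have hw : w = w' := by
      ext y
      refine ⟨fun hy => ?_, fun hy => ?_⟩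
      · have := h (f.symm ⟨y, hy⟩)
        rw [Equiv.apply_symm_apply] at this
        simpa [← this] using (g (f.symm ⟨y, hy⟩)).2
      · have := h (g.symm ⟨y, hy⟩)
        rw [Equiv.apply_symm_apply] at this
        simpa [this] using (f (g.symm ⟨y, hy⟩)).2
    subst hw
    congr 1
    exact Equiv.ext fun i => Subtype.ext (h i)
  let e : {x : Fin l → EuclideanSpace ℝ (Fin d) // Function.Injective x ∧ ∀ i, x i ∈ X.carrier} ≃
      Σ s₁ : hX.toFinset.powersetCard l, (Fin l ≃ s₁.1) :=
    { toFun := fun x => ⟨⟨Finset.univ.image x.1, by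
          rw [Finset.mem_powersetCard]
          refine ⟨?_, by rw [Finset.card_image_of_injective _ x.2.1]; simp⟩
          intro y hy
          obtain ⟨i, -, rfl⟩ := Finset.mem_image.1 hy
          simpa using x.2.2 i⟩,
          Equiv.ofBijective (fun i => ⟨x.1 i, Finset.mem_image_of_mem _ (Finset.mem_univ i)⟩)
            ⟨fun i j h => x.2.1 (congrArg Subtype.val h), fun y => by
              obtain ⟨i, -, hi⟩ := Finset.mem_image.1 y.2
              exact ⟨i, Subtype.ext hi⟩⟩⟩
      invFun := fun z => ⟨fun i => (z.2 i).1, fun i j h => z.2.injective (Subtype.ext h), fun i => by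
        have := (Finset.mem_powersetCard.1 z.1.2).1 (z.2 i).2
        simpa using this⟩
      left_inv := fun x => rfl
      right_inv := by
        rintro ⟨w, f⟩
        exact key _ _ _ _ fun i => rfl }
  rw [distinctSum, ← e.symm.tsum_eq, ENNReal.tsum_sigma']
  have h1 : ∀ (s₁ : hX.toFinset.powersetCard l) (f : Fin l ≃ s₁.1),
      u (Finset.univ.image (e.symm ⟨s₁, f⟩).1) = u s₁.1 := by
    intro s₁ f
    have := congrArg (fun z => z.1.1) (e.apply_symm_apply ⟨s₁, f⟩)
    exact congrArg u this
  simp only [h1]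
  have h2 : ∀ s₁ : hX.toFinset.powersetCard l, ∑' _ : Fin l ≃ s₁.1, u s₁.1 = l ! * u s₁.1 := by
    intro s₁
    have hc : Fintype.card s₁.1 = l := by
      rw [Fintype.card_coe]; exact (Finset.mem_powersetCard.1 s₁.2).2
    rw [tsum_fintype, Finset.sum_const, Finset.card_univ,
      Fintype.card_equiv (Fintype.equivFinOfCardEq hc).symm, Fintype.card_fin, nsmul_eq_mul]
  simp only [h2]
  rw [ENNReal.tsum_mul_left, Finset.tsum_subtype (hX.toFinset.powersetCard l) u]

theorem sum_powerset_eq_tsum_distinctSum [DecidableEq (EuclideanSpace ℝ (Fin d))]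
    (X : PointConfig d) (hX : X.carrier.Finite)
    (u : Finset (EuclideanSpace ℝ (Fin d)) → ℝ≥0∞) :
    ∑ s₁ ∈ hX.toFinset.powerset, u s₁ =
      ∑' l : ℕ, (l ! : ℝ≥0∞)⁻¹ * distinctSum X (fun x : Fin l → _ => u (Finset.univ.image x)) := by
  have h1 : ∀ l : ℕ, (l ! : ℝ≥0∞)⁻¹ * distinctSum X
      (fun x : Fin l → _ => u (Finset.univ.image x)) =
      ∑ s₁ ∈ hX.toFinset.powersetCard l, u s₁ := by
    intro l
    rw [sum_powersetCard_eq_distinctSum X hX, ← mul_assoc, ENNReal.inv_mul_cancel, one_mul]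
    · exact_mod_cast (Nat.factorial_pos l).ne'
    · exact ENNReal.natCast_ne_top _
  simp only [h1]
  rw [Finset.sum_powerset, tsum_eq_sum]
  intro l hl
  rw [Finset.powersetCard_eq_empty.2, Finset.sum_empty]
  simpa using hl

theorem distinctSum_restrict {p : ℕ} (X : PointConfig d) (B : Set (EuclideanSpace ℝ (Fin d)))
    (F : (Fin p → EuclideanSpace ℝ (Fin d)) → ℝ≥0∞) :
    distinctSum (X.restrict B) F = distinctSum X ({x | ∀ i, x i ∈ B}.indicator F) := by
  refine (tsum_subtype {x : Fin p → EuclideanSpace ℝ (Fin d) | Function.Injective x ∧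
    ∀ i, x i ∈ (X.restrict B).carrier} F).trans (Eq.trans ?_
    (tsum_subtype {x : Fin p → EuclideanSpace ℝ (Fin d) | Function.Injective x ∧
      ∀ i, x i ∈ X.carrier} _).symm)
  rw [Set.indicator_indicator]
  congr 2
  have : {x : Fin p → EuclideanSpace ℝ (Fin d) | Function.Injective x ∧
      ∀ i, x i ∈ (X.restrict B).carrier} = {x | Function.Injective x ∧ ∀ i, x i ∈ X.carrier} ∩
        {x | ∀ i, x i ∈ B} := by
    ext x
    simp only [PointConfig.restrict_carrier, Set.mem_inter_iff, Set.mem_ofPred_eq, forall_and]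
    tauto
  rw [this]

end FiniteSums

/-! ### Constant intensity and growth of the correlation functions -/

section Correlation

variable {d : ℕ} {P : Measure (PointConfig d)}
  {ρ : (p : ℕ) → (Fin p → EuclideanSpace ℝ (Fin d)) → ℝ}

theorem PointConfig.pointSum_translate (X : PointConfig d) (y : EuclideanSpace ℝ (Fin d))
    (F : EuclideanSpace ℝ (Fin d) → ℝ≥0∞) :
    (X.translate y).pointSum F = X.pointSum fun x => F (x + y) := by
  rw [pointSum, pointSum]
  exact tsum_image (f := F) (g := fun x => x + y) (s := X.carrier)
    (fun a _ b _ h => add_right_cancel h)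

theorem measurable_vecOne : Measurable fun x : EuclideanSpace ℝ (Fin d) => ![x] := by
  refine measurable_pi_lambda _ fun i => ?_
  fin_cases i
  exact measurable_id

theorem lintegral_fin_one (F : (Fin 1 → EuclideanSpace ℝ (Fin d)) → ℝ≥0∞) :
    ∫⁻ x, F x = ∫⁻ x, F ![x] := by
  have := (volume_preserving_funUnique (Fin 1) (EuclideanSpace ℝ (Fin d))).symm
  refine (this.lintegral_comp_emb (MeasurableEquiv.measurableEmbedding _) F).symm.trans ?_
  refine lintegral_congr fun x => ?_
  congr 1
  ext i; fin_cases i; rfl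

theorem lintegral_pointSum (hρ : IsCorrelationFunction P ρ)
    {F : EuclideanSpace ℝ (Fin d) → ℝ≥0∞} (hF : Measurable F) :
    ∫⁻ X, X.pointSum F ∂P = ∫⁻ x, F x * ENNReal.ofReal (ρ 1 ![x]) := by
  have := hρ.lintegral_distinctSum 1 (fun x => F (x 0)) (by fun_prop)
  simp only [distinctSum_one] at this
  rw [lintegral_fin_one] at this
  exact this

/-- Testing the Campbell formula on Borel sets, stationarity gives for each shift y that ρ^(1) is
almost everywhere invariant under y. Fubini exchanges the null sets and yields one base point x₀
whose value is taken almost everywhere. -/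
theorem exists_intensity [SFinite P] (hP : IsStationaryLaw P) (hρ : IsCorrelationFunction P ρ) :
    ∃ r : ℝ, 0 ≤ r ∧ ∀ᵐ x : EuclideanSpace ℝ (Fin d), ρ 1 ![x] = r := by
  set f : EuclideanSpace ℝ (Fin d) → ℝ≥0∞ := fun x => ENNReal.ofReal (ρ 1 ![x]) with hf
  have hfm : Measurable f := ((hρ.measurable 1).comp measurable_vecOne).ennreal_ofReal
  have h1 : ∀ y, ∀ᵐ x, f (x - y) = f x := by
    intro y
    refine ae_eq_of_forall_setLIntegral_eq_of_sigmaFinite (hfm.comp (measurable_id.sub_const y)) hfm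
      fun s hs _ => ?_
    have h2 : ∫⁻ X, X.pointSum (s.indicator 1) ∂P =
        ∫⁻ X, (X.translate y).pointSum (s.indicator 1) ∂P := by
      rw [← (hP y).lintegral_comp]
      exact PointConfig.measurable_pointSum measurable_id
        ((measurable_one.indicator hs).comp measurable_snd)
    simp only [PointConfig.pointSum_translate] at h2
    have h6 : Measurable fun x => s.indicator (1 : EuclideanSpace ℝ (Fin d) → ℝ≥0∞) (x + y) :=
      (measurable_one.indicator hs).comp (measurable_id.add_const y)
    rw [lintegral_pointSum hρ (measurable_one.indicator hs), lintegral_pointSum hρ h6,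
      ← lintegral_sub_right_eq_self (fun x => s.indicator 1 (x + y) * _) y] at h2
    rw [← lintegral_indicator hs, ← lintegral_indicator hs]
    refine (lintegral_congr fun x => ?_).trans (h2.symm.trans (lintegral_congr fun x => ?_)) <;>
      by_cases h : x ∈ s <;> simp [h, hf]
  have h3 : ∀ᵐ z : EuclideanSpace ℝ (Fin d) × EuclideanSpace ℝ (Fin d), f (z.2 - z.1) = f z.2 := by
    refine (Measure.ae_prod_iff_ae_ae ?_).2 ?_
    rotate_left
    · exact Filter.Eventually.of_forall h1
    · exact measurableSet_eq_fun (by fun_prop) (by fun_prop)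
  -- From "for every shift, at almost every point" to "at almost every point, for almost every
  -- shift".
  have h4 := Measure.ae_ae_of_ae_prod (Measure.measurePreserving_swap.quasiMeasurePreserving.ae h3)
  obtain ⟨x₀, hx₀⟩ := h4.exists
  refine ⟨ρ 1 ![x₀], hρ.nonneg _ _, ?_⟩
  have h5 := (quasiMeasurePreserving_sub_left volume x₀).ae hx₀
  filter_upwards [h5] with x hx
  simp only [Prod.swap, sub_sub_cancel, hf] at hx
  exact (ENNReal.ofReal_eq_ofReal_iff (hρ.nonneg _ _) (hρ.nonneg _ _)).1 hx

/-- The coincidence set of two coordinates is the kernel of x ↦ x_i - x_j, a proper subspace because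
d ≥ 1. -/
theorem ae_injective (hd : 1 ≤ d) (p : ℕ) :
    ∀ᵐ x : Fin p → EuclideanSpace ℝ (Fin d), Function.Injective x := by
  have : ∀ i j : Fin p, i ≠ j → ∀ᵐ x : Fin p → EuclideanSpace ℝ (Fin d), x i ≠ x j := by
    intro i j hij
    let L : (Fin p → EuclideanSpace ℝ (Fin d)) →ₗ[ℝ] EuclideanSpace ℝ (Fin d) :=
      { toFun := fun x => x i - x j
        map_add' := fun x y => by simp only [Pi.add_apply]; abel
        map_smul' := fun c x => by simp [smul_sub] }
    have hL : LinearMap.ker L ≠ ⊤ := by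
      intro h
      have : Nonempty (Fin d) := ⟨⟨0, hd⟩⟩
      obtain ⟨v, hv⟩ := exists_ne (0 : EuclideanSpace ℝ (Fin d))
      have : Function.update (0 : Fin p → EuclideanSpace ℝ (Fin d)) i v ∈ LinearMap.ker L := by
        rw [h]; trivial
      simp [L, hij.symm] at this
      exact hv this
    have := Measure.addHaar_submodule (volume : Measure (Fin p → EuclideanSpace ℝ (Fin d))) _ hL
    rw [ae_iff]
    convert this using 2
    ext x
    simp [L, sub_eq_zero]
  have h2 : ∀ᵐ x : Fin p → EuclideanSpace ℝ (Fin d), ∀ i j, i ≠ j → x i ≠ x j := by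
    refine ae_all_iff.2 fun i => ae_all_iff.2 fun j => ?_
    by_cases hij : i = j
    · exact Filter.Eventually.of_forall fun x h => absurd hij h
    · filter_upwards [this i j hij] with x hx _ using hx
  filter_upwards [h2] with x hx i j h
  by_contra hij
  exact hx i j hij h

/-- Points are split off one at a time: decay of correlations with q = 1 and Φ ≤ Φ(0) gives ρ^(p+1)
≤ r ρ^(p) + C^(p+1) (p+1)!^a Φ(0), where r is the intensity. The constant r + C + C Φ(0) closes this
recursion. -/
theorem exists_correlation_bound (hd : 1 ≤ d) [SFinite P] (hP : IsStationaryLaw P)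
    (hρ : IsCorrelationFunction P ρ) {a ahat : ℝ} (ha : 0 ≤ a) (hEDC : CondEDC ρ a ahat) :
    ∃ K : ℝ, 1 ≤ K ∧ ∀ p : ℕ, ∀ᵐ x : Fin p → EuclideanSpace ℝ (Fin d),
      1 ≤ p → ρ p x ≤ K ^ p * (p ! : ℝ) ^ a := by
  obtain ⟨r, hr, hr1⟩ := exists_intensity hP hρ
  obtain ⟨C, Φ, hC, ⟨hΦ, hΦ0, -⟩, h⟩ := hEDC
  have hΦ00 := hΦ0 0 le_rfl
  refine ⟨r + C + C * Φ 0, by nlinarith, fun p => ?_⟩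
  -- On injective tuples all of whose coordinates see the intensity r, the induction is pointwise:
  -- both properties pass to the initial segment.
  have h1 : ∀ᵐ x : Fin p → EuclideanSpace ℝ (Fin d), ∀ i, ρ 1 ![x i] = r :=
    ae_all_iff.2 fun i => (Measure.quasiMeasurePreserving_eval
      (fun _ : Fin p => (volume : Measure (EuclideanSpace ℝ (Fin d)))) i).ae hr1
  filter_upwards [h1, ae_injective hd p] with x hx hinj hp
  clear h1
  induction p, hp using Nat.le_induction with
  | base =>
    have : ![x 0] = x := by ext i; fin_cases i; rfl
    rw [← this, hx]
    simp
    nlinarith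
  | succ p hp ih =>
    have hxe : Fin.append (Fin.init x) (fun _ : Fin 1 => x (Fin.last p)) = x := by
      rw [Fin.append_right_eq_snoc, Fin.snoc_init_self]
    have h2 := h p 1 hp le_rfl (Fin.init x) (fun _ => x (Fin.last p)) (by rw [hxe]; exact hinj)
    rw [hxe] at h2
    have h3 : ρ 1 (fun _ => x (Fin.last p)) = r := by
      rw [← hx (Fin.last p)]; congr 1; ext i; fin_cases i; rfl
    have h4 := ih (Fin.init x) (fun i => hx _)
      (hinj.comp (Fin.castSucc_injective p))
    have h5 : Φ (⨅ ij : Fin p × Fin 1, dist (Fin.init x ij.1) (x (Fin.last p))) ≤ Φ 0 :=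
      hΦ (Set.mem_Ici.2 le_rfl) (Set.mem_Ici.2 (Real.iInf_nonneg fun _ => dist_nonneg))
        (Real.iInf_nonneg fun _ => dist_nonneg)
    rw [h3] at h2
    have h6 : ((p ! : ℝ)) ^ a ≤ (((p + 1)! : ℕ) : ℝ) ^ a :=
      Real.rpow_le_rpow (by positivity) (by exact_mod_cast Nat.factorial_le (Nat.le_succ p)) ha
    set K := r + C + C * Φ 0 with hK
    have hCK : C ^ p ≤ K ^ p := pow_le_pow_left₀ (by linarith) (by nlinarith) p
    have hA : (0 : ℝ) < (((p + 1)! : ℕ) : ℝ) ^ a := by positivity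
    set A := (((p + 1)! : ℕ) : ℝ) ^ a
    have hKp : 0 < K ^ p := pow_pos (by nlinarith) p
    calc ρ (p + 1) x ≤ ρ p (Fin.init x) * r + C ^ (p + 1) * A * Φ 0 := by
          have := (abs_le.1 h2).2
          have h7 : C ^ (p + 1) * A * Φ (⨅ ij : Fin p × Fin 1,
              dist (Fin.init x ij.1) (x (Fin.last p))) ≤ C ^ (p + 1) * A * Φ 0 := by gcongr
          linarith
      _ ≤ K ^ p * A * r + K ^ p * C * A * Φ 0 := by
          rw [pow_succ C p]
          have : ρ p (Fin.init x) ≤ K ^ p * A := h4.trans (by gcongr)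
          gcongr
      _ ≤ K ^ (p + 1) * A := by
          rw [pow_succ K p, hK]
          have : 0 ≤ K ^ p * A * C := by positivity
          rw [← hK]
          nlinarith

end Correlation

/-! ### Campbell formulas for pairs of tuples, in one configuration or in two independent ones -/

section TwoCampbell

variable {d : ℕ} {P : Measure (PointConfig d)}
  {ρ : (p : ℕ) → (Fin p → EuclideanSpace ℝ (Fin d)) → ℝ}

theorem measurePreserving_append (α : Type*) [MeasureSpace α] [SigmaFinite (volume : Measure α)]
    (m n : ℕ) :
    MeasurePreserving (fun z : (Fin m → α) × (Fin n → α) => Fin.append z.1 z.2) := by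
  have hm : Measurable fun z : (Fin m → α) × (Fin n → α) => Fin.append z.1 z.2 := by
    refine measurable_pi_lambda _ fun i => ?_
    refine Fin.addCases (fun j => ?_) (fun j => ?_) i
    · simp only [Fin.append_left]; fun_prop
    · simp only [Fin.append_right]; fun_prop
  refine ⟨hm, (Measure.pi_eq fun s hs => ?_).symm⟩
  rw [Measure.map_apply hm (MeasurableSet.univ_pi hs)]
  have : (fun z : (Fin m → α) × (Fin n → α) => Fin.append z.1 z.2) ⁻¹' Set.univ.pi s =
      (Set.univ.pi fun i => s (Fin.castAdd n i)) ×ˢ (Set.univ.pi fun i => s (Fin.natAdd m i)) := by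
    ext z
    simp only [Set.mem_preimage, Set.mem_pi, Set.mem_univ, true_imp_iff, Set.mem_prod]
    refine ⟨fun h => ⟨fun i => by simpa using h (Fin.castAdd n i),
      fun i => by simpa using h (Fin.natAdd m i)⟩, fun h i => ?_⟩
    refine Fin.addCases (fun j => ?_) (fun j => ?_) i
    · simpa using h.1 j
    · simpa using h.2 j
  rw [this, Measure.volume_eq_prod, Measure.prod_prod, volume_pi_pi, volume_pi_pi,
    Fin.prod_univ_add]

/-- Two tuples from the same configuration may share points; as w vanishes in that case,
concatenation identifies the double sum with a sum over tuples of length m + n. -/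
theorem distinctSum_distinctSum {m n : ℕ} (X : PointConfig d)
    (w : (Fin m → EuclideanSpace ℝ (Fin d)) → (Fin n → EuclideanSpace ℝ (Fin d)) → ℝ≥0∞)
    (hw : ∀ x y, w x y ≠ 0 → ∀ i j, x i ≠ y j) :
    distinctSum X (fun x => distinctSum X (w x)) =
      distinctSum X fun v : Fin (m + n) → EuclideanSpace ℝ (Fin d) =>
        w (fun i => v (Fin.castAdd n i)) (fun i => v (Fin.natAdd m i)) := by
  rw [distinctSum_eq_tsum_ite, distinctSum_eq_tsum_ite,
    ← (Fin.appendEquiv (α := X.carrier) m n).tsum_eq,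
    ENNReal.summable.tsum_prod' fun _ => ENNReal.summable]
  refine tsum_congr fun x => ?_
  have h1 : ∀ y : Fin n → X.carrier, (fun i => (Fin.append x y i).1) =
      Fin.append (fun i => (x i).1) (fun i => (y i).1) := by
    intro y
    ext1 i
    refine Fin.addCases (fun j => ?_) (fun j => ?_) i <;> simp
  by_cases hx : Function.Injective fun i => (x i).1
  · rw [Set.indicator_of_mem (by exact hx), distinctSum_eq_tsum_ite]
    refine tsum_congr fun y => ?_
    change _ = Set.indicator _ _ (fun i => (Fin.append x y i).1)
    rw [h1 y]
    by_cases h0 : w (fun i => (x i).1) (fun i => (y i).1) = 0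
    · rw [Set.indicator_apply_eq_zero.2 fun _ => h0, eq_comm, Set.indicator_apply_eq_zero]
      intro _
      simpa using h0
    · by_cases hy : Function.Injective fun i => (y i).1
      · rw [Set.indicator_of_mem (by exact hy), Set.indicator_of_mem]
        · simp
        · exact Fin.append_injective_iff.2 ⟨hx, hy, fun i j => hw _ _ h0 i j⟩
      · rw [Set.indicator_of_notMem (by exact hy), Set.indicator_of_notMem]
        exact fun h => hy (Fin.append_injective_iff.1 h).2.1
  · rw [Set.indicator_of_notMem (by exact hx), eq_comm, ENNReal.tsum_eq_zero]
    intro y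
    change Set.indicator _ _ (fun i => (Fin.append x y i).1) = 0
    rw [h1 y, Set.indicator_of_notMem]
    exact fun h => hx (Fin.append_injective_iff.1 h).1

theorem lintegral_distinctSum_diag (hρ : IsCorrelationFunction P ρ) {m n : ℕ}
    {w : (Fin m → EuclideanSpace ℝ (Fin d)) → (Fin n → EuclideanSpace ℝ (Fin d)) → ℝ≥0∞}
    (hwm : Measurable (Function.uncurry w)) (hw : ∀ x y, w x y ≠ 0 → ∀ i j, x i ≠ y j) :
    ∫⁻ X, distinctSum X (fun x => distinctSum X (w x)) ∂P =
      ∫⁻ z : (Fin m → EuclideanSpace ℝ (Fin d)) × (Fin n → EuclideanSpace ℝ (Fin d)),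
        w z.1 z.2 * ENNReal.ofReal (ρ (m + n) (Fin.append z.1 z.2)) := by
  simp only [distinctSum_distinctSum _ w hw]
  have hm : Measurable fun v : Fin (m + n) → EuclideanSpace ℝ (Fin d) =>
      w (fun i => v (Fin.castAdd n i)) (fun i => v (Fin.natAdd m i)) :=
    hwm.comp (Measurable.prodMk (by fun_prop) (by fun_prop))
  rw [hρ.lintegral_distinctSum _ _ hm]
  refine ((measurePreserving_append (EuclideanSpace ℝ (Fin d)) m n).lintegral_comp
      (hm.mul (hρ.measurable _).ennreal_ofReal)).symm.trans (lintegral_congr fun z => ?_)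
  simp

/-- Counterpart of `lintegral_distinctSum_diag` for independent configurations: the weight is the
same and only the density changes, from ρ^(m+n) to ρ^(m) ρ^(n). -/
theorem lintegral_distinctSum_prod [SFinite P] (hρ : IsCorrelationFunction P ρ) {m n : ℕ}
    {w : (Fin m → EuclideanSpace ℝ (Fin d)) → (Fin n → EuclideanSpace ℝ (Fin d)) → ℝ≥0∞}
    (hwm : Measurable (Function.uncurry w)) :
    ∫⁻ Z, distinctSum Z.1 (fun x => distinctSum Z.2 (w x)) ∂(P.prod P) =
      ∫⁻ z : (Fin m → EuclideanSpace ℝ (Fin d)) × (Fin n → EuclideanSpace ℝ (Fin d)),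
        w z.1 z.2 * ENNReal.ofReal (ρ m z.1 * ρ n z.2) := by
  have h1 : Measurable fun q : PointConfig d × (Fin m → EuclideanSpace ℝ (Fin d)) =>
      distinctSum q.1 (w q.2) :=
    measurable_distinctSum measurable_fst (F := fun q => w q.2)
      (hwm.comp ((measurable_snd.comp measurable_fst).prodMk measurable_snd))
  have h2 : Measurable fun Z : PointConfig d × PointConfig d =>
      distinctSum Z.1 (fun x => distinctSum Z.2 (w x)) :=
    measurable_distinctSum measurable_fst (F := fun Z x => distinctSum Z.2 (w x))
      (h1.comp ((measurable_snd.comp measurable_fst).prodMk measurable_snd))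
  rw [lintegral_prod _ h2.aemeasurable]
  have h3 : ∀ X : PointConfig d, ∫⁻ Y, distinctSum X (fun x => distinctSum Y (w x)) ∂P =
      distinctSum X fun x => ∫⁻ y, w x y * ENNReal.ofReal (ρ n y) := by
    intro X
    simp only [distinctSum_eq_tsum_ite X]
    have hm : ∀ x : Fin m → X.carrier, Measurable fun Y : PointConfig d =>
        {x : Fin m → EuclideanSpace ℝ (Fin d) | Function.Injective x}.indicator
          (fun x => distinctSum Y (w x)) (fun i => (x i).1) := by
      intro x
      by_cases hx : Function.Injective fun i => (x i).1
      · simp only [Set.indicator_of_mem (show (fun i => (x i).1) ∈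
          {x : Fin m → EuclideanSpace ℝ (Fin d) | Function.Injective x} from hx)]
        exact h1.comp (measurable_id.prodMk measurable_const)
      · simp only [Set.indicator_of_notMem (show (fun i => (x i).1) ∉
          {x : Fin m → EuclideanSpace ℝ (Fin d) | Function.Injective x} from hx)]
        exact measurable_const
    rw [lintegral_tsum fun x => (hm x).aemeasurable]
    refine tsum_congr fun x => ?_
    by_cases hx : Function.Injective fun i => (x i).1
    · simp only [Set.indicator_of_mem (show (fun i => (x i).1) ∈
          {x : Fin m → EuclideanSpace ℝ (Fin d) | Function.Injective x} from hx)]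
      exact hρ.lintegral_distinctSum n _ (hwm.comp (measurable_const.prodMk measurable_id))
    · simp only [Set.indicator_of_notMem (show (fun i => (x i).1) ∉
          {x : Fin m → EuclideanSpace ℝ (Fin d) | Function.Injective x} from hx)]
      simp
  simp only [h3]
  have h4 : Measurable fun z : (Fin m → EuclideanSpace ℝ (Fin d)) ×
      (Fin n → EuclideanSpace ℝ (Fin d)) => w z.1 z.2 * ENNReal.ofReal (ρ n z.2) :=
    hwm.mul ((hρ.measurable n).ennreal_ofReal.comp measurable_snd)
  have h5 : Measurable fun z : (Fin m → EuclideanSpace ℝ (Fin d)) ×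
      (Fin n → EuclideanSpace ℝ (Fin d)) => w z.1 z.2 * ENNReal.ofReal (ρ m z.1 * ρ n z.2) :=
    hwm.mul (((hρ.measurable m).comp measurable_fst).mul
      ((hρ.measurable n).comp measurable_snd)).ennreal_ofReal
  rw [hρ.lintegral_distinctSum m _ h4.lintegral_prod_right', Measure.volume_eq_prod,
    lintegral_prod _ h5.aemeasurable]
  refine lintegral_congr fun x => ?_
  refine (lintegral_mul_const _ (h4.comp (measurable_const.prodMk measurable_id))).symm.trans
    (lintegral_congr fun y => ?_)
  simp only [Function.comp, id]
  rw [ENNReal.ofReal_mul (hρ.nonneg _ _)]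
  ring

end TwoCampbell

/-! ### The Möbius transform of a function of two finite configurations -/

section Moebius

variable {d : ℕ}

/-- A finite set of points as a configuration. -/
def PointConfig.ofFinset (s : Finset (EuclideanSpace ℝ (Fin d))) : PointConfig d where
  carrier := s
  finite_inter _ _ := s.finite_toSet.inter_of_left _

open Classical in
/-- The configuration of the points `x j`, `j ∈ J`, of a tuple of pairwise distinct points. -/
noncomputable def tupleConfig {l : ℕ} (J : Finset (Fin l)) (x : Fin l → EuclideanSpace ℝ (Fin d)) :
    PointConfig d :=
  PointConfig.ofFinset (if Function.Injective x then J.image x else ∅)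

theorem measurableSet_injective (l : ℕ) :
    MeasurableSet {x : Fin l → EuclideanSpace ℝ (Fin d) | Function.Injective x} := by
  have : {x : Fin l → EuclideanSpace ℝ (Fin d) | Function.Injective x} =
      ⋂ i, ⋂ j, {x | x i = x j → i = j} := by
    ext x; simp [Function.Injective]
  rw [this]
  refine MeasurableSet.iInter fun i => MeasurableSet.iInter fun j => ?_
  by_cases h : i = j
  · simp [h]
  · simp only [h, imp_false]
    exact (measurableSet_eq_fun (by fun_prop) (by fun_prop)).compl

/-- On injective tuples the number of points in B is the number of j in J with x_j in B. Other
tuples are sent to the empty configuration, so that the counts need no correction for repeated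
points. -/
theorem measurable_tupleConfig {l : ℕ} (J : Finset (Fin l)) :
    Measurable (tupleConfig (d := d) J) := by
  classical
  refine PointConfig.measurable_of_ncard fun B hB _ => ?_
  have : (fun x : Fin l → EuclideanSpace ℝ (Fin d) => ((tupleConfig J x).carrier ∩ B).ncard) =
      {x : Fin l → EuclideanSpace ℝ (Fin d) | Function.Injective x}.indicator
        fun x => ∑ j ∈ J, if x j ∈ B then 1 else 0 := by
    ext x
    by_cases hx : Function.Injective x
    · rw [Set.indicator_of_mem (by exact hx)]
      have : (tupleConfig J x).carrier ∩ B = ((J.filter fun j => x j ∈ B).image x : Finset _) := by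
        ext y
        simp only [tupleConfig, hx, if_true, PointConfig.ofFinset]
        simp only [Finset.coe_image, Finset.coe_filter, Set.mem_inter_iff, Set.mem_image,
          Finset.mem_coe, Set.mem_ofPred_eq]
        constructor
        · rintro ⟨⟨j, hj, rfl⟩, h⟩; exact ⟨j, ⟨hj, h⟩, rfl⟩
        · rintro ⟨j, ⟨hj, h⟩, rfl⟩; exact ⟨⟨j, hj, rfl⟩, h⟩
      rw [this, Set.ncard_coe_finset, Finset.card_image_of_injective _ hx, Finset.card_filter]
    · rw [Set.indicator_of_notMem (by exact hx)]
      simp [tupleConfig, hx, PointConfig.ofFinset]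
  rw [this]
  refine Measurable.indicator ?_ (measurableSet_injective l)
  refine Finset.measurable_sum _ fun j _ => Measurable.ite ?_ measurable_const measurable_const
  exact measurable_pi_apply j hB

variable (H : PointConfig d → PointConfig d → ℝ)

open Classical in
/-- The Moebius transform of `H` in both arguments. -/
noncomputable def moebius (s t : Finset (EuclideanSpace ℝ (Fin d))) : ℝ :=
  ∑ s' ∈ s.powerset, (-1 : ℝ) ^ (s \ s').card *
    ∑ t' ∈ t.powerset, (-1 : ℝ) ^ (t \ t').card * H (.ofFinset s') (.ofFinset t')

open Classical in
theorem sum_moebius (s t : Finset (EuclideanSpace ℝ (Fin d))) :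
    ∑ s' ∈ s.powerset, ∑ t' ∈ t.powerset, moebius H s' t' = H (.ofFinset s) (.ofFinset t) := by
  have h1 : ∀ s' ∈ s.powerset, ∑ t' ∈ t.powerset, moebius H s' t' =
      ∑ s'' ∈ s'.powerset, (-1 : ℝ) ^ (s' \ s'').card * H (.ofFinset s'') (.ofFinset t) := by
    intro s' _
    simp only [moebius]
    rw [Finset.sum_comm]
    refine Finset.sum_congr rfl fun s'' _ => ?_
    rw [← Finset.mul_sum]
    congr 1
    exact Finset.sum_powerset_sum_powerset_neg_one (fun t' => H (.ofFinset s'') (.ofFinset t')) t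
  rw [Finset.sum_congr rfl h1]
  exact Finset.sum_powerset_sum_powerset_neg_one (fun s' => H (.ofFinset s') (.ofFinset t)) s

/-- The sum of 3^|u'| over the subsets u' of u is (3 + 1)^|u|. -/
theorem abs_moebius_le {T : ℝ}
    (hH : ∀ s t : Finset (EuclideanSpace ℝ (Fin d)),
      |H (.ofFinset s) (.ofFinset t)| ≤ T * 3 ^ s.card * 3 ^ t.card)
    (s t : Finset (EuclideanSpace ℝ (Fin d))) :
    |moebius H s t| ≤ T * 4 ^ s.card * 4 ^ t.card := by
  classical
  have h4 : ∀ u : Finset (EuclideanSpace ℝ (Fin d)), ∑ u' ∈ u.powerset, (3 : ℝ) ^ u'.card =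
      4 ^ u.card := by
    intro u
    have := Finset.sum_pow_mul_eq_add_pow (3 : ℝ) 1 u
    simp only [one_pow, mul_one] at this
    rw [this]; norm_num
  calc |moebius H s t| ≤ ∑ s' ∈ s.powerset, ∑ t' ∈ t.powerset, T * 3 ^ s'.card * 3 ^ t'.card := by
        refine (Finset.abs_sum_le_sum_abs _ _).trans (Finset.sum_le_sum fun s' _ => ?_)
        rw [abs_mul, abs_pow, abs_neg, abs_one, one_pow, one_mul]
        refine (Finset.abs_sum_le_sum_abs _ _).trans (Finset.sum_le_sum fun t' _ => ?_)
        rw [abs_mul, abs_pow, abs_neg, abs_one, one_pow, one_mul]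
        exact hH s' t'
    _ = T * 4 ^ s.card * 4 ^ t.card := by
        simp only [← Finset.mul_sum, h4]
        rw [← Finset.sum_mul, ← Finset.mul_sum, h4]

/-- The Moebius transform of `H` at the points of two tuples. -/
noncomputable def tupleMoebius {l m : ℕ} (x : Fin l → EuclideanSpace ℝ (Fin d))
    (y : Fin m → EuclideanSpace ℝ (Fin d)) : ℝ :=
  ∑ I : Finset (Fin l), (-1 : ℝ) ^ (Finset.univ \ I).card *
    ∑ J : Finset (Fin m), (-1 : ℝ) ^ (Finset.univ \ J).card *
      H (tupleConfig I x) (tupleConfig J y)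

-- The tuple version of the transform is what can be measurable in the points; both versions agree
-- on injective tuples.
open Classical in
theorem moebius_image {l m : ℕ} {x : Fin l → EuclideanSpace ℝ (Fin d)}
    (hx : Function.Injective x) {y : Fin m → EuclideanSpace ℝ (Fin d)}
    (hy : Function.Injective y) :
    moebius H (Finset.univ.image x) (Finset.univ.image y) = tupleMoebius H x y := by
  have key : ∀ {n : ℕ} {v : Fin n → EuclideanSpace ℝ (Fin d)}, Function.Injective v →
      ∀ F : Finset (EuclideanSpace ℝ (Fin d)) → ℝ,
      ∑ s ∈ (Finset.univ.image v).powerset, (-1 : ℝ) ^ ((Finset.univ.image v) \ s).card * F s =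
      ∑ I : Finset (Fin n), (-1 : ℝ) ^ (Finset.univ \ I).card * F (I.image v) := by
    intro n v hv F
    rw [Finset.powerset_image, Finset.sum_image (Finset.image_injective hv).injOn,
      Finset.powerset_univ]
    refine Finset.sum_congr rfl fun I _ => ?_
    rw [← Finset.image_sdiff _ _ hv, Finset.card_image_of_injective _ hv]
  rw [moebius, key hx (fun s' => ∑ t' ∈ (Finset.univ.image y).powerset,
    (-1 : ℝ) ^ ((Finset.univ.image y) \ t').card * H (.ofFinset s') (.ofFinset t')), tupleMoebius]
  refine Finset.sum_congr rfl fun I _ => ?_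
  rw [key hy (fun t' => H (.ofFinset (I.image x)) (.ofFinset t'))]
  simp [tupleConfig, hx, hy]

theorem measurable_tupleMoebius (hH : Measurable (Function.uncurry H)) (l m : ℕ) :
    Measurable fun z : (Fin l → EuclideanSpace ℝ (Fin d)) × (Fin m → EuclideanSpace ℝ (Fin d)) =>
      tupleMoebius H z.1 z.2 := by
  refine Finset.measurable_sum _ fun I _ => Measurable.const_mul (Finset.measurable_sum _
    fun J _ => Measurable.const_mul ?_ _) _
  exact hH.comp (((measurable_tupleConfig I).comp measurable_fst).prodMk
    ((measurable_tupleConfig J).comp measurable_snd))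

end Moebius

/-! ### Linearity of sums over tuples -/

section DistinctSumLemmas

variable {d : ℕ}

theorem distinctSum_congr {p : ℕ} {X : PointConfig d}
    {F G : (Fin p → EuclideanSpace ℝ (Fin d)) → ℝ≥0∞}
    (h : ∀ x, Function.Injective x → F x = G x) : distinctSum X F = distinctSum X G :=
  tsum_congr fun x => h x.1 x.2.1

theorem distinctSum_tsum {p : ℕ} (X : PointConfig d)
    (F : ℕ → (Fin p → EuclideanSpace ℝ (Fin d)) → ℝ≥0∞) :
    distinctSum X (fun x => ∑' m, F m x) = ∑' m, distinctSum X (F m) :=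
  ENNReal.tsum_comm

theorem distinctSum_const_mul {p : ℕ} (X : PointConfig d) (c : ℝ≥0∞)
    (F : (Fin p → EuclideanSpace ℝ (Fin d)) → ℝ≥0∞) :
    distinctSum X (fun x => c * F x) = c * distinctSum X F :=
  ENNReal.tsum_mul_left

end DistinctSumLemmas

/-! ### Expansion of local functionals into Möbius sums -/

section Weights

variable {d : ℕ} (H : PointConfig d → PointConfig d → ℝ) (A B : Set (EuclideanSpace ℝ (Fin d)))

/-- Pairs of tuples of pairwise distinct points in `A` and in `B`. -/
def tuplePairs (l m : ℕ) :
    Set ((Fin l → EuclideanSpace ℝ (Fin d)) × (Fin m → EuclideanSpace ℝ (Fin d))) :=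
  {z | (Function.Injective z.1 ∧ ∀ i, z.1 i ∈ A) ∧ Function.Injective z.2 ∧ ∀ j, z.2 j ∈ B}

/-- The positive part of the Moebius transform at pairs of tuples in `A` and in `B`. -/
noncomputable def moebiusWeight (l m : ℕ) (x : Fin l → EuclideanSpace ℝ (Fin d))
    (y : Fin m → EuclideanSpace ℝ (Fin d)) : ℝ≥0∞ :=
  (tuplePairs A B l m).indicator (fun z => ENNReal.ofReal (tupleMoebius H z.1 z.2)) (x, y)

/-- The sum of the positive part of the Moebius transform over pairs of finite sets of points. -/
noncomputable def moebiusSum (X Y : PointConfig d) : ℝ≥0∞ :=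
  ∑' l : ℕ, ∑' m : ℕ, (l ! : ℝ≥0∞)⁻¹ * ((m ! : ℝ≥0∞)⁻¹ *
    distinctSum X fun x => distinctSum Y fun y => moebiusWeight H A B l m x y)

variable {A B}

theorem measurableSet_tuplePairs (hA : MeasurableSet A) (hB : MeasurableSet B) (l m : ℕ) :
    MeasurableSet (tuplePairs A B l m) := by
  have h : ∀ {n : ℕ} {C : Set (EuclideanSpace ℝ (Fin d))}, MeasurableSet C →
      MeasurableSet {x : Fin n → EuclideanSpace ℝ (Fin d) | Function.Injective x ∧ ∀ i, x i ∈ C} := by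
    intro n C hC
    have h1 := measurableSet_injective (d := d) n
    have h2 : {x : Fin n → EuclideanSpace ℝ (Fin d) | ∀ i, x i ∈ C} = Set.univ.pi fun _ => C := by
      ext x; simp
    have h3 : MeasurableSet {x : Fin n → EuclideanSpace ℝ (Fin d) | ∀ i, x i ∈ C} := by
      rw [h2]
      exact MeasurableSet.univ_pi fun _ => hC
    exact h1.inter h3
  exact (measurable_fst (h hA)).inter (measurable_snd (h hB))

variable {H}

theorem measurable_moebiusWeight (hH : Measurable (Function.uncurry H)) (hA : MeasurableSet A)
    (hB : MeasurableSet B) (l m : ℕ) :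
    Measurable (Function.uncurry (moebiusWeight H A B l m)) :=
  (measurable_tupleMoebius H hH l m).ennreal_ofReal.indicator (measurableSet_tuplePairs hA hB l m)

theorem measurable_moebiusTerm (hH : Measurable (Function.uncurry H)) (hA : MeasurableSet A)
    (hB : MeasurableSet B) (l m : ℕ) :
    Measurable fun Z : PointConfig d × PointConfig d =>
      distinctSum Z.1 fun x => distinctSum Z.2 fun y => moebiusWeight H A B l m x y := by
  have hw := measurable_moebiusWeight hH hA hB l m
  have h1 : Measurable fun q : PointConfig d × (Fin l → EuclideanSpace ℝ (Fin d)) =>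
      distinctSum q.1 (moebiusWeight H A B l m q.2) :=
    measurable_distinctSum measurable_fst (F := fun q => moebiusWeight H A B l m q.2)
      (hw.comp ((measurable_snd.comp measurable_fst).prodMk measurable_snd))
  exact measurable_distinctSum measurable_fst
    (F := fun Z x => distinctSum Z.2 (moebiusWeight H A B l m x))
    (h1.comp ((measurable_snd.comp measurable_fst).prodMk measurable_snd))

theorem measurable_moebiusSum (hH : Measurable (Function.uncurry H)) (hA : MeasurableSet A)
    (hB : MeasurableSet B) :
    Measurable fun Z : PointConfig d × PointConfig d => moebiusSum H A B Z.1 Z.2 :=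
  Measurable.tsum fun l => Measurable.tsum fun m =>
    ((measurable_moebiusTerm hH hA hB l m).const_mul _).const_mul _

/-- The factors 1/l! and 1/m! cancel the enumerations of each pair of finite sets, and only points
in the bounded sets A and B count, so the series is a finite sum. -/
theorem moebiusSum_eq (hAb : Bornology.IsBounded A) (hBb : Bornology.IsBounded B)
    (X Y : PointConfig d) :
    moebiusSum H A B X Y =
      ∑ s ∈ (X.finite_inter A hAb).toFinset.powerset, ∑ t ∈ (Y.finite_inter B hBb).toFinset.powerset,
        ENNReal.ofReal (moebius H s t) := by
  classical
  have hX : (X.restrict A).carrier.Finite := X.finite_inter A hAb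
  have hY : (Y.restrict B).carrier.Finite := Y.finite_inter B hBb
  rw [show (X.finite_inter A hAb).toFinset = hX.toFinset from rfl,
    show (Y.finite_inter B hBb).toFinset = hY.toFinset from rfl,
    sum_powerset_eq_tsum_distinctSum (X.restrict A) hX]
  refine tsum_congr fun l => ?_
  rw [ENNReal.tsum_mul_left]
  congr 1
  simp only [sum_powerset_eq_tsum_distinctSum (Y.restrict B) hY, distinctSum_tsum,
    distinctSum_const_mul]
  refine tsum_congr fun m => ?_
  congr 1
  rw [distinctSum_restrict]
  refine distinctSum_congr fun x hx => ?_
  simp only [distinctSum_restrict]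
  by_cases hxA : ∀ i, x i ∈ A
  · rw [Set.indicator_of_mem (by exact hxA)]
    refine distinctSum_congr fun y hy => ?_
    by_cases hyB : ∀ i, y i ∈ B
    · rw [Set.indicator_of_mem (by exact hyB), moebiusWeight, Set.indicator_of_mem,
        moebius_image H hx hy]
      exact ⟨⟨hx, hxA⟩, hy, hyB⟩
    · rw [Set.indicator_of_notMem (by exact hyB), moebiusWeight, Set.indicator_of_notMem]
      exact fun h => hyB h.2.2
  · rw [Set.indicator_of_notMem (by exact hxA)]
    exact ENNReal.tsum_eq_zero.2 fun y => Set.indicator_of_notMem (fun h => hxA h.1.2) _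

theorem moebiusSum_ne_top (hAb : Bornology.IsBounded A) (hBb : Bornology.IsBounded B)
    (X Y : PointConfig d) : moebiusSum H A B X Y ≠ ∞ := by
  rw [moebiusSum_eq hAb hBb]
  simp [ENNReal.sum_eq_top]

/-- The Campbell formula needs nonnegative weights, so the transform is split into its positive part
and that of -H; their difference is the transform, which sums back to H. -/
theorem apply_restrict_eq_moebiusSum (hAb : Bornology.IsBounded A) (hBb : Bornology.IsBounded B)
    (X Y : PointConfig d) :
    H (X.restrict A) (Y.restrict B) =
      (moebiusSum H A B X Y).toReal - (moebiusSum (-H) A B X Y).toReal := by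
  have hneg : ∀ s t, moebius (-H) s t = -moebius H s t := by
    intro s t
    simp [moebius, Finset.sum_neg_distrib]
  have htop : ∀ (s : Finset (EuclideanSpace ℝ (Fin d))) (G : PointConfig d → PointConfig d → ℝ),
      ∑ t ∈ (Y.finite_inter B hBb).toFinset.powerset, ENNReal.ofReal (moebius G s t) ≠ ∞ := by
    intro s G
    simp [ENNReal.sum_eq_top]
  rw [moebiusSum_eq hAb hBb, moebiusSum_eq hAb hBb, ENNReal.toReal_sum fun s _ => htop s _,
    ENNReal.toReal_sum fun s _ => htop s _, ← Finset.sum_sub_distrib]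
  have h1 : ∀ s : Finset (EuclideanSpace ℝ (Fin d)),
      (∑ t ∈ (Y.finite_inter B hBb).toFinset.powerset,
        ENNReal.ofReal (moebius H s t)).toReal - (∑ t ∈ (Y.finite_inter B hBb).toFinset.powerset,
        ENNReal.ofReal (moebius (-H) s t)).toReal =
      ∑ t ∈ (Y.finite_inter B hBb).toFinset.powerset, moebius H s t := by
    intro s
    rw [ENNReal.toReal_sum (by simp), ENNReal.toReal_sum (by simp), ← Finset.sum_sub_distrib]
    refine Finset.sum_congr rfl fun t _ => ?_
    rw [hneg, ENNReal.toReal_ofReal', ENNReal.toReal_ofReal']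
    exact max_zero_sub_max_neg_zero_eq_self _
  simp only [h1]
  rw [sum_moebius, PointConfig.ofFinset, PointConfig.ofFinset]
  congr 1 <;> exact PointConfig.ext_carrier (by simp)

end Weights

/-! ### Series with powers of factorials -/

section SeriesBounds

theorem factorial_add_le (l m : ℕ) : (l + m)! ≤ 2 ^ (l + m) * (l ! * m !) := by
  rw [← Nat.add_choose_mul_factorial_mul_factorial l m, mul_assoc]
  exact Nat.mul_le_mul_right _ (Nat.choose_le_two_pow _ _)

/-- With y = (2x)^(1/(1-a)) the term (2x)^l / l!^(1-a) equals (y^l / l!)^(1-a), and y^l / l! ≤ e^y.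
The extra 2 leaves a geometric factor for the summation. -/
theorem pow_div_factorial_rpow_le {a x : ℝ} (ha₀ : 0 ≤ a) (ha₁ : a < 1) (hx : 0 ≤ x) (l : ℕ) :
    x ^ l / (l ! : ℝ) ^ (1 - a) ≤ Real.exp ((2 * x) ^ (1 / (1 - a))) * (1 / 2) ^ l := by
  have h1a : 0 < 1 - a := by linarith
  set y := (2 * x) ^ (1 / (1 - a)) with hy
  have hy0 : 0 ≤ y := by positivity
  have h1 : (y ^ l / l !) ^ (1 - a) ≤ Real.exp y := by
    calc (y ^ l / l !) ^ (1 - a) ≤ (Real.exp y) ^ (1 - a) :=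
          Real.rpow_le_rpow (by positivity) (Real.pow_div_factorial_le_exp y hy0 l) h1a.le
      _ ≤ (Real.exp y) ^ (1 : ℝ) :=
          Real.rpow_le_rpow_of_exponent_le (Real.one_le_exp hy0) (by linarith)
      _ = Real.exp y := Real.rpow_one _
  have h2 : (y ^ l / l !) ^ (1 - a) = (2 * x) ^ l / (l ! : ℝ) ^ (1 - a) := by
    rw [Real.div_rpow (by positivity) (by positivity), hy, ← Real.rpow_natCast, ← Real.rpow_mul
      (by positivity), ← Real.rpow_mul (by positivity), ← Real.rpow_natCast]
    congr 2
    field_simp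
  rw [h2] at h1
  calc x ^ l / (l ! : ℝ) ^ (1 - a) = (2 * x) ^ l / (l ! : ℝ) ^ (1 - a) * (1 / 2) ^ l := by
        rw [div_mul_eq_mul_div, ← mul_pow]
        congr 2
        ring
    _ ≤ _ := by gcongr

theorem tsum_pow_div_factorial_rpow_le {a x : ℝ} (ha₀ : 0 ≤ a) (ha₁ : a < 1) (hx : 0 ≤ x) :
    ∑' l : ℕ, ENNReal.ofReal (x ^ l / (l ! : ℝ) ^ (1 - a)) ≤
      ENNReal.ofReal (2 * Real.exp ((2 * x) ^ (1 / (1 - a)))) := by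
  calc ∑' l : ℕ, ENNReal.ofReal (x ^ l / (l ! : ℝ) ^ (1 - a))
      ≤ ∑' l : ℕ, ENNReal.ofReal (Real.exp ((2 * x) ^ (1 / (1 - a))) * (1 / 2) ^ l) :=
        ENNReal.tsum_le_tsum fun l =>
          ENNReal.ofReal_le_ofReal (pow_div_factorial_rpow_le ha₀ ha₁ hx l)
    _ = _ := by
        rw [← ENNReal.ofReal_tsum_of_nonneg (fun n => by positivity)
          (summable_geometric_two.mul_left _), tsum_mul_left, tsum_geometric_two, mul_comm]

end SeriesBounds

/-! ### Uniform bounds for Möbius series -/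

section WeightBounds

variable {d : ℕ} {H : PointConfig d → PointConfig d → ℝ} {A B : Set (EuclideanSpace ℝ (Fin d))}

theorem moebiusWeight_le {T : ℝ}
    (hH : ∀ s t : Finset (EuclideanSpace ℝ (Fin d)),
      |H (.ofFinset s) (.ofFinset t)| ≤ T * 3 ^ s.card * 3 ^ t.card) (l m : ℕ)
    (x : Fin l → EuclideanSpace ℝ (Fin d)) (y : Fin m → EuclideanSpace ℝ (Fin d)) :
    moebiusWeight H A B l m x y ≤
      ((Set.univ.pi fun _ => A) ×ˢ (Set.univ.pi fun _ => B)).indicator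
        (fun _ => ENNReal.ofReal (T * 4 ^ (l + m))) (x, y) := by
  classical
  by_cases h : (x, y) ∈ tuplePairs A B l m
  · rw [moebiusWeight, Set.indicator_of_mem h, Set.indicator_of_mem]
    · refine ENNReal.ofReal_le_ofReal ?_
      rw [← moebius_image H h.1.1 h.2.1]
      refine (le_abs_self _).trans ((abs_moebius_le H hH _ _).trans (le_of_eq ?_))
      rw [Finset.card_image_of_injective _ h.1.1, Finset.card_image_of_injective _ h.2.1]
      simp only [Finset.card_univ, Fintype.card_fin]
      ring
    · exact ⟨fun i _ => h.1.2 i, fun i _ => h.2.2 i⟩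
  · rw [moebiusWeight, Set.indicator_of_notMem h]
    exact zero_le

/-- The transform contributes 4^(l+m), the density c^(l+m) (l+m)!^a, the domain V^(l+m), and
splitting (l+m)!^a costs at most 2^(l+m). The double series therefore factors into two copies of the
series of (8cV)^l / l!^(1-a). Stated for a general density, so that it covers both ρ^(l) ρ^(m) and
the difference of densities. -/
theorem tsum_lintegral_moebiusWeight_le {T : ℝ} (hT : 0 ≤ T)
    (hH : ∀ s t : Finset (EuclideanSpace ℝ (Fin d)),
      |H (.ofFinset s) (.ofFinset t)| ≤ T * 3 ^ s.card * 3 ^ t.card)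
    (hA : MeasurableSet A) (hB : MeasurableSet B)
    {V : ℝ} (hV : 0 ≤ V) (hAV : volume A ≤ ENNReal.ofReal V) (hBV : volume B ≤ ENNReal.ofReal V)
    {a c q : ℝ} (ha₀ : 0 ≤ a) (ha₁ : a < 1) (hc : 0 ≤ c) (hq : 0 ≤ q)
    {D : ∀ l m : ℕ, (Fin l → EuclideanSpace ℝ (Fin d)) × (Fin m → EuclideanSpace ℝ (Fin d)) → ℝ≥0∞}
    (hD : ∀ l m, ∀ᵐ z, z ∈ tuplePairs A B l m →
      D l m z ≤ ENNReal.ofReal (c ^ (l + m) * ((l + m)! : ℝ) ^ a * q)) :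
    ∑' l : ℕ, ∑' m : ℕ, (l ! : ℝ≥0∞)⁻¹ * ((m ! : ℝ≥0∞)⁻¹ *
      ∫⁻ z, moebiusWeight H A B l m z.1 z.2 * D l m z) ≤
      ENNReal.ofReal (T * q * (2 * Real.exp ((16 * c * V) ^ (1 / (1 - a)))) ^ 2) := by
  set t : ℕ → ℝ := fun l => (8 * c * V) ^ l / (l ! : ℝ) ^ (1 - a) with ht
  have ht0 : ∀ l, 0 ≤ t l := fun l => by positivity
  have h1 : ∀ l m : ℕ, (l ! : ℝ≥0∞)⁻¹ * ((m ! : ℝ≥0∞)⁻¹ *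
      ∫⁻ z, moebiusWeight H A B l m z.1 z.2 * D l m z) ≤
      ENNReal.ofReal (T * q) * (ENNReal.ofReal (t l) * ENNReal.ofReal (t m)) := by
    intro l m
    have h2 : ∫⁻ z, moebiusWeight H A B l m z.1 z.2 * D l m z ≤
        ENNReal.ofReal (T * 4 ^ (l + m) * (c ^ (l + m) * ((l + m)! : ℝ) ^ a * q) *
          V ^ (l + m)) := by
      set S : Set ((Fin l → EuclideanSpace ℝ (Fin d)) × (Fin m → EuclideanSpace ℝ (Fin d))) :=
        (Set.univ.pi fun _ => A) ×ˢ (Set.univ.pi fun _ => B) with hS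
      have hSm : MeasurableSet S :=
        (MeasurableSet.univ_pi fun _ => hA).prod (MeasurableSet.univ_pi fun _ => hB)
      calc ∫⁻ z, moebiusWeight H A B l m z.1 z.2 * D l m z
          ≤ ∫⁻ z, S.indicator (fun _ => ENNReal.ofReal (T * 4 ^ (l + m)) *
              ENNReal.ofReal (c ^ (l + m) * ((l + m)! : ℝ) ^ a * q)) z := by
            refine lintegral_mono_ae ?_
            filter_upwards [hD l m] with z hz
            by_cases hz' : z ∈ tuplePairs A B l m
            · have := moebiusWeight_le (A := A) (B := B) hH l m z.1 z.2
              have hzS : z ∈ S := ⟨fun i _ => hz'.1.2 i, fun i _ => hz'.2.2 i⟩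
              rw [Set.indicator_of_mem hzS] at this ⊢
              exact mul_le_mul' this (hz hz')
            · rw [moebiusWeight, Set.indicator_of_notMem hz', zero_mul]
              exact zero_le
        _ = ENNReal.ofReal (T * 4 ^ (l + m)) *
              ENNReal.ofReal (c ^ (l + m) * ((l + m)! : ℝ) ^ a * q) * volume S :=
            lintegral_indicator_const hSm _
        _ ≤ ENNReal.ofReal (T * 4 ^ (l + m)) *
              ENNReal.ofReal (c ^ (l + m) * ((l + m)! : ℝ) ^ a * q) *
              ENNReal.ofReal (V ^ (l + m)) := by
            gcongr
            rw [hS, Measure.volume_eq_prod, Measure.prod_prod, volume_pi_pi, volume_pi_pi,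
              Finset.prod_const, Finset.prod_const, ENNReal.ofReal_pow hV, pow_add]
            simp only [Finset.card_univ, Fintype.card_fin]
            gcongr
        _ = _ := by
            rw [← ENNReal.ofReal_mul (by positivity), ← ENNReal.ofReal_mul (by positivity)]
    have hinv : ∀ n : ℕ, (n ! : ℝ≥0∞)⁻¹ = ENNReal.ofReal ((n ! : ℝ)⁻¹) := by
      intro n
      rw [ENNReal.ofReal_inv_of_pos (by positivity), ENNReal.ofReal_natCast]
    rw [hinv, hinv]
    calc _ ≤ ENNReal.ofReal ((l ! : ℝ)⁻¹) * (ENNReal.ofReal ((m ! : ℝ)⁻¹) *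
          ENNReal.ofReal (T * 4 ^ (l + m) * (c ^ (l + m) * ((l + m)! : ℝ) ^ a * q) *
          V ^ (l + m))) := by gcongr
      _ = ENNReal.ofReal ((l ! : ℝ)⁻¹ * ((m ! : ℝ)⁻¹ *
          (T * 4 ^ (l + m) * (c ^ (l + m) * ((l + m)! : ℝ) ^ a * q) * V ^ (l + m)))) := by
          rw [ENNReal.ofReal_mul (p := ((l ! : ℝ)⁻¹)) (by positivity),
            ENNReal.ofReal_mul (p := ((m ! : ℝ)⁻¹)) (by positivity)]
      _ ≤ ENNReal.ofReal (T * q * (t l * t m)) := by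
          refine ENNReal.ofReal_le_ofReal ?_
          have h3 : ((l + m)! : ℝ) ^ a ≤ 2 ^ (l + m) * ((l ! : ℝ) ^ a * (m ! : ℝ) ^ a) := by
            calc ((l + m)! : ℝ) ^ a ≤ (2 ^ (l + m) * (l ! * m !)) ^ a :=
                  Real.rpow_le_rpow (by positivity) (by exact_mod_cast factorial_add_le l m) ha₀
              _ = (2 ^ (l + m)) ^ a * ((l ! : ℝ) ^ a * (m ! : ℝ) ^ a) := by
                  rw [Real.mul_rpow (by positivity) (by positivity),
                    Real.mul_rpow (by positivity) (by positivity)]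
              _ ≤ _ := by
                  gcongr
                  exact (Real.rpow_le_rpow_of_exponent_le
                    (one_le_pow₀ (by norm_num)) ha₁.le).trans (by rw [Real.rpow_one])
          have h4 : ∀ n : ℕ, (n ! : ℝ) ^ (1 - a) = n ! / (n ! : ℝ) ^ a := by
            intro n
            rw [Real.rpow_sub (by positivity), Real.rpow_one]
          calc _ ≤ (l ! : ℝ)⁻¹ * ((m ! : ℝ)⁻¹ * (T * 4 ^ (l + m) * (c ^ (l + m) *
                  (2 ^ (l + m) * ((l ! : ℝ) ^ a * (m ! : ℝ) ^ a)) * q) * V ^ (l + m))) := by gcongr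
            _ = T * q * (t l * t m) := by
                simp only [ht, h4]
                have h8 : ∀ n : ℕ, (8 : ℝ) ^ n = 4 ^ n * 2 ^ n := fun n => by
                  rw [← mul_pow]; norm_num
                field_simp
                rw [pow_add, pow_add, pow_add, pow_add, mul_pow, mul_pow, mul_pow, mul_pow, h8, h8]
                ring
      _ = _ := by
          rw [ENNReal.ofReal_mul (by positivity), ENNReal.ofReal_mul (ht0 l)]
  have h5 := tsum_pow_div_factorial_rpow_le ha₀ ha₁ (show 0 ≤ 8 * c * V by positivity)
  calc _ ≤ ∑' l : ℕ, ∑' m : ℕ,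
        ENNReal.ofReal (T * q) * (ENNReal.ofReal (t l) * ENNReal.ofReal (t m)) :=
        ENNReal.tsum_le_tsum fun l => ENNReal.tsum_le_tsum fun m => h1 l m
    _ = ENNReal.ofReal (T * q) * ((∑' l, ENNReal.ofReal (t l)) * ∑' m, ENNReal.ofReal (t m)) := by
        simp only [ENNReal.tsum_mul_left, ENNReal.tsum_mul_right]
    _ ≤ ENNReal.ofReal (T * q) *
        (ENNReal.ofReal (2 * Real.exp ((2 * (8 * c * V)) ^ (1 / (1 - a)))) *
          ENNReal.ofReal (2 * Real.exp ((2 * (8 * c * V)) ^ (1 / (1 - a))))) := by gcongr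
    _ = _ := by
        rw [← ENNReal.ofReal_mul (by positivity), ← ENNReal.ofReal_mul (by positivity), ← sq]
        ring_nf

end WeightBounds

/-! ### Decorrelation of functionals of distant regions -/

section Mixing

variable {d : ℕ} {P : Measure (PointConfig d)}
  {ρ : (p : ℕ) → (Fin p → EuclideanSpace ℝ (Fin d)) → ℝ}

/-- There is one empty tuple, and the product measure gives it mass one, so the Campbell formula for
p = 0 reads 1 = ρ^(0). -/
theorem correlation_zero [IsProbabilityMeasure P] (hρ : IsCorrelationFunction P ρ)
    (x : Fin 0 → EuclideanSpace ℝ (Fin d)) : ρ 0 x = 1 := by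
  have h := hρ.lintegral_distinctSum 0 (fun _ => 1) measurable_const
  simp only [distinctSum_zero, lintegral_const, measure_univ, one_mul] at h
  have h2 : ∀ y : Fin 0 → EuclideanSpace ℝ (Fin d), ρ 0 y = ρ 0 x := fun y => by
    rw [Subsingleton.elim y x]
  simp only [h2, lintegral_const, volume_pi, Measure.pi_univ] at h
  simp at h
  rw [← ENNReal.toReal_ofReal (hρ.nonneg 0 x), ← h, ENNReal.toReal_one]

theorem correlation_cast {m n : ℕ} (h : m = n) (x : Fin n → EuclideanSpace ℝ (Fin d)) :
    ρ m (x ∘ Fin.cast h) = ρ n x := by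
  subst h; rfl

theorem correlation_append_zero {m : ℕ} (x : Fin m → EuclideanSpace ℝ (Fin d))
    (y : Fin 0 → EuclideanSpace ℝ (Fin d)) : ρ (m + 0) (Fin.append x y) = ρ m x := by
  rw [Subsingleton.elim y Fin.elim0, Fin.append_elim0]
  exact correlation_cast (ρ := ρ) rfl x

theorem correlation_zero_append {m : ℕ} (x : Fin m → EuclideanSpace ℝ (Fin d))
    (y : Fin 0 → EuclideanSpace ℝ (Fin d)) : ρ (0 + m) (Fin.append y x) = ρ m x := by
  rw [Subsingleton.elim y Fin.elim0, Fin.elim0_append]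
  exact correlation_cast (ρ := ρ) _ x

variable {H : PointConfig d → PointConfig d → ℝ} {A B : Set (EuclideanSpace ℝ (Fin d))}

theorem lintegral_moebiusSum_prod [SFinite P] (hρ : IsCorrelationFunction P ρ)
    (hH : Measurable (Function.uncurry H)) (hA : MeasurableSet A) (hB : MeasurableSet B) :
    ∫⁻ Z, moebiusSum H A B Z.1 Z.2 ∂(P.prod P) =
      ∑' l : ℕ, ∑' m : ℕ, (l ! : ℝ≥0∞)⁻¹ * ((m ! : ℝ≥0∞)⁻¹ *
        ∫⁻ z : (Fin l → EuclideanSpace ℝ (Fin d)) × (Fin m → EuclideanSpace ℝ (Fin d)),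
        moebiusWeight H A B l m z.1 z.2 * ENNReal.ofReal (ρ l z.1 * ρ m z.2)) := by
  have hm := fun l m => measurable_moebiusTerm hH hA hB l m
  simp only [moebiusSum]
  rw [lintegral_tsum fun l => (Measurable.tsum fun m =>
    ((hm l m).const_mul _).const_mul _).aemeasurable]
  refine tsum_congr fun l => ?_
  rw [lintegral_tsum fun m => (((hm l m).const_mul _).const_mul _).aemeasurable]
  refine tsum_congr fun m => ?_
  rw [lintegral_const_mul _ ((hm l m).const_mul _), lintegral_const_mul _ (hm l m),
    lintegral_distinctSum_prod hρ (measurable_moebiusWeight hH hA hB l m)]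

theorem lintegral_moebiusSum_diag (hρ : IsCorrelationFunction P ρ)
    (hH : Measurable (Function.uncurry H)) (hA : MeasurableSet A) (hB : MeasurableSet B)
    (hAB : Disjoint A B) :
    ∫⁻ X, moebiusSum H A B X X ∂P =
      ∑' l : ℕ, ∑' m : ℕ, (l ! : ℝ≥0∞)⁻¹ * ((m ! : ℝ≥0∞)⁻¹ *
        ∫⁻ z : (Fin l → EuclideanSpace ℝ (Fin d)) × (Fin m → EuclideanSpace ℝ (Fin d)),
        moebiusWeight H A B l m z.1 z.2 *
          ENNReal.ofReal (ρ (l + m) (Fin.append z.1 z.2))) := by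
  have hm : ∀ l m, Measurable fun X : PointConfig d =>
      distinctSum X fun x => distinctSum X fun y => moebiusWeight H A B l m x y := fun l m =>
    (measurable_moebiusTerm hH hA hB l m).comp (measurable_id.prodMk measurable_id)
  simp only [moebiusSum]
  rw [lintegral_tsum fun l => (Measurable.tsum fun m =>
    ((hm l m).const_mul _).const_mul _).aemeasurable]
  refine tsum_congr fun l => ?_
  rw [lintegral_tsum fun m => (((hm l m).const_mul _).const_mul _).aemeasurable]
  refine tsum_congr fun m => ?_
  rw [lintegral_const_mul _ ((hm l m).const_mul _), lintegral_const_mul _ (hm l m)]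
  congr 2
  refine lintegral_distinctSum_diag hρ (measurable_moebiusWeight hH hA hB l m) ?_
  intro x y hxy i j h
  have hz : (x, y) ∈ tuplePairs A B l m := by
    by_contra hz
    exact hxy (Set.indicator_of_notMem hz _)
  exact Set.disjoint_left.1 hAB (hz.1.2 i) (by simpa [h] using hz.2.2 j)

/-- The common factor in the bounds for Moebius sums over sets of volume at most `V`. -/
noncomputable def volumeFactor (a c V : ℝ) : ℝ :=
  (2 * Real.exp ((16 * c * V) ^ (1 / (1 - a)))) ^ 2

/-- Needed for finiteness only; smallness comes from `tsum_moebius_error_le`. -/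
theorem lintegral_moebiusSum_prod_le [IsProbabilityMeasure P] (hρ : IsCorrelationFunction P ρ)
    (hH : Measurable (Function.uncurry H)) (hA : MeasurableSet A) (hB : MeasurableSet B)
    {T : ℝ} (hT : 0 ≤ T)
    (hHT : ∀ s t : Finset (EuclideanSpace ℝ (Fin d)),
      |H (.ofFinset s) (.ofFinset t)| ≤ T * 3 ^ s.card * 3 ^ t.card)
    {V : ℝ} (hV : 0 ≤ V) (hAV : volume A ≤ ENNReal.ofReal V) (hBV : volume B ≤ ENNReal.ofReal V)
    {a K : ℝ} (ha₀ : 0 ≤ a) (ha₁ : a < 1) (hK : 1 ≤ K)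
    (hbound : ∀ p : ℕ, ∀ᵐ x : Fin p → EuclideanSpace ℝ (Fin d),
      1 ≤ p → ρ p x ≤ K ^ p * (p ! : ℝ) ^ a) :
    ∫⁻ Z, moebiusSum H A B Z.1 Z.2 ∂(P.prod P) ≤ ENNReal.ofReal (T * volumeFactor a K V) := by
  have hb : ∀ p : ℕ, ∀ᵐ x : Fin p → EuclideanSpace ℝ (Fin d), ρ p x ≤ K ^ p * (p ! : ℝ) ^ a := by
    intro p
    rcases Nat.eq_zero_or_pos p with rfl | hp
    · exact Filter.Eventually.of_forall fun x => by simp [correlation_zero hρ x]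
    · filter_upwards [hbound p] with x hx using hx hp
  rw [lintegral_moebiusSum_prod hρ hH hA hB]
  have := tsum_lintegral_moebiusWeight_le (H := H) (D := fun l m z =>
    ENNReal.ofReal (ρ l z.1 * ρ m z.2)) (c := K) (q := 1) hT hHT hA hB hV hAV hBV ha₀ ha₁
    (by linarith) zero_le_one fun l m => by
      have h1 := Measure.quasiMeasurePreserving_fst (μ := (volume : Measure
        (Fin l → EuclideanSpace ℝ (Fin d)))) (ν := (volume : Measure
        (Fin m → EuclideanSpace ℝ (Fin d)))) |>.ae (hb l)
      have h2 := Measure.quasiMeasurePreserving_snd (μ := (volume : Measure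
        (Fin l → EuclideanSpace ℝ (Fin d)))) (ν := (volume : Measure
        (Fin m → EuclideanSpace ℝ (Fin d)))) |>.ae (hb m)
      filter_upwards [h1, h2] with z hz1 hz2 _
      refine ENNReal.ofReal_le_ofReal ?_
      have h3 : (l ! : ℝ) ^ a * (m ! : ℝ) ^ a ≤ ((l + m)! : ℝ) ^ a := by
        rw [← Real.mul_rpow (by positivity) (by positivity)]
        refine Real.rpow_le_rpow (by positivity) ?_ ha₀
        exact_mod_cast Nat.le_of_dvd (Nat.factorial_pos _)
          (Nat.factorial_mul_factorial_dvd_factorial_add l m)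
      calc ρ l z.1 * ρ m z.2 ≤ (K ^ l * (l ! : ℝ) ^ a) * (K ^ m * (m ! : ℝ) ^ a) :=
            mul_le_mul hz1 hz2 (hρ.nonneg _ _) (by positivity)
        _ = K ^ (l + m) * ((l ! : ℝ) ^ a * (m ! : ℝ) ^ a) := by rw [pow_add]; ring
        _ ≤ K ^ (l + m) * ((l + m)! : ℝ) ^ a * 1 := by rw [mul_one]; gcongr
  rw [mul_one] at this
  exact this

/-- Decay of correlations is assumed for two nonempty tuples. If one of them is empty, the two
densities coincide because ρ^(0) = 1. -/
theorem tsum_moebius_error_le [IsProbabilityMeasure P] (hρ : IsCorrelationFunction P ρ)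
    (hA : MeasurableSet A) (hB : MeasurableSet B)
    {T : ℝ} (hT : 0 ≤ T)
    (hHT : ∀ s t : Finset (EuclideanSpace ℝ (Fin d)),
      |H (.ofFinset s) (.ofFinset t)| ≤ T * 3 ^ s.card * 3 ^ t.card)
    {V : ℝ} (hV : 0 ≤ V) (hAV : volume A ≤ ENNReal.ofReal V) (hBV : volume B ≤ ENNReal.ofReal V)
    {a C δ : ℝ} (ha₀ : 0 ≤ a) (ha₁ : a < 1) (hC : 1 ≤ C) (hδ : 0 < δ)
    (hAB : ∀ x ∈ A, ∀ y ∈ B, δ ≤ dist x y)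
    {Φ : ℝ → ℝ} (hΦ : AntitoneOn Φ (Set.Ici 0)) (hΦ0 : ∀ s, 0 ≤ s → 0 ≤ Φ s)
    (h : ∀ (p q : ℕ), 1 ≤ p → 1 ≤ q →
      ∀ (x : Fin p → EuclideanSpace ℝ (Fin d)) (y : Fin q → EuclideanSpace ℝ (Fin d)),
        Function.Injective (Fin.append x y) →
          |ρ (p + q) (Fin.append x y) - ρ p x * ρ q y| ≤
            C ^ (p + q) * ((p + q)! : ℝ) ^ a * Φ (⨅ ij : Fin p × Fin q, dist (x ij.1) (y ij.2))) :
    ∑' l : ℕ, ∑' m : ℕ, (l ! : ℝ≥0∞)⁻¹ * ((m ! : ℝ≥0∞)⁻¹ *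
      ∫⁻ z : (Fin l → EuclideanSpace ℝ (Fin d)) × (Fin m → EuclideanSpace ℝ (Fin d)),
        moebiusWeight H A B l m z.1 z.2 *
        ENNReal.ofReal |ρ (l + m) (Fin.append z.1 z.2) - ρ l z.1 * ρ m z.2|) ≤
      ENNReal.ofReal (T * Φ δ * volumeFactor a C V) := by
  have hΦδ := hΦ0 δ hδ.le
  refine tsum_lintegral_moebiusWeight_le (H := H) (D := fun l m z =>
    ENNReal.ofReal |ρ (l + m) (Fin.append z.1 z.2) - ρ l z.1 * ρ m z.2|) (c := C) (q := Φ δ)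
    hT hHT hA hB hV hAV hBV ha₀ ha₁ (by linarith) hΦδ fun l m =>
    Filter.Eventually.of_forall fun z hz => ENNReal.ofReal_le_ofReal ?_
  obtain ⟨x, y⟩ := z
  rcases Nat.eq_zero_or_pos l with rfl | hl
  · rw [correlation_zero_append (ρ := ρ), correlation_zero hρ, one_mul, sub_self, abs_zero]
    positivity
  rcases Nat.eq_zero_or_pos m with rfl | hm
  · rw [correlation_append_zero (ρ := ρ), correlation_zero hρ, mul_one, sub_self, abs_zero]
    positivity
  have hdist : ∀ i j, δ ≤ dist (x i) (y j) := fun i j => hAB _ (hz.1.2 i) _ (hz.2.2 j)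
  refine (h l m hl hm x y (Fin.append_injective_iff.2 ⟨hz.1.1, hz.2.1, fun i j hij => ?_⟩)).trans ?_
  · have := hdist i j
    rw [hij, dist_self] at this
    linarith
  · have : Nonempty (Fin l × Fin m) := ⟨(⟨0, hl⟩, ⟨0, hm⟩)⟩
    have h1 : δ ≤ ⨅ ij : Fin l × Fin m, dist (x ij.1) (y ij.2) := le_ciInf fun ij => hdist _ _
    have h2 := hΦ (Set.mem_Ici.2 hδ.le) (Set.mem_Ici.2 (hδ.le.trans h1)) h1
    gcongr

/-- A one-sided comparison in the extended reals, where subtraction is not available; it is used in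
both directions. -/
theorem tsum_le_tsum_add_error
    (hH : Measurable (Function.uncurry H)) (hA : MeasurableSet A) (hB : MeasurableSet B)
    {D₁ D₂ : ∀ l m : ℕ, (Fin l → EuclideanSpace ℝ (Fin d)) × (Fin m → EuclideanSpace ℝ (Fin d)) → ℝ}
    (hD₂ : ∀ l m, Measurable (D₂ l m)) :
    ∑' l : ℕ, ∑' m : ℕ, (l ! : ℝ≥0∞)⁻¹ * ((m ! : ℝ≥0∞)⁻¹ *
      ∫⁻ z : (Fin l → EuclideanSpace ℝ (Fin d)) × (Fin m → EuclideanSpace ℝ (Fin d)),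
        moebiusWeight H A B l m z.1 z.2 * ENNReal.ofReal (D₁ l m z)) ≤
    ∑' l : ℕ, ∑' m : ℕ, (l ! : ℝ≥0∞)⁻¹ * ((m ! : ℝ≥0∞)⁻¹ *
      ∫⁻ z : (Fin l → EuclideanSpace ℝ (Fin d)) × (Fin m → EuclideanSpace ℝ (Fin d)),
        moebiusWeight H A B l m z.1 z.2 * ENNReal.ofReal (D₂ l m z)) +
    ∑' l : ℕ, ∑' m : ℕ, (l ! : ℝ≥0∞)⁻¹ * ((m ! : ℝ≥0∞)⁻¹ *
      ∫⁻ z : (Fin l → EuclideanSpace ℝ (Fin d)) × (Fin m → EuclideanSpace ℝ (Fin d)),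
        moebiusWeight H A B l m z.1 z.2 * ENNReal.ofReal |D₁ l m z - D₂ l m z|) := by
  simp only [← ENNReal.tsum_add, ← mul_add]
  refine ENNReal.tsum_le_tsum fun l => ENNReal.tsum_le_tsum fun m => ?_
  rw [← lintegral_add_left]
  · gcongr with z
    rw [← mul_add]
    gcongr
    refine (ENNReal.ofReal_le_ofReal (?_ : D₁ l m z ≤ D₂ l m z + |D₁ l m z - D₂ l m z|)).trans
      ENNReal.ofReal_add_le
    linarith [le_abs_self (D₁ l m z - D₂ l m z)]
  · exact (measurable_moebiusWeight hH hA hB l m).mul (hD₂ l m).ennreal_ofReal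

/-- The square doubles the exponent, and 2 x^u ≤ (2x)^u since u = 1/(1-a) ≥ 1. -/
theorem volumeFactor_le {a c V : ℝ} (ha₀ : 0 ≤ a) (ha₁ : a < 1) (hc : 0 ≤ c) (hV : 0 ≤ V) :
    volumeFactor a c V ≤ 4 * Real.exp ((32 * c * V) ^ (1 / (1 - a))) := by
  have h1 : (2 : ℝ) * (16 * c * V) ^ (1 / (1 - a)) ≤ (32 * c * V) ^ (1 / (1 - a)) := by
    rw [show 32 * c * V = 2 * (16 * c * V) by ring, Real.mul_rpow (x := 2) (by norm_num)
      (by positivity)]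
    refine mul_le_mul_of_nonneg_right ?_ (by positivity)
    have : (1 : ℝ) ≤ 1 / (1 - a) := by rw [le_div_iff₀ (by linarith)]; linarith
    calc (2 : ℝ) = 2 ^ (1 : ℝ) := (Real.rpow_one _).symm
      _ ≤ _ := Real.rpow_le_rpow_of_exponent_le (by norm_num) this
  rw [volumeFactor, mul_pow, ← Real.exp_nat_mul, show ((2 : ℝ) ^ 2) = 4 by norm_num]
  gcongr
  exact_mod_cast h1

/-- Both expectations are Möbius series with the same weights, so their difference is a series in
the differences of the densities. The exponential of a power of the volume is the price of summing
that series, and exp(-c δ^ahat) is the gain from Φ(δ). -/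
theorem exists_mixing (hd : 1 ≤ d) [IsProbabilityMeasure P] (hP : IsStationaryLaw P)
    (hρ : IsCorrelationFunction P ρ) {a ahat : ℝ} (ha₀ : 0 ≤ a) (ha₁ : a < 1)
    (hEDC : CondEDC ρ a ahat) :
    ∃ K c : ℝ, 1 ≤ K ∧ 0 < c ∧
      ∀ (H : PointConfig d → PointConfig d → ℝ) (A B : Set (EuclideanSpace ℝ (Fin d)))
        (T V δ : ℝ), Measurable (Function.uncurry H) → MeasurableSet A → MeasurableSet B →
        Bornology.IsBounded A → Bornology.IsBounded B → 0 ≤ T → 0 ≤ V → 0 < δ →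
        volume A ≤ ENNReal.ofReal V → volume B ≤ ENNReal.ofReal V →
        (∀ s t : Finset (EuclideanSpace ℝ (Fin d)),
          |H (.ofFinset s) (.ofFinset t)| ≤ T * 3 ^ s.card * 3 ^ t.card) →
        (∀ x ∈ A, ∀ y ∈ B, δ ≤ dist x y) →
        Integrable (fun X => H (X.restrict A) (X.restrict B)) P ∧
        Integrable (fun Z => H (Z.1.restrict A) (Z.2.restrict B)) (P.prod P) ∧
        |∫ X, H (X.restrict A) (X.restrict B) ∂P -
          ∫ Z, H (Z.1.restrict A) (Z.2.restrict B) ∂(P.prod P)| ≤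
          T * (K * Real.exp ((K * V) ^ (1 / (1 - a)) - c * δ ^ ahat)) := by
  obtain ⟨K₀, hK₀, hbound⟩ := exists_correlation_bound hd hP hρ ha₀ hEDC
  obtain ⟨C, Φ, hC, ⟨hΦ, hΦ0, c, C', hc, hΦexp⟩, h⟩ := hEDC
  -- The base of the exponent needs 32 C from `volumeFactor_le`; the prefactor needs 8 |C'|, where 8
  -- = 2 · 4 counts the two signs and the factor of `volumeFactor_le`.
  refine ⟨32 * C + 8 * |C'| + 1, c, by nlinarith [abs_nonneg C'], hc, ?_⟩
  intro H A B T V δ hH hA hB hAb hBb hT hV hδ hAV hBV hHT hAB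
  have hdisj : Disjoint A B := Set.disjoint_left.2 fun x hx hx' => by
    have := hAB x hx x hx'
    rw [dist_self] at this
    linarith
  have hHneg : Measurable (Function.uncurry (-H)) := hH.neg
  have hHTneg : ∀ s t : Finset (EuclideanSpace ℝ (Fin d)),
      |(-H) (.ofFinset s) (.ofFinset t)| ≤ T * 3 ^ s.card * 3 ^ t.card := by
    intro s t
    simpa using hHT s t
  have hρm : ∀ l m : ℕ, Measurable fun z : (Fin l → EuclideanSpace ℝ (Fin d)) ×
      (Fin m → EuclideanSpace ℝ (Fin d)) => ρ l z.1 * ρ m z.2 := fun l m =>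
    ((hρ.measurable l).comp measurable_fst).mul ((hρ.measurable m).comp measurable_snd)
  have hρa : ∀ l m : ℕ, Measurable fun z : (Fin l → EuclideanSpace ℝ (Fin d)) ×
      (Fin m → EuclideanSpace ℝ (Fin d)) => ρ (l + m) (Fin.append z.1 z.2) := fun l m =>
    (hρ.measurable _).comp (measurePreserving_append _ l m).measurable
  set e := T * Φ δ * volumeFactor a C V with he
  have hvf : 0 ≤ volumeFactor a C V := by rw [volumeFactor]; positivity
  have he0 : 0 ≤ e := mul_nonneg (mul_nonneg hT (hΦ0 δ hδ.le)) hvf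
  have key : ∀ G : PointConfig d → PointConfig d → ℝ, Measurable (Function.uncurry G) →
      (∀ s t : Finset (EuclideanSpace ℝ (Fin d)),
        |G (.ofFinset s) (.ofFinset t)| ≤ T * 3 ^ s.card * 3 ^ t.card) →
      ∫⁻ X, moebiusSum G A B X X ∂P ≠ ∞ ∧
      ∫⁻ Z, moebiusSum G A B Z.1 Z.2 ∂(P.prod P) ≠ ∞ ∧
      |(∫⁻ X, moebiusSum G A B X X ∂P).toReal -
        (∫⁻ Z, moebiusSum G A B Z.1 Z.2 ∂(P.prod P)).toReal| ≤ e := by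
    intro G hG hGT
    have herr := tsum_moebius_error_le (H := G) hρ hA hB hT hGT hV hAV hBV ha₀ ha₁ hC hδ hAB hΦ
      hΦ0 h
    have h2 : ∫⁻ Z, moebiusSum G A B Z.1 Z.2 ∂(P.prod P) ≠ ∞ :=
      ne_top_of_le_ne_top ENNReal.ofReal_ne_top (lintegral_moebiusSum_prod_le hρ hG hA hB hT hGT hV
        hAV hBV ha₀ ha₁ hK₀ hbound)
    have h12 : ∫⁻ X, moebiusSum G A B X X ∂P ≤
        ∫⁻ Z, moebiusSum G A B Z.1 Z.2 ∂(P.prod P) + ENNReal.ofReal e := by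
      rw [lintegral_moebiusSum_diag hρ hG hA hB hdisj, lintegral_moebiusSum_prod hρ hG hA hB]
      exact (tsum_le_tsum_add_error hG hA hB hρm).trans (by gcongr)
    have h21 : ∫⁻ Z, moebiusSum G A B Z.1 Z.2 ∂(P.prod P) ≤
        ∫⁻ X, moebiusSum G A B X X ∂P + ENNReal.ofReal e := by
      rw [lintegral_moebiusSum_diag hρ hG hA hB hdisj, lintegral_moebiusSum_prod hρ hG hA hB]
      refine (tsum_le_tsum_add_error hG hA hB hρa).trans ?_
      simp only [abs_sub_comm (ρ _ _ * ρ _ _)]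
      gcongr
    -- Finiteness on the diagonal is inherited from the product law through the error bound.
    have h1 : ∫⁻ X, moebiusSum G A B X X ∂P ≠ ∞ :=
      ne_top_of_le_ne_top (ENNReal.add_ne_top.2 ⟨h2, ENNReal.ofReal_ne_top⟩) h12
    refine ⟨h1, h2, abs_sub_le_iff.2 ⟨?_, ?_⟩⟩
    · have := ENNReal.toReal_mono (ENNReal.add_ne_top.2 ⟨h2, ENNReal.ofReal_ne_top⟩) h12
      rw [ENNReal.toReal_add h2 ENNReal.ofReal_ne_top, ENNReal.toReal_ofReal he0] at this
      linarith
    · have := ENNReal.toReal_mono (ENNReal.add_ne_top.2 ⟨h1, ENNReal.ofReal_ne_top⟩) h21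
      rw [ENNReal.toReal_add h1 ENNReal.ofReal_ne_top, ENNReal.toReal_ofReal he0] at this
      linarith
  obtain ⟨k1, k2, k3⟩ := key H hH hHT
  obtain ⟨n1, n2, n3⟩ := key (-H) hHneg hHTneg
  have hm1 : ∀ G : PointConfig d → PointConfig d → ℝ, Measurable (Function.uncurry G) →
      Measurable fun X => moebiusSum G A B X X := fun G hG =>
    (measurable_moebiusSum hG hA hB).comp (measurable_id.prodMk measurable_id)
  have hI1 := integrable_toReal_of_lintegral_ne_top (hm1 H hH).aemeasurable k1
  have hI1' := integrable_toReal_of_lintegral_ne_top (hm1 _ hHneg).aemeasurable n1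
  have hI2 := integrable_toReal_of_lintegral_ne_top (measurable_moebiusSum hH hA hB).aemeasurable k2
  have hI2' := integrable_toReal_of_lintegral_ne_top
    (measurable_moebiusSum hHneg hA hB).aemeasurable n2
  simp only [apply_restrict_eq_moebiusSum (H := H) hAb hBb]
  refine ⟨hI1.sub hI1', hI2.sub hI2', ?_⟩
  rw [integral_sub hI1 hI1', integral_sub hI2 hI2',
    integral_toReal (hm1 H hH).aemeasurable (Filter.Eventually.of_forall fun X =>
      (moebiusSum_ne_top hAb hBb _ _).lt_top),
    integral_toReal (hm1 _ hHneg).aemeasurable (Filter.Eventually.of_forall fun X =>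
      (moebiusSum_ne_top hAb hBb _ _).lt_top),
    integral_toReal (measurable_moebiusSum hH hA hB).aemeasurable (Filter.Eventually.of_forall
      fun X => (moebiusSum_ne_top hAb hBb _ _).lt_top),
    integral_toReal (measurable_moebiusSum hHneg hA hB).aemeasurable (Filter.Eventually.of_forall
      fun X => (moebiusSum_ne_top hAb hBb _ _).lt_top)]
  have h2e : 2 * e ≤ T * ((32 * C + 8 * |C'| + 1) * Real.exp
      (((32 * C + 8 * |C'| + 1) * V) ^ (1 / (1 - a)) - c * δ ^ ahat)) := by
    have h1 := volumeFactor_le ha₀ ha₁ (by linarith : 0 ≤ C) hV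
    have h2 : Φ δ ≤ |C'| * Real.exp (-c * δ ^ ahat) :=
      (hΦexp δ hδ.le).trans (by gcongr; exact le_abs_self _)
    have h3 : 0 < 1 - a := by linarith
    calc 2 * e ≤ 2 * (T * (|C'| * Real.exp (-c * δ ^ ahat)) *
          (4 * Real.exp ((32 * C * V) ^ (1 / (1 - a))))) := by
          rw [he]
          have := hΦ0 δ hδ.le
          gcongr
      _ = T * (8 * |C'| * Real.exp ((32 * C * V) ^ (1 / (1 - a)) - c * δ ^ ahat)) := by
          rw [sub_eq_add_neg _ (c * δ ^ ahat), Real.exp_add, neg_mul]; ring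
      _ ≤ _ := by
          gcongr
          · linarith
          · linarith [abs_nonneg C']
  have := abs_sub_le_iff.1 k3
  have := abs_sub_le_iff.1 n3
  refine (abs_sub_le_iff.2 ⟨?_, ?_⟩).trans h2e <;> linarith

/-- The same expansion, applied to H = 3^(number of points in A), which does not use its second
argument (B is empty): H is at most its positive Möbius sum. -/
theorem exists_exp_moment_bound (hd : 1 ≤ d) [IsProbabilityMeasure P] (hP : IsStationaryLaw P)
    (hρ : IsCorrelationFunction P ρ) {a ahat : ℝ} (ha₀ : 0 ≤ a) (ha₁ : a < 1)
    (hEDC : CondEDC ρ a ahat) :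
    ∃ K : ℝ, 1 ≤ K ∧ ∀ (A : Set (EuclideanSpace ℝ (Fin d))), MeasurableSet A →
      Bornology.IsBounded A → volume A ≤ 1 →
      ∫⁻ X, 3 ^ (X.carrier ∩ A).ncard ∂P ≤ ENNReal.ofReal K := by
  obtain ⟨K₀, hK₀, hbound⟩ := exists_correlation_bound hd hP hρ ha₀ hEDC
  refine ⟨volumeFactor a K₀ 1 + 1, by rw [volumeFactor]; nlinarith [sq_nonneg (2 * Real.exp
    ((16 * K₀ * 1) ^ (1 / (1 - a))))], fun A hA hAb hA1 => ?_⟩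
  let H : PointConfig d → PointConfig d → ℝ := fun X _ => 3 ^ (X.carrier ∩ A).ncard
  have hH : Measurable (Function.uncurry H) :=
    ((measurable_from_top (f := fun k : ℕ => (3 : ℝ) ^ k)).comp
      (PointConfig.measurable_ncard_inter hA hAb)).comp measurable_fst
  have hHT : ∀ s t : Finset (EuclideanSpace ℝ (Fin d)),
      |H (.ofFinset s) (.ofFinset t)| ≤ 1 * 3 ^ s.card * 3 ^ t.card := by
    intro s t
    simp only [H, abs_pow]
    rw [abs_of_pos (by norm_num : (0 : ℝ) < 3), one_mul]
    have h1 : ((PointConfig.ofFinset s).carrier ∩ A).ncard ≤ s.card := by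
      rw [← Set.ncard_coe_finset]
      exact Set.ncard_le_ncard Set.inter_subset_left s.finite_toSet
    calc (3 : ℝ) ^ ((PointConfig.ofFinset s).carrier ∩ A).ncard ≤ 3 ^ s.card :=
          pow_le_pow_right₀ (by norm_num) h1
      _ ≤ 3 ^ s.card * 3 ^ t.card := le_mul_of_one_le_right (by positivity)
          (one_le_pow₀ (by norm_num))
  have h1 := lintegral_moebiusSum_prod_le (B := ∅) hρ hH hA MeasurableSet.empty zero_le_one hHT
    zero_le_one (by simpa using hA1) (by simp) ha₀ ha₁ hK₀ hbound
  have h2 : ∀ Z : PointConfig d × PointConfig d,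
      (3 : ℝ≥0∞) ^ (Z.1.carrier ∩ A).ncard ≤ moebiusSum H A ∅ Z.1 Z.2 := by
    intro Z
    have h3 := apply_restrict_eq_moebiusSum (H := H) hAb Bornology.isBounded_empty Z.1 Z.2
    have h4 : H (Z.1.restrict A) (Z.2.restrict ∅) ≤ (moebiusSum H A ∅ Z.1 Z.2).toReal := by
      rw [h3]; linarith [ENNReal.toReal_nonneg (a := moebiusSum (-H) A ∅ Z.1 Z.2)]
    have h5 := ENNReal.ofReal_le_ofReal h4
    rw [ENNReal.ofReal_toReal (moebiusSum_ne_top hAb Bornology.isBounded_empty _ _)] at h5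
    simp only [H, PointConfig.restrict_carrier, Set.inter_assoc, Set.inter_self] at h5
    rwa [ENNReal.ofReal_pow (by norm_num), ENNReal.ofReal_ofNat] at h5
  calc ∫⁻ X, 3 ^ (X.carrier ∩ A).ncard ∂P
      = ∫⁻ Z, 3 ^ (Z.1.carrier ∩ A).ncard ∂(P.prod P) := by
        rw [lintegral_prod]
        · simp
        · exact (((measurable_from_top (f := fun k : ℕ => (3 : ℝ≥0∞) ^ k)).comp
            (PointConfig.measurable_ncard_inter hA hAb)).comp measurable_fst).aemeasurable
    _ ≤ ∫⁻ Z, moebiusSum H A ∅ Z.1 Z.2 ∂(P.prod P) := lintegral_mono h2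
    _ ≤ _ := h1.trans (ENNReal.ofReal_le_ofReal (by linarith))

end Mixing

/-! ### Joint cumulants as an abstract transform of joint moments -/

section Cumulants

variable {ι : Type*} [LinearOrder ι]

/-- The subsets of `S` that contain its least element. -/
def headSubsets (S : Finset ι) (h : S.Nonempty) : Finset (Finset ι) :=
  S.powerset.filter (S.min' h ∈ ·)

/-- The joint cumulants that belong to a family of joint moments `m`. -/
noncomputable def jointCumulant (m : Finset ι → ℝ) (S : Finset ι) : ℝ :=
  if h : S.Nonempty then
    -- A moment decomposes according to the block T that contains the least element, and the term T
    -- = S is solved for. Fixing the head makes the recursion unambiguous without set partitions.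
    m S - ∑ T ∈ ((headSubsets S h).erase S).attach, jointCumulant m T.1 * m (S \ T.1)
  else 0
termination_by S.card
decreasing_by
  have := T.2
  simp only [headSubsets, Finset.mem_erase, Finset.mem_filter, Finset.mem_powerset] at this
  exact Finset.card_lt_card (Finset.ssubset_iff_subset_ne.2 ⟨this.2.1, this.1⟩)

theorem jointCumulant_eq (m : Finset ι → ℝ) {S : Finset ι} (h : S.Nonempty) :
    jointCumulant m S =
      m S - ∑ T ∈ (headSubsets S h).erase S, jointCumulant m T * m (S \ T) := by
  rw [jointCumulant, dif_pos h, Finset.sum_attach _ fun T => jointCumulant m T * m (S \ T)]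

theorem self_mem_headSubsets {S : Finset ι} (h : S.Nonempty) : S ∈ headSubsets S h := by
  simp [headSubsets, Finset.min'_mem]

theorem moment_eq_sum_jointCumulant {m : Finset ι → ℝ} (hm : m ∅ = 1) {S : Finset ι}
    (h : S.Nonempty) :
    m S = ∑ T ∈ headSubsets S h, jointCumulant m T * m (S \ T) := by
  rw [← Finset.add_sum_erase _ _ (self_mem_headSubsets h), Finset.sdiff_self, hm, mul_one,
    jointCumulant_eq m h]
  ring

theorem jointCumulant_congr {m m' : Finset ι → ℝ} {S : Finset ι} (h : ∀ T ⊆ S, m T = m' T) :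
    jointCumulant m S = jointCumulant m' S := by
  induction S using Finset.strongInduction with
  | H S ih =>
    by_cases hS : S.Nonempty
    · rw [jointCumulant_eq m hS, jointCumulant_eq m' hS, h S le_rfl]
      congr 1
      refine Finset.sum_congr rfl fun T hT => ?_
      simp only [headSubsets, Finset.mem_erase, Finset.mem_filter, Finset.mem_powerset] at hT
      rw [ih T (Finset.ssubset_iff_subset_ne.2 ⟨hT.2.1, hT.1⟩) fun U hU => h U (hU.trans hT.2.1),
        h (S \ T) Finset.sdiff_subset]
    · rw [jointCumulant, jointCumulant, dif_neg hS, dif_neg hS]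

/-- Sums over the subsets with the least element, by cardinality. -/
theorem sum_headSubsets_card (g : ℕ → ℝ) {S : Finset ι} (h : S.Nonempty) :
    ∑ T ∈ headSubsets S h, g T.card =
      ∑ t ∈ Finset.range S.card, ((S.card - 1).choose t : ℝ) * g (t + 1) := by
  have h1 : headSubsets S h = (S.erase (S.min' h)).powerset.image (insert (S.min' h)) := by
    ext T
    simp only [headSubsets, Finset.mem_filter, Finset.mem_powerset, Finset.mem_image]
    constructor
    · rintro ⟨h1, h2⟩
      exact ⟨T.erase (S.min' h), Finset.erase_subset_erase _ h1, Finset.insert_erase h2⟩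
    · rintro ⟨U, hU, rfl⟩
      exact ⟨Finset.insert_subset (Finset.min'_mem _ _) (hU.trans (Finset.erase_subset _ _)),
        Finset.mem_insert_self _ _⟩
  have hnot : ∀ U ∈ (S.erase (S.min' h)).powerset, S.min' h ∉ U := fun U hU hm =>
    Finset.notMem_erase _ _ (Finset.mem_powerset.1 hU hm)
  rw [h1, Finset.sum_image]
  · have h2 : ∀ U ∈ (S.erase (S.min' h)).powerset,
        g (insert (S.min' h) U).card = g (U.card + 1) := fun U hU => by
      rw [Finset.card_insert_of_notMem (hnot U hU)]
    rw [Finset.sum_congr rfl h2, Finset.sum_powerset_apply_card (fun k => g (k + 1)),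
      Finset.card_erase_of_mem (Finset.min'_mem _ _), Nat.sub_add_cancel h.card_pos]
    simp
  · intro U hU V hV hUV
    have := congrArg (fun W => W.erase (S.min' h)) hUV
    simpa [Finset.erase_insert (hnot U hU), Finset.erase_insert (hnot V hV)] using this

theorem ssubset_of_mem_erase_headSubsets {S T : Finset ι} {h : S.Nonempty}
    (hT : T ∈ (headSubsets S h).erase S) : T ⊂ S :=
  Finset.ssubset_iff_subset_ne.2 ⟨Finset.mem_powerset.1
    (Finset.mem_filter.1 (Finset.mem_of_mem_erase hT)).1, Finset.ne_of_mem_erase hT⟩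

/-- The induction step for a cumulant bound with constant 4C. The number of blocks of size t + 1 is
(s-1 choose t), and (s-1 choose t) (t+1)! (s-t-1)! ≤ s!; this spends one of the τ ≥ 1 factorial
powers. What remains is the geometric sum of 4^(t+1), which is at most 4^s - 1. -/
theorem sum_headSubsets_factorial_le {C τ : ℝ} (hC : 0 ≤ C) (hτ : 1 ≤ τ) {S : Finset ι}
    (h : S.Nonempty) :
    C ^ S.card * (S.card ! : ℝ) ^ τ +
      ∑ T ∈ (headSubsets S h).erase S, (4 * C) ^ T.card * (T.card ! : ℝ) ^ τ *
        (C ^ (S.card - T.card) * ((S.card - T.card)! : ℝ) ^ τ) ≤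
      (4 * C) ^ S.card * (S.card ! : ℝ) ^ τ := by
  set s := S.card with hs
  have hs0 : 0 < s := h.card_pos
  have h1 : ∑ T ∈ (headSubsets S h).erase S, (4 * C) ^ T.card * (T.card ! : ℝ) ^ τ *
        (C ^ (s - T.card) * ((s - T.card)! : ℝ) ^ τ) =
      ∑ t ∈ Finset.range (s - 1), ((s - 1).choose t : ℝ) * ((4 * C) ^ (t + 1) *
        ((t + 1)! : ℝ) ^ τ * (C ^ (s - (t + 1)) * ((s - (t + 1))! : ℝ) ^ τ)) := by
    have h2 := sum_headSubsets_card (fun t => (4 * C) ^ t * (t ! : ℝ) ^ τ *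
        (C ^ (s - t) * ((s - t)! : ℝ) ^ τ)) h
    rw [← Finset.add_sum_erase _ _ (self_mem_headSubsets h), ← hs] at h2
    obtain ⟨s', hs'⟩ : ∃ s', s = s' + 1 := ⟨s - 1, by omega⟩
    rw [hs'] at h2 ⊢
    rw [Finset.sum_range_succ] at h2
    simp only [Nat.add_sub_cancel, Nat.choose_self, Nat.cast_one, one_mul] at h2 ⊢
    linarith
  rw [h1]
  have h2 : ∀ t ∈ Finset.range (s - 1), ((s - 1).choose t : ℝ) * ((4 * C) ^ (t + 1) *
        ((t + 1)! : ℝ) ^ τ * (C ^ (s - (t + 1)) * ((s - (t + 1))! : ℝ) ^ τ)) ≤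
      C ^ s * (s ! : ℝ) ^ τ * 4 ^ (t + 1) := by
    intro t ht
    rw [Finset.mem_range] at ht
    have h3 : (s - 1).choose t * ((t + 1)! * (s - (t + 1))!) ≤ s ! := by
      have h4 := Nat.choose_mul_factorial_mul_factorial (show t ≤ s - 1 by omega)
      have h5 : s ! = s * (s - 1)! := (Nat.mul_factorial_pred hs0.ne').symm
      rw [h5, ← h4, Nat.factorial_succ, show s - 1 - t = s - (t + 1) by omega]
      calc (s - 1).choose t * ((t + 1) * t ! * (s - (t + 1))!)
          = (t + 1) * ((s - 1).choose t * t ! * (s - (t + 1))!) := by ring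
        _ ≤ _ := Nat.mul_le_mul_right _ (by omega)
    have h6 : (t + 1)! * (s - (t + 1))! ≤ s ! := by
      refine le_trans ?_ h3
      exact Nat.le_mul_of_pos_left _ (Nat.choose_pos (by omega))
    have h7 : ((t + 1)! : ℝ) ^ τ * ((s - (t + 1))! : ℝ) ^ τ =
        ((t + 1)! * (s - (t + 1))! : ℝ) * ((t + 1)! * (s - (t + 1))! : ℝ) ^ (τ - 1) := by
      rw [← Real.mul_rpow (by positivity) (by positivity)]
      nth_rw 2 [← Real.rpow_one ((t + 1)! * (s - (t + 1))! : ℝ)]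
      rw [← Real.rpow_add (by positivity)]
      congr 1; ring
    have h8 : ((t + 1)! * (s - (t + 1))! : ℝ) ^ (τ - 1) ≤ (s ! : ℝ) ^ (τ - 1) :=
      Real.rpow_le_rpow (by positivity) (by exact_mod_cast h6) (by linarith)
    have h9 : (s ! : ℝ) ^ τ = s ! * (s ! : ℝ) ^ (τ - 1) := by
      nth_rw 2 [← Real.rpow_one (s ! : ℝ)]
      rw [← Real.rpow_add (by positivity)]
      congr 1; ring
    have h10 : C ^ (t + 1) * C ^ (s - (t + 1)) = C ^ s := by
      rw [← pow_add]; congr 1; omega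
    calc _ = (C ^ (t + 1) * C ^ (s - (t + 1))) * 4 ^ (t + 1) * ((s - 1).choose t *
          (((t + 1)! : ℝ) ^ τ * ((s - (t + 1))! : ℝ) ^ τ)) := by rw [mul_pow]; ring
      _ = C ^ s * 4 ^ (t + 1) * (((s - 1).choose t * ((t + 1)! * (s - (t + 1))! : ℝ)) *
          ((t + 1)! * (s - (t + 1))! : ℝ) ^ (τ - 1)) := by rw [h10, h7]; ring
      _ ≤ C ^ s * 4 ^ (t + 1) * (s ! * (s ! : ℝ) ^ (τ - 1)) := by
          gcongr
          exact_mod_cast h3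
      _ = _ := by rw [h9]; ring
  have h11 : ∑ t ∈ Finset.range (s - 1), (4 : ℝ) ^ (t + 1) ≤ 4 ^ s - 1 := by
    have h12 : ∀ n : ℕ, ∑ t ∈ Finset.range n, (4 : ℝ) ^ (t + 1) ≤ 4 ^ (n + 1) - 1 := by
      intro n
      induction n with
      | zero => norm_num
      | succ n ih =>
        rw [Finset.sum_range_succ, pow_succ _ (n + 1)]
        have : (1 : ℝ) ≤ 4 ^ (n + 1) := one_le_pow₀ (by norm_num)
        linarith
    have := h12 (s - 1)
    rwa [Nat.sub_add_cancel hs0] at this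
  have h13 : 0 ≤ C ^ s * (s ! : ℝ) ^ τ := by positivity
  calc _ ≤ C ^ s * (s ! : ℝ) ^ τ + ∑ t ∈ Finset.range (s - 1),
        C ^ s * (s ! : ℝ) ^ τ * 4 ^ (t + 1) := by exact add_le_add le_rfl (Finset.sum_le_sum h2)
    _ ≤ C ^ s * (s ! : ℝ) ^ τ + C ^ s * (s ! : ℝ) ^ τ * (4 ^ s - 1) := by
        rw [← Finset.mul_sum]; gcongr
    _ = _ := by rw [mul_pow]; ring

theorem abs_jointCumulant_le {m : Finset ι → ℝ} {C τ : ℝ} (hC : 0 ≤ C) (hτ : 1 ≤ τ)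
    {S : Finset ι} (hm : ∀ T ⊆ S, |m T| ≤ C ^ T.card * (T.card ! : ℝ) ^ τ) :
    |jointCumulant m S| ≤ (4 * C) ^ S.card * (S.card ! : ℝ) ^ τ := by
  induction S using Finset.strongInduction with
  | H S ih =>
    by_cases hS : S.Nonempty
    · rw [jointCumulant_eq m hS]
      refine le_trans ?_ (sum_headSubsets_factorial_le hC hτ hS)
      refine (abs_sub _ _).trans (add_le_add (hm S le_rfl)
        ((Finset.abs_sum_le_sum_abs _ _).trans (Finset.sum_le_sum fun T hT => ?_)))
      have hTS := ssubset_of_mem_erase_headSubsets hT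
      rw [abs_mul, ← Finset.card_sdiff_of_subset hTS.subset]
      exact mul_le_mul (ih T hTS fun U hU => hm U (hU.trans hTS.subset)) (hm _ Finset.sdiff_subset)
        (abs_nonneg _) (by positivity)
    · rw [jointCumulant, dif_neg hS, abs_zero]
      positivity

/-- Let J be the side that contains the least element. Subtracting m(S \ J) times the recursion for
m(S ∩ J) from the recursion for m(S) leaves three kinds of terms: the splitting error of S,
splitting errors of S \ T for heads T ⊆ J, and cumulants of heads T that meet both sides, which are
small by induction. Each is ε times a term of `sum_headSubsets_factorial_le`. -/
theorem abs_jointCumulant_le_of_split {m : Finset ι → ℝ} (hm0 : m ∅ = 1) {C τ ε : ℝ} (hC : 0 ≤ C)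
    (hτ : 1 ≤ τ) (hε : 0 ≤ ε) {S I : Finset ι}
    (hm : ∀ T ⊆ S, |m T| ≤ C ^ T.card * (T.card ! : ℝ) ^ τ)
    (hsplit : ∀ T ⊆ S, |m T - m (T ∩ I) * m (T \ I)| ≤ ε * (C ^ T.card * (T.card ! : ℝ) ^ τ))
    (h1 : (S ∩ I).Nonempty) (h2 : (S \ I).Nonempty) :
    |jointCumulant m S| ≤ ε * ((4 * C) ^ S.card * (S.card ! : ℝ) ^ τ) := by
  induction S using Finset.strongInduction with
  | H S ih =>
    have hS : S.Nonempty := h1.mono Finset.inter_subset_left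
    have hμ := S.min'_mem hS
    -- The hypotheses are symmetric under I ↔ S \ I, so the side with the least element may be
    -- chosen.
    obtain ⟨J, hμJ, hJ, h1J, h2J⟩ : ∃ J : Finset ι, S.min' hS ∈ J ∧
        (∀ T ⊆ S, |m T - m (T ∩ J) * m (T \ J)| ≤ ε * (C ^ T.card * (T.card ! : ℝ) ^ τ)) ∧
        (∀ T ⊆ S, (T ∩ J).Nonempty → (T \ J).Nonempty →
          (T ∩ I).Nonempty ∧ (T \ I).Nonempty) ∧ (S \ J).Nonempty := by
      by_cases hI : S.min' hS ∈ I
      · exact ⟨I, hI, hsplit, fun T _ h h' => ⟨h, h'⟩, h2⟩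
      · have e1 : ∀ T ⊆ S, T ∩ (S \ I) = T \ I := fun T hT => by
          rw [← Finset.inter_sdiff_assoc, Finset.inter_eq_left.2 hT]
        have e2 : ∀ T ⊆ S, T \ (S \ I) = T ∩ I := fun T hT => by
          ext x; simp only [Finset.mem_sdiff, Finset.mem_inter]
          have := @hT x
          tauto
        refine ⟨S \ I, Finset.mem_sdiff.2 ⟨hμ, hI⟩, fun T hT => ?_, fun T hT => ?_, ?_⟩
        · rw [e1 T hT, e2 T hT, mul_comm (m (T \ I))]
          exact hsplit T hT
        · rw [e1 T hT, e2 T hT]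
          exact fun h h' => ⟨h', h⟩
        · rw [e2 S le_rfl]
          exact h1
    have hSJ : (S ∩ J).Nonempty := ⟨_, Finset.mem_inter.2 ⟨hμ, hμJ⟩⟩
    have hSJne : S ∩ J ≠ S := fun h => by
      obtain ⟨x, hx⟩ := h2J
      rw [Finset.mem_sdiff] at hx
      rw [← h] at hx
      exact hx.2 (Finset.mem_inter.1 hx.1).2
    have hmin : (S ∩ J).min' hSJ = S.min' hS :=
      le_antisymm (Finset.min'_le _ _ (Finset.mem_inter.2 ⟨hμ, hμJ⟩))
        (Finset.min'_subset _ Finset.inter_subset_left)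
    -- The least elements of S and S ∩ J agree, so the heads of S ∩ J are among the proper heads of
    -- S.
    have hsub : headSubsets (S ∩ J) hSJ ⊆ (headSubsets S hS).erase S := by
      intro T hT
      simp only [headSubsets, Finset.mem_filter, Finset.mem_powerset, Finset.mem_erase, hmin]
        at hT ⊢
      refine ⟨fun h => ?_, hT.1.trans Finset.inter_subset_left, hT.2⟩
      rw [h] at hT
      exact hSJne (Finset.Subset.antisymm Finset.inter_subset_left hT.1)
    have hmoment := moment_eq_sum_jointCumulant hm0 hSJ
    have hkey : jointCumulant m S = (m S - m (S ∩ J) * m (S \ J)) -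
        (∑ T ∈ headSubsets (S ∩ J) hSJ,
          jointCumulant m T * (m (S \ T) - m ((S ∩ J) \ T) * m (S \ J)) +
        ∑ T ∈ (headSubsets S hS).erase S \ headSubsets (S ∩ J) hSJ,
          jointCumulant m T * m (S \ T)) := by
      rw [jointCumulant_eq m hS, ← Finset.sum_sdiff hsub, hmoment, Finset.sum_mul]
      simp only [mul_sub, Finset.sum_sub_distrib]
      have : ∀ T ∈ headSubsets (S ∩ J) hSJ, jointCumulant m T * m ((S ∩ J) \ T) * m (S \ J) =
          jointCumulant m T * (m ((S ∩ J) \ T) * m (S \ J)) := fun T _ => mul_assoc _ _ _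
      rw [Finset.sum_congr rfl this]
      ring
    have hTerm : ∀ T ∈ (headSubsets S hS).erase S, 0 ≤ (4 * C) ^ T.card * (T.card ! : ℝ) ^ τ *
        (C ^ (S.card - T.card) * ((S.card - T.card)! : ℝ) ^ τ) := fun T _ => by positivity
    have hb1 : ∀ T ∈ headSubsets (S ∩ J) hSJ,
        |jointCumulant m T * (m (S \ T) - m ((S ∩ J) \ T) * m (S \ J))| ≤
          ε * ((4 * C) ^ T.card * (T.card ! : ℝ) ^ τ *
            (C ^ (S.card - T.card) * ((S.card - T.card)! : ℝ) ^ τ)) := by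
      intro T hT
      have hTS := ssubset_of_mem_erase_headSubsets (hsub hT)
      have hTJ : T ⊆ S ∩ J := Finset.mem_powerset.1 (Finset.mem_filter.1 hT).1
      have e1 : (S ∩ J) \ T = (S \ T) ∩ J := by
        ext x; simp only [Finset.mem_sdiff, Finset.mem_inter]; tauto
      have e2 : S \ J = (S \ T) \ J := by
        ext x; simp only [Finset.mem_sdiff]
        have := @hTJ x
        simp only [Finset.mem_inter] at this
        tauto
      rw [abs_mul, ← Finset.card_sdiff_of_subset hTS.subset, e1, e2, mul_left_comm]
      exact mul_le_mul (abs_jointCumulant_le hC hτ fun U hU => hm U (hU.trans hTS.subset))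
        (hJ _ Finset.sdiff_subset) (abs_nonneg _) (by positivity)
    have hb2 : ∀ T ∈ (headSubsets S hS).erase S \ headSubsets (S ∩ J) hSJ,
        |jointCumulant m T * m (S \ T)| ≤
          ε * ((4 * C) ^ T.card * (T.card ! : ℝ) ^ τ *
            (C ^ (S.card - T.card) * ((S.card - T.card)! : ℝ) ^ τ)) := by
      intro T hT
      rw [Finset.mem_sdiff] at hT
      have hTS := ssubset_of_mem_erase_headSubsets hT.1
      have hμT : S.min' hS ∈ T := (Finset.mem_filter.1 (Finset.mem_of_mem_erase hT.1)).2
      have hTJ : (T \ J).Nonempty := by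
        by_contra hne
        rw [Finset.not_nonempty_iff_eq_empty, Finset.sdiff_eq_empty_iff_subset] at hne
        refine hT.2 ?_
        simp only [headSubsets, Finset.mem_filter, Finset.mem_powerset, hmin]
        exact ⟨Finset.subset_inter hTS.subset hne, hμT⟩
      have hc := h1J T hTS.subset ⟨_, Finset.mem_inter.2 ⟨hμT, hμJ⟩⟩ hTJ
      rw [abs_mul, ← Finset.card_sdiff_of_subset hTS.subset, ← mul_assoc]
      exact mul_le_mul (ih T hTS (fun U hU => hm U (hU.trans hTS.subset))
        (fun U hU => hsplit U (hU.trans hTS.subset)) hc.1 hc.2)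
        (hm _ Finset.sdiff_subset) (abs_nonneg _) (by positivity)
    rw [hkey]
    refine le_trans ?_ (mul_le_mul_of_nonneg_left (sum_headSubsets_factorial_le hC hτ hS) hε)
    rw [mul_add, Finset.mul_sum, ← Finset.sum_sdiff hsub]
    refine (abs_sub _ _).trans (add_le_add (hJ S le_rfl) ((abs_add_le _ _).trans ?_))
    rw [add_comm]
    refine add_le_add ?_ ?_
    · exact (Finset.abs_sum_le_sum_abs _ _).trans (Finset.sum_le_sum hb2)
    · exact (Finset.abs_sum_le_sum_abs _ _).trans (Finset.sum_le_sum hb1)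

end Cumulants

/-! ### Multilinearity of joint cumulants -/

section Tuples

variable {ι ζ : Type*} [LinearOrder ι] [Fintype ι]

/-- The tuples with entries in `Z` at the indices in `S` and `z₀` elsewhere. -/
def tuplesOn (Z : Finset ζ) (z₀ : ζ) (S : Finset ι) : Finset (ι → ζ) :=
  Fintype.piFinset fun i => if i ∈ S then Z else {z₀}

theorem mem_tuplesOn {Z : Finset ζ} {z₀ : ζ} {S : Finset ι} {f : ι → ζ} :
    f ∈ tuplesOn Z z₀ S ↔ (∀ i ∈ S, f i ∈ Z) ∧ ∀ i ∉ S, f i = z₀ := by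
  simp only [tuplesOn, Fintype.mem_piFinset]
  constructor
  · intro h
    exact ⟨fun i hi => by simpa [hi] using h i, fun i hi => by simpa [hi] using h i⟩
  · intro h i
    by_cases hi : i ∈ S
    · simpa [hi] using h.1 i hi
    · simpa [hi] using h.2 i hi

/-- Coordinates outside of the index set are frozen at z₀, so a tuple on S is the same as a tuple on
T together with one on S \ T. -/
theorem sum_tuplesOn_mul {Z : Finset ζ} {z₀ : ζ} {S T : Finset ι} (hT : T ⊆ S)
    {F G : (ι → ζ) → ℝ} (hF : ∀ f g : ι → ζ, (∀ i ∈ T, f i = g i) → F f = F g)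
    (hG : ∀ f g : ι → ζ, (∀ i ∈ S \ T, f i = g i) → G f = G g) :
    ∑ f ∈ tuplesOn Z z₀ S, F f * G f =
      (∑ f ∈ tuplesOn Z z₀ T, F f) * ∑ f ∈ tuplesOn Z z₀ (S \ T), G f := by
  rw [Finset.sum_mul_sum, ← Finset.sum_product']
  refine Finset.sum_bij' (fun f _ => (T.piecewise f fun _ => z₀, (S \ T).piecewise f fun _ => z₀))
    (fun p _ => T.piecewise p.1 p.2) ?_ ?_ ?_ ?_ ?_
  · intro f hf
    rw [mem_tuplesOn] at hf
    simp only [Finset.mem_product, mem_tuplesOn]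
    refine ⟨⟨fun i hi => ?_, fun i hi => ?_⟩, fun i hi => ?_, fun i hi => ?_⟩
    · simpa [hi] using hf.1 i (hT hi)
    · simp [hi]
    · rw [Finset.piecewise_eq_of_mem _ _ _ hi]; exact hf.1 i (Finset.sdiff_subset hi)
    · rw [Finset.piecewise_eq_of_notMem _ _ _ hi]
  · intro p hp
    simp only [Finset.mem_product, mem_tuplesOn] at hp
    rw [mem_tuplesOn]
    refine ⟨fun i hi => ?_, fun i hi => ?_⟩
    · by_cases h : i ∈ T
      · simpa [h] using hp.1.1 i h
      · simpa [h] using hp.2.1 i (Finset.mem_sdiff.2 ⟨hi, h⟩)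
    · have h : i ∉ T := fun h => hi (hT h)
      simpa [h] using hp.2.2 i (fun h' => hi (Finset.sdiff_subset h'))
  · intro f hf
    rw [mem_tuplesOn] at hf
    ext i
    by_cases h : i ∈ T
    · simp [h]
    · by_cases h' : i ∈ S
      · simp [h, h']
      · simp [h, h', hf.2 i h']
  · intro p hp
    simp only [Finset.mem_product, mem_tuplesOn] at hp
    refine Prod.ext (funext fun i => ?_) (funext fun i => ?_)
    · by_cases h : i ∈ T
      · simp [h]
      · simp [h, hp.1.2 i h]
    · by_cases h : i ∈ S \ T
      · simp only [Finset.mem_sdiff] at h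
        simp [h.1, h.2]
      · simp only [Finset.piecewise_eq_of_notMem _ _ _ h]
        exact (hp.2.2 i h).symm
  · intro f hf
    congr 1
    · exact hF _ _ fun i hi => by simp [hi]
    · exact hG _ _ fun i hi => by
        dsimp only
        exact (Finset.piecewise_eq_of_mem _ _ _ hi).symm

/-- The recursion is a sum of products of quantities that depend on disjoint sets of coordinates,
and each such product expands by `sum_tuplesOn_mul`. -/
theorem jointCumulant_sum {Z : Finset ζ} {z₀ : ζ} {m : Finset ι → ℝ} {M : (ι → ζ) → Finset ι → ℝ}
    (hM : ∀ (T : Finset ι) (f g : ι → ζ), (∀ i ∈ T, f i = g i) → M f T = M g T)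
    (hm : ∀ S, m S = ∑ f ∈ tuplesOn Z z₀ S, M f S) (S : Finset ι) :
    jointCumulant m S = ∑ f ∈ tuplesOn Z z₀ S, jointCumulant (M f) S := by
  induction S using Finset.strongInduction with
  | H S ih =>
    by_cases hS : S.Nonempty
    · simp only [jointCumulant_eq _ hS]
      rw [Finset.sum_sub_distrib, ← hm, Finset.sum_comm]
      congr 1
      refine Finset.sum_congr rfl fun T hT => ?_
      have hTS := ssubset_of_mem_erase_headSubsets hT
      rw [ih T hTS, hm, ← sum_tuplesOn_mul hTS.subset]
      · exact fun f g h => jointCumulant_congr fun U hU => hM U f g fun i hi => h i (hU hi)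
      · exact fun f g h => hM _ f g h
    · simp [jointCumulant, hS]

theorem pow_sum_eq_sum_tuplesOn {R : Type*} [CommSemiring R] (Z : Finset ζ) (z₀ : ζ) (y : ζ → R)
    (S : Finset ι) :
    (∑ z ∈ Z, y z) ^ S.card = ∑ f ∈ tuplesOn Z z₀ S, ∏ i ∈ S, y (f i) := by
  have h := Finset.prod_univ_sum (fun i => if i ∈ S then Z else {z₀})
    (fun (i : ι) z => if i ∈ S then y z else 1)
  have h1 : ∀ i, (∑ z ∈ if i ∈ S then Z else {z₀}, if i ∈ S then y z else 1) =
      if i ∈ S then ∑ z ∈ Z, y z else 1 := by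
    intro i
    by_cases hi : i ∈ S <;> simp [hi]
  simp only [h1] at h
  rw [Finset.prod_ite_mem, Finset.univ_inter, Finset.prod_const] at h
  rw [h]
  refine Finset.sum_congr rfl fun f _ => ?_
  rw [Finset.prod_ite_mem, Finset.univ_inter]

end Tuples

/-! ### Counting tuples without large gaps -/

section Chained

variable {ι ζ : Type*} [LinearOrder ι] [AddCommGroup ζ]

/-- The entries of `f` at the indices in `S` can be reached from the one at `i₀` by steps
in `box`. -/
def IsChained (box : Finset ζ) (S : Finset ι) (i₀ : ι) (f : ι → ζ) : Prop :=
  ∀ I ⊆ S, i₀ ∈ I → I ≠ S → ∃ i ∈ I, ∃ j ∈ S \ I, f j - f i ∈ box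

/-- The reached set grows from i₀ one index at a time, each new index getting as parent an index
reached before. The second property replaces the order of discovery: every proper subset containing
the root has an index outside whose parent lies inside. -/
theorem IsChained.exists_parent {box : Finset ζ} {S : Finset ι} {i₀ : ι} (hi₀ : i₀ ∈ S) {f : ι → ζ}
    (h : IsChained box S i₀ f) :
    ∃ p : ι → ι, (∀ i ∈ S.erase i₀, p i ∈ S ∧ f i - f (p i) ∈ box) ∧
      ∀ I ⊆ S, i₀ ∈ I → I ≠ S → ∃ j ∈ S \ I, p j ∈ I := by
  have key : ∀ n : ℕ, n + 1 ≤ S.card → ∃ J ⊆ S, J.card = n + 1 ∧ i₀ ∈ J ∧ ∃ p : ι → ι,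
      (∀ i ∈ J.erase i₀, p i ∈ J ∧ f i - f (p i) ∈ box) ∧
      ∀ I ⊆ J, i₀ ∈ I → I ≠ J → ∃ j ∈ J \ I, p j ∈ I := by
    intro n
    induction n with
    | zero =>
      intro _
      refine ⟨{i₀}, by simpa using hi₀, by simp, by simp, id, by simp, ?_⟩
      intro I hI h0 hne
      exact absurd (Finset.Subset.antisymm hI (by simpa using h0)) hne
    | succ n ih =>
      intro hn
      obtain ⟨J, hJS, hJc, hJ0, p, hp1, hp2⟩ := ih (by omega)
      have hJne : J ≠ S := fun h => by rw [h] at hJc; omega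
      obtain ⟨i, hi, j, hj, hij⟩ := h J hJS hJ0 hJne
      rw [Finset.mem_sdiff] at hj
      refine ⟨insert j J, Finset.insert_subset hj.1 hJS, by
        rw [Finset.card_insert_of_notMem hj.2, hJc], Finset.mem_insert_of_mem hJ0,
        Function.update p j i, ?_, ?_⟩
      · intro k hk
        rw [Finset.mem_erase, Finset.mem_insert] at hk
        by_cases hkj : k = j
        · subst hkj
          simp [hi, hij]
        · have := hp1 k (Finset.mem_erase.2 ⟨hk.1, hk.2.resolve_left hkj⟩)
          simp only [Function.update_of_ne hkj]
          exact ⟨Finset.mem_insert_of_mem this.1, this.2⟩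
      · intro I hI h0 hne
        by_cases hJI : J ⊆ I
        · refine ⟨j, Finset.mem_sdiff.2 ⟨Finset.mem_insert_self _ _, fun hjI => hne ?_⟩, ?_⟩
          · exact Finset.Subset.antisymm hI (Finset.insert_subset hjI hJI)
          · simpa using hJI hi
        · obtain ⟨k, hk, hpk⟩ := hp2 (J ∩ I) Finset.inter_subset_left
            (Finset.mem_inter.2 ⟨hJ0, h0⟩) (fun h => hJI (Finset.inter_eq_left.1 h))
          simp only [Finset.mem_sdiff, Finset.mem_inter, not_and] at hk
          have hkj : k ≠ j := fun h => hj.2 (h ▸ hk.1)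
          refine ⟨k, Finset.mem_sdiff.2 ⟨Finset.mem_insert_of_mem hk.1, hk.2 hk.1⟩, ?_⟩
          simp only [Function.update_of_ne hkj]
          exact (Finset.mem_inter.1 hpk).2
  have hc : 0 < S.card := Finset.card_pos.2 ⟨i₀, hi₀⟩
  obtain ⟨J, hJS, hJc, -, p, hp⟩ := key (S.card - 1) (by omega)
  obtain rfl : J = S := Finset.eq_of_subset_of_card_le hJS (by omega)
  exact ⟨p, hp⟩

-- A chained tuple is encoded by its value at the root and, for every other index, its parent and
-- the increment to the parent. If two tuples have the same code, the set of indices where they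
-- agree contains the root and is closed under passing to children, so it is all of S.
open Classical in
theorem card_filter_isChained_le [Fintype ι] (Z : Finset ζ) (z₀ : ζ) (box : Finset ζ) {S : Finset ι} {i₀ : ι}
    (hi₀ : i₀ ∈ S) :
    ((tuplesOn Z z₀ S).filter (IsChained box S i₀)).card ≤
      Z.card * (S.card * box.card) ^ (S.card - 1) := by
  let p : (ι → ζ) → ι → ι := fun f =>
    if h : IsChained box S i₀ f then (h.exists_parent hi₀).choose else id
  have hp : ∀ f, IsChained box S i₀ f →
      (∀ i ∈ S.erase i₀, p f i ∈ S ∧ f i - f (p f i) ∈ box) ∧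
        ∀ I ⊆ S, i₀ ∈ I → I ≠ S → ∃ j ∈ S \ I, p f j ∈ I := by
    intro f h
    simp only [p, dif_pos h]
    exact (h.exists_parent hi₀).choose_spec
  let R : Finset (ζ × (ι → ι × ζ)) := Z ×ˢ Fintype.piFinset fun i =>
    if i ∈ S.erase i₀ then S ×ˢ box else {(i₀, 0)}
  have hR : R.card = Z.card * (S.card * box.card) ^ (S.card - 1) := by
    simp only [R, Finset.card_product, Fintype.card_piFinset]
    congr 1
    have : ∀ i, (if i ∈ S.erase i₀ then S ×ˢ box else {(i₀, 0)}).card =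
        if i ∈ S.erase i₀ then S.card * box.card else 1 := fun i => by
      split_ifs <;> simp
    rw [Finset.prod_congr rfl fun i _ => this i, Finset.prod_ite_mem, Finset.univ_inter,
      Finset.prod_const, Finset.card_erase_of_mem hi₀]
  rw [← hR]
  refine Finset.card_le_card_of_injOn (fun f => (f i₀, fun i =>
    if i ∈ S.erase i₀ then (p f i, f i - f (p f i)) else (i₀, 0))) ?_ ?_
  · intro f hf
    rw [Finset.mem_coe, Finset.mem_filter, mem_tuplesOn] at hf
    simp only [R, Finset.coe_product, Set.mem_prod, Finset.mem_coe, Fintype.mem_piFinset]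
    refine ⟨hf.1.1 _ hi₀, fun i => ?_⟩
    split_ifs with hi
    · exact Finset.mem_product.2 ((hp f hf.2).1 i hi)
    · simp
  · intro f hf g hg hfg
    rw [Finset.mem_coe, Finset.mem_filter, mem_tuplesOn] at hf hg
    simp only [Prod.mk.injEq] at hfg
    have h0 : S.filter (fun i => f i = g i) = S := by
      by_contra hne
      obtain ⟨j, hj, hpj⟩ := (hp f hf.2).2 _ (Finset.filter_subset _ _)
        (Finset.mem_filter.2 ⟨hi₀, hfg.1⟩) hne
      rw [Finset.mem_sdiff] at hj
      have hji : j ≠ i₀ := fun h => hj.2 (Finset.mem_filter.2 ⟨hj.1, h ▸ hfg.1⟩)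
      have h2 := congrFun hfg.2 j
      simp only [Finset.mem_erase, ne_eq, hji, not_false_eq_true, hj.1, and_self, if_true,
        Prod.mk.injEq] at h2
      refine hj.2 (Finset.mem_filter.2 ⟨hj.1, ?_⟩)
      have h3 := (Finset.mem_filter.1 hpj).2
      have h4 := h2.2
      rw [← h2.1, ← h3] at h4
      exact sub_left_injective h4
    ext i
    by_cases hi : i ∈ S
    · rw [← h0] at hi
      exact (Finset.mem_filter.1 hi).2
    · rw [hf.1.2 i hi, hg.1.2 i hi]

/-- Each tuple is sorted by the least N for which it is chained at scale N + 1. Then either N = 0 or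
it is not chained at scale N, so the bound B w(N) applies, while the number of such tuples is
controlled by the box at scale N + 1. -/
theorem sum_abs_le_of_isChained [Fintype ι] (Z : Finset ζ) (z₀ : ζ) (box : ℕ → Finset ζ) {S : Finset ι}
    {i₀ : ι} (hi₀ : i₀ ∈ S) {κ : (ι → ζ) → ℝ} {B : ℝ} {w : ℕ → ℝ} (hB : 0 ≤ B)
    (hw : ∀ N, 0 ≤ w N)
    (hκ : ∀ f ∈ tuplesOn Z z₀ S, ∀ N, (N = 0 ∨ ¬ IsChained (box N) S i₀ f) → |κ f| ≤ B * w N)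
    {N₀ : ℕ} (hN₀ : ∀ z ∈ Z, ∀ z' ∈ Z, z' - z ∈ box (N₀ + 1)) :
    ∑ f ∈ tuplesOn Z z₀ S, |κ f| ≤ B * (Z.card * ∑ N ∈ Finset.range (N₀ + 1),
      w N * ((S.card : ℝ) * (box (N + 1)).card) ^ (S.card - 1)) := by
  classical
  have h1 : ∀ f ∈ tuplesOn Z z₀ S, |κ f| ≤ ∑ N ∈ Finset.range (N₀ + 1),
      if IsChained (box (N + 1)) S i₀ f then B * w N else 0 := by
    intro f hf
    have hex : ∃ N, IsChained (box (N + 1)) S i₀ f := by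
      refine ⟨N₀, fun I hI h0 hne => ?_⟩
      obtain ⟨j, hj, hjI⟩ := Finset.exists_of_ssubset (Finset.ssubset_iff_subset_ne.2 ⟨hI, hne⟩)
      rw [mem_tuplesOn] at hf
      exact ⟨i₀, h0, j, Finset.mem_sdiff.2 ⟨hj, hjI⟩, hN₀ _ (hf.1 _ hi₀) _ (hf.1 _ hj)⟩
    have hle : Nat.find hex ≤ N₀ := by
      refine Nat.find_min' hex fun I hI h0 hne => ?_
      obtain ⟨j, hj, hjI⟩ := Finset.exists_of_ssubset (Finset.ssubset_iff_subset_ne.2 ⟨hI, hne⟩)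
      rw [mem_tuplesOn] at hf
      exact ⟨i₀, h0, j, Finset.mem_sdiff.2 ⟨hj, hjI⟩, hN₀ _ (hf.1 _ hi₀) _ (hf.1 _ hj)⟩
    have h2 : |κ f| ≤ B * w (Nat.find hex) := by
      refine hκ f hf _ ?_
      rcases Nat.eq_zero_or_pos (Nat.find hex) with h | h
      · exact Or.inl h
      · right
        have := Nat.find_min hex (show Nat.find hex - 1 < Nat.find hex by omega)
        rwa [Nat.sub_add_cancel h] at this
    refine h2.trans ?_
    have h3 := Finset.single_le_sum (f := fun N => if IsChained (box (N + 1)) S i₀ f then B * w N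
      else 0) (fun N _ => by
        have := mul_nonneg hB (hw N)
        positivity) (Finset.mem_range.2 (Nat.lt_succ_of_le hle))
    simpa only [if_pos (Nat.find_spec hex)] using h3
  refine (Finset.sum_le_sum h1).trans ?_
  rw [Finset.sum_comm, Finset.mul_sum, Finset.mul_sum]
  refine Finset.sum_le_sum fun N _ => ?_
  rw [← Finset.sum_filter, Finset.sum_const, nsmul_eq_mul]
  have h4 := card_filter_isChained_le Z z₀ (box (N + 1)) hi₀
  have h5 : (((tuplesOn Z z₀ S).filter (IsChained (box (N + 1)) S i₀)).card : ℝ) ≤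
      Z.card * ((S.card : ℝ) * (box (N + 1)).card) ^ (S.card - 1) := by exact_mod_cast h4
  calc _ ≤ (Z.card * ((S.card : ℝ) * (box (N + 1)).card) ^ (S.card - 1)) * (B * w N) :=
        mul_le_mul_of_nonneg_right h5 (mul_nonneg hB (hw N))
    _ = _ := by ring

end Chained

/-! ### From mixing to a cumulant bound for sums over a lattice -/

section CumulantBound

theorem add_one_pow_le_factorial_mul_exp (N k : ℕ) :
    ((N : ℝ) + 1) ^ k ≤ k ! * Real.exp (N + 1) := by
  have h := Real.pow_div_factorial_le_exp ((N : ℝ) + 1) (by positivity) k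
  rwa [div_le_iff₀ (by positivity), mul_comm] at h

theorem natCast_pow_le_factorial_mul_exp (k : ℕ) : (k : ℝ) ^ k ≤ k ! * Real.exp 1 ^ k := by
  have h := Real.pow_div_factorial_le_exp (k : ℝ) (by positivity) k
  rwa [div_le_iff₀ (by positivity), mul_comm, ← Real.exp_one_pow] at h

theorem one_le_factorial_cast (k : ℕ) : (1 : ℝ) ≤ k ! := by exact_mod_cast Nat.factorial_pos k

theorem sum_exp_neg_nat_le (n : ℕ) : ∑ N ∈ Finset.range n, Real.exp (-(N : ℝ)) ≤ 2 := by
  have h1 : ∀ N : ℕ, Real.exp (-(N : ℝ)) = Real.exp (-1) ^ N := fun N => by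
    rw [← Real.exp_nat_mul]; ring_nf
  have h3 : Real.exp (-1) ≤ 1 / 2 := by
    rw [Real.exp_neg, ← one_div]
    exact one_div_le_one_div_of_le (by norm_num) (by linarith [Real.add_one_le_exp (1 : ℝ)])
  simp only [h1]
  have h4 : Real.exp (-1) < 1 := by linarith
  calc _ ≤ ∑' N : ℕ, Real.exp (-1) ^ N :=
        (summable_geometric_of_lt_one (Real.exp_pos _).le h4).sum_le_tsum _ fun i _ => by positivity
    _ = (1 - Real.exp (-1))⁻¹ := tsum_geometric_of_lt_one (Real.exp_pos _).le h4
    _ ≤ 2 := by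
        rw [inv_le_comm₀ (by linarith) (by norm_num)]
        linarith

/-- The number of chained tuples, weighted by the decay of the cumulants. -/
theorem sum_exp_mul_pow_le {k : ℕ} {K D q : ℝ} (hk : 1 ≤ k) (hK : 1 ≤ K) (hD : 0 ≤ D) (hq : 0 ≤ q)
    {c : ℕ → ℝ} (hc0 : ∀ N, 0 ≤ c N) (hc : ∀ N : ℕ, c N ≤ K * (k : ℝ) ^ D * ((N : ℝ) + 1) ^ q)
    (n : ℕ) :
    ∑ N ∈ Finset.range n, Real.exp (-((q + 1) * N)) * ((k : ℝ) * c N) ^ (k - 1) ≤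
      2 * Real.exp q * (K * Real.exp (1 + D)) ^ k * (k ! : ℝ) ^ (1 + D + q) := by
  have hk0 : (1 : ℝ) ≤ k := by exact_mod_cast hk
  have hf := one_le_factorial_cast k
  have h1 : ∀ N : ℕ, Real.exp (-((q + 1) * N)) * ((k : ℝ) * c N) ^ (k - 1) ≤
      Real.exp (-(N : ℝ)) * (Real.exp q * (K * Real.exp (1 + D)) ^ k *
        (k ! : ℝ) ^ (1 + D + q)) := by
    intro N
    have hN1 : (1 : ℝ) ≤ ((N : ℝ) + 1) ^ q := Real.one_le_rpow (by simp) hq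
    have hkD : (1 : ℝ) ≤ (k : ℝ) ^ D := Real.one_le_rpow hk0 hD
    have h2 : ((k : ℝ) * c N) ^ (k - 1) ≤ (k * (K * (k : ℝ) ^ D * ((N : ℝ) + 1) ^ q)) ^ k := by
      refine (pow_le_pow_left₀ (mul_nonneg (by positivity) (hc0 N))
        (mul_le_mul_of_nonneg_left (hc N) (by positivity)) _).trans ?_
      refine pow_le_pow_right₀ ?_ (Nat.sub_le _ _)
      exact one_le_mul_of_one_le_of_one_le hk0 (one_le_mul_of_one_le_of_one_le
        (one_le_mul_of_one_le_of_one_le hK hkD) hN1)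
    -- Since (N+1)^k ≤ k! e^(N+1), polynomial growth in N costs k!^q and e^(qN); the decay rate q +
    -- 1 pays for the latter and leaves e^(-N) to sum.
    have h3 : (((N : ℝ) + 1) ^ q) ^ k ≤ (k ! : ℝ) ^ q * (Real.exp q * Real.exp (q * N)) := by
      rw [← Real.rpow_natCast, ← Real.rpow_mul (by positivity), mul_comm q, Real.rpow_mul
        (by positivity), Real.rpow_natCast]
      refine (Real.rpow_le_rpow (by positivity) (add_one_pow_le_factorial_mul_exp N k) hq).trans ?_
      rw [Real.mul_rpow (by positivity) (by positivity), ← Real.exp_mul, ← Real.exp_add]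
      apply le_of_eq
      ring_nf
    have h4 : ((k : ℝ) ^ D) ^ k ≤ (k ! : ℝ) ^ D * Real.exp D ^ k := by
      rw [← Real.rpow_natCast, ← Real.rpow_mul (by positivity), mul_comm D, Real.rpow_mul
        (by positivity), Real.rpow_natCast]
      refine (Real.rpow_le_rpow (by positivity) (natCast_pow_le_factorial_mul_exp k) hD).trans ?_
      rw [Real.mul_rpow (by positivity) (by positivity), ← Real.exp_nat_mul, ← Real.exp_mul,
        ← Real.exp_nat_mul]
      apply le_of_eq
      ring_nf
    have h5 : ((k : ℝ) * (K * (k : ℝ) ^ D * ((N : ℝ) + 1) ^ q)) ^ k ≤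
        (k ! * Real.exp 1 ^ k) * (K ^ k * ((k ! : ℝ) ^ D * Real.exp D ^ k) *
          ((k ! : ℝ) ^ q * (Real.exp q * Real.exp (q * N)))) := by
      rw [mul_pow, mul_pow, mul_pow]
      gcongr
      exact natCast_pow_le_factorial_mul_exp k
    have h6 : Real.exp (-((q + 1) * N)) = Real.exp (-(N : ℝ)) * Real.exp (-(q * N)) := by
      rw [← Real.exp_add]; ring_nf
    have h7 : Real.exp (-(q * N)) * Real.exp (q * N) = 1 := by
      rw [← Real.exp_add]; simp
    calc _ ≤ Real.exp (-((q + 1) * N)) * ((k ! * Real.exp 1 ^ k) * (K ^ k *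
          ((k ! : ℝ) ^ D * Real.exp D ^ k) *
          ((k ! : ℝ) ^ q * (Real.exp q * Real.exp (q * N))))) :=
        mul_le_mul_of_nonneg_left (h2.trans h5) (Real.exp_pos _).le
      _ = Real.exp (-(N : ℝ)) * (Real.exp q * (K * (Real.exp 1 * Real.exp D)) ^ k *
        ((k ! : ℝ) * (k ! : ℝ) ^ D * (k ! : ℝ) ^ q)) *
          (Real.exp (-(q * N)) * Real.exp (q * N)) := by
        rw [h6]; ring
      _ = _ := by
        rw [h7, mul_one, ← Real.exp_add, Real.rpow_add (by positivity), Real.rpow_add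
          (by positivity), Real.rpow_one]
  refine (Finset.sum_le_sum fun N _ => h1 N).trans ?_
  rw [← Finset.sum_mul]
  calc _ ≤ 2 * (Real.exp q * (K * Real.exp (1 + D)) ^ k * (k ! : ℝ) ^ (1 + D + q)) :=
        mul_le_mul_of_nonneg_right (sum_exp_neg_nat_le n) (by positivity)
    _ = _ := by ring

/-- A tuple that is not chained at scale N splits into two groups whose increments avoid the box,
hence its joint cumulant is at most exp(-(q+1) N) times the trivial bound. The exponent t + 1 + D +
q collects the moments, the k^(k-1) choices of parents, and the k-dependence and N-dependence of the
box sizes. -/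
theorem abs_jointCumulant_sum_le {Ω ζ : Type*} [MeasurableSpace Ω] {P : Measure Ω}
    [IsProbabilityMeasure P] [AddCommGroup ζ] {Y : ζ → Ω → ℝ} {Z : Finset ζ} {k : ℕ}
    {box : ℕ → Finset ζ} {C t K D q : ℝ} (hk : 1 ≤ k) (hC : 0 ≤ C) (ht : 1 ≤ t) (hK : 1 ≤ K)
    (hD : 0 ≤ D) (hq : 0 ≤ q)
    (hint : ∀ (T : Finset (Fin k)) (f : Fin k → ζ), Integrable (fun ω => ∏ i ∈ T, Y (f i) ω) P)
    (hmom : ∀ (T : Finset (Fin k)) (f : Fin k → ζ),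
      |∫ ω, ∏ i ∈ T, Y (f i) ω ∂P| ≤ C ^ T.card * (T.card ! : ℝ) ^ t)
    (hmix : ∀ N : ℕ, 1 ≤ N → ∀ (T I : Finset (Fin k)) (f : Fin k → ζ),
      (∀ i ∈ T ∩ I, ∀ j ∈ T \ I, f j - f i ∉ box N) →
      |∫ ω, ∏ i ∈ T, Y (f i) ω ∂P -
        (∫ ω, ∏ i ∈ T ∩ I, Y (f i) ω ∂P) * ∫ ω, ∏ i ∈ T \ I, Y (f i) ω ∂P| ≤
          Real.exp (-((q + 1) * N)) * (C ^ T.card * (T.card ! : ℝ) ^ t))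
    (hbox : ∀ N : ℕ, ((box (N + 1)).card : ℝ) ≤ K * (k : ℝ) ^ D * ((N : ℝ) + 1) ^ q)
    (hZ : ∃ N₀ : ℕ, ∀ z ∈ Z, ∀ z' ∈ Z, z' - z ∈ box (N₀ + 1)) :
    |jointCumulant (fun T : Finset (Fin k) => ∫ ω, (∑ z ∈ Z, Y z ω) ^ T.card ∂P) Finset.univ| ≤
      Z.card * (2 * Real.exp q * (4 * C * K * Real.exp (1 + D)) ^ k *
        (k ! : ℝ) ^ (t + 1 + D + q)) := by
  obtain ⟨N₀, hN₀⟩ := hZ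
  let i₀ : Fin k := ⟨0, hk⟩
  let M : (Fin k → ζ) → Finset (Fin k) → ℝ := fun f T => ∫ ω, ∏ i ∈ T, Y (f i) ω ∂P
  have hM : ∀ (T : Finset (Fin k)) (f g : Fin k → ζ), (∀ i ∈ T, f i = g i) → M f T = M g T := by
    intro T f g h
    simp only [M]
    congr 1
    ext ω
    exact Finset.prod_congr rfl fun i hi => by rw [h i hi]
  have hm : ∀ S : Finset (Fin k), ∫ ω, (∑ z ∈ Z, Y z ω) ^ S.card ∂P =
      ∑ f ∈ tuplesOn Z (0 : ζ) S, M f S := by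
    intro S
    simp only [M]
    rw [← integral_finsetSum _ fun f _ => hint S f]
    congr 1
    ext ω
    exact pow_sum_eq_sum_tuplesOn Z 0 (fun z => Y z ω) S
  rw [jointCumulant_sum hM hm]
  refine (Finset.abs_sum_le_sum_abs _ _).trans ?_
  have hM0 : ∀ f, M f ∅ = 1 := fun f => by simp [M]
  have hk' : (Finset.univ : Finset (Fin k)).card = k := by simp
  refine (sum_abs_le_of_isChained Z 0 box (Finset.mem_univ i₀) (κ := fun f =>
    jointCumulant (M f) Finset.univ) (B := (4 * C) ^ k * (k ! : ℝ) ^ t)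
    (w := fun N => Real.exp (-((q + 1) * N))) (by positivity) (fun N => (Real.exp_pos _).le)
    ?_ hN₀).trans ?_
  · intro f _ N hN
    rcases hN with rfl | hN
    · have := abs_jointCumulant_le (S := Finset.univ) (m := M f) hC ht fun T _ => hmom T f
      simpa [hk'] using this
    · rcases Nat.eq_zero_or_pos N with rfl | hN0
      · have := abs_jointCumulant_le (S := Finset.univ) (m := M f) hC ht fun T _ => hmom T f
        simpa [hk'] using this
      simp only [IsChained, not_forall] at hN
      obtain ⟨I, hI, h0, hne, h⟩ := hN
      push Not at h
      have := abs_jointCumulant_le_of_split (hM0 f) hC ht (Real.exp_pos (-((q + 1) * N))).le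
        (S := Finset.univ) (I := I) (fun T _ => hmom T f) (fun T _ => hmix N hN0 T I f ?_)
        ⟨i₀, by simpa using h0⟩ ?_
      · rw [hk'] at this
        simpa only [mul_comm] using this
      · intro i hi j hj
        refine h i (Finset.mem_inter.1 hi).2 j (Finset.mem_sdiff.2 ⟨Finset.mem_univ _, ?_⟩)
        exact (Finset.mem_sdiff.1 hj).2
      · rw [Finset.sdiff_nonempty]
        exact fun h => hne (Finset.Subset.antisymm hI h)
  · rw [hk']
    have h1 := sum_exp_mul_pow_le hk hK hD hq (c := fun N => ((box (N + 1)).card : ℝ))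
      (fun N => by positivity) hbox (N₀ + 1)
    calc _ ≤ (4 * C) ^ k * (k ! : ℝ) ^ t * (Z.card * (2 * Real.exp q *
          (K * Real.exp (1 + D)) ^ k * (k ! : ℝ) ^ (1 + D + q))) := by gcongr
      _ = _ := by
        rw [show t + 1 + D + q = t + (1 + D + q) by ring, Real.rpow_add (by positivity) t]
        ring

end CumulantBound

/-! ### Moments of one variable controlled by its cumulants -/

section Scalar

/-- The cumulants that belong to a sequence of moments. -/
noncomputable def cumulantSeq (m : ℕ → ℝ) : ℕ → ℝ
  | 0 => 0
  | n + 1 => m (n + 1) - ∑ t : Fin n, (n.choose t : ℝ) * (cumulantSeq m (t + 1) * m (n - t))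

theorem cumulantSeq_succ (m : ℕ → ℝ) (n : ℕ) :
    cumulantSeq m (n + 1) = m (n + 1) -
      ∑ t ∈ Finset.range n, (n.choose t : ℝ) * (cumulantSeq m (t + 1) * m (n - t)) := by
  rw [cumulantSeq, Finset.sum_range fun t => (n.choose t : ℝ) * (cumulantSeq m (t + 1) * m (n - t))]

theorem moment_succ_eq_sum_cumulantSeq {m : ℕ → ℝ} (hm : m 0 = 1) (n : ℕ) :
    m (n + 1) = ∑ t ∈ Finset.range (n + 1),
      (n.choose t : ℝ) * (cumulantSeq m (t + 1) * m (n - t)) := by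
  rw [Finset.sum_range_succ, cumulantSeq_succ m n]
  simp [hm]

/-- If moments depend on the cardinality only, so do all terms of the recursion, and the heads of
size t + 1 are counted by a binomial coefficient. -/
theorem jointCumulant_card {ι : Type*} [LinearOrder ι] (m : ℕ → ℝ) (S : Finset ι) :
    jointCumulant (fun T : Finset ι => m T.card) S = cumulantSeq m S.card := by
  induction S using Finset.strongInduction with
  | H S ih =>
    by_cases hS : S.Nonempty
    · obtain ⟨n, hn⟩ : ∃ n, S.card = n + 1 :=
        ⟨S.card - 1, (Nat.sub_add_cancel (Finset.card_pos.2 hS)).symm⟩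
      rw [jointCumulant_eq _ hS, hn, cumulantSeq_succ]
      congr 1
      have h := sum_headSubsets_card (fun t => cumulantSeq m t * m (S.card - t)) hS
      rw [hn, Finset.sum_range_succ, ← Finset.add_sum_erase _ _ (self_mem_headSubsets hS), hn] at h
      simp only [Nat.add_sub_cancel, Nat.choose_self, Nat.cast_one, one_mul, Nat.add_sub_add_right]
        at h
      have h2 : ∑ T ∈ (headSubsets S hS).erase S, jointCumulant (fun T : Finset ι => m T.card) T *
          m (S \ T).card =
          ∑ T ∈ (headSubsets S hS).erase S, cumulantSeq m T.card * m (n + 1 - T.card) := by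
        refine Finset.sum_congr rfl fun T hT => ?_
        have hTS := ssubset_of_mem_erase_headSubsets hT
        rw [ih T hTS, Finset.card_sdiff_of_subset hTS.subset, hn]
      rw [h2]
      linarith
    · rw [Finset.not_nonempty_iff_eq_empty.1 hS]
      simp [jointCumulant, cumulantSeq]

/-- Moments are dominated by the exponential generating function of the cumulants. -/
theorem abs_moment_le_exp_cumulantSeq {m c : ℕ → ℝ} (hm : m 0 = 1) {τ : ℝ} (hτ : 0 < τ) (K : ℕ)
    (hc : ∀ j, j + 1 ≤ K → |cumulantSeq m (j + 1)| ≤ c (j + 1)) :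
    |m K| ≤ K ! * τ⁻¹ ^ K *
      Real.exp (∑ j ∈ Finset.range K, c (j + 1) * τ ^ (j + 1) / (j + 1)!) := by
  set a : ℕ → ℝ := fun s => |m s| * τ ^ s / s ! with ha
  set w : ℕ → ℝ := fun j => c (j + 1) * τ ^ (j + 1) / (j + 1)! with hw
  have ha0 : ∀ s, 0 ≤ a s := fun s => by positivity
  have hw0 : ∀ j ∈ Finset.range K, 0 ≤ w j := fun j hj => by
    have := (abs_nonneg _).trans (hc j (Finset.mem_range.1 hj))
    simp only [w]
    positivity
  -- The moment recursion in normalized form: the coefficient inequality behind f' ≤ W' f for the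
  -- generating polynomials below.
  have hrec : ∀ s ∈ Finset.range K, a (s + 1) * (s + 1 : ℕ) ≤
      ∑ t ∈ Finset.range (s + 1), w t * (t + 1 : ℕ) * a (s - t) := by
    intro s hs
    have hs' := Finset.mem_range.1 hs
    have h1 : |m (s + 1)| ≤ ∑ t ∈ Finset.range (s + 1),
        (s.choose t : ℝ) * (c (t + 1) * |m (s - t)|) := by
      rw [moment_succ_eq_sum_cumulantSeq hm s]
      refine (Finset.abs_sum_le_sum_abs _ _).trans (Finset.sum_le_sum fun t ht => ?_)
      rw [abs_mul, abs_mul, Nat.abs_cast]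
      have := hc t (by have := Finset.mem_range.1 ht; omega)
      gcongr
    calc a (s + 1) * (s + 1 : ℕ) = |m (s + 1)| * (τ ^ (s + 1) / s !) := by
          simp only [a, Nat.factorial_succ]
          push_cast
          field_simp
      _ ≤ (∑ t ∈ Finset.range (s + 1), (s.choose t : ℝ) * (c (t + 1) * |m (s - t)|)) *
          (τ ^ (s + 1) / s !) := by gcongr
      _ = _ := by
          rw [Finset.sum_mul]
          refine Finset.sum_congr rfl fun t ht => ?_
          have hts : t ≤ s := Nat.lt_succ_iff.1 (Finset.mem_range.1 ht)
          simp only [a, w, Nat.factorial_succ]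
          rw [Nat.cast_choose ℝ hts, show s + 1 = (t + 1) + (s - t) by omega, pow_add]
          push_cast
          field_simp
  let f : ℝ → ℝ := fun x => ∑ s ∈ Finset.range (K + 1), a s * x ^ s
  let W : ℝ → ℝ := fun x => ∑ j ∈ Finset.range K, w j * x ^ (j + 1)
  have hf : ∀ x, HasDerivAt f (∑ s ∈ Finset.range K, a (s + 1) * ((s + 1 : ℕ) * x ^ s)) x := by
    intro x
    have h1 : HasDerivAt f (∑ s ∈ Finset.range (K + 1), a s * (s * x ^ (s - 1))) x :=
      HasDerivAt.fun_sum fun s _ => (hasDerivAt_pow s x).const_mul _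
    rw [Finset.sum_range_succ'] at h1
    simpa using h1
  have hW : ∀ x, HasDerivAt W (∑ j ∈ Finset.range K, w j * ((j + 1 : ℕ) * x ^ j)) x := by
    intro x
    exact HasDerivAt.fun_sum fun s _ => (hasDerivAt_pow (s + 1) x).const_mul _
  have hg : ∀ x, HasDerivAt (fun x => f x * Real.exp (-W x))
      (((∑ s ∈ Finset.range K, a (s + 1) * ((s + 1 : ℕ) * x ^ s)) -
        (∑ j ∈ Finset.range K, w j * ((j + 1 : ℕ) * x ^ j)) * f x) * Real.exp (-W x)) x := by
    intro x
    refine ((hf x).fun_mul (hW x).fun_neg.exp).congr_deriv ?_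
    ring
  -- Since f' ≤ W' f on [0, 1], Grönwall's argument gives f(1) ≤ f(0) e^(W(1)) = e^(W(1)). Truncated
  -- polynomials suffice because all coefficients are nonnegative.
  have hanti : AntitoneOn (fun x => f x * Real.exp (-W x)) (Set.Icc 0 1) := by
    refine antitoneOn_of_deriv_nonpos (convex_Icc 0 1)
      (fun x _ => (hg x).continuousAt.continuousWithinAt)
      (fun x _ => (hg x).differentiableAt.differentiableWithinAt) fun x hx => ?_
    rw [interior_Icc] at hx
    rw [(hg x).deriv]
    refine mul_nonpos_of_nonpos_of_nonneg (sub_nonpos.2 ?_) (Real.exp_pos _).le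
    have hx0 := hx.1.le
    calc ∑ s ∈ Finset.range K, a (s + 1) * ((s + 1 : ℕ) * x ^ s)
        ≤ ∑ s ∈ Finset.range K, ∑ t ∈ Finset.range (s + 1),
          (w t * ((t + 1 : ℕ) * x ^ t)) * (a (s - t) * x ^ (s - t)) := by
          refine Finset.sum_le_sum fun s hs => ?_
          rw [← mul_assoc]
          refine (mul_le_mul_of_nonneg_right (hrec s hs) (pow_nonneg hx0 s)).trans_eq ?_
          rw [Finset.sum_mul]
          refine Finset.sum_congr rfl fun t ht => ?_
          have hts : t ≤ s := Nat.lt_succ_iff.1 (Finset.mem_range.1 ht)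
          have hxs : x ^ s = x ^ t * x ^ (s - t) := by rw [← pow_add, Nat.add_sub_cancel' hts]
          rw [hxs]
          ring
      _ = ∑ t ∈ Finset.range K, ∑ r ∈ Finset.range (K - t),
          (w t * ((t + 1 : ℕ) * x ^ t)) * (a r * x ^ r) :=
          Finset.sum_range_diag_flip K fun t r =>
            (w t * ((t + 1 : ℕ) * x ^ t)) * (a r * x ^ r)
      _ ≤ ∑ t ∈ Finset.range K, (w t * ((t + 1 : ℕ) * x ^ t)) * f x := by
          refine Finset.sum_le_sum fun t ht => ?_
          rw [← Finset.mul_sum]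
          have h0 := hw0 t ht
          refine mul_le_mul_of_nonneg_left ?_ (by positivity)
          refine Finset.sum_le_sum_of_subset_of_nonneg
            (Finset.range_subset_range.2 (by omega)) fun r _ _ => ?_
          have := ha0 r
          positivity
      _ = _ := by rw [Finset.sum_mul]
  have h01 := hanti (Set.left_mem_Icc.2 zero_le_one) (Set.right_mem_Icc.2 zero_le_one) zero_le_one
  have hf0 : f 0 = 1 := by
    simp only [f]
    rw [Finset.sum_range_succ']
    simp [a, hm]
  have hW0 : W 0 = 0 := by simp [W]
  have hW1 : W 1 = ∑ j ∈ Finset.range K, w j := by simp [W]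
  simp only [hf0, hW0, neg_zero, Real.exp_zero, mul_one, hW1] at h01
  rw [Real.exp_neg, mul_inv_le_iff₀ (Real.exp_pos _), one_mul] at h01
  have haK : a K ≤ f 1 := by
    have := Finset.single_le_sum (f := fun s => a s * (1 : ℝ) ^ s) (fun s _ => by
      have := ha0 s
      positivity) (Finset.self_mem_range_succ K)
    simpa only [one_pow, mul_one, f] using this
  have h2 := haK.trans h01
  have h3 : |m K| = K ! * τ⁻¹ ^ K * a K := by
    simp only [a, inv_pow]
    field_simp
  rw [h3]
  exact mul_le_mul_of_nonneg_left h2 (by positivity)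

/-- The power j - 2 matches the power of Δ in the Statulevičius condition, so that higher cumulants
become powers of τ K^ν / Δ. -/
theorem factorial_le_two_mul_pow {j K : ℕ} (hj : 2 ≤ j) (hjK : j ≤ K) : j ! ≤ 2 * K ^ (j - 2) := by
  induction j, hj using Nat.le_induction with
  | base => simp
  | succ j hj ih =>
    rw [Nat.factorial_succ, show j + 1 - 2 = (j - 2) + 1 by omega, pow_succ]
    calc (j + 1) * j ! ≤ K * (2 * K ^ (j - 2)) := Nat.mul_le_mul hjK (ih (by omega))
      _ = _ := by ring

set_option maxHeartbeats 800000 in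
/-- Moments under a Statulevičius condition on the cumulants. -/
theorem abs_moment_le_of_cumulantSeq_le {m : ℕ → ℝ} (hm : m 0 = 1) (hm1 : m 1 = 0) {σ Δ ν τ : ℝ}
    (hσ : 0 < σ) (hm2 : m 2 = σ ^ 2) (hΔ : 0 < Δ) (hν : 0 ≤ ν)
    (hκ : ∀ j, 3 ≤ j → |cumulantSeq m j| ≤ σ ^ j * (j ! : ℝ) ^ (1 + ν) / Δ ^ (j - 2))
    (hτ : 0 < τ) {K : ℕ} (hτK : τ * (K : ℝ) ^ ν ≤ (2 ^ ν * 16)⁻¹ * Δ) :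
    |m K| ≤ K ! * (σ / τ) ^ K * Real.exp (5 / 8 * τ ^ 2) := by
  let c : ℕ → ℝ := fun j => if j = 1 then 0 else if j = 2 then σ ^ 2 else
    σ ^ j * (j ! : ℝ) ^ (1 + ν) / Δ ^ (j - 2)
  have hc1 : c (0 + 1) = 0 := if_pos rfl
  have hc2 : c (0 + 1 + 1) = σ ^ 2 := (if_neg (by norm_num)).trans (if_pos rfl)
  have hc3 : ∀ j, c (j + 1 + 1 + 1) = σ ^ (j + 1 + 1 + 1) * ((j + 1 + 1 + 1)! : ℝ) ^ (1 + ν) /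
      Δ ^ (j + 1) := fun j => (if_neg (by omega)).trans (if_neg (by omega))
  have hk1 : cumulantSeq m (0 + 1) = 0 := by
    rw [cumulantSeq_succ, zero_add, hm1, Finset.sum_range_zero, sub_zero]
  have hk2 : cumulantSeq m (0 + 1 + 1) = σ ^ 2 := by
    rw [cumulantSeq_succ, Finset.sum_range_one, hk1, zero_mul, mul_zero, sub_zero]
    exact hm2
  have hc : ∀ j, j + 1 ≤ K → |cumulantSeq m (j + 1)| ≤ c (j + 1) := by
    intro j _
    rcases j with _ | _ | j
    · rw [hk1, hc1, abs_zero]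
    · rw [hk2, hc2, abs_of_nonneg (sq_nonneg _)]
    · rw [hc3]
      exact hκ _ (by omega)
  have h := abs_moment_le_exp_cumulantSeq hm (div_pos hτ hσ) K hc
  rw [inv_div] at h
  refine h.trans (mul_le_mul_of_nonneg_left (Real.exp_le_exp.2 ?_) (by positivity))
  clear h
  clear_value c
  set η : ℝ := τ * (K : ℝ) ^ ν / Δ with hη
  have hη0 : 0 ≤ η := by positivity
  have hη1 : η ≤ (2 ^ ν * 16)⁻¹ := by rwa [hη, div_le_iff₀ hΔ]
  have h2ν : (1 : ℝ) ≤ 2 ^ ν := Real.one_le_rpow (by norm_num) hν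
  have hη2 : η ≤ 1 / 16 := by
    refine hη1.trans ?_
    rw [mul_inv, ← one_div (16 : ℝ)]
    exact mul_le_of_le_one_left (by norm_num) (inv_le_one_of_one_le₀ h2ν)
  -- The index is shifted: j stands for the cumulant of order j + 1. Orders one and two give 0 and
  -- τ²/2, and order j + 1 ≥ 3 gives a geometric term in η.
  have hterm : ∀ j ∈ Finset.range K, c (j + 1) * (τ / σ) ^ (j + 1) / (j + 1)! ≤
      if j = 0 then 0 else if j = 1 then τ ^ 2 / 2 else
        2 ^ ν * τ ^ 2 * η ^ (j - 1) := by
    intro j hj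
    have hjK := Finset.mem_range.1 hj
    rcases j with _ | _ | j
    · rw [hc1]
      simp
    · rw [hc2, if_neg (by omega), if_pos (by omega), div_pow]
      apply le_of_eq
      simp only [Nat.reduceAdd, Nat.factorial_two, Nat.cast_ofNat]
      field_simp
    · rw [hc3, if_neg (by omega), if_neg (by omega)]
      have hfac : (((j + 1 + 1 + 1)! : ℕ) : ℝ) ≤ 2 * (K : ℝ) ^ (j + 1) := by
        have := factorial_le_two_mul_pow (j := j + 1 + 1 + 1) (by omega) (Nat.succ_le_of_lt hjK)
        exact_mod_cast this
      have hfac' : (((j + 1 + 1 + 1)! : ℕ) : ℝ) ^ ν ≤ 2 ^ ν * ((K : ℝ) ^ ν) ^ (j + 1) := by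
        refine (Real.rpow_le_rpow (by positivity) hfac hν).trans_eq ?_
        rw [Real.mul_rpow (by norm_num) (by positivity), ← Real.rpow_natCast, ← Real.rpow_natCast,
          ← Real.rpow_mul (by positivity), ← Real.rpow_mul (by positivity), mul_comm ν]
      rw [Real.rpow_add (by positivity), Real.rpow_one, show j + 1 + 1 - 1 = j + 1 by omega, hη, div_pow, div_pow, mul_pow]
      calc σ ^ (j + 1 + 1 + 1) * ((j + 1 + 1 + 1)! * ((j + 1 + 1 + 1)! : ℝ) ^ ν) / Δ ^ (j + 1) *
            (τ ^ (j + 1 + 1 + 1) / σ ^ (j + 1 + 1 + 1)) / (j + 1 + 1 + 1)!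
          = ((j + 1 + 1 + 1)! : ℝ) ^ ν * (τ ^ 2 * τ ^ (j + 1) / Δ ^ (j + 1)) := by
            rw [← pow_add, show 2 + (j + 1) = j + 1 + 1 + 1 by ring]
            field_simp
        _ ≤ 2 ^ ν * ((K : ℝ) ^ ν) ^ (j + 1) * (τ ^ 2 * τ ^ (j + 1) / Δ ^ (j + 1)) := by gcongr
        _ = _ := by ring
  refine (Finset.sum_le_sum hterm).trans ?_
  have hbound : ∀ n : ℕ, ∑ j ∈ Finset.range n, (if j = 0 then 0 else if j = 1 then τ ^ 2 / 2 else
        2 ^ ν * τ ^ 2 * η ^ (j - 1)) ≤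
      τ ^ 2 / 2 + 2 ^ ν * τ ^ 2 * (η * ∑ j ∈ Finset.range n, η ^ j) := by
    intro n
    have h0 : ∀ n : ℕ, 0 ≤ ∑ j ∈ Finset.range n, η ^ j :=
      fun n => Finset.sum_nonneg fun j _ => by positivity
    rcases n with _ | _ | n
    · have := h0 0
      simp; positivity
    · have := h0 1
      simp; positivity
    · rw [Finset.sum_range_succ', Finset.sum_range_succ']
      simp only [if_true, add_zero, Nat.add_eq_zero_iff, one_ne_zero, and_false, if_false,
        zero_add]
      rw [add_comm]
      have h1 : ∀ j : ℕ, j + 1 + 1 = 1 ↔ False := fun j => iff_false_intro (by omega)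
      simp only [h1, if_false, Nat.add_sub_cancel]
      gcongr
      rw [← Finset.mul_sum]
      gcongr
      simp only [pow_succ']
      rw [← Finset.mul_sum]
      gcongr
      · omega
  refine (hbound K).trans ?_
  have hgeo : ∑ j ∈ Finset.range K, η ^ j ≤ 16 / 15 := by
    calc _ ≤ ∑' j : ℕ, η ^ j := (summable_geometric_of_lt_one hη0 (by linarith)).sum_le_tsum _
          fun i _ => by positivity
      _ = (1 - η)⁻¹ := tsum_geometric_of_lt_one hη0 (by linarith)
      _ ≤ 16 / 15 := by
        rw [inv_le_comm₀ (by linarith) (by norm_num)]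
        linarith
  have h5 : 2 ^ ν * η ≤ 1 / 16 := by
    calc 2 ^ ν * η ≤ 2 ^ ν * (2 ^ ν * 16)⁻¹ := by gcongr
      _ = 1 / 16 := by field_simp
  -- The higher cumulants add at most τ²/16 · 16/15 = τ²/15, and 1/2 + 1/15 ≤ 5/8.
  calc τ ^ 2 / 2 + 2 ^ ν * τ ^ 2 * (η * ∑ j ∈ Finset.range K, η ^ j)
      ≤ τ ^ 2 / 2 + 2 ^ ν * τ ^ 2 * (η * (16 / 15)) := by gcongr
    _ = τ ^ 2 / 2 + (2 ^ ν * η) * (τ ^ 2 * (16 / 15)) := by ring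
    _ ≤ τ ^ 2 / 2 + 1 / 16 * (τ ^ 2 * (16 / 15)) := by gcongr
    _ ≤ _ := by nlinarith [sq_nonneg τ]

end Scalar

/-! ### Tail bound under a Statulevičius condition -/

section Tail

variable {Ω : Type*} [MeasurableSpace Ω] {P : Measure Ω} [IsProbabilityMeasure P] {S : Ω → ℝ}

theorem measureReal_le_moment_div {K : ℕ} (hK : Even K) (hS : Integrable (fun ω => S ω ^ K) P)
    {t : ℝ} (ht : 0 < t) :
    P.real {ω | t ≤ |S ω|} ≤ (∫ ω, S ω ^ K ∂P) / t ^ K := by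
  rw [le_div_iff₀ (by positivity), mul_comm]
  refine le_trans ?_ (mul_meas_ge_le_integral_of_nonneg
    (Filter.Eventually.of_forall fun ω => hK.pow_nonneg (S ω)) hS (t ^ K))
  refine mul_le_mul_of_nonneg_left (measureReal_mono fun ω hω => ?_) (by positivity)
  rw [Set.mem_ofPred_eq] at hω ⊢
  rw [← hK.pow_abs (S ω)]
  exact pow_le_pow_left₀ ht.le hω K

theorem inv_four_mul_le_two_mul_exp {y : ℝ} (hy : 2 ≤ y) (hy' : y ≤ 16) :
    1 / (4 * y) ≤ 2 * Real.exp (-(1 / 4) * y) := by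
  have he : Real.exp 1 < 2.7182818286 := Real.exp_one_lt_d9
  have h4 : Real.exp (y / 4) ≤ 8 * y := by
    rcases le_total y 8 with h | h
    · have h1 : Real.exp (y / 4) ≤ Real.exp 1 ^ 2 := by
        rw [Real.exp_one_pow]
        exact Real.exp_le_exp.2 (by push_cast; linarith)
      have h2 : Real.exp 1 ^ 2 ≤ 2.72 ^ 2 :=
        pow_le_pow_left₀ (Real.exp_pos _).le (by linarith) 2
      have h3 : (2.72 : ℝ) ^ 2 ≤ 8 := by norm_num
      linarith
    · have h1 : Real.exp (y / 4) ≤ Real.exp 1 ^ 4 := by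
        rw [Real.exp_one_pow]
        exact Real.exp_le_exp.2 (by push_cast; linarith)
      have h2 : Real.exp 1 ^ 4 ≤ 2.72 ^ 4 :=
        pow_le_pow_left₀ (Real.exp_pos _).le (by linarith) 4
      have h3 : (2.72 : ℝ) ^ 4 ≤ 64 := by norm_num
      linarith
  rw [show -(1 / 4) * y = -(y / 4) by ring, Real.exp_neg, ← div_eq_mul_inv, div_le_div_iff₀
    (by positivity) (Real.exp_pos _)]
  linarith

/-- Three regimes in y: for y ≤ 2 the right-hand side is at least 1, for 2 ≤ y ≤ 16 Chebyshev's
inequality with s² ≥ 4y suffices, and for y ≥ 16 Markov's inequality is applied to the moment of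
order 2m with m near 3y/8. -/
theorem measureReal_le_of_cumulantSeq_le (hS : ∀ k : ℕ, Integrable (fun ω => S ω ^ k) P)
    (hS0 : ∫ ω, S ω ∂P = 0) {σ Δ ν : ℝ} (hσ : 0 < σ) (hS2 : ∫ ω, S ω ^ 2 ∂P = σ ^ 2) (hΔ : 0 < Δ)
    (hν : 0 ≤ ν)
    (hκ : ∀ j, 3 ≤ j → |cumulantSeq (fun k => ∫ ω, S ω ^ k ∂P) j| ≤
      σ ^ j * (j ! : ℝ) ^ (1 + ν) / Δ ^ (j - 2))
    {s : ℝ} (hs : 0 ≤ s) :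
    P.real {ω | s * σ ≤ |S ω|} ≤ 2 * Real.exp (-(1 / 4) *
      min (s ^ 2 / 4) ((s * ((2 ^ ν * 24)⁻¹ * Δ)) ^ (1 / (1 + ν)))) := by
  set y := min (s ^ 2 / 4) ((s * ((2 ^ ν * 24)⁻¹ * Δ)) ^ (1 / (1 + ν))) with hy
  have hy1 : y ≤ s ^ 2 / 4 := min_le_left _ _
  have hy2 : y ≤ (s * ((2 ^ ν * 24)⁻¹ * Δ)) ^ (1 / (1 + ν)) := min_le_right _ _
  rcases le_total y 2 with hy' | hy'
  · refine (measureReal_le_one).trans ?_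
    have := Real.add_one_le_exp (-(1 / 4) * y)
    linarith
  have hs0 : 0 < s := by
    rcases hs.eq_or_lt with h | h
    · rw [← h] at hy1
      norm_num at hy1
      linarith
    · exact h
  have hsσ : 0 < s * σ := by positivity
  rcases le_total y 16 with hy16 | hy16
  · refine (measureReal_le_moment_div even_two (hS 2) hsσ).trans ?_
    rw [hS2, mul_pow]
    refine le_trans ?_ (inv_four_mul_le_two_mul_exp hy' hy16)
    rw [div_le_div_iff₀ (by positivity) (by positivity), one_mul, mul_comm]
    exact mul_le_mul_of_nonneg_right (by linarith) (by positivity)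
  set m := ⌊3 * y / 8⌋₊ with hm
  have hm1 : (m : ℝ) ≤ 3 * y / 8 := Nat.floor_le (by positivity)
  have hm2 : 3 * y / 8 - 1 < m := Nat.sub_one_lt_floor _
  have hm0 : (0 : ℝ) < m := by linarith
  refine (measureReal_le_moment_div (even_two_mul m) (hS _) hsσ).trans ?_
  -- The choice τ = 3y/(2s). With m ≤ 3y/8 it gives m / (τ s) ≤ 1/4, hence a factor 8^(-m) ≤ e^(-2m)
  -- after (2m)! ≤ 2^m m^(2m); and τ² ≤ 9y/16 because s² ≥ 4y. The constant 24 = 16 · 3/2 makes τ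
  -- admissible in the moment bound.
  have hτ : 0 < 3 / 2 * y / s := by positivity
  have hτK : 3 / 2 * y / s * ((2 * m : ℕ) : ℝ) ^ ν ≤ (2 ^ ν * 16)⁻¹ * Δ := by
    have h1 : ((2 * m : ℕ) : ℝ) ^ ν ≤ y ^ ν := by
      refine Real.rpow_le_rpow (by positivity) ?_ hν
      push_cast
      linarith
    have h2 : y * y ^ ν ≤ s * ((2 ^ ν * 24)⁻¹ * Δ) := by
      rw [← Real.rpow_one_add' (by linarith) (by linarith)]
      refine (Real.rpow_le_rpow (by linarith) hy2 (by linarith)).trans_eq ?_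
      rw [← Real.rpow_mul (by positivity), one_div_mul_cancel (by linarith), Real.rpow_one]
    calc 3 / 2 * y / s * ((2 * m : ℕ) : ℝ) ^ ν ≤ 3 / 2 * y / s * y ^ ν := by gcongr
      _ = 3 / 2 / s * (y * y ^ ν) := by ring
      _ ≤ 3 / 2 / s * (s * ((2 ^ ν * 24)⁻¹ * Δ)) := by gcongr
      _ = _ := by
        field_simp
        norm_num
  have hmom := abs_moment_le_of_cumulantSeq_le (m := fun k => ∫ ω, S ω ^ k ∂P) (by simp)
    (by simpa using hS0) hσ hS2 hΔ hν hκ hτ hτK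
  have hfac : (((2 * m)! : ℕ) : ℝ) ≤ 2 ^ m * (m : ℝ) ^ (2 * m) := by
    have h1 : (2 * m)! ≤ (2 * m) ^ m * m ! := Nat.factorial_two_mul_le m
    have h2 : m ! ≤ m ^ m := Nat.factorial_le_pow m
    have h3 : (2 * m)! ≤ 2 ^ m * m ^ (2 * m) := by
      refine h1.trans ((Nat.mul_le_mul_left _ h2).trans_eq ?_)
      rw [mul_pow, two_mul m, pow_add]
      ring
    exact_mod_cast h3
  have hexp2 : Real.exp 2 ≤ 8 := by
    have he : Real.exp 1 < 2.7182818286 := Real.exp_one_lt_d9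
    have h2 : Real.exp 1 ^ 2 ≤ 2.72 ^ 2 := pow_le_pow_left₀ (Real.exp_pos _).le (by linarith) 2
    rw [Real.exp_one_pow] at h2
    norm_num at h2
    linarith
  calc (∫ ω, S ω ^ (2 * m) ∂P) / (s * σ) ^ (2 * m)
      ≤ ((2 * m)! * (σ / (3 / 2 * y / s)) ^ (2 * m) *
          Real.exp (5 / 8 * (3 / 2 * y / s) ^ 2)) / (s * σ) ^ (2 * m) := by
        gcongr
        exact (le_abs_self _).trans hmom
    _ ≤ (2 ^ m * (3 * y / 8) ^ (2 * m) * (σ / (3 / 2 * y / s)) ^ (2 * m) *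
          Real.exp (5 / 8 * (3 / 2 * y / s) ^ 2)) / (s * σ) ^ (2 * m) := by
        gcongr
        refine hfac.trans ?_
        gcongr
    _ = (1 / 8) ^ m * Real.exp (5 / 8 * (3 / 2 * y / s) ^ 2) := by
        have h1 : 3 * y / 8 * (σ / (3 / 2 * y / s)) / (s * σ) = 1 / 4 := by
          field_simp
          norm_num
        have h2 : (2 : ℝ) ^ m * (1 / 4) ^ (2 * m) = (1 / 8) ^ m := by
          rw [pow_mul, ← mul_pow]
          norm_num
        rw [← h2, ← h1]
        generalize 3 * y / 8 = u, σ / (3 / 2 * y / s) = v, s * σ = w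
        rw [div_pow (u * v), mul_pow u]
        ring
    _ ≤ Real.exp (-2) ^ m * Real.exp (5 / 8 * (9 / 16 * y)) := by
        gcongr
        · rw [Real.exp_neg, ← one_div]
          exact one_div_le_one_div_of_le (Real.exp_pos _) hexp2
        · rw [div_pow, div_le_iff₀ (by positivity)]
          nlinarith
    _ = Real.exp (-2 * m + 5 / 8 * (9 / 16 * y)) := by
        rw [← Real.exp_nat_mul, ← Real.exp_add]
        ring_nf
    -- Here m > 3y/8 - 1 makes the exponent at most -3y/4 + 2 + 45y/128, which is below -y/4 for y ≥
    -- 16.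
    _ ≤ Real.exp (-(1 / 4) * y) := Real.exp_le_exp.2 (by linarith)
    _ ≤ _ := by linarith [Real.exp_pos (-(1 / 4) * y)]

end Tail

/-! ### Real sums over the points in a bounded set -/

namespace PointConfig

variable {d : ℕ}

/-- The sum of `g` over the points of `X` in `A`. -/
noncomputable def finSum (X : PointConfig d) (A : Set (EuclideanSpace ℝ (Fin d)))
    (g : EuclideanSpace ℝ (Fin d) → ℝ) : ℝ :=
  ∑ᶠ x ∈ X.carrier ∩ A, g x

variable {A B : Set (EuclideanSpace ℝ (Fin d))} {g h : EuclideanSpace ℝ (Fin d) → ℝ}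

theorem finSum_eq_sum (X : PointConfig d) (hA : Bornology.IsBounded A)
    (g : EuclideanSpace ℝ (Fin d) → ℝ) :
    X.finSum A g = ∑ x ∈ (X.finite_inter A hA).toFinset, g x :=
  finsum_mem_eq_finite_toFinset_sum _ _

theorem finSum_congr (X : PointConfig d) (hgh : ∀ x ∈ X.carrier ∩ A, g x = h x) :
    X.finSum A g = X.finSum A h :=
  finsum_mem_congr rfl hgh

theorem finSum_mono (X : PointConfig d) (hA : Bornology.IsBounded A)
    (hgh : ∀ x ∈ X.carrier ∩ A, g x ≤ h x) : X.finSum A g ≤ X.finSum A h := by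
  rw [X.finSum_eq_sum hA, X.finSum_eq_sum hA]
  exact Finset.sum_le_sum fun x hx => hgh x (by simpa using hx)

theorem finSum_nonneg (X : PointConfig d) (hg : ∀ x, 0 ≤ g x) : 0 ≤ X.finSum A g :=
  finsum_nonneg fun x => finsum_nonneg fun _ => hg x

theorem abs_finSum_le (X : PointConfig d) (hA : Bornology.IsBounded A)
    (g : EuclideanSpace ℝ (Fin d) → ℝ) : |X.finSum A g| ≤ X.finSum A fun x => |g x| := by
  rw [X.finSum_eq_sum hA, X.finSum_eq_sum hA]
  exact Finset.abs_sum_le_sum_abs _ _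

theorem finSum_const (X : PointConfig d) (hA : Bornology.IsBounded A) (c : ℝ) :
    X.finSum A (fun _ => c) = (X.carrier ∩ A).ncard * c := by
  rw [X.finSum_eq_sum hA, Finset.sum_const, nsmul_eq_mul,
    Set.ncard_eq_toFinset_card _ (X.finite_inter A hA)]

theorem finSum_sub (X : PointConfig d) (hA : Bornology.IsBounded A)
    (g h : EuclideanSpace ℝ (Fin d) → ℝ) :
    X.finSum A (fun x => g x - h x) = X.finSum A g - X.finSum A h := by
  rw [X.finSum_eq_sum hA, X.finSum_eq_sum hA, X.finSum_eq_sum hA, Finset.sum_sub_distrib]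

theorem finSum_const_mul (X : PointConfig d) (hA : Bornology.IsBounded A) (c : ℝ)
    (g : EuclideanSpace ℝ (Fin d) → ℝ) :
    X.finSum A (fun x => c * g x) = c * X.finSum A g := by
  rw [X.finSum_eq_sum hA, X.finSum_eq_sum hA, Finset.mul_sum]

theorem finSum_pow_le (X : PointConfig d) (hA : Bornology.IsBounded A) (hg : ∀ x, 0 ≤ g x)
    (k : ℕ) :
    X.finSum A g ^ (k + 1) ≤
      ((X.carrier ∩ A).ncard : ℝ) ^ k * X.finSum A fun x => g x ^ (k + 1) := by
  rw [X.finSum_eq_sum hA, X.finSum_eq_sum hA, Set.ncard_eq_toFinset_card _ (X.finite_inter A hA)]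
  set s := (X.finite_inter A hA).toFinset
  rcases s.eq_empty_or_nonempty with hs | hs
  · rw [hs]; simp
  have h := pow_sum_div_card_le_sum_pow (s := s) (f := g) (fun x _ => hg x) k
  have h0 : (0 : ℝ) < s.card := by exact_mod_cast hs.card_pos
  rwa [div_le_iff₀ (by positivity), mul_comm] at h

theorem finSum_biUnion {ζ : Type*} (X : PointConfig d) (Z : Finset ζ)
    {B : ζ → Set (EuclideanSpace ℝ (Fin d))} (hB : ∀ z, Bornology.IsBounded (B z))
    (hd : Pairwise fun z z' => Disjoint (B z) (B z')) (hA : A ⊆ ⋃ z ∈ Z, B z)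
    (hg : ∀ x ∉ A, g x = 0) : X.finSum A g = ∑ z ∈ Z, X.finSum (B z) g := by
  have h1 : ∑ z ∈ Z, X.finSum (B z) g = ∑ᶠ x ∈ ⋃ z ∈ (Z : Set ζ), X.carrier ∩ B z, g x := by
    rw [finsum_mem_biUnion _ Z.finite_toSet fun z _ => X.finite_inter _ (hB z),
      finsum_mem_coe_finset]
    · rfl
    · exact fun z _ z' _ hz => (hd hz).mono Set.inter_subset_right Set.inter_subset_right
  rw [h1, finSum, finsum_mem_def, finsum_mem_def]
  congr 1
  ext x
  by_cases hx : x ∈ A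
  · by_cases hX : x ∈ X.carrier
    · rw [Set.indicator_of_mem (show x ∈ X.carrier ∩ A from ⟨hX, hx⟩), Set.indicator_of_mem]
      simp only [← Set.inter_iUnion]
      exact ⟨hX, hA hx⟩
    · rw [Set.indicator_of_notMem fun h => hX h.1, Set.indicator_of_notMem]
      simp only [← Set.inter_iUnion]
      exact fun h => hX h.1
  · rw [Set.indicator_of_notMem fun h => hx h.2, Set.indicator_apply_eq_zero.2 fun _ => hg x hx]

theorem ofReal_finSum (X : PointConfig d) (hA : Bornology.IsBounded A) (hg : ∀ x, 0 ≤ g x) :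
    ENNReal.ofReal (X.finSum A g) = X.pointSum (A.indicator fun x => ENNReal.ofReal (g x)) := by
  rw [X.finSum_eq_sum hA, ENNReal.ofReal_sum_of_nonneg fun x _ => hg x, pointSum,
    tsum_subtype X.carrier, Set.indicator_indicator, sum_eq_tsum_indicator,
    Set.Finite.coe_toFinset]

/-- Positive and negative parts are extended-real point sums, whose measurability is known. -/
theorem measurable_finSum {T : Type*} [MeasurableSpace T] {Y : T → PointConfig d}
    (hY : Measurable Y) {F : T → EuclideanSpace ℝ (Fin d) → ℝ}
    (hF : Measurable (Function.uncurry F)) (hA : MeasurableSet A)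
    (hAb : Bornology.IsBounded A) : Measurable fun t => (Y t).finSum A (F t) := by
  have h1 : ∀ G : T → EuclideanSpace ℝ (Fin d) → ℝ, Measurable (Function.uncurry G) →
      (∀ t x, 0 ≤ G t x) → Measurable fun t => (Y t).finSum A (G t) := by
    intro G hG h0
    have h2 : (fun t => (Y t).finSum A (G t)) = fun t => ((Y t).pointSum
        (A.indicator fun x => ENNReal.ofReal (G t x))).toReal := by
      ext t
      rw [← (Y t).ofReal_finSum hAb (h0 t), ENNReal.toReal_ofReal ((Y t).finSum_nonneg (h0 t))]
    rw [h2]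
    exact (measurable_pointSum_indicator hY (F := fun t x => ENNReal.ofReal (G t x))
      hG.ennreal_ofReal hA hAb).ennreal_toReal
  have h3 : (fun t => (Y t).finSum A (F t)) = fun t => (Y t).finSum A (fun x => max (F t x) 0) -
      (Y t).finSum A (fun x => max (-F t x) 0) := by
    ext t
    rw [← finSum_sub _ hAb]
    exact finSum_congr _ fun x _ => (max_zero_sub_max_neg_zero_eq_self _).symm
  rw [h3]
  exact (h1 _ (hF.max measurable_const) fun _ _ => le_max_right _ _).sub
    (h1 _ (hF.neg.max measurable_const) fun _ _ => le_max_right _ _)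

end PointConfig

/-! ### The tiling of space by half-open unit cubes -/

section Cells

variable {d : ℕ}

/-- The unit cube around the lattice point `z`. -/
def cell (z : Fin d → ℤ) : Set (EuclideanSpace ℝ (Fin d)) :=
  {x | ∀ i, (z i : ℝ) - 1 / 2 ≤ x i ∧ x i < z i + 1 / 2}

/-- The point of `ℝ^d` with integer coordinates `z`. -/
noncomputable def latticePoint (z : Fin d → ℤ) : EuclideanSpace ℝ (Fin d) :=
  WithLp.toLp 2 fun i => (z i : ℝ)

/-- The index of the cell that contains `x`. -/
noncomputable def cellIndex (x : EuclideanSpace ℝ (Fin d)) (i : Fin d) : ℤ := ⌊x i + 1 / 2⌋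

@[simp] theorem latticePoint_apply (z : Fin d → ℤ) (i : Fin d) : latticePoint z i = z i := rfl

theorem mem_cell_iff {z : Fin d → ℤ} {x : EuclideanSpace ℝ (Fin d)} :
    x ∈ cell z ↔ cellIndex x = z := by
  rw [funext_iff]
  refine forall_congr' fun i => ?_
  rw [cellIndex, Int.floor_eq_iff]
  constructor <;> rintro ⟨h1, h2⟩ <;> constructor <;> linarith

theorem pairwise_disjoint_cell :
    Pairwise fun z z' : Fin d → ℤ => Disjoint (cell z) (cell z') := fun _ _ hz =>
  Set.disjoint_left.2 fun _ hx hx' => hz ((mem_cell_iff.1 hx).symm.trans (mem_cell_iff.1 hx'))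

theorem iUnion_cell : ⋃ z : Fin d → ℤ, cell z = Set.univ :=
  Set.iUnion_eq_univ_iff.2 fun x => ⟨cellIndex x, mem_cell_iff.2 rfl⟩

theorem measurableSet_cell (z : Fin d → ℤ) : MeasurableSet (cell z) := by
  have : cell z = ⋂ i, {x : EuclideanSpace ℝ (Fin d) | (z i : ℝ) - 1 / 2 ≤ x i} ∩
      {x : EuclideanSpace ℝ (Fin d) | x i < z i + 1 / 2} := by
    ext x
    simp [cell]
  rw [this]
  refine MeasurableSet.iInter fun i => MeasurableSet.inter ?_ ?_
  · exact measurableSet_le measurable_const (by fun_prop)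
  · exact measurableSet_lt (by fun_prop) measurable_const

theorem dist_le_of_abs_le {x y : EuclideanSpace ℝ (Fin d)} {r : ℝ} (hr : 0 ≤ r)
    (h : ∀ i, |x i - y i| ≤ r) : dist x y ≤ d * r := by
  rw [EuclideanSpace.dist_eq]
  have h0 : (d : ℝ) ≤ d ^ 2 := by
    have : d ≤ d ^ 2 := Nat.le_self_pow two_ne_zero d
    exact_mod_cast this
  refine Real.sqrt_le_iff.2 ⟨by positivity, ?_⟩
  calc ∑ i, dist (x i) (y i) ^ 2 ≤ ∑ _i : Fin d, r ^ 2 := by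
        gcongr with i
        exact h i
    _ = d * r ^ 2 := by simp
    _ ≤ d ^ 2 * r ^ 2 := by gcongr
    _ = _ := by ring

theorem abs_apply_sub_le_dist (x y : EuclideanSpace ℝ (Fin d)) (i : Fin d) :
    |x i - y i| ≤ dist x y := by
  rw [dist_eq_norm]
  exact PiLp.norm_apply_le (x - y) i

theorem cell_subset_closedBall (z : Fin d → ℤ) :
    cell z ⊆ Metric.closedBall (latticePoint z) d := by
  intro x hx
  rw [Metric.mem_closedBall]
  refine (dist_le_of_abs_le zero_le_one fun i => ?_).trans_eq (mul_one _)
  have := hx i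
  rw [latticePoint_apply, abs_le]
  constructor <;> linarith

theorem isBounded_cell (z : Fin d → ℤ) : Bornology.IsBounded (cell z) :=
  Metric.isBounded_closedBall.subset (cell_subset_closedBall z)

theorem volume_cell (z : Fin d → ℤ) : volume (cell z) = 1 := by
  have h := (EuclideanSpace.volume_preserving_symm_measurableEquiv_toLp (Fin d)).symm
  have h2 : cell z = (MeasurableEquiv.toLp 2 (Fin d → ℝ)).symm ⁻¹'
      (Set.univ.pi fun i => Set.Ico ((z i : ℝ) - 1 / 2) (z i + 1 / 2)) := by
    ext x
    simp [cell]
  rw [h2, (EuclideanSpace.volume_preserving_symm_measurableEquiv_toLp (Fin d)).measure_preimage_equiv,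
    Real.volume_pi_Ico]
  simp
  norm_num

end Cells

/-! ### Bounds in mean, with the Cauchy–Schwarz inequality replaced by weighted squares -/

section MeanLE

variable {Ω : Type*} [MeasurableSpace Ω] {μ : Measure Ω} {f g : Ω → ℝ} {F G : ℝ}

/-- `f` is integrable with mean at most `F`. -/
def MeanLE (μ : Measure Ω) (f : Ω → ℝ) (F : ℝ) : Prop := Integrable f μ ∧ ∫ ω, f ω ∂μ ≤ F

theorem MeanLE.of_lintegral (hf : Measurable f) (h0 : ∀ ω, 0 ≤ f ω) (hF : 0 ≤ F)
    (h : ∫⁻ ω, ENNReal.ofReal (f ω) ∂μ ≤ ENNReal.ofReal F) : MeanLE μ f F := by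
  refine ⟨⟨hf.aestronglyMeasurable, ?_⟩, ?_⟩
  · rw [hasFiniteIntegral_iff_ofReal (Filter.Eventually.of_forall h0)]
    exact h.trans_lt ENNReal.ofReal_lt_top
  · rw [integral_eq_lintegral_of_nonneg_ae (Filter.Eventually.of_forall h0)
      hf.aestronglyMeasurable]
    exact ENNReal.toReal_le_of_le_ofReal hF h

theorem MeanLE.lintegral_le (h : MeanLE μ f F) (h0 : ∀ ω, 0 ≤ f ω) :
    ∫⁻ ω, ENNReal.ofReal (f ω) ∂μ ≤ ENNReal.ofReal F := by
  rw [← ofReal_integral_eq_lintegral_ofReal h.1 (Filter.Eventually.of_forall h0)]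
  exact ENNReal.ofReal_le_ofReal h.2

theorem MeanLE.mono (h : MeanLE μ g G) (hf : Measurable f) (hfg : ∀ ω, |f ω| ≤ g ω) :
    MeanLE μ f G := by
  have hi : Integrable f μ := h.1.mono' hf.aestronglyMeasurable (Filter.Eventually.of_forall hfg)
  exact ⟨hi, (integral_mono hi h.1 fun ω => (le_abs_self _).trans (hfg ω)).trans h.2⟩

theorem MeanLE.le (h : MeanLE μ f F) (hFG : F ≤ G) : MeanLE μ f G := ⟨h.1, h.2.trans hFG⟩

theorem MeanLE.add (hf : MeanLE μ f F) (hg : MeanLE μ g G) :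
    MeanLE μ (fun ω => f ω + g ω) (F + G) :=
  ⟨hf.1.add hg.1, by rw [integral_add hf.1 hg.1]; exact add_le_add hf.2 hg.2⟩

theorem MeanLE.const_mul (hf : MeanLE μ f F) {c : ℝ} (hc : 0 ≤ c) :
    MeanLE μ (fun ω => c * f ω) (c * F) :=
  ⟨hf.1.const_mul c, by rw [integral_const_mul]; exact mul_le_mul_of_nonneg_left hf.2 hc⟩

theorem MeanLE.const [IsProbabilityMeasure μ] (c : ℝ) : MeanLE μ (fun _ => c) c :=
  ⟨integrable_const c, by simp⟩

theorem MeanLE.sum {ι : Type*} {s : Finset ι} {f : ι → Ω → ℝ} {F : ℝ}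
    (h : ∀ i ∈ s, MeanLE μ (f i) F) : MeanLE μ (fun ω => ∑ i ∈ s, f i ω) (s.card * F) := by
  refine ⟨integrable_finsetSum s fun i hi => (h i hi).1, ?_⟩
  rw [integral_finsetSum s fun i hi => (h i hi).1, ← nsmul_eq_mul]
  exact Finset.sum_le_card_nsmul _ _ _ fun i hi => (h i hi).2

/-- 2|f| ≤ f²/a + a, integrated. -/
theorem MeanLE.of_sq [IsProbabilityMeasure μ] {a : ℝ} (ha : 0 < a) (hf : Measurable f)
    (h : MeanLE μ (fun ω => f ω ^ 2) (a ^ 2)) : MeanLE μ (fun ω => |f ω|) a := by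
  have h1 := ((h.const_mul (inv_pos.2 ha).le).add (MeanLE.const a)).const_mul
    (show (0 : ℝ) ≤ 1 / 2 by norm_num)
  refine (h1.mono hf.abs fun ω => ?_).le (le_of_eq ?_)
  · rw [abs_abs, ← sq_abs (f ω)]
    have h2 : a⁻¹ * |f ω| ^ 2 + a - 2 * |f ω| = a⁻¹ * (|f ω| - a) ^ 2 := by
      field_simp
      ring
    have h3 : 0 ≤ a⁻¹ * (|f ω| - a) ^ 2 := by positivity
    linarith
  · field_simp
    ring

/-- Two functions that agree off a small set have close integrals. -/
theorem abs_integral_sub_le_of_eq_off [IsFiniteMeasure μ] {a δ : ℝ} (ha : 0 < a) (hδ : 0 < δ)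
    {U U' : Ω → ℝ}
    (hU : Measurable U) (hU' : Measurable U') (hUg : ∀ ω, |U ω| ≤ g ω) (hUg' : ∀ ω, |U' ω| ≤ g ω)
    (hg1 : Integrable g μ) (hg : MeanLE μ (fun ω => g ω ^ 2) (a ^ 2)) {D : Set Ω}
    (hD : MeasurableSet D) (hμD : μ.real D ≤ δ ^ 2) (h : ∀ ω ∉ D, U ω = U' ω) :
    |∫ ω, U ω ∂μ - ∫ ω, U' ω ∂μ| ≤ 2 * a * δ := by
  have hUi : Integrable U μ := hg1.mono' hU.aestronglyMeasurable (Filter.Eventually.of_forall hUg)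
  have hUi' : Integrable U' μ :=
    hg1.mono' hU'.aestronglyMeasurable (Filter.Eventually.of_forall hUg')
  rw [← integral_sub hUi hUi']
  have h1 : MeanLE μ (D.indicator fun _ => (1 : ℝ)) (δ ^ 2) :=
    ⟨(integrable_const 1).indicator hD, by rw [integral_indicator_const _ hD]; simpa using hμD⟩
  -- On the exceptional set |U - U'| ≤ 2g ≤ (δ/a) g² + a/δ. These weights balance the two means,
  -- each contributing a δ.
  have h2 := (hg.const_mul (show 0 ≤ δ / a by positivity)).add
    (h1.const_mul (show 0 ≤ a / δ by positivity))
  have h3 := h2.mono (f := fun ω => |U ω - U' ω|) (hU.sub hU').abs fun ω => ?_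
  · refine (abs_integral_le_integral_abs).trans (h3.2.trans_eq ?_)
    field_simp
    ring
  · rw [abs_abs]
    by_cases hω : ω ∈ D
    · rw [Set.indicator_of_mem hω]
      have h4 : |U ω - U' ω| ≤ 2 * g ω := by
        have := abs_sub (U ω) (U' ω)
        linarith [hUg ω, hUg' ω]
      have h5 : δ / a * g ω ^ 2 + a / δ * 1 - 2 * g ω = (δ * g ω - a) ^ 2 / (a * δ) := by
        field_simp
        ring
      have h6 : 0 ≤ (δ * g ω - a) ^ 2 / (a * δ) := by positivity
      linarith
    · rw [h ω hω, sub_self, abs_zero]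
      have : 0 ≤ D.indicator (fun _ => (1 : ℝ)) ω := Set.indicator_nonneg (fun _ _ => zero_le_one) _
      positivity

theorem prod_le_sum_pow {ι : Type*} {s : Finset ι} (hs : s.Nonempty) {a : ι → ℝ}
    (ha : ∀ i, 0 ≤ a i) : ∏ i ∈ s, a i ≤ ∑ i ∈ s, a i ^ s.card := by
  obtain ⟨j, hj, hmax⟩ := s.exists_max_image a hs
  calc ∏ i ∈ s, a i ≤ ∏ _i ∈ s, a j := Finset.prod_le_prod (fun i _ => ha i) hmax
    _ = a j ^ s.card := Finset.prod_const _
    _ ≤ _ := Finset.single_le_sum (f := fun i => a i ^ s.card) (fun i _ => pow_nonneg (ha i) _) hj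

theorem factorial_two_mul_le_four_pow (k : ℕ) : ((2 * k)! : ℝ) ≤ 4 ^ k * (k ! : ℝ) ^ 2 := by
  have h1 : (2 * k)! ≤ 4 ^ k * k ! ^ 2 := by
    have h2 := Nat.choose_mul_factorial_mul_factorial (show k ≤ 2 * k by omega)
    rw [show 2 * k - k = k by omega] at h2
    have h3 : (2 * k).choose k ≤ 4 ^ k := by
      have := Nat.choose_le_two_pow (2 * k) k
      rwa [pow_mul] at this
    calc (2 * k)! = (2 * k).choose k * (k ! ^ 2) := by rw [← h2]; ring
      _ ≤ _ := Nat.mul_le_mul_right _ h3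
  exact_mod_cast h1

theorem factorial_two_mul_rpow_le (k : ℕ) {s : ℝ} (hs : 0 ≤ s) :
    ((2 * k)! : ℝ) ^ s ≤ ((4 : ℝ) ^ s) ^ k * ((k ! : ℝ) ^ s) ^ 2 := by
  refine (Real.rpow_le_rpow (by positivity) (factorial_two_mul_le_four_pow k) hs).trans_eq ?_
  rw [Real.mul_rpow (by positivity) (by positivity), ← Real.rpow_natCast, ← Real.rpow_natCast,
    ← Real.rpow_natCast, ← Real.rpow_natCast, ← Real.rpow_mul (by positivity),
    ← Real.rpow_mul (by positivity), ← Real.rpow_mul (by positivity),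
    ← Real.rpow_mul (by positivity), mul_comm s, mul_comm s]

end MeanLE

/-! ### Moments of cell sums of a localizable field -/

section Localizable

variable {d : ℕ} {P : Measure (PointConfig d)} {g g' : EuclideanSpace ℝ (Fin d) → PointConfig d → ℝ}
  {C β b K : ℝ}

open Classical in
/-- `g'` is a bounded function of the configuration within distance `r` which differs from `g`
only with a small probability. -/
structure IsTruncation (P : Measure (PointConfig d))
    (g g' : EuclideanSpace ℝ (Fin d) → PointConfig d → ℝ) (r M ε : ℝ) : Prop where
  measurable : Measurable (Function.uncurry g')
  restrict_eq : ∀ x X B, Metric.closedBall x r ⊆ B → g' x (X.restrict B) = g' x X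
  abs_le_abs : ∀ x X, |g' x X| ≤ |g x X|
  abs_le : ∀ x X, |g' x X| ≤ M
  meanLE : ∀ z, MeanLE P (fun X => X.finSum (cell z) fun x => if g' x X = g x X then 0 else 1) ε

/-- A field of scores with growing moments that can be truncated. -/
structure IsLocalizable (P : Measure (PointConfig d))
    (g : EuclideanSpace ℝ (Fin d) → PointConfig d → ℝ) (C β b : ℝ) : Prop where
  measurable : Measurable (Function.uncurry g)
  moment : ∀ z, ∀ k : ℕ, 1 ≤ k →
    MeanLE P (fun X => X.finSum (cell z) fun x => |g x X| ^ k) (C ^ k * (k ! : ℝ) ^ β)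
  trunc : ∀ N : ℕ, 1 ≤ N → ∃ g', IsTruncation P g g' (C * (N : ℝ) ^ b) (C * (N : ℝ) ^ β)
    (C * Real.exp (-N))

/-- A bound for the centered sum of `g` over a cell. -/
noncomputable def envelope (g : EuclideanSpace ℝ (Fin d) → PointConfig d → ℝ) (C : ℝ)
    (z : Fin d → ℤ) (X : PointConfig d) : ℝ :=
  X.finSum (cell z) (fun x => |g x X|) + C

theorem measurable_cellSum (hg : Measurable (Function.uncurry g)) (z : Fin d → ℤ) :
    Measurable fun X : PointConfig d => X.finSum (cell z) fun x => g x X :=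
  PointConfig.measurable_finSum measurable_id (F := fun X x => g x X)
    (hg.comp measurable_swap) (measurableSet_cell z) (isBounded_cell z)

theorem measurable_envelope (hg : Measurable (Function.uncurry g)) (z : Fin d → ℤ) :
    Measurable (envelope g C z) :=
  (measurable_cellSum (g := fun x X => |g x X|) hg.abs z).add_const C

theorem envelope_nonneg (hC : 0 ≤ C) (z : Fin d → ℤ) (X : PointConfig d) :
    0 ≤ envelope g C z X :=
  add_nonneg (X.finSum_nonneg fun _ => abs_nonneg _) hC

/-- The power mean inequality produces a power of the number n of points times a sum of k-th powers.
A weighted square separates the two factors, and n^(2k) ≤ (2k)! e^n ≤ (2k)! 3^n reduces the first to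
the exponential moment. -/
theorem cellSum_abs_pow_le {k : ℕ} (hk : 1 ≤ k) {A : ℝ} (hA : 0 < A) (z : Fin d → ℤ)
    (X : PointConfig d) :
    (X.finSum (cell z) fun x => |g x X|) ^ k ≤
      1 / 2 * (A * (2 * k)! * 3 ^ (X.carrier ∩ cell z).ncard +
        A⁻¹ * X.finSum (cell z) fun x => |g x X| ^ (2 * k)) := by
  obtain ⟨j, rfl⟩ : ∃ j, k = j + 1 := ⟨k - 1, by omega⟩
  have hb := isBounded_cell z
  refine (X.finSum_pow_le hb (fun x => abs_nonneg _) j).trans ?_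
  set n := (X.carrier ∩ cell z).ncard with hn
  rw [← X.finSum_const_mul hb]
  have h1 : X.finSum (cell z) (fun x => (n : ℝ) ^ j * |g x X| ^ (j + 1)) ≤
      X.finSum (cell z) (fun x => 1 / 2 * A * (n : ℝ) ^ (2 * j) -
        -(1 / 2 * A⁻¹) * |g x X| ^ (2 * (j + 1))) := by
    refine X.finSum_mono hb fun x _ => ?_
    have h2 : 1 / 2 * A * (n : ℝ) ^ (2 * j) - -(1 / 2 * A⁻¹) * |g x X| ^ (2 * (j + 1)) -
        (n : ℝ) ^ j * |g x X| ^ (j + 1) =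
        (A * (n : ℝ) ^ j - |g x X| ^ (j + 1)) ^ 2 / (2 * A) := by
      field_simp
      ring
    have h3 : 0 ≤ (A * (n : ℝ) ^ j - |g x X| ^ (j + 1)) ^ 2 / (2 * A) := by positivity
    linarith
  refine h1.trans ?_
  rw [X.finSum_sub hb, X.finSum_const hb, X.finSum_const_mul hb, ← hn]
  have h4 : (n : ℝ) * (n : ℝ) ^ (2 * j) ≤ (2 * (j + 1))! * 3 ^ n := by
    have h5 : n * n ^ (2 * j) ≤ n ^ (2 * (j + 1)) := by
      rw [← pow_succ']
      rcases Nat.eq_zero_or_pos n with h0 | h0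
      · rw [h0]; simp
      · exact Nat.pow_le_pow_right h0 (by omega)
    have h6 : (n : ℝ) * (n : ℝ) ^ (2 * j) ≤ (n : ℝ) ^ (2 * (j + 1)) := by exact_mod_cast h5
    have h7 := Real.pow_div_factorial_le_exp (n : ℝ) (by positivity) (2 * (j + 1))
    rw [div_le_iff₀ (by positivity)] at h7
    have h8 : Real.exp n ≤ 3 ^ n := by
      rw [← Real.exp_one_pow]
      exact pow_le_pow_left₀ (Real.exp_pos _).le (by linarith [Real.exp_one_lt_d9]) n
    calc _ ≤ _ := h6
      _ ≤ _ := h7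
      _ ≤ 3 ^ n * (2 * (j + 1))! := by gcongr
      _ = _ := mul_comm _ _
  have h9 := mul_le_mul_of_nonneg_left h4 hA.le
  linarith

theorem IsLocalizable.cellSum_moment (hg : IsLocalizable P g C β b) (hC : 1 ≤ C) (hβ : 0 ≤ β)
    (hK1 : 1 ≤ K)
    (hK : ∀ z, MeanLE P (fun X => (3 : ℝ) ^ (X.carrier ∩ cell z).ncard) K) (z : Fin d → ℤ)
    {k : ℕ} (hk : 1 ≤ k) :
    MeanLE P (fun X => (X.finSum (cell z) fun x => |g x X|) ^ k)
      ((K * C ^ 2 * 2 ^ (β + 1)) ^ k * (k ! : ℝ) ^ (β + 1)) := by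
  -- This weight balances A (2k)! against (2k)!^β / A; both become (2k)!^((β+1)/2), which is of
  -- order k!^(β+1).
  set A : ℝ := ((2 * k)! : ℝ) ^ ((β - 1) / 2) with hA
  have hA0 : 0 < A := by positivity
  have h1 := (((hK z).const_mul (c := A * (2 * k)!) (by positivity)).add
    ((hg.moment z (2 * k) (by omega)).const_mul (inv_pos.2 hA0).le)).const_mul
      (show (0 : ℝ) ≤ 1 / 2 by norm_num)
  refine (h1.mono ((measurable_cellSum (g := fun x X => |g x X|) hg.measurable.abs z).pow_const k)
    fun X => ?_).le ?_
  · rw [abs_of_nonneg (pow_nonneg (X.finSum_nonneg fun x => abs_nonneg _) k)]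
    exact cellSum_abs_pow_le hk hA0 z X
  · have hF : A * (2 * k)! = ((2 * k)! : ℝ) ^ ((β + 1) / 2) := by
      rw [hA, ← Real.rpow_add_one (by positivity)]
      ring_nf
    have hF' : A⁻¹ * ((2 * k)! : ℝ) ^ β = ((2 * k)! : ℝ) ^ ((β + 1) / 2) := by
      rw [hA, ← Real.rpow_neg (by positivity), ← Real.rpow_add (by positivity)]
      ring_nf
    have hF2 : ((2 * k)! : ℝ) ^ ((β + 1) / 2) ≤ (2 ^ (β + 1)) ^ k * (k ! : ℝ) ^ (β + 1) := by
      refine (factorial_two_mul_rpow_le k (by positivity)).trans_eq ?_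
      rw [show (4 : ℝ) = 2 ^ (2 : ℝ) by norm_num, ← Real.rpow_mul (by norm_num),
        ← Real.rpow_natCast ((k ! : ℝ) ^ _) 2, ← Real.rpow_mul (by positivity)]
      congr 3
      · ring
      · push_cast; ring
    have hKk : K ≤ K ^ k := le_self_pow₀ hK1 (by omega)
    have hCk : (1 : ℝ) ≤ (C ^ 2) ^ k := one_le_pow₀ (one_le_pow₀ hC)
    have hKC : (K + (C ^ 2) ^ k) / 2 ≤ K ^ k * (C ^ 2) ^ k := by
      have h1K : 1 ≤ K ^ k := one_le_pow₀ hK1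
      nlinarith
    calc 1 / 2 * (A * (2 * k)! * K + A⁻¹ * (C ^ (2 * k) * ((2 * k)! : ℝ) ^ β))
        = (K + (C ^ 2) ^ k) / 2 * ((2 * k)! : ℝ) ^ ((β + 1) / 2) := by
          rw [hF, pow_mul, show A⁻¹ * ((C ^ 2) ^ k * ((2 * k)! : ℝ) ^ β) =
            (C ^ 2) ^ k * (A⁻¹ * ((2 * k)! : ℝ) ^ β) by ring, hF']
          ring
      _ ≤ K ^ k * (C ^ 2) ^ k * ((2 ^ (β + 1)) ^ k * (k ! : ℝ) ^ (β + 1)) := by gcongr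
      _ = _ := by rw [mul_pow, mul_pow]; ring

/-- The constant in the moment bounds for envelopes. -/
noncomputable def envelopeConst (K C β : ℝ) : ℝ := 2 * (K * C ^ 2 * 2 ^ (β + 1) + C)

theorem one_le_envelopeConst (hC : 1 ≤ C) (hK1 : 1 ≤ K) : 1 ≤ envelopeConst K C β := by
  have : 0 ≤ K * C ^ 2 * 2 ^ (β + 1) := by positivity
  rw [envelopeConst]
  linarith

theorem IsLocalizable.envelope_moment [IsProbabilityMeasure P] (hg : IsLocalizable P g C β b)
    (hC : 1 ≤ C) (hβ : 0 ≤ β) (hK1 : 1 ≤ K)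
    (hK : ∀ z, MeanLE P (fun X => (3 : ℝ) ^ (X.carrier ∩ cell z).ncard) K) (z : Fin d → ℤ)
    {k : ℕ} (hk : 1 ≤ k) :
    MeanLE P (fun X => envelope g C z X ^ k) (envelopeConst K C β ^ k * (k ! : ℝ) ^ (β + 1)) := by
  have h1 := ((hg.cellSum_moment hC hβ hK1 hK z hk).add (MeanLE.const (C ^ k))).const_mul
    (show (0 : ℝ) ≤ 2 ^ k by positivity)
  have hC0 : 0 ≤ C := by linarith
  refine (h1.mono ((measurable_envelope hg.measurable z).pow_const k) fun X => ?_).le ?_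
  · have h0 : 0 ≤ X.finSum (cell z) fun x => |g x X| := X.finSum_nonneg fun _ => abs_nonneg _
    rw [abs_of_nonneg (pow_nonneg (envelope_nonneg hC0 z X) k)]
    refine (add_pow_le h0 hC0 k).trans ?_
    gcongr
    · norm_num
    · omega
  · rw [envelopeConst]
    have h2 : (1 : ℝ) ≤ (k ! : ℝ) ^ (β + 1) :=
      Real.one_le_rpow (one_le_factorial_cast k) (by linarith)
    have hM : 0 ≤ K * C ^ 2 * 2 ^ (β + 1) := by positivity
    have h3 := pow_add_pow_le hM hC0 (Nat.one_le_iff_ne_zero.1 hk)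
    have h4 : 0 ≤ C ^ k := by positivity
    generalize (K * C ^ 2 * 2 ^ (β + 1)) = M at *
    rw [mul_pow, mul_assoc (2 ^ k)]
    refine mul_le_mul_of_nonneg_left ?_ (by positivity)
    nlinarith

/-- The squared product is at most the sum of the powers of order 2|T| of its factors, so no joint
moments are needed. -/
theorem IsLocalizable.prod_envelope_sq [IsProbabilityMeasure P] (hg : IsLocalizable P g C β b)
    (hC : 1 ≤ C) (hβ : 0 ≤ β) (hK1 : 1 ≤ K)
    (hK : ∀ z, MeanLE P (fun X => (3 : ℝ) ^ (X.carrier ∩ cell z).ncard) K) {ι : Type*}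
    (T : Finset ι) (f : ι → Fin d → ℤ) :
    MeanLE P (fun X => (∏ i ∈ T, envelope g C (f i) X) ^ 2)
      (((2 * envelopeConst K C β * 2 ^ (β + 1)) ^ T.card * (T.card ! : ℝ) ^ (β + 1)) ^ 2) := by
  rcases T.eq_empty_or_nonempty with rfl | hT
  · simpa using MeanLE.const (μ := P) 1
  have hT1 : 1 ≤ T.card := hT.card_pos
  have hM := one_le_envelopeConst (β := β) hC hK1
  have h1 := MeanLE.sum (s := T) fun i _ =>
    hg.envelope_moment hC hβ hK1 hK (f i) (k := 2 * T.card) (by omega)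
  have h0 : ∀ X, 0 ≤ ∏ i ∈ T, envelope g C (f i) X := fun X =>
    Finset.prod_nonneg fun i _ => envelope_nonneg (by linarith) _ _
  refine (h1.mono ((Finset.measurable_prod T fun i _ =>
    measurable_envelope hg.measurable (f i)).pow_const 2) fun X => ?_).le ?_
  · rw [abs_of_nonneg (sq_nonneg _), ← Finset.prod_pow]
    simp only [pow_mul]
    exact prod_le_sum_pow hT fun i => sq_nonneg _
  · have h2 : (T.card : ℝ) ≤ 4 ^ T.card := by
      have h3 : T.card < 4 ^ T.card := Nat.lt_pow_self (by norm_num)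
      exact_mod_cast h3.le
    have h4 := factorial_two_mul_rpow_le T.card (show 0 ≤ β + 1 by linarith)
    calc (T.card : ℝ) * (envelopeConst K C β ^ (2 * T.card) * ((2 * T.card)! : ℝ) ^ (β + 1))
        ≤ 4 ^ T.card * (envelopeConst K C β ^ (2 * T.card) * (((4 : ℝ) ^ (β + 1)) ^ T.card *
          ((T.card ! : ℝ) ^ (β + 1)) ^ 2)) := by gcongr
      _ = _ := by
        have h5 : (4 : ℝ) ^ (β + 1) = (2 ^ (β + 1)) ^ 2 := by
          rw [← Real.rpow_natCast (2 ^ (β + 1)) 2, ← Real.rpow_mul (by norm_num),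
            show (4 : ℝ) = 2 ^ (2 : ℝ) by norm_num, ← Real.rpow_mul (by norm_num)]
          congr 1
          push_cast
          ring
        have h6 : (4 : ℝ) ^ T.card = (2 ^ T.card) ^ 2 := by
          rw [← pow_mul, mul_comm, pow_mul]
          norm_num
        rw [h5, h6]
        ring

end Localizable

/-! ### Effect of truncating the scores -/

section TruncationError

variable {d : ℕ} {P : Measure (PointConfig d)} {g g' : EuclideanSpace ℝ (Fin d) → PointConfig d → ℝ}
  {C β b K r M ε : ℝ}

open Classical in
/-- The configurations for which `g'` differs from `g` in one of the given cells. -/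
def truncationSet (g g' : EuclideanSpace ℝ (Fin d) → PointConfig d → ℝ) {ι : Type*} (I : Finset ι)
    (f : ι → Fin d → ℤ) : Set (PointConfig d) :=
  ⋃ i ∈ I, {X | 1 ≤ X.finSum (cell (f i)) fun x => if g' x X = g x X then 0 else 1}

open Classical in
theorem measurable_truncation_indicator (hg : Measurable (Function.uncurry g))
    (hg' : Measurable (Function.uncurry g')) (z : Fin d → ℤ) :
    Measurable fun X : PointConfig d =>
      X.finSum (cell z) fun x => if g' x X = g x X then (0 : ℝ) else 1 := by
  refine measurable_cellSum (g := fun x X => if g' x X = g x X then (0 : ℝ) else 1) ?_ z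
  exact Measurable.ite (measurableSet_eq_fun hg' hg) measurable_const measurable_const

theorem measurableSet_truncationSet (hg : Measurable (Function.uncurry g))
    (hg' : Measurable (Function.uncurry g')) {ι : Type*} (I : Finset ι) (f : ι → Fin d → ℤ) :
    MeasurableSet (truncationSet g g' I f) :=
  Finset.measurableSet_biUnion I fun i _ =>
    measurableSet_le measurable_const (measurable_truncation_indicator hg hg' (f i))

theorem eq_of_notMem_truncationSet {ι : Type*} {I : Finset ι} {f : ι → Fin d → ℤ}
    {X : PointConfig d} (hX : X ∉ truncationSet g g' I f) {i : ι} (hi : i ∈ I)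
    {x : EuclideanSpace ℝ (Fin d)} (hx : x ∈ X.carrier ∩ cell (f i)) : g' x X = g x X := by
  classical
  by_contra hne
  refine hX (Set.mem_biUnion hi ?_)
  rw [Set.mem_ofPred_eq, X.finSum_eq_sum (isBounded_cell _)]
  have h := Finset.single_le_sum (s := (X.finite_inter _ (isBounded_cell (f i))).toFinset)
    (f := fun x => if g' x X = g x X then (0 : ℝ) else 1)
    (fun x _ => by split_ifs <;> norm_num) (show x ∈ _ by simpa using hx)
  simp only [if_neg hne] at h
  convert h

theorem IsTruncation.measureReal_truncationSet_le [IsProbabilityMeasure P]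
    (h : IsTruncation P g g' r M ε) {ι : Type*}
    (I : Finset ι) (f : ι → Fin d → ℤ) : P.real (truncationSet g g' I f) ≤ I.card * ε := by
  classical
  refine (measureReal_biUnion_finset_le I _).trans ?_
  rw [← nsmul_eq_mul]
  refine Finset.sum_le_card_nsmul _ _ _ fun i _ => ?_
  have h1 := mul_meas_ge_le_integral_of_nonneg (Filter.Eventually.of_forall fun X : PointConfig d =>
    X.finSum_nonneg (A := cell (f i)) (g := fun x => if g' x X = g x X then (0 : ℝ) else 1)
      fun x => by split_ifs <;> norm_num) (h.meanLE (f i)).1 1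
  rw [one_mul] at h1
  exact h1.trans (h.meanLE (f i)).2

/-- Stated for two measure preserving maps p and q, so that one argument serves both for a single
configuration (p = q = id) and for two independent ones (the projections). The square root of the
probability of the exceptional set comes from the second-moment bound for G. -/
theorem IsTruncation.abs_integral_sub_le {Z : Type*} [MeasurableSpace Z] {μ : Measure Z}
    [IsProbabilityMeasure P] [IsProbabilityMeasure μ] (h : IsTruncation P g g' r M ε) (hε : 0 < ε)
    (hg : Measurable (Function.uncurry g)) {p q : Z → PointConfig d} (hp : MeasurePreserving p μ P)
    (hq : MeasurePreserving q μ P) {ι : Type*} {I J : Finset ι} (hI : I.Nonempty)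
    {f : ι → Fin d → ℤ} {G : Z → ℝ} {G₀ : ℝ} (hG₀ : 0 < G₀) (hGm : Measurable G)
    (hG0 : ∀ ω, 0 ≤ G ω) (hG : MeanLE μ (fun ω => G ω ^ 2) (G₀ ^ 2))
    {F F' : PointConfig d → PointConfig d → ℝ} (hF : Measurable (Function.uncurry F))
    (hF' : Measurable (Function.uncurry F')) (hFG : ∀ ω, |F (p ω) (q ω)| ≤ G ω)
    (hFG' : ∀ ω, |F' (p ω) (q ω)| ≤ G ω)
    (hFF' : ∀ X Y, (∀ i ∈ I, ∀ x ∈ X.carrier ∩ cell (f i), g' x X = g x X) →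
      (∀ j ∈ J, ∀ y ∈ Y.carrier ∩ cell (f j), g' y Y = g y Y) → F X Y = F' X Y) :
    Integrable (fun ω => F (p ω) (q ω)) μ ∧
      |∫ ω, F (p ω) (q ω) ∂μ - ∫ ω, F' (p ω) (q ω) ∂μ| ≤
        2 * G₀ * √(((I.card : ℝ) + J.card) * ε) := by
  have hG1 : Integrable G μ := by
    have := (MeanLE.of_sq hG₀ hGm hG).1
    simpa only [abs_of_nonneg (hG0 _)] using this
  have hFm : Measurable fun ω => F (p ω) (q ω) := hF.comp (hp.measurable.prodMk hq.measurable)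
  have hFm' : Measurable fun ω => F' (p ω) (q ω) := hF'.comp (hp.measurable.prodMk hq.measurable)
  have hI0 : (0 : ℝ) < I.card := by exact_mod_cast hI.card_pos
  have hk : 0 < ((I.card : ℝ) + J.card) * ε := by positivity
  refine ⟨hG1.mono' hFm.aestronglyMeasurable (Filter.Eventually.of_forall hFG), ?_⟩
  refine abs_integral_sub_le_of_eq_off hG₀ (Real.sqrt_pos.2 hk) hFm hFm' hFG hFG' hG1 hG
    (D := p ⁻¹' truncationSet g g' I f ∪ q ⁻¹' truncationSet g g' J f)
    ((hp.measurable (measurableSet_truncationSet hg h.measurable I f)).union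
      (hq.measurable (measurableSet_truncationSet hg h.measurable J f))) ?_ fun ω hω => ?_
  · refine (measureReal_union_le _ _).trans ?_
    rw [hp.measureReal_preimage (measurableSet_truncationSet hg h.measurable I f).nullMeasurableSet,
      hq.measureReal_preimage (measurableSet_truncationSet hg h.measurable J f).nullMeasurableSet,
      Real.sq_sqrt hk.le, add_mul]
    exact add_le_add (h.measureReal_truncationSet_le I f) (h.measureReal_truncationSet_le J f)
  · rw [Set.mem_union, not_or] at hω
    exact hFF' _ _ (fun i hi x hx => eq_of_notMem_truncationSet hω.1 hi hx)
      fun j hj y hy => eq_of_notMem_truncationSet hω.2 hj hy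

end TruncationError

/-! ### The mixing property and neighbourhoods of cells -/

section FieldMixing

variable {d : ℕ} {P : Measure (PointConfig d)} {g g' : EuclideanSpace ℝ (Fin d) → PointConfig d → ℝ}
  {a ahat C β b K c : ℝ}

/-- The law `P` decorrelates exponentially fast over distances, and its point counts have
exponential moments. -/
structure IsMixing (P : Measure (PointConfig d)) (a ahat K c : ℝ) : Prop where
  abs_sub_le : ∀ (H : PointConfig d → PointConfig d → ℝ) (A B : Set (EuclideanSpace ℝ (Fin d)))
    (T V δ : ℝ), Measurable (Function.uncurry H) → MeasurableSet A → MeasurableSet B →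
    Bornology.IsBounded A → Bornology.IsBounded B → 0 ≤ T → 0 ≤ V → 0 < δ →
    volume A ≤ ENNReal.ofReal V → volume B ≤ ENNReal.ofReal V →
    (∀ s t : Finset (EuclideanSpace ℝ (Fin d)),
      |H (.ofFinset s) (.ofFinset t)| ≤ T * 3 ^ s.card * 3 ^ t.card) →
    (∀ x ∈ A, ∀ y ∈ B, δ ≤ dist x y) →
    |∫ X, H (X.restrict A) (X.restrict B) ∂P -
      ∫ Z, H (Z.1.restrict A) (Z.2.restrict B) ∂(P.prod P)| ≤
      T * (K * Real.exp ((K * V) ^ (1 / (1 - a)) - c * δ ^ ahat))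
  exp_moment : ∀ z, MeanLE P (fun X => (3 : ℝ) ^ (X.carrier ∩ cell z).ncard) K

theorem exists_isMixing (hd : 1 ≤ d) [IsProbabilityMeasure P] (hP : IsStationaryLaw P)
    {ρ : (p : ℕ) → (Fin p → EuclideanSpace ℝ (Fin d)) → ℝ} (hρ : IsCorrelationFunction P ρ)
    (ha₀ : 0 ≤ a) (ha₁ : a < 1) (hEDC : CondEDC ρ a ahat) :
    ∃ K c : ℝ, 1 ≤ K ∧ 0 < c ∧ IsMixing P a ahat K c := by
  obtain ⟨K, c, hK, hc, h⟩ := exists_mixing hd hP hρ ha₀ ha₁ hEDC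
  obtain ⟨K', hK', h'⟩ := exists_exp_moment_bound hd hP hρ ha₀ ha₁ hEDC
  refine ⟨max K K', c, hK.trans (le_max_left _ _), hc, ?_, fun z => ?_⟩
  · intro H A B T V δ h1 h2 h3 h4 h5 h6 h7 h8 h9 h10 h11 h12
    refine (h H A B T V δ h1 h2 h3 h4 h5 h6 h7 h8 h9 h10 h11 h12).2.2.trans ?_
    have : (0 : ℝ) ≤ 1 / (1 - a) := by
      have : 0 < 1 - a := by linarith
      positivity
    gcongr <;> exact le_max_left _ _
  · refine (MeanLE.of_lintegral ?_ (fun X => by positivity) (by linarith) ?_).le (le_max_right K K')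
    · exact measurable_const.pow
        (PointConfig.measurable_ncard_inter (measurableSet_cell z) (isBounded_cell z))
    · have := h' (cell z) (measurableSet_cell z) (isBounded_cell z) (volume_cell z).le
      simpa [ENNReal.ofReal_pow] using this

/-- The union of balls of radius `r + d` around the lattice points that belong to `I`. -/
def thickening {ι : Type*} (I : Finset ι) (f : ι → Fin d → ℤ) (r : ℝ) :
    Set (EuclideanSpace ℝ (Fin d)) :=
  ⋃ i ∈ I, Metric.closedBall (latticePoint (f i)) (r + d)

theorem volume_thickening_le {ι : Type*} (I : Finset ι) (f : ι → Fin d → ℤ) {r : ℝ}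
    (hr : 0 ≤ r) :
    volume (thickening I f r) ≤ ENNReal.ofReal (I.card *
      ((r + d) ^ d * volume.real (Metric.ball (0 : EuclideanSpace ℝ (Fin d)) 1))) := by
  refine (measure_biUnion_finset_le I _).trans ?_
  have h : ∀ i ∈ I, volume (Metric.closedBall (latticePoint (f i)) (r + d)) ≤
      ENNReal.ofReal ((r + d) ^ d * volume.real (Metric.ball (0 : EuclideanSpace ℝ (Fin d)) 1)) := by
    intro i _
    rw [Measure.addHaar_closedBall _ _ (by positivity), ENNReal.ofReal_mul (by positivity),
      ofReal_measureReal]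
    simp
  refine (Finset.sum_le_card_nsmul _ _ _ h).trans_eq ?_
  rw [nsmul_eq_mul, ENNReal.ofReal_mul (p := (I.card : ℝ)) (by positivity), ENNReal.ofReal_natCast]

theorem cell_inter_thickening {ι : Type*} {I : Finset ι} {f : ι → Fin d → ℤ} {r : ℝ} (hr : 0 ≤ r)
    {i : ι} (hi : i ∈ I) : cell (f i) ⊆ thickening I f r := fun x hx =>
  Set.mem_biUnion hi (Metric.closedBall_subset_closedBall (by linarith)
    (cell_subset_closedBall _ hx))

theorem closedBall_subset_thickening {ι : Type*} {I : Finset ι} {f : ι → Fin d → ℤ} {r : ℝ} {i : ι}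
    (hi : i ∈ I) {x : EuclideanSpace ℝ (Fin d)} (hx : x ∈ cell (f i)) :
    Metric.closedBall x r ⊆ thickening I f r := fun y hy => by
  refine Set.mem_biUnion hi ?_
  have := cell_subset_closedBall _ hx
  rw [Metric.mem_closedBall] at *
  linarith [dist_triangle y x (latticePoint (f i))]

theorem le_dist_of_mem_thickening {ι : Type*} {I J : Finset ι} {f : ι → Fin d → ℤ} {r δ : ℝ}
    (h : ∀ i ∈ I, ∀ j ∈ J, δ + 2 * (r + d) ≤ dist (latticePoint (f i)) (latticePoint (f j)))
    {x y : EuclideanSpace ℝ (Fin d)} (hx : x ∈ thickening I f r) (hy : y ∈ thickening J f r) :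
    δ ≤ dist x y := by
  simp only [thickening, Set.mem_iUnion, Metric.mem_closedBall, exists_prop] at hx hy
  obtain ⟨i, hi, hx⟩ := hx
  obtain ⟨j, hj, hy⟩ := hy
  have := h i hi j hj
  have h1 := dist_triangle4 (latticePoint (f i)) x y (latticePoint (f j))
  rw [dist_comm _ x] at h1
  linarith

/-- A pointwise bound for truncated envelopes in terms of the number of points. -/
theorem prod_envelope_ofFinset_le {M : ℝ} (hg' : ∀ x X, |g' x X| ≤ M) (hC : 0 ≤ C) (hCM : C ≤ M)
    {ι : Type*} (I : Finset ι) (f : ι → Fin d → ℤ) (s : Finset (EuclideanSpace ℝ (Fin d))) :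
    ∏ i ∈ I, envelope g' C (f i) (.ofFinset s) ≤ M ^ I.card * I.card ! * (3 * 3 ^ s.card) := by
  have hM : 0 ≤ M := hC.trans hCM
  have h1 : ∀ i ∈ I, envelope g' C (f i) (.ofFinset s) ≤ M * (s.card + 1) := by
    intro i _
    have hb := isBounded_cell (f i)
    have h2 := (PointConfig.ofFinset s).finSum_mono hb
      (g := fun x => |g' x (.ofFinset s)|) (h := fun _ => M) fun x _ => hg' _ _
    rw [PointConfig.finSum_const _ hb] at h2
    have h3 : ((PointConfig.ofFinset s).carrier ∩ cell (f i)).ncard ≤ s.card := by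
      rw [← Set.ncard_coe_finset]
      exact Set.ncard_le_ncard Set.inter_subset_left s.finite_toSet
    have h4 : (((PointConfig.ofFinset s).carrier ∩ cell (f i)).ncard : ℝ) * M ≤ s.card * M :=
      mul_le_mul_of_nonneg_right (by exact_mod_cast h3) hM
    rw [envelope]
    linarith
  -- The product is at most M^k (|s|+1)^k with k = |I|, and (|s|+1)^k ≤ k! e^(|s|+1) ≤ k! · 3 ·
  -- 3^|s|, the growth allowed in the mixing bound.
  refine (Finset.prod_le_prod (fun i _ => envelope_nonneg hC _ _) h1).trans ?_
  rw [Finset.prod_const, mul_pow, mul_assoc]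
  refine mul_le_mul_of_nonneg_left ?_ (by positivity)
  refine (add_one_pow_le_factorial_mul_exp s.card I.card).trans ?_
  refine mul_le_mul_of_nonneg_left ?_ (by positivity)
  have h5 : Real.exp 1 ≤ 3 := by linarith [Real.exp_one_lt_d9]
  calc Real.exp (s.card + 1) = Real.exp 1 ^ (s.card + 1) := by
        rw [Real.exp_one_pow]; push_cast; rfl
    _ ≤ 3 ^ (s.card + 1) := pow_le_pow_left₀ (Real.exp_pos _).le h5 _
    _ = _ := pow_succ' _ _

end FieldMixing

/-! ### Decorrelation of scores in distant cells -/

section FieldMixing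

variable {d : ℕ} {P : Measure (PointConfig d)} {a ahat C β b K c : ℝ}

/-- The exponent of the truncation level in the correlation length. -/
noncomputable def lengthExponent (d : ℕ) (a ahat b : ℝ) : ℝ :=
  b * max 1 (d / ((1 - a) * ahat)) + 1 / ahat

theorem factorial_mul_factorial_rpow_le (m n : ℕ) {s : ℝ} (hs : 0 ≤ s) :
    (m ! : ℝ) ^ s * (n ! : ℝ) ^ s ≤ ((m + n)! : ℝ) ^ s := by
  rw [← Real.mul_rpow (by positivity) (by positivity)]
  refine Real.rpow_le_rpow (by positivity) ?_ hs
  exact_mod_cast Nat.le_of_dvd (Nat.factorial_pos _) (Nat.factorial_mul_factorial_dvd_factorial_add m n)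

/-- The distance from which on truncated fields are almost uncorrelated. -/
theorem exists_correlation_length (ha₁ : a < 1) (hahat : 0 < ahat) (hC : 1 ≤ C)
    (hβ : 0 ≤ β) (hb : 0 ≤ b) (hK : 1 ≤ K) (hc : 0 < c) {v : ℝ} (hv : 0 ≤ v) :
    ∃ Γ : ℝ, 1 ≤ Γ ∧ ∀ k N : ℕ, 1 ≤ k → 1 ≤ N → ∃ δ : ℝ, 0 < δ ∧
      δ + 2 * (C * (N : ℝ) ^ b + d) ≤
        Γ * (k : ℝ) ^ (1 / ((1 - a) * ahat)) * (N : ℝ) ^ lengthExponent d a ahat b ∧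
      (K * (k * ((C * (N : ℝ) ^ b + d) ^ d * v))) ^ (1 / (1 - a)) - c * δ ^ ahat ≤
        -((β + 1) * N) := by
  have h1a : 0 < 1 - a := by linarith
  set u' : ℝ := 1 / (1 - a) with hu'
  have hu'0 : 0 < u' := by positivity
  set w := lengthExponent d a ahat b with hw
  have hwb : b ≤ w := by
    rw [hw, lengthExponent]
    have h1 : b * 1 ≤ b * max 1 (d / ((1 - a) * ahat)) :=
      mul_le_mul_of_nonneg_left (le_max_left _ _) hb
    have h2 : 0 < 1 / ahat := by positivity
    linarith
  -- This is what the length exponent is made for: δ^ahat must beat both the volume term, of order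
  -- N^(b d u'), and N itself. The maximum with 1 in its definition gives b ≤ w, so that the
  -- truncation radius fits into the gap too.
  have hwd : b * d * u' + 1 ≤ w * ahat := by
    rw [hw, lengthExponent, add_mul, one_div_mul_cancel hahat.ne']
    have h1 : b * (d / ((1 - a) * ahat)) ≤ b * max 1 (d / ((1 - a) * ahat)) :=
      mul_le_mul_of_nonneg_left (le_max_right _ _) hb
    have h2 := mul_le_mul_of_nonneg_right h1 hahat.le
    have h3 : b * (d / ((1 - a) * ahat)) * ahat = b * d * u' := by
      rw [hu']
      field_simp
    linarith
  have hbdu : 0 ≤ b * d * u' := by positivity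
  set K₃ := K * ((C + d) ^ d * v) + 1 with hK₃
  have hK₃0 : 0 < K₃ := by positivity
  set L := K₃ ^ u' + β + 1 with hL
  have hL0 : 0 < L := by positivity
  refine ⟨(L / c) ^ (1 / ahat) + 2 * (C + d), ?_, fun k N hk hN => ?_⟩
  · have h1 : 0 ≤ (L / c) ^ (1 / ahat) := by positivity
    have h2 : (0 : ℝ) ≤ d := by positivity
    linarith
  have hk1 : (1 : ℝ) ≤ k := by exact_mod_cast hk
  have hN1 : (1 : ℝ) ≤ N := by exact_mod_cast hN
  have hNb : 1 ≤ (N : ℝ) ^ b := Real.one_le_rpow hN1 hb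
  have hku : 1 ≤ (k : ℝ) ^ (1 / ((1 - a) * ahat)) := Real.one_le_rpow hk1 (by positivity)
  have hCd : C * (N : ℝ) ^ b + d ≤ (C + d) * (N : ℝ) ^ b := by
    have : (d : ℝ) * 1 ≤ d * (N : ℝ) ^ b := by gcongr
    linarith
  -- Solves c δ^ahat = L k^u' N^(w ahat); the summands of L = K₃^u' + β + 1 pay for the volume term
  -- and for (β + 1) N.
  refine ⟨(L / c) ^ (1 / ahat) * (k : ℝ) ^ (1 / ((1 - a) * ahat)) * (N : ℝ) ^ w, by positivity,
    ?_, ?_⟩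
  · have h1 : (N : ℝ) ^ b ≤ (k : ℝ) ^ (1 / ((1 - a) * ahat)) * (N : ℝ) ^ w := by
      have h2 : (N : ℝ) ^ b ≤ (N : ℝ) ^ w := Real.rpow_le_rpow_of_exponent_le hN1 hwb
      have h3 : 0 ≤ (N : ℝ) ^ w := by positivity
      nlinarith
    have h2 : (C + d) * (N : ℝ) ^ b ≤
        (C + d) * ((k : ℝ) ^ (1 / ((1 - a) * ahat)) * (N : ℝ) ^ w) := by gcongr
    linarith
  · have h1 : c * ((L / c) ^ (1 / ahat) * (k : ℝ) ^ (1 / ((1 - a) * ahat)) * (N : ℝ) ^ w) ^ ahat =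
        L * ((k : ℝ) ^ u' * (N : ℝ) ^ (w * ahat)) := by
      rw [Real.mul_rpow (by positivity) (by positivity), Real.mul_rpow (by positivity)
        (by positivity), ← Real.rpow_mul (by positivity), ← Real.rpow_mul (by positivity),
        ← Real.rpow_mul (by positivity), one_div_mul_cancel hahat.ne', Real.rpow_one,
        show 1 / ((1 - a) * ahat) * ahat = u' by rw [hu']; field_simp]
      field_simp
    have h2 : (K * (k * ((C * (N : ℝ) ^ b + d) ^ d * v))) ^ u' ≤
        K₃ ^ u' * ((k : ℝ) ^ u' * (N : ℝ) ^ (w * ahat)) := by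
      have h3 : K * (k * ((C * (N : ℝ) ^ b + d) ^ d * v)) ≤ K₃ * (k * (N : ℝ) ^ (b * d)) := by
        have h4 : (C * (N : ℝ) ^ b + d) ^ d ≤ (C + d) ^ d * (N : ℝ) ^ (b * d) := by
          refine (pow_le_pow_left₀ (by positivity) hCd d).trans_eq ?_
          rw [mul_pow, ← Real.rpow_natCast ((N : ℝ) ^ b), ← Real.rpow_mul (by positivity)]
        calc K * (k * ((C * (N : ℝ) ^ b + d) ^ d * v)) ≤
            K * (k * ((C + d) ^ d * (N : ℝ) ^ (b * d) * v)) := by gcongr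
          _ = (K * ((C + d) ^ d * v)) * (k * (N : ℝ) ^ (b * d)) := by ring
          _ ≤ _ := by
            gcongr
            linarith
      refine (Real.rpow_le_rpow (by positivity) h3 hu'0.le).trans ?_
      rw [Real.mul_rpow (by positivity) (by positivity), Real.mul_rpow (by positivity)
        (by positivity), ← Real.rpow_mul (by positivity)]
      have h5 : (N : ℝ) ^ (b * d * u') ≤ (N : ℝ) ^ (w * ahat) :=
        Real.rpow_le_rpow_of_exponent_le hN1 (by linarith)
      exact mul_le_mul_of_nonneg_left (mul_le_mul_of_nonneg_left h5 (by positivity)) (by positivity)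
    have h3 : (N : ℝ) ≤ (k : ℝ) ^ u' * (N : ℝ) ^ (w * ahat) := by
      have h4 : (N : ℝ) ^ (1 : ℝ) ≤ (N : ℝ) ^ (w * ahat) :=
        Real.rpow_le_rpow_of_exponent_le hN1 (by linarith)
      rw [Real.rpow_one] at h4
      have h5 : 1 ≤ (k : ℝ) ^ u' := Real.one_le_rpow hk1 hu'0.le
      nlinarith
    have h4 : (β + 1) * N ≤ (β + 1) * ((k : ℝ) ^ u' * (N : ℝ) ^ (w * ahat)) := by gcongr
    rw [h1, hL]
    linarith

/-- Functionals of the scores in distant cells are almost uncorrelated. -/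
theorem IsMixing.exists_field_mixing [IsProbabilityMeasure P] (h : IsMixing P a ahat K c)
    (ha₁ : a < 1) (hahat : 0 < ahat) (hC : 1 ≤ C)
    (hβ : 0 ≤ β) (hb : 0 ≤ b) (hK : 1 ≤ K) (hc : 0 < c) :
    ∃ B Γ : ℝ, 1 ≤ B ∧ 1 ≤ Γ ∧ ∀ g : EuclideanSpace ℝ (Fin d) → PointConfig d → ℝ,
      IsLocalizable P g C β b → ∀ N : ℕ, 1 ≤ N →
      ∃ g' : EuclideanSpace ℝ (Fin d) → PointConfig d → ℝ, Measurable (Function.uncurry g') ∧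
      (∀ x X, |g' x X| ≤ |g x X|) ∧
      ∀ (ι : Type) (I J : Finset ι) (f : ι → Fin d → ℤ) (F F' : PointConfig d → PointConfig d → ℝ),
      I.Nonempty → Measurable (Function.uncurry F) → Measurable (Function.uncurry F') →
      (∀ X Y, |F X Y| ≤ (∏ i ∈ I, envelope g C (f i) X) * ∏ j ∈ J, envelope g C (f j) Y) →
      (∀ X Y, |F' X Y| ≤ (∏ i ∈ I, envelope g' C (f i) X) * ∏ j ∈ J, envelope g' C (f j) Y) →
      (∀ X Y, (∀ i ∈ I, ∀ x ∈ X.carrier ∩ cell (f i), g' x X = g x X) →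
        (∀ j ∈ J, ∀ y ∈ Y.carrier ∩ cell (f j), g' y Y = g y Y) → F X Y = F' X Y) →
      (∀ X Y X' Y', (∀ i ∈ I, X'.carrier ∩ cell (f i) = X.carrier ∩ cell (f i) ∧
          ∀ x ∈ cell (f i), g' x X' = g' x X) →
        (∀ j ∈ J, Y'.carrier ∩ cell (f j) = Y.carrier ∩ cell (f j) ∧
          ∀ y ∈ cell (f j), g' y Y' = g' y Y) → F' X' Y' = F' X Y) →
      (∀ i ∈ I, ∀ j ∈ J, Γ * ((I.card + J.card : ℕ) : ℝ) ^ (1 / ((1 - a) * ahat)) *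
        (N : ℝ) ^ lengthExponent d a ahat b ≤ dist (latticePoint (f i)) (latticePoint (f j))) →
      Integrable (fun X => F X X) P ∧ Integrable (fun Z => F Z.1 Z.2) (P.prod P) ∧
      |∫ X, F X X ∂P - ∫ Z, F Z.1 Z.2 ∂(P.prod P)| ≤
        B ^ (I.card + J.card) * ((I.card + J.card)! : ℝ) ^ (β + 1) * Real.exp (-(N / 2)) := by
  obtain ⟨Γ, hΓ, hlen⟩ := exists_correlation_length (d := d) ha₁ hahat hC hβ hb hK hc
    (v := volume.real (Metric.ball (0 : EuclideanSpace ℝ (Fin d)) 1)) measureReal_nonneg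
  set E := 2 * envelopeConst K C β * 2 ^ (β + 1) with hE
  have hE1 : 1 ≤ E := by
    have h1 := one_le_envelopeConst (β := β) hC hK
    have h2 : (1 : ℝ) ≤ 2 ^ (β + 1) := Real.one_le_rpow (by norm_num) (by linarith)
    nlinarith
  have hC0 : 0 ≤ C := by linarith
  refine ⟨26 * K * C * E, Γ, ?_, hΓ, fun g hg N hN => ?_⟩
  · have : 1 ≤ K * C * E := one_le_mul_of_one_le_of_one_le (one_le_mul_of_one_le_of_one_le hK hC) hE1
    linarith
  obtain ⟨g', hg'⟩ := hg.trunc N hN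
  refine ⟨g', hg'.measurable, hg'.abs_le_abs, ?_⟩
  intro ι I J f F F' hI hF hF' hFb hFb' hFF' hloc hdist
  set k := I.card + J.card with hk
  have hk1 : 1 ≤ k := by have := hI.card_pos; omega
  have hN1 : (1 : ℝ) ≤ N := by exact_mod_cast hN
  have hkR : (1 : ℝ) ≤ k := by exact_mod_cast hk1
  have hNb : 1 ≤ (N : ℝ) ^ b := Real.one_le_rpow hN1 hb
  have hNβ : 1 ≤ (N : ℝ) ^ β := Real.one_le_rpow hN1 hβ
  set r := C * (N : ℝ) ^ b with hr
  have hr0 : 0 ≤ r := by positivity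
  set ε := C * Real.exp (-N) with hε
  have hε0 : 0 < ε := by positivity
  have henv : ∀ z X, envelope g' C z X ≤ envelope g C z X := fun z X =>
    add_le_add_left (X.finSum_mono (isBounded_cell z) fun x _ => hg'.abs_le_abs x X) C
  have henv0 : ∀ z X, 0 ≤ envelope g C z X := fun z X => envelope_nonneg hC0 z X
  have henv0' : ∀ z X, 0 ≤ envelope g' C z X := fun z X => envelope_nonneg hC0 z X
  have hFb'' : ∀ X Y, |F' X Y| ≤ (∏ i ∈ I, envelope g C (f i) X) * ∏ j ∈ J, envelope g C (f j) Y :=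
    fun X Y => (hFb' X Y).trans (mul_le_mul (Finset.prod_le_prod (fun i _ => henv0' _ _)
      fun i _ => henv _ _) (Finset.prod_le_prod (fun i _ => henv0' _ _) fun i _ => henv _ _)
      (Finset.prod_nonneg fun i _ => henv0' _ _) (Finset.prod_nonneg fun i _ => henv0 _ _))
  have hmW : ∀ (S : Finset ι), Measurable fun X => ∏ i ∈ S, envelope g C (f i) X := fun S =>
    Finset.measurable_prod S fun i _ => measurable_envelope hg.measurable (f i)
  have hW0 : ∀ (S : Finset ι) X, 0 ≤ ∏ i ∈ S, envelope g C (f i) X := fun S X =>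
    Finset.prod_nonneg fun i _ => henv0 _ _
  have hI2 := hg.prod_envelope_sq hC hβ hK h.exp_moment I f
  have hJ2 := hg.prod_envelope_sq hC hβ hK h.exp_moment J f
  rw [← hE] at hI2 hJ2
  set G₀ := E ^ k * (k ! : ℝ) ^ (β + 1) with hG₀
  have hG₀0 : 0 < G₀ := by positivity
  have hGP : MeanLE P (fun X => ((∏ i ∈ I, envelope g C (f i) X) *
      ∏ j ∈ J, envelope g C (f j) X) ^ 2) (G₀ ^ 2) := by
    -- On a single configuration the two products form one product over the disjoint sum of the
    -- index sets.
    have := hg.prod_envelope_sq hC hβ hK h.exp_moment (I.disjSum J) (Sum.elim f f)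
    simpa only [Finset.prod_disjSum, Sum.elim_inl, Sum.elim_inr, Finset.card_disjSum, ← hk, ← hE,
      ← hG₀] using this
  have hGPP : MeanLE (P.prod P) (fun Z => ((∏ i ∈ I, envelope g C (f i) Z.1) *
      ∏ j ∈ J, envelope g C (f j) Z.2) ^ 2) (G₀ ^ 2) := by
    simp only [mul_pow _ _ 2]
    refine ⟨hI2.1.mul_prod hJ2.1, ?_⟩
    rw [integral_prod_mul (fun X => (∏ i ∈ I, envelope g C (f i) X) ^ 2)
      fun Y => (∏ j ∈ J, envelope g C (f j) Y) ^ 2]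
    refine (mul_le_mul hI2.2 hJ2.2 (integral_nonneg fun _ => sq_nonneg _) (sq_nonneg _)).trans ?_
    rw [← mul_pow]
    refine pow_le_pow_left₀ (by positivity) ?_ 2
    have := factorial_mul_factorial_rpow_le I.card J.card (show 0 ≤ β + 1 by linarith)
    calc _ = E ^ k * ((I.card ! : ℝ) ^ (β + 1) * (J.card ! : ℝ) ^ (β + 1)) := by
          rw [hk, pow_add]; ring
      _ ≤ _ := by
          rw [hG₀]
          exact mul_le_mul_of_nonneg_left this (by positivity)
  obtain ⟨hi1, he1⟩ := hg'.abs_integral_sub_le hε0 hg.measurable (MeasurePreserving.id P)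
    (MeasurePreserving.id P) hI hG₀0 ((hmW I).mul (hmW J))
    (fun X => mul_nonneg (hW0 I X) (hW0 J X)) hGP hF hF' (fun X => hFb X X) (fun X => hFb'' X X) hFF'
  obtain ⟨hi2, he2⟩ := hg'.abs_integral_sub_le hε0 hg.measurable
    (measurePreserving_fst (μ := P) (ν := P)) (measurePreserving_snd (μ := P) (ν := P)) hI hG₀0
    (((hmW I).comp measurable_fst).mul ((hmW J).comp measurable_snd))
    (fun Z => mul_nonneg (hW0 I Z.1) (hW0 J Z.2)) hGPP hF hF' (fun Z => hFb Z.1 Z.2)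
    (fun Z => hFb'' Z.1 Z.2) hFF'
  refine ⟨hi1, hi2, ?_⟩
  obtain ⟨δ, hδ, hδ1, hδ2⟩ := hlen k N hk1 hN
  -- The truncated scores depend on the points within distance r only, so the truncated functional
  -- sees only the neighbourhoods of the cells.
  have hrestr : ∀ X Y, F' (X.restrict (thickening I f r)) (Y.restrict (thickening J f r)) =
      F' X Y := by
    intro X Y
    refine hloc _ _ _ _ (fun i hi => ⟨?_, fun x hx => ?_⟩) fun j hj => ⟨?_, fun x hx => ?_⟩
    · rw [PointConfig.restrict_carrier, Set.inter_assoc, Set.inter_eq_self_of_subset_right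
        (cell_inter_thickening hr0 hi)]
    · exact hg'.restrict_eq x X _ (closedBall_subset_thickening hi hx)
    · rw [PointConfig.restrict_carrier, Set.inter_assoc, Set.inter_eq_self_of_subset_right
        (cell_inter_thickening hr0 hj)]
    · exact hg'.restrict_eq x Y _ (closedBall_subset_thickening hj hx)
  set M := C * (N : ℝ) ^ β with hM
  have hCM : C ≤ M := le_mul_of_one_le_right hC0 hNβ
  have hM0 : 0 ≤ M := hC0.trans hCM
  -- Each of the two products contributes a factor 3 from `prod_envelope_ofFinset_le`.
  set T := 9 * (M ^ k * (k ! : ℝ)) with hT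
  have hT0 : 0 ≤ T := by positivity
  set v := volume.real (Metric.ball (0 : EuclideanSpace ℝ (Fin d)) 1) with hv
  have hv0 : 0 ≤ v := measureReal_nonneg
  have hvol : ∀ S : Finset ι, S.card ≤ k →
      volume (thickening S f r) ≤ ENNReal.ofReal (k * ((r + d) ^ d * v)) := fun S hS => by
    refine (volume_thickening_le S f hr0).trans (ENNReal.ofReal_le_ofReal ?_)
    have : (S.card : ℝ) ≤ k := by exact_mod_cast hS
    gcongr
  have hfin : ∀ (S : Finset ι), MeasurableSet (thickening S f r) ∧
      Bornology.IsBounded (thickening S f r) := fun S =>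
    ⟨S.measurableSet_biUnion fun i _ => Metric.isClosed_closedBall.measurableSet,
      (Bornology.isBounded_biUnion_finset S).2 fun i _ => Metric.isBounded_closedBall⟩
  have hmix := h.abs_sub_le F' (thickening I f r) (thickening J f r) T
    (k * ((r + d) ^ d * v)) δ hF' (hfin I).1 (hfin J).1 (hfin I).2 (hfin J).2 hT0 (by positivity)
    hδ (hvol I (by omega)) (hvol J (by omega)) (fun s t => ?_)
    (fun x hx y hy => le_dist_of_mem_thickening
      (fun i hi j hj => hδ1.trans (hdist i hi j hj)) hx hy)
  · simp only [hrestr] at hmix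
    have h3 : T * (K * Real.exp ((K * (k * ((r + d) ^ d * v))) ^ (1 / (1 - a)) - c * δ ^ ahat)) ≤
        9 * K * C ^ k * (k ! : ℝ) ^ (β + 1) * Real.exp (-N) := by
      -- The truncation level costs e^(βN), which is why the correlation length was set up to gain
      -- e^(-(β+1)N).
      have hMk : M ^ k ≤ C ^ k * ((k ! : ℝ) ^ β * Real.exp (β * N)) := by
        rw [hM, mul_pow, ← Real.rpow_natCast ((N : ℝ) ^ β), ← Real.rpow_mul (by positivity),
          mul_comm β, Real.rpow_mul (by positivity), Real.rpow_natCast]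
        have h4 := Real.pow_div_factorial_le_exp (N : ℝ) (by positivity) k
        rw [div_le_iff₀ (by positivity)] at h4
        have h5 := Real.rpow_le_rpow (by positivity) h4 hβ
        rw [Real.mul_rpow (by positivity) (by positivity), ← Real.exp_mul, mul_comm,
          mul_comm (N : ℝ)] at h5
        gcongr
      calc _ ≤ 9 * (C ^ k * ((k ! : ℝ) ^ β * Real.exp (β * N)) * (k ! : ℝ)) *
            (K * Real.exp (-((β + 1) * N))) := by
            rw [hT]
            gcongr
        _ = 9 * K * C ^ k * ((k ! : ℝ) ^ β * (k ! : ℝ)) *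
            (Real.exp (β * N) * Real.exp (-((β + 1) * N))) := by ring
        _ = _ := by
            rw [← Real.rpow_add_one (by positivity), ← Real.exp_add]
            ring_nf
    -- The square root of a truncation probability of order e^(-N): this term limits the final rate
    -- to N/2.
    have h4 : √(((I.card : ℝ) + J.card) * ε) ≤ (2 * C) ^ k * Real.exp (-(N / 2)) := by
      refine Real.sqrt_le_iff.2 ⟨by positivity, ?_⟩
      rw [← Nat.cast_add, ← hk, mul_pow, ← Real.exp_nat_mul,
        show ((2 : ℕ) : ℝ) * (-((N : ℝ) / 2)) = -N by push_cast; ring, hε, ← mul_assoc]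
      gcongr
      have h5 : (k : ℝ) ≤ 2 ^ k := by exact_mod_cast Nat.lt_two_pow_self.le
      have h6 : C ≤ C ^ k := le_self_pow₀ hC (by omega)
      have h7 : (k : ℝ) * C ≤ (2 * C) ^ k := by
        rw [mul_pow]
        gcongr
      have h8 : (1 : ℝ) ≤ (2 * C) ^ k := one_le_pow₀ (by linarith)
      nlinarith
    have h5 : Real.exp (-N) ≤ Real.exp (-(N / 2)) := Real.exp_le_exp.2 (by linarith)
    have h6 : |∫ X, F X X ∂P - ∫ Z, F Z.1 Z.2 ∂(P.prod P)| ≤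
        4 * G₀ * ((2 * C) ^ k * Real.exp (-(N / 2))) +
          9 * K * C ^ k * (k ! : ℝ) ^ (β + 1) * Real.exp (-(N / 2)) := by
      have h7 := _root_.abs_sub_le (∫ X, F X X ∂P) (∫ X, F' X X ∂P) (∫ Z, F Z.1 Z.2 ∂(P.prod P))
      have h8 := _root_.abs_sub_le (∫ X, F' X X ∂P) (∫ Z, F' Z.1 Z.2 ∂(P.prod P))
        (∫ Z, F Z.1 Z.2 ∂(P.prod P))
      rw [abs_sub_comm (∫ Z, F' Z.1 Z.2 ∂(P.prod P))] at h8
      have h9 := mul_le_mul_of_nonneg_left h4 (show 0 ≤ 2 * G₀ by positivity)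
      have h10 := mul_le_mul_of_nonneg_left h5
        (show 0 ≤ 9 * K * C ^ k * (k ! : ℝ) ^ (β + 1) by positivity)
      have h11 := hmix.trans h3
      simp only [id_eq] at he1
      linarith
    refine h6.trans ?_
    have h7 : 4 * (E ^ k * (2 * C) ^ k) + 9 * K * C ^ k ≤ (26 * K * C * E) ^ k := by
      have h8 : K ≤ K ^ k := le_self_pow₀ hK (by omega)
      have h9 : (1 : ℝ) ≤ E ^ k := one_le_pow₀ hE1
      have h10 : (13 : ℝ) ≤ 13 ^ k := le_self_pow₀ (by norm_num) (by omega)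
      have h11 : (1 : ℝ) ≤ 2 ^ k := one_le_pow₀ (by norm_num)
      calc 4 * (E ^ k * (2 * C) ^ k) + 9 * K * C ^ k
          ≤ 4 * K * (E ^ k * (2 * C) ^ k) + 9 * K * (E ^ k * (2 * C) ^ k) := by
            have h12 : C ^ k ≤ E ^ k * (2 * C) ^ k := by
              rw [mul_pow 2 C]
              have : 0 ≤ C ^ k := by positivity
              calc C ^ k ≤ 2 ^ k * C ^ k := le_mul_of_one_le_left this h11
                _ ≤ _ := le_mul_of_one_le_left (by positivity) h9
            have h13 : 4 * (E ^ k * (2 * C) ^ k) ≤ 4 * K * (E ^ k * (2 * C) ^ k) := by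
              gcongr
              linarith
            have h14 := mul_le_mul_of_nonneg_left h12 (show 0 ≤ 9 * K by positivity)
            linarith
        _ = 13 * (K * (E ^ k * (2 * C) ^ k)) := by ring
        _ ≤ 13 ^ k * (K ^ k * (E ^ k * (2 * C) ^ k)) := by gcongr
        _ = _ := by rw [← mul_pow, ← mul_pow, ← mul_pow]; ring_nf
    calc _ = (4 * (E ^ k * (2 * C) ^ k) + 9 * K * C ^ k) *
          ((k ! : ℝ) ^ (β + 1) * Real.exp (-(N / 2))) := by rw [hG₀]; ring
      _ ≤ (26 * K * C * E) ^ k * ((k ! : ℝ) ^ (β + 1) * Real.exp (-(N / 2))) := by gcongr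
      _ = _ := by ring
  · refine (hFb' _ _).trans ?_
    have h1 := prod_envelope_ofFinset_le hg'.abs_le hC0 hCM I f s
    have h2 := prod_envelope_ofFinset_le hg'.abs_le hC0 hCM J f t
    have h3 : (I.card ! : ℝ) * J.card ! ≤ k ! := by
      exact_mod_cast Nat.le_of_dvd (Nat.factorial_pos _)
        (Nat.factorial_mul_factorial_dvd_factorial_add I.card J.card)
    calc _ ≤ M ^ I.card * I.card ! * (3 * 3 ^ s.card) * (M ^ J.card * J.card ! * (3 * 3 ^ t.card)) :=
          mul_le_mul h1 h2 (Finset.prod_nonneg fun i _ => henv0' _ _) (by positivity)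
      _ = 9 * (M ^ k * ((I.card ! : ℝ) * J.card !)) * 3 ^ s.card * 3 ^ t.card := by
          rw [hk, pow_add]; ring
      _ ≤ _ := by
          rw [hT]
          gcongr

end FieldMixing

/-! ### Cumulants of sums of localizable scores -/

section FieldCumulants

variable {d : ℕ} {P : Measure (PointConfig d)} {g g' : EuclideanSpace ℝ (Fin d) → PointConfig d → ℝ}
  {a ahat C β b K c : ℝ}

/-- The sum of the scores in a cell, minus the constant `e z`. -/
noncomputable def centeredCellSum (g : EuclideanSpace ℝ (Fin d) → PointConfig d → ℝ)
    (e : (Fin d → ℤ) → ℝ) (z : Fin d → ℤ) (X : PointConfig d) : ℝ :=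
  X.finSum (cell z) (fun x => g x X) - e z

/-- The mean of the sum of the scores in a cell. -/
noncomputable def cellMean (P : Measure (PointConfig d))
    (g : EuclideanSpace ℝ (Fin d) → PointConfig d → ℝ) (z : Fin d → ℤ) : ℝ :=
  ∫ X, X.finSum (cell z) (fun x => g x X) ∂P

theorem measurable_centeredCellSum (hg : Measurable (Function.uncurry g)) (e : (Fin d → ℤ) → ℝ)
    (z : Fin d → ℤ) : Measurable (centeredCellSum g e z) :=
  (measurable_cellSum hg z).sub_const _

theorem abs_centeredCellSum_le {e : (Fin d → ℤ) → ℝ} {z : Fin d → ℤ} (he : |e z| ≤ C)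
    (X : PointConfig d) : |centeredCellSum g e z X| ≤ envelope g C z X := by
  rw [centeredCellSum, envelope]
  refine (abs_sub _ _).trans (add_le_add (X.abs_finSum_le (isBounded_cell z) _) he)

theorem IsLocalizable.abs_cellMean_le (hg : IsLocalizable P g C β b) (z : Fin d → ℤ) :
    |cellMean P g z| ≤ C := by
  have h1 := (hg.moment z 1 le_rfl)
  simp only [pow_one, Nat.factorial_one, Nat.cast_one, Real.one_rpow, mul_one] at h1
  refine (abs_integral_le_integral_abs).trans ?_
  have h2 := h1.mono (f := fun X => |X.finSum (cell z) fun x => g x X|)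
    (measurable_cellSum hg.measurable z).abs fun X => by
      rw [abs_abs]; exact X.abs_finSum_le (isBounded_cell z) _
  exact h2.2

theorem IsLocalizable.prod_centeredCellSum [IsProbabilityMeasure P] (hg : IsLocalizable P g C β b)
    (hC : 1 ≤ C) (hβ : 0 ≤ β) (hK1 : 1 ≤ K)
    (hK : ∀ z, MeanLE P (fun X => (3 : ℝ) ^ (X.carrier ∩ cell z).ncard) K) {ι : Type*}
    (T : Finset ι) (f : ι → Fin d → ℤ) {e : (Fin d → ℤ) → ℝ} (he : ∀ z, |e z| ≤ C) :
    MeanLE P (fun X => |∏ i ∈ T, centeredCellSum g e (f i) X|)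
      ((2 * envelopeConst K C β * 2 ^ (β + 1)) ^ T.card * (T.card ! : ℝ) ^ (β + 1)) := by
  have hE := one_le_envelopeConst (β := β) hC hK1
  refine MeanLE.of_sq (by positivity) (Finset.measurable_prod T fun i _ =>
    measurable_centeredCellSum hg.measurable e (f i)) ?_
  refine (hg.prod_envelope_sq hC hβ hK1 hK T f).mono ((Finset.measurable_prod T fun i _ =>
    measurable_centeredCellSum hg.measurable e (f i)).pow_const 2) fun X => ?_
  rw [abs_of_nonneg (sq_nonneg _), ← sq_abs, Finset.abs_prod]
  refine pow_le_pow_left₀ (Finset.prod_nonneg fun i _ => abs_nonneg _) ?_ 2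
  exact Finset.prod_le_prod (fun i _ => abs_nonneg _) fun i _ => abs_centeredCellSum_le (he _) X

theorem IsLocalizable.integrable_prod_centeredCellSum [IsProbabilityMeasure P]
    (hg : IsLocalizable P g C β b) (hC : 1 ≤ C) (hβ : 0 ≤ β) (hK1 : 1 ≤ K)
    (hK : ∀ z, MeanLE P (fun X => (3 : ℝ) ^ (X.carrier ∩ cell z).ncard) K) {ι : Type*}
    (T : Finset ι) (f : ι → Fin d → ℤ) {e : (Fin d → ℤ) → ℝ} (he : ∀ z, |e z| ≤ C) :
    Integrable (fun X => ∏ i ∈ T, centeredCellSum g e (f i) X) P :=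
  (integrable_norm_iff (Finset.measurable_prod T fun i _ =>
    measurable_centeredCellSum hg.measurable e (f i)).aestronglyMeasurable).1
    (hg.prod_centeredCellSum hC hβ hK1 hK T f he).1

theorem IsLocalizable.integrable_pow_sum [IsProbabilityMeasure P]
    (hg : IsLocalizable P g C β b) (hC : 1 ≤ C) (hβ : 0 ≤ β) (hK1 : 1 ≤ K)
    (hK : ∀ z, MeanLE P (fun X => (3 : ℝ) ^ (X.carrier ∩ cell z).ncard) K)
    {e : (Fin d → ℤ) → ℝ} (he : ∀ z, |e z| ≤ C) (Z : Finset (Fin d → ℤ)) (k : ℕ) :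
    Integrable (fun X => (∑ z ∈ Z, centeredCellSum g e z X) ^ k) P := by
  have h := fun X => pow_sum_eq_sum_tuplesOn Z (0 : Fin d → ℤ) (fun z => centeredCellSum g e z X)
    (Finset.univ : Finset (Fin k))
  simp only [Finset.card_univ, Fintype.card_fin] at h
  simp only [h]
  exact integrable_finsetSum _ fun f _ =>
    hg.integrable_prod_centeredCellSum hC hβ hK1 hK _ f he

/-- Products of centered sums over distant cells are almost uncorrelated. -/
theorem IsMixing.exists_prod_mixing [IsProbabilityMeasure P] (h : IsMixing P a ahat K c)
    (ha₁ : a < 1) (hahat : 0 < ahat) (hC : 1 ≤ C) (hβ : 0 ≤ β) (hb : 0 ≤ b) (hK : 1 ≤ K)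
    (hc : 0 < c) :
    ∃ B Γ : ℝ, 1 ≤ B ∧ 1 ≤ Γ ∧ ∀ g : EuclideanSpace ℝ (Fin d) → PointConfig d → ℝ,
      IsLocalizable P g C β b → ∀ e : (Fin d → ℤ) → ℝ, (∀ z, |e z| ≤ C) → ∀ N : ℕ, 1 ≤ N →
      ∀ (ι : Type) (I J : Finset ι) (f : ι → Fin d → ℤ),
      (∀ i ∈ I, ∀ j ∈ J, Γ * ((I.card + J.card : ℕ) : ℝ) ^ (1 / ((1 - a) * ahat)) *
        (N : ℝ) ^ lengthExponent d a ahat b ≤ dist (latticePoint (f i)) (latticePoint (f j))) →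
      |∫ X, (∏ i ∈ I, centeredCellSum g e (f i) X) * ∏ j ∈ J, centeredCellSum g e (f j) X ∂P -
        (∫ X, ∏ i ∈ I, centeredCellSum g e (f i) X ∂P) *
          ∫ X, ∏ j ∈ J, centeredCellSum g e (f j) X ∂P| ≤
        B ^ (I.card + J.card) * ((I.card + J.card)! : ℝ) ^ (β + 1) * Real.exp (-(N / 2)) := by
  obtain ⟨B, Γ, hB, hΓ, hmain⟩ := h.exists_field_mixing ha₁ hahat hC hβ hb hK hc
  refine ⟨B, Γ, hB, hΓ, fun g hg e he N hN ι I J f hdist => ?_⟩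
  -- With I empty both sides are the same integral; the field mixing bound requires I nonempty.
  rcases I.eq_empty_or_nonempty with rfl | hI
  · simp only [Finset.prod_empty, one_mul, integral_const, probReal_univ, smul_eq_mul, sub_self,
      abs_zero]
    positivity
  obtain ⟨g', hg'm, hg'g, hg'⟩ := hmain g hg N hN
  let F : (EuclideanSpace ℝ (Fin d) → PointConfig d → ℝ) → PointConfig d → PointConfig d → ℝ :=
    fun g X Y => (∏ i ∈ I, centeredCellSum g e (f i) X) * ∏ j ∈ J, centeredCellSum g e (f j) Y
  have hFm : ∀ g : EuclideanSpace ℝ (Fin d) → PointConfig d → ℝ, Measurable (Function.uncurry g) →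
      Measurable (Function.uncurry (F g)) := fun g hg =>
    ((Finset.measurable_prod I fun i _ => measurable_centeredCellSum hg e (f i)).comp
      measurable_fst).mul ((Finset.measurable_prod J fun i _ =>
        measurable_centeredCellSum hg e (f i)).comp measurable_snd)
  have hFb : ∀ (g : EuclideanSpace ℝ (Fin d) → PointConfig d → ℝ) X Y, |F g X Y| ≤
      (∏ i ∈ I, envelope g C (f i) X) * ∏ j ∈ J, envelope g C (f j) Y := by
    intro g X Y
    simp only [F]
    rw [abs_mul, Finset.abs_prod, Finset.abs_prod]
    refine mul_le_mul (Finset.prod_le_prod (fun i _ => abs_nonneg _) fun i _ =>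
      abs_centeredCellSum_le (he _) X) (Finset.prod_le_prod (fun i _ => abs_nonneg _) fun i _ =>
      abs_centeredCellSum_le (he _) Y) (Finset.prod_nonneg fun i _ => abs_nonneg _)
      (Finset.prod_nonneg fun i _ => envelope_nonneg (by linarith) _ _)
  have := hg' ι I J f (F g) (F g') hI (hFm g hg.measurable) (hFm g' hg'm) (hFb g) (hFb g')
    (fun X Y hX hY => ?_) (fun X Y X' Y' hX hY => ?_) hdist
  · rw [integral_prod_mul (fun X => ∏ i ∈ I, centeredCellSum g e (f i) X)
      fun Y => ∏ j ∈ J, centeredCellSum g e (f j) Y] at this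
    exact this.2.2
  · simp only [F, centeredCellSum]
    congr 1
    · exact Finset.prod_congr rfl fun i hi => by
        rw [X.finSum_congr fun x hx => (hX i hi x hx).symm]
    · exact Finset.prod_congr rfl fun i hi => by
        rw [Y.finSum_congr fun x hx => (hY i hi x hx).symm]
  · simp only [F, centeredCellSum]
    congr 1
    · refine Finset.prod_congr rfl fun i hi => ?_
      rw [X'.finSum_congr fun x hx => (hX i hi).2 x hx.2, PointConfig.finSum, PointConfig.finSum,
        (hX i hi).1]
    · refine Finset.prod_congr rfl fun i hi => ?_
      rw [Y'.finSum_congr fun x hx => (hY i hi).2 x hx.2, PointConfig.finSum, PointConfig.finSum,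
        (hY i hi).1]

/-- The lattice points with coordinates at most `G`. -/
noncomputable def latticeBox (d : ℕ) (G : ℕ) : Finset (Fin d → ℤ) :=
  Fintype.piFinset fun _ => Finset.Icc (-(G : ℤ)) G

theorem mem_latticeBox {G : ℕ} {v : Fin d → ℤ} : v ∈ latticeBox d G ↔ ∀ i, |v i| ≤ G := by
  simp [latticeBox, Fintype.mem_piFinset, abs_le]

theorem card_latticeBox (G : ℕ) : (latticeBox d G).card = (2 * G + 1) ^ d := by
  simp only [latticeBox, Fintype.card_piFinset, Int.card_Icc, Finset.prod_const, Finset.card_univ,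
    Fintype.card_fin]
  congr 1
  omega

/-- Some integer coordinate exceeds ⌊x⌋, hence is at least ⌊x⌋ + 1, which is larger than x. -/
theorem le_dist_of_notMem_latticeBox {x : ℝ} {z z' : Fin d → ℤ} (h : z' - z ∉ latticeBox d ⌊x⌋₊) :
    x ≤ dist (latticePoint z) (latticePoint z') := by
  rw [mem_latticeBox] at h
  push Not at h
  obtain ⟨i, hi⟩ := h
  have h1 := abs_apply_sub_le_dist (latticePoint z') (latticePoint z) i
  rw [dist_comm] at h1
  refine le_trans ?_ h1
  simp only [latticePoint_apply]
  have h2 : (⌊x⌋₊ : ℤ) + 1 ≤ |z' i - z i| := hi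
  have h3 : ((⌊x⌋₊ : ℝ) + 1) ≤ |(z' i : ℝ) - z i| := by exact_mod_cast h2
  exact (Nat.lt_floor_add_one x).le.trans h3

/-- The box at scale N consists of the lattice offsets below the correlation length for k cells at
truncation level m N. Its size is of order k^(u d) N^(w d), which explains the last two summands of
the exponent. The constant depends on the field only through the constants of `IsLocalizable`, so it
is uniform in the window. -/
theorem IsMixing.exists_cumulant_bound [IsProbabilityMeasure P] (h : IsMixing P a ahat K c)
    (ha₁ : a < 1) (hahat : 0 < ahat) (hC : 1 ≤ C) (hβ : 0 ≤ β) (hb : 0 ≤ b) (hK : 1 ≤ K)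
    (hc : 0 < c) :
    ∃ A : ℝ, 1 ≤ A ∧ ∀ g : EuclideanSpace ℝ (Fin d) → PointConfig d → ℝ,
      IsLocalizable P g C β b → ∀ e : (Fin d → ℤ) → ℝ, (∀ z, |e z| ≤ C) →
      ∀ (Z : Finset (Fin d → ℤ)) (k : ℕ), 1 ≤ k →
      |cumulantSeq (fun j => ∫ X, (∑ z ∈ Z, centeredCellSum g e z X) ^ j ∂P) k| ≤
        Z.card * (A ^ k * (k ! : ℝ) ^
          (β + 1 + 1 + d / ((1 - a) * ahat) + lengthExponent d a ahat b * d)) := by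
  obtain ⟨B, Γ, hB, hΓ, hmix⟩ := h.exists_prod_mixing ha₁ hahat hC hβ hb hK hc
  have h1a : 0 < 1 - a := by linarith
  set u := 1 / ((1 - a) * ahat) with hu
  have hu0 : 0 < u := by positivity
  set w := lengthExponent d a ahat b with hw
  have hw0 : 0 < w := by
    rw [hw, lengthExponent]
    positivity
  set q := w * d with hq
  have hq0 : 0 ≤ q := by positivity
  set D := d / ((1 - a) * ahat) with hD
  have hD0 : 0 ≤ D := by positivity
  have hDu : u * d = D := by rw [hu, hD]; ring
  -- Rescaling the truncation level by m turns the available decay e^(-mN/2) into the required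
  -- e^(-(q+1)N).
  obtain ⟨m, hm⟩ := exists_nat_ge (2 * (q + 1))
  have hm1 : (1 : ℝ) ≤ m := by linarith
  have hm1' : 1 ≤ m := by exact_mod_cast hm1
  set E := 2 * envelopeConst K C β * 2 ^ (β + 1) with hE
  have hE0 : 0 ≤ E := by
    have := one_le_envelopeConst (β := β) hC hK
    positivity
  set C' := B + E with hC'
  have hC'0 : 0 ≤ C' := by linarith
  set K' := (3 * (Γ * (m : ℝ) ^ w)) ^ d with hK'
  have hmw : 1 ≤ (m : ℝ) ^ w := Real.one_le_rpow hm1 hw0.le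
  have hK'1 : 1 ≤ K' := one_le_pow₀ (by nlinarith)
  refine ⟨2 * Real.exp q * (4 * C' * K' * Real.exp (1 + D)) + 1, by
    have : 0 ≤ 2 * Real.exp q * (4 * C' * K' * Real.exp (1 + D)) := by positivity
    linarith, fun g hg e he Z k hk => ?_⟩
  have hk1 : (1 : ℝ) ≤ k := by exact_mod_cast hk
  have hku : 1 ≤ (k : ℝ) ^ u := Real.one_le_rpow hk1 hu0.le
  let gap : ℕ → ℝ := fun N => Γ * (k : ℝ) ^ u * ((m * N : ℕ) : ℝ) ^ w
  have hmain := abs_jointCumulant_sum_le (P := P) (Y := centeredCellSum g e) (Z := Z) (k := k)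
    (box := fun N => latticeBox d ⌊gap N⌋₊) (C := C') (t := β + 1) (K := K') (D := D) (q := q) hk
    hC'0 (by linarith) hK'1 hD0 hq0
    (fun T f => hg.integrable_prod_centeredCellSum hC hβ hK h.exp_moment T f he)
    (fun T f => ?_) (fun N hN T I f hbox => ?_) (fun N => ?_) ?_
  · have h2 := jointCumulant_card (ι := Fin k)
      (fun j => ∫ X, (∑ z ∈ Z, centeredCellSum g e z X) ^ j ∂P) Finset.univ
    rw [Finset.card_univ, Fintype.card_fin] at h2
    rw [← h2]
    refine hmain.trans ?_
    refine mul_le_mul_of_nonneg_left ?_ (by positivity)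
    refine mul_le_mul_of_nonneg_right ?_ (by positivity)
    have h3 : 1 ≤ 2 * Real.exp q := by
      have := Real.add_one_le_exp q
      linarith
    calc 2 * Real.exp q * (4 * C' * K' * Real.exp (1 + D)) ^ k
        ≤ (2 * Real.exp q) ^ k * (4 * C' * K' * Real.exp (1 + D)) ^ k := by
          gcongr
          exact le_self_pow₀ h3 (by omega)
      _ = (2 * Real.exp q * (4 * C' * K' * Real.exp (1 + D))) ^ k := by rw [← mul_pow]
      _ ≤ _ := pow_le_pow_left₀ (by positivity) (by linarith) k
  · refine (abs_integral_le_integral_abs).trans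
      ((hg.prod_centeredCellSum hC hβ hK h.exp_moment T f he).2.trans ?_)
    rw [← hE]
    gcongr
    linarith
  · have hcard : (T ∩ I).card + (T \ I).card = T.card := by
      rw [Finset.card_inter_add_card_sdiff]
    have h4 := hmix g hg e he (m * N) (Nat.mul_pos hm1' hN) (Fin k) (T ∩ I) (T \ I) f ?_
    · rw [hcard] at h4
      simp only [Finset.prod_inter_mul_prod_sdiff] at h4
      refine h4.trans ?_
      have h5 : Real.exp (-(((m * N : ℕ) : ℝ) / 2)) ≤ Real.exp (-((q + 1) * N)) := by
        refine Real.exp_le_exp.2 ?_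
        push_cast
        have : 2 * (q + 1) * (N : ℝ) ≤ m * N := by gcongr
        linarith
      calc _ ≤ C' ^ T.card * (T.card ! : ℝ) ^ (β + 1) * Real.exp (-((q + 1) * N)) := by
            gcongr
            linarith
        _ = _ := by ring
    · intro i hi j hj
      refine le_trans ?_ (le_dist_of_notMem_latticeBox (hbox i hi j hj))
      have : (((T ∩ I).card + (T \ I).card : ℕ) : ℝ) ≤ k := by
        rw [hcard]
        exact_mod_cast (Finset.card_le_univ T).trans_eq (Fintype.card_fin k)
      simp only [gap]
      gcongr
  · have hN1 : (1 : ℝ) ≤ (N : ℝ) + 1 := by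
      have : (0 : ℝ) ≤ N := by positivity
      linarith
    have hgap : gap (N + 1) = Γ * (m : ℝ) ^ w * (k : ℝ) ^ u * ((N : ℝ) + 1) ^ w := by
      simp only [gap]
      push_cast
      rw [Real.mul_rpow (by positivity) (by positivity)]
      ring
    have hgap1 : 1 ≤ gap (N + 1) := by
      rw [hgap]
      exact one_le_mul_of_one_le_of_one_le (one_le_mul_of_one_le_of_one_le
        (one_le_mul_of_one_le_of_one_le hΓ hmw) hku) (Real.one_le_rpow hN1 hw0.le)
    rw [card_latticeBox]
    push_cast
    have h6 : 2 * (⌊gap (N + 1)⌋₊ : ℝ) + 1 ≤ 3 * gap (N + 1) := by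
      have := Nat.floor_le (zero_le_one.trans hgap1)
      linarith
    refine (pow_le_pow_left₀ (by positivity) h6 d).trans_eq ?_
    rw [hgap, hK', ← hDu, hq, Real.rpow_mul (by positivity), Real.rpow_mul (by positivity),
      Real.rpow_natCast, Real.rpow_natCast]
    ring
  · obtain ⟨R, hR⟩ : ∃ R : ℕ, ∀ z ∈ Z, ∀ z' ∈ Z, ∀ i, |(z' - z) i| ≤ R := by
      refine ⟨∑ z ∈ Z, ∑ z' ∈ Z, ∑ i, ((z' - z) i).natAbs, fun z hz z' hz' i => ?_⟩
      rw [Int.abs_eq_natAbs]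
      have h7 := Finset.single_le_sum (f := fun i => ((z' - z) i).natAbs)
        (fun _ _ => Nat.zero_le _) (Finset.mem_univ i)
      have h8 := Finset.single_le_sum (f := fun z' => ∑ i, ((z' - z) i).natAbs)
        (fun _ _ => Nat.zero_le _) hz'
      have h9 := Finset.single_le_sum (f := fun z => ∑ z' ∈ Z, ∑ i, ((z' - z) i).natAbs)
        (fun _ _ => Nat.zero_le _) hz
      exact_mod_cast h7.trans (h8.trans h9)
    obtain ⟨N₀, hN₀⟩ := ((((tendsto_rpow_atTop hw0).comp tendsto_natCast_atTop_atTop).eventually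
      (Filter.eventually_ge_atTop (R : ℝ))).and (Filter.eventually_ge_atTop 1)).exists
    refine ⟨N₀, fun z hz z' hz' => mem_latticeBox.2 fun i => (hR z hz z' hz' i).trans ?_⟩
    have h10 : (R : ℝ) ≤ gap (N₀ + 1) := by
      refine hN₀.1.trans ?_
      have h11 : (N₀ : ℝ) ≤ ((m * (N₀ + 1) : ℕ) : ℝ) := by
        have h12 : N₀ ≤ m * (N₀ + 1) := by nlinarith
        exact_mod_cast h12
      have h13 : (N₀ : ℝ) ^ w ≤ ((m * (N₀ + 1) : ℕ) : ℝ) ^ w := by gcongr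
      have h14 : 1 ≤ Γ * (k : ℝ) ^ u := one_le_mul_of_one_le_of_one_le hΓ hku
      exact h13.trans (le_mul_of_one_le_left (by positivity) h14)
    exact_mod_cast Nat.le_floor h10

end FieldCumulants

/-! ### Events of small stabilization radius are local -/

section Stabilization

variable {d : ℕ} {ξ : EuclideanSpace ℝ (Fin d) → PointConfig d → ℝ}

theorem PointConfig.union_restrict_compl (X : PointConfig d) (B : Set (EuclideanSpace ℝ (Fin d))) :
    (X.restrict B).union (X.restrict Bᶜ) = X :=
  PointConfig.ext_carrier (Set.inter_union_compl _ _)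

theorem StabilizesAt.eq_restrict {x : EuclideanSpace ℝ (Fin d)} {X : PointConfig d} {r : ℝ}
    (h : StabilizesAt ξ x X r) : ξ x X = ξ x (X.restrict (Metric.closedBall x r)) := by
  have := h X
  rwa [PointConfig.union_restrict_compl] at this

theorem stabilizesAt_congr {x : EuclideanSpace ℝ (Fin d)} {X X' : PointConfig d} {r : ℝ}
    (h : X.restrict (Metric.closedBall x r) = X'.restrict (Metric.closedBall x r)) :
    StabilizesAt ξ x X r ↔ StabilizesAt ξ x X' r := by
  rw [StabilizesAt, StabilizesAt, h]

/-- The infimum runs over naturals, so it is attained whenever it is finite. -/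
theorem stabRadius_le_iff {x : EuclideanSpace ℝ (Fin d)} {X : PointConfig d} {n : ℕ} :
    stabRadius ξ x X ≤ n ↔ ∃ j ≤ n, StabilizesAt ξ x X j := by
  constructor
  · intro h
    by_contra! hne
    have h1 : ((n + 1 : ℕ) : ℝ≥0∞) ≤ stabRadius ξ x X := by
      refine le_iInf₂ fun j hj => ?_
      have : n < j := by
        by_contra! hjn
        exact hne j hjn hj
      exact_mod_cast this
    have h2 := h1.trans h
    norm_cast at h2
    omega
  · rintro ⟨j, hjn, hj⟩
    exact (iInf₂_le j hj).trans (by exact_mod_cast hjn)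

theorem restrict_closedBall_mono {x : EuclideanSpace ℝ (Fin d)} {X X' : PointConfig d} {r s : ℝ}
    (hrs : r ≤ s)
    (h : X.restrict (Metric.closedBall x s) = X'.restrict (Metric.closedBall x s)) :
    X.restrict (Metric.closedBall x r) = X'.restrict (Metric.closedBall x r) := by
  have hsub := Metric.closedBall_subset_closedBall (x := x) hrs
  rw [← X.restrict_restrict_of_subset hsub, h, X'.restrict_restrict_of_subset hsub]

/-- Whether the radius is at most n is decided by the points in the ball of radius n, since
stabilization at j ≤ n involves only the ball of radius j. This makes the truncation by the radius a
local operation. -/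
theorem stabRadius_le_congr {x : EuclideanSpace ℝ (Fin d)} {X X' : PointConfig d} {n : ℕ}
    (h : X.restrict (Metric.closedBall x n) = X'.restrict (Metric.closedBall x n)) :
    stabRadius ξ x X ≤ n ↔ stabRadius ξ x X' ≤ n := by
  rw [stabRadius_le_iff, stabRadius_le_iff]
  refine exists_congr fun j => and_congr_right fun hj => stabilizesAt_congr ?_
  exact restrict_closedBall_mono (by exact_mod_cast hj) h

theorem score_congr_of_stabRadius_le {x : EuclideanSpace ℝ (Fin d)} {X X' : PointConfig d} {n : ℕ}
    (h : X.restrict (Metric.closedBall x n) = X'.restrict (Metric.closedBall x n))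
    (hn : stabRadius ξ x X ≤ n) : ξ x X = ξ x X' := by
  obtain ⟨j, hj, hs⟩ := stabRadius_le_iff.1 hn
  have hjn := restrict_closedBall_mono (show (j : ℝ) ≤ n by exact_mod_cast hj) h
  rw [hs.eq_restrict, hjn, ← ((stabilizesAt_congr hjn).1 hs).eq_restrict]

end Stabilization

/-! ### Expected point sums through Palm distributions -/

section PointSums

variable {d : ℕ} {P : Measure (PointConfig d)}

theorem PointConfig.pointSum_mono (X : PointConfig d) {F G : EuclideanSpace ℝ (Fin d) → ℝ≥0∞}
    (h : ∀ x ∈ X.carrier, F x ≤ G x) : X.pointSum F ≤ X.pointSum G :=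
  ENNReal.tsum_le_tsum fun x => h x x.2

theorem PointConfig.pointSum_add (X : PointConfig d) (F G : EuclideanSpace ℝ (Fin d) → ℝ≥0∞) :
    X.pointSum (fun x => F x + G x) = X.pointSum F + X.pointSum G :=
  ENNReal.tsum_add

theorem PointConfig.pointSum_const_mul (X : PointConfig d) (c : ℝ≥0∞)
    (F : EuclideanSpace ℝ (Fin d) → ℝ≥0∞) :
    X.pointSum (fun x => c * F x) = c * X.pointSum F :=
  ENNReal.tsum_mul_left

theorem lintegral_pointSum_palm {ρ : (p : ℕ) → (Fin p → EuclideanSpace ℝ (Fin d)) → ℝ}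
    {Q : (p : ℕ) → Kernel (Fin p → EuclideanSpace ℝ (Fin d)) (PointConfig d)} (hQ : IsPalm P ρ Q)
    {F : EuclideanSpace ℝ (Fin d) → PointConfig d → ℝ≥0∞} (hF : Measurable (Function.uncurry F)) :
    ∫⁻ X, X.pointSum (fun x => F x X) ∂P =
      ∫⁻ x, (∫⁻ X, F (x 0) X ∂(Q 1 x)) * ENNReal.ofReal (ρ 1 x) := by
  have hm : Measurable (Function.uncurry
      fun (x : Fin 1 → EuclideanSpace ℝ (Fin d)) (X : PointConfig d) => F (x 0) X) :=
    hF.comp (((measurable_pi_apply (0 : Fin 1)).comp measurable_fst).prodMk measurable_snd :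
      Measurable fun p : (Fin 1 → EuclideanSpace ℝ (Fin d)) × PointConfig d => (p.1 0, p.2))
  have h := hQ.campbell 1 (fun x X => F (x 0) X) hm
  simpa only [distinctSum_one, Matrix.cons_val_zero] using h

/-- Palm expectations bounded by `c` give expected sums of at most `c` times the number of
points. -/
theorem lintegral_pointSum_indicator_le {ρ : (p : ℕ) → (Fin p → EuclideanSpace ℝ (Fin d)) → ℝ}
    {Q : (p : ℕ) → Kernel (Fin p → EuclideanSpace ℝ (Fin d)) (PointConfig d)} (hQ : IsPalm P ρ Q)
    (hρ : IsCorrelationFunction P ρ)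
    {F : EuclideanSpace ℝ (Fin d) → PointConfig d → ℝ≥0∞} (hF : Measurable (Function.uncurry F))
    {A : Set (EuclideanSpace ℝ (Fin d))} (hA : MeasurableSet A) {c : ℝ≥0∞}
    (h : ∀ᵐ x : Fin 1 → EuclideanSpace ℝ (Fin d), x 0 ∈ A → 0 < ρ 1 x →
      ∫⁻ X, F (x 0) X ∂(Q 1 x) ≤ c) :
    ∫⁻ X, X.pointSum (A.indicator fun x => F x X) ∂P ≤
      c * ∫⁻ X, X.pointSum (A.indicator 1) ∂P := by
  have hF' : Measurable (Function.uncurry fun x X => A.indicator (fun x => F x X) x) := by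
    have : (Function.uncurry fun x X => A.indicator (fun x => F x X) x) =
        (A ×ˢ Set.univ).indicator (Function.uncurry F) := by
      ext p
      by_cases hp : p.1 ∈ A <;> simp [Function.uncurry, Set.indicator, hp]
    rw [this]
    exact hF.indicator (hA.prod MeasurableSet.univ)
  have h1 : Measurable fun x : Fin 1 → EuclideanSpace ℝ (Fin d) =>
      A.indicator (1 : EuclideanSpace ℝ (Fin d) → ℝ≥0∞) (x 0) :=
    (measurable_one.indicator hA).comp (measurable_pi_apply 0)
  have h2 := hρ.lintegral_distinctSum 1 (fun x => A.indicator 1 (x 0)) h1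
  have h3 : Measurable fun x : Fin 1 → EuclideanSpace ℝ (Fin d) =>
      A.indicator (1 : EuclideanSpace ℝ (Fin d) → ℝ≥0∞) (x 0) * ENNReal.ofReal (ρ 1 x) :=
    h1.mul (hρ.measurable 1).ennreal_ofReal
  simp only [distinctSum_one, Matrix.cons_val_zero] at h2
  rw [lintegral_pointSum_palm hQ hF', show (fun X : PointConfig d => X.pointSum (A.indicator 1)) =
    fun X => X.pointSum fun a => A.indicator 1 a from rfl, h2, ← lintegral_const_mul _ h3]
  refine lintegral_mono_ae ?_
  filter_upwards [h] with x hx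
  by_cases hxA : x 0 ∈ A
  · simp only [Set.indicator_of_mem hxA, Pi.one_apply, one_mul]
    rcases (hρ.nonneg 1 x).eq_or_lt with h0 | h0
    · simp [← h0]
    · exact mul_le_mul_left (hx hxA h0) _
  · simp [Set.indicator_of_notMem hxA]

end PointSums

/-! ### Score fields are localizable -/

section ScoreField

variable {d : ℕ} {P : Measure (PointConfig d)} {ξ : EuclideanSpace ℝ (Fin d) → PointConfig d → ℝ}
  {W : Set (EuclideanSpace ℝ (Fin d))} {C β b : ℝ}

/-- The scores of the points in `W` with respect to the configuration in `W`, weighted by `w`. -/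
noncomputable def scoreField (ξ : EuclideanSpace ℝ (Fin d) → PointConfig d → ℝ)
    (W : Set (EuclideanSpace ℝ (Fin d))) (w : EuclideanSpace ℝ (Fin d) → ℝ)
    (x : EuclideanSpace ℝ (Fin d)) (X : PointConfig d) : ℝ :=
  W.indicator (fun x => ξ x (X.restrict W) * w x) x

/-- Moments of the scores and of the stabilization radii of the points in the unit cubes. -/
structure HasScoreMoments (P : Measure (PointConfig d))
    (ξ : EuclideanSpace ℝ (Fin d) → PointConfig d → ℝ) (W : Set (EuclideanSpace ℝ (Fin d)))
    (C β b : ℝ) : Prop where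
  moment : ∀ z, ∀ k : ℕ, 1 ≤ k →
    ∫⁻ X, X.pointSum ((cell z ∩ W).indicator fun x =>
      ENNReal.ofReal (|ξ x (X.restrict W)| ^ k)) ∂P ≤ ENNReal.ofReal (C ^ k * (k ! : ℝ) ^ β)
  stab : ∀ z, ∀ N : ℕ, 1 ≤ N →
    ∫⁻ X, X.pointSum ((cell z ∩ W).indicator fun x => stabRadius ξ x (X.restrict W) ^ N) ∂P ≤
      ENNReal.ofReal (C ^ N * (N ! : ℝ) ^ b)

theorem measurable_restrict_uncurry {α : Type*} [MeasurableSpace α]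
    {F : EuclideanSpace ℝ (Fin d) → PointConfig d → α} (hF : Measurable (Function.uncurry F))
    (hW : MeasurableSet W) : Measurable (Function.uncurry fun x (X : PointConfig d) => F x (X.restrict W)) :=
  hF.comp (measurable_fst.prodMk ((PointConfig.measurable_restrict hW).comp measurable_snd))

theorem measurable_scoreField (hξ : Measurable (Function.uncurry ξ)) (hW : MeasurableSet W)
    {w : EuclideanSpace ℝ (Fin d) → ℝ} (hw : Measurable w) :
    Measurable (Function.uncurry (scoreField ξ W w)) := by
  have : Function.uncurry (scoreField ξ W w) = (W ×ˢ Set.univ).indicator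
      fun p => ξ p.1 (p.2.restrict W) * w p.1 := by
    ext p
    by_cases hp : p.1 ∈ W <;> simp [Function.uncurry, scoreField, Set.indicator, hp]
  rw [this]
  exact ((measurable_restrict_uncurry hξ hW).mul (hw.comp measurable_fst)).indicator
    (hW.prod MeasurableSet.univ)

theorem measurable_indicator_uncurry {F : EuclideanSpace ℝ (Fin d) → PointConfig d → ℝ≥0∞}
    (hF : Measurable (Function.uncurry F)) {A : Set (EuclideanSpace ℝ (Fin d))}
    (hA : MeasurableSet A) (hAb : Bornology.IsBounded A) :
    Measurable fun X : PointConfig d => X.pointSum (A.indicator fun x => F x X) :=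
  PointConfig.measurable_pointSum_indicator measurable_id (F := fun X x => F x X) (hF.comp measurable_swap)
    hA hAb

theorem factorial_rpow_le (N : ℕ) {s : ℝ} (hs : 0 ≤ s) : (N ! : ℝ) ^ s ≤ ((N : ℝ) ^ s) ^ N := by
  have h : (N ! : ℝ) ≤ (N : ℝ) ^ N := by exact_mod_cast Nat.factorial_le_pow N
  refine (Real.rpow_le_rpow (by positivity) h hs).trans_eq ?_
  rw [← Real.rpow_natCast, ← Real.rpow_natCast, ← Real.rpow_mul (by positivity),
    ← Real.rpow_mul (by positivity), mul_comm]

/-- Markov's inequality for the `N`-th moment at level `e C N^s`. -/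
theorem markov_exp_le {N : ℕ} (hN : 1 ≤ N) {s m : ℝ} (hs : 0 ≤ s) (hC : 1 ≤ C)
    (hm : Real.exp 1 * C * (N : ℝ) ^ s ≤ m) :
    (m ^ N)⁻¹ * (C ^ N * (N ! : ℝ) ^ s) ≤ Real.exp (-N) := by
  have hN0 : (0 : ℝ) < N := by exact_mod_cast hN
  have h1 : (Real.exp 1 * C * (N : ℝ) ^ s) ^ N ≤ m ^ N := pow_le_pow_left₀ (by positivity) hm N
  have h0 : 0 < (Real.exp 1 * C * (N : ℝ) ^ s) ^ N := by positivity
  rw [inv_mul_le_iff₀ (h0.trans_le h1)]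
  calc C ^ N * (N ! : ℝ) ^ s ≤ C ^ N * ((N : ℝ) ^ s) ^ N := by
        gcongr
        exact factorial_rpow_le N hs
    _ = (Real.exp 1 * C * (N : ℝ) ^ s) ^ N * Real.exp (-N) := by
        rw [mul_pow, mul_pow, Real.exp_one_pow, Real.exp_neg]
        field_simp
    _ ≤ _ := by gcongr

/-- The score is set to zero unless its radius is at most ⌈e C N^b⌉ and its modulus at most e C N^β.
Markov's inequality for N-th moments bounds the expected number of changed points in a cube by
e^(-N) for either reason. The factor 4 has room for e < 3 and for rounding up. -/
theorem HasScoreMoments.isLocalizable (h : HasScoreMoments P ξ W C β b) (hC : 1 ≤ C) (hβ : 0 ≤ β)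
    (hb : 0 ≤ b) (hW : MeasurableSet W) (hξ : Measurable (Function.uncurry ξ))
    (hR : Measurable (Function.uncurry (stabRadius ξ))) {w : EuclideanSpace ℝ (Fin d) → ℝ}
    (hw : Measurable w) {M : ℝ} (hM : 1 ≤ M) (hwM : ∀ x, |w x| ≤ M) :
    IsLocalizable P (scoreField ξ W w) (4 * C * M) β b := by
  classical
  have hξW := measurable_restrict_uncurry hξ hW
  have hRW := measurable_restrict_uncurry hR hW
  have hgm := measurable_scoreField hξ hW hw
  have hC0 : 0 < C := by linarith
  have hM0 : 0 < M := by linarith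
  have hCM : C ≤ C * M := le_mul_of_one_le_right hC0.le hM
  refine ⟨hgm, fun z k hk => ?_, fun N hN => ?_⟩
  · refine (MeanLE.of_lintegral (measurable_cellSum (g := fun x X => |scoreField ξ W w x X| ^ k)
      (hgm.abs.pow_const k) z) (fun X => X.finSum_nonneg fun x => by positivity)
      (F := M ^ k * (C ^ k * (k ! : ℝ) ^ β)) (by positivity) ?_).le ?_
    · rw [ENNReal.ofReal_mul (by positivity)]
      refine le_trans ?_ (mul_le_mul_right (h.moment z k hk) _)
      rw [← lintegral_const_mul _ (measurable_indicator_uncurry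
        (F := fun x X => ENNReal.ofReal (|ξ x (X.restrict W)| ^ k))
        (hξW.abs.pow_const k).ennreal_ofReal ((measurableSet_cell z).inter hW)
        ((isBounded_cell z).subset Set.inter_subset_left))]
      refine lintegral_mono fun X => ?_
      rw [X.ofReal_finSum (isBounded_cell z) fun x => by positivity, ← X.pointSum_const_mul]
      refine X.pointSum_mono fun x _ => ?_
      by_cases hz : x ∈ cell z
      · by_cases hx : x ∈ W
        · rw [Set.indicator_of_mem hz, Set.indicator_of_mem (show x ∈ cell z ∩ W from ⟨hz, hx⟩), scoreField,
            Set.indicator_of_mem hx, ← ENNReal.ofReal_mul (by positivity), abs_mul, mul_pow,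
            mul_comm]
          refine ENNReal.ofReal_le_ofReal ?_
          gcongr
          exact hwM x
        · rw [Set.indicator_of_mem hz, scoreField, Set.indicator_of_notMem hx, abs_zero,
            zero_pow (by omega), ENNReal.ofReal_zero]
          exact zero_le
      · rw [Set.indicator_of_notMem hz]
        exact zero_le
    · rw [← mul_assoc, ← mul_pow]
      refine mul_le_mul_of_nonneg_right (pow_le_pow_left₀ (by positivity) ?_ k) (by positivity)
      nlinarith
  · have hN0 : (1 : ℝ) ≤ N := by exact_mod_cast hN
    have hNb : 1 ≤ (N : ℝ) ^ b := Real.one_le_rpow hN0 hb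
    have hNβ : 1 ≤ (N : ℝ) ^ β := Real.one_le_rpow hN0 hβ
    have he : Real.exp 1 ≤ 3 := by linarith [Real.exp_one_lt_d9]
    set r : ℕ := ⌈Real.exp 1 * C * (N : ℝ) ^ b⌉₊ with hr
    have hr1 : Real.exp 1 * C * (N : ℝ) ^ b ≤ r := Nat.le_ceil _
    have hr0 : (0 : ℝ) < r := lt_of_lt_of_le (by positivity) hr1
    have hr2 : (r : ℝ) ≤ 4 * C * M * (N : ℝ) ^ b := by
      have h1 := (Nat.ceil_lt_add_one (show 0 ≤ Real.exp 1 * C * (N : ℝ) ^ b by positivity)).le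
      rw [← hr] at h1
      have h2 : Real.exp 1 * (C * (N : ℝ) ^ b) ≤ 3 * (C * (N : ℝ) ^ b) := by gcongr
      have h3 : 1 ≤ C * (N : ℝ) ^ b := one_le_mul_of_one_le_of_one_le hC hNb
      have h4 : C * (N : ℝ) ^ b ≤ C * M * (N : ℝ) ^ b := by gcongr
      linarith
    set m : ℝ := Real.exp 1 * C * (N : ℝ) ^ β with hm
    have hm0 : 0 < m := by positivity
    let S : Set (EuclideanSpace ℝ (Fin d) × PointConfig d) :=
      {p | stabRadius ξ p.1 (p.2.restrict W) ≤ r ∧ |ξ p.1 (p.2.restrict W)| ≤ m}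
    have hS : MeasurableSet S := (measurableSet_le hRW measurable_const).inter
      (measurableSet_le hξW.abs measurable_const)
    let g' : EuclideanSpace ℝ (Fin d) → PointConfig d → ℝ := fun x X =>
      if (x, X) ∈ S then scoreField ξ W w x X else 0
    have hg'm : Measurable (Function.uncurry g') := Measurable.ite hS hgm measurable_const
    refine ⟨g', hg'm, fun x X B hB => ?_, fun x X => ?_, fun x X => ?_, fun z => ?_⟩
    · have hsub : Metric.closedBall x r ⊆ B :=
        (Metric.closedBall_subset_closedBall hr2).trans hB
      -- Restricting to B changes nothing inside the r-ball, and there both the truncation event and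
      -- the score are determined up to the fixed window W.
      have hball : (X.restrict W).restrict (Metric.closedBall x r) =
          ((X.restrict B).restrict W).restrict (Metric.closedBall x r) := by
        refine PointConfig.ext_carrier ?_
        simp only [PointConfig.restrict_carrier]
        ext y
        constructor
        · rintro ⟨⟨h1, h2⟩, h3⟩
          exact ⟨⟨⟨h1, hsub h3⟩, h2⟩, h3⟩
        · rintro ⟨⟨⟨h1, -⟩, h2⟩, h3⟩
          exact ⟨⟨h1, h2⟩, h3⟩
      by_cases hX : stabRadius ξ x (X.restrict W) ≤ r
      · have h1 := score_congr_of_stabRadius_le hball hX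
        have h2 := (stabRadius_le_congr (ξ := ξ) hball).1 hX
        simp only [g', S, Set.mem_ofPred_eq, scoreField, Set.indicator, hX, h2, ← h1]
      · have h2 : ¬ stabRadius ξ x ((X.restrict B).restrict W) ≤ r :=
          fun h => hX ((stabRadius_le_congr (ξ := ξ) hball).2 h)
        simp only [g', S, Set.mem_ofPred_eq, hX, h2, false_and, if_false]
    · simp only [g']
      split_ifs
      · exact le_rfl
      · simp
    · have hbound : m * M ≤ 4 * C * M * (N : ℝ) ^ β := by
        calc m * M = Real.exp 1 * (C * M * (N : ℝ) ^ β) := by rw [hm]; ring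
          _ ≤ 4 * (C * M * (N : ℝ) ^ β) := by gcongr; linarith
          _ = _ := by ring
      simp only [g']
      split_ifs with hx
      · refine le_trans ?_ hbound
        rw [scoreField]
        by_cases hxW : x ∈ W
        · rw [Set.indicator_of_mem hxW, abs_mul]
          exact mul_le_mul hx.2 (hwM x) (abs_nonneg _) hm0.le
        · rw [Set.indicator_of_notMem hxW, abs_zero]
          positivity
      · rw [abs_zero]
        positivity
    · have hbm : Measurable fun X : PointConfig d =>
          X.finSum (cell z) fun x => if g' x X = scoreField ξ W w x X then (0 : ℝ) else 1 := by
        have := measurable_truncation_indicator hgm hg'm z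
        convert this
      have hite : ∀ x X, 0 ≤ if g' x X = scoreField ξ W w x X then (0 : ℝ) else 1 := fun x X => by
        split_ifs <;> norm_num
      refine MeanLE.le (F := 2 * Real.exp (-N)) ?_ ?_
      swap
      · gcongr
        nlinarith
      have hAm := (measurableSet_cell z).inter hW
      have hAb := (isBounded_cell z).subset (Set.inter_subset_left (t := W))
      have key : ∫⁻ X, ENNReal.ofReal (X.finSum (cell z) fun x =>
          if g' x X = scoreField ξ W w x X then (0 : ℝ) else 1) ∂P ≤
          ENNReal.ofReal (2 * Real.exp (-N)) := by
        calc _ ≤ ∫⁻ X, (ENNReal.ofReal ((r : ℝ) ^ N)⁻¹ * X.pointSum ((cell z ∩ W).indicator fun x =>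
                stabRadius ξ x (X.restrict W) ^ N) +
              ENNReal.ofReal (m ^ N)⁻¹ * X.pointSum ((cell z ∩ W).indicator fun x =>
                ENNReal.ofReal (|ξ x (X.restrict W)| ^ N))) ∂P := by
              refine lintegral_mono fun X => ?_
              rw [X.ofReal_finSum (isBounded_cell z) fun x => hite x X, ← X.pointSum_const_mul,
                ← X.pointSum_const_mul, ← X.pointSum_add]
              refine X.pointSum_mono fun x _ => ?_
              by_cases hz : x ∈ cell z
              swap
              · rw [Set.indicator_of_notMem hz]
                exact zero_le
              rw [Set.indicator_of_mem hz]
              by_cases hxW : x ∈ W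
              swap
              · have : g' x X = scoreField ξ W w x X := by
                  simp [g', scoreField, Set.indicator_of_notMem hxW]
                rw [if_pos this, ENNReal.ofReal_zero]
                exact zero_le
              have hzW : x ∈ cell z ∩ W := ⟨hz, hxW⟩
              rw [Set.indicator_of_mem hzW, Set.indicator_of_mem hzW]
              by_cases hx : (x, X) ∈ S
              · rw [if_pos (by simp [g', hx]), ENNReal.ofReal_zero]
                exact zero_le
              · have h1 : ENNReal.ofReal (if g' x X = scoreField ξ W w x X then (0 : ℝ) else 1) ≤
                    1 := by
                  split_ifs <;> simp
                refine h1.trans ?_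
                by_cases hx1 : stabRadius ξ x (X.restrict W) ≤ r
                · refine le_add_of_nonneg_of_le zero_le ?_
                  have hx2 : m < |ξ x (X.restrict W)| := by
                    by_contra! hle
                    exact hx ⟨hx1, hle⟩
                  rw [← ENNReal.ofReal_mul (by positivity), ENNReal.one_le_ofReal,
                    ← div_eq_inv_mul, one_le_div (by positivity)]
                  exact pow_le_pow_left₀ hm0.le hx2.le N
                · refine le_add_of_le_of_nonneg ?_ zero_le
                  push Not at hx1
                  rw [ENNReal.ofReal_inv_of_pos (by positivity), ENNReal.ofReal_pow hr0.le,
                    ENNReal.ofReal_natCast, ← ENNReal.div_eq_inv_mul,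
                    ENNReal.le_div_iff_mul_le (Or.inl (by
                      have : r ≠ 0 := by
                        have : 0 < r := by exact_mod_cast hr0
                        omega
                      simp [this])) (Or.inl (by simp)), one_mul]
                  exact pow_le_pow_left' hx1.le N
          _ = ENNReal.ofReal ((r : ℝ) ^ N)⁻¹ * ∫⁻ X, X.pointSum ((cell z ∩ W).indicator fun x =>
                stabRadius ξ x (X.restrict W) ^ N) ∂P +
              ENNReal.ofReal (m ^ N)⁻¹ * ∫⁻ X, X.pointSum ((cell z ∩ W).indicator fun x =>
                ENNReal.ofReal (|ξ x (X.restrict W)| ^ N)) ∂P := by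
              have h1 := measurable_indicator_uncurry
                (F := fun x X => stabRadius ξ x (X.restrict W) ^ N) (hRW.pow_const N) hAm hAb
              have h2 := measurable_indicator_uncurry
                (F := fun x X => ENNReal.ofReal (|ξ x (X.restrict W)| ^ N))
                (hξW.abs.pow_const N).ennreal_ofReal hAm hAb
              rw [lintegral_add_left (h1.const_mul _), lintegral_const_mul _ h1,
                lintegral_const_mul _ h2]
          _ ≤ ENNReal.ofReal ((r : ℝ) ^ N)⁻¹ * ENNReal.ofReal (C ^ N * (N ! : ℝ) ^ b) +
              ENNReal.ofReal (m ^ N)⁻¹ * ENNReal.ofReal (C ^ N * (N ! : ℝ) ^ β) := by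
              gcongr
              · exact h.stab z N hN
              · exact h.moment z N hN
          _ ≤ _ := by
              rw [← ENNReal.ofReal_mul (by positivity), ← ENNReal.ofReal_mul (by positivity),
                ← ENNReal.ofReal_add (by positivity) (by positivity)]
              refine ENNReal.ofReal_le_ofReal ?_
              have h1 := markov_exp_le hN hb hC hr1
              have h2 := markov_exp_le hN hβ hC hm.ge
              linarith
      have := MeanLE.of_lintegral hbm (fun X => X.finSum_nonneg fun x => hite x X)
        (by positivity) key
      convert this

end ScoreField

/-! ### Windows and large balls -/

section Windows

variable {d : ℕ}

theorem measurableSet_window (d n : ℕ) : MeasurableSet (window d n) := by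
  have : window d n = ⋂ i, {x : EuclideanSpace ℝ (Fin d) | |x i| ≤ (n : ℝ) ^ (1 / (d : ℝ)) / 2} := by
    ext x
    simp [window]
  rw [this]
  exact MeasurableSet.iInter fun i => measurableSet_le (by fun_prop) measurable_const

theorem closedBall_subset_window {n : ℕ} {z : Fin d → ℤ} {x : EuclideanSpace ℝ (Fin d)}
    (hx : x ∈ cell z) {r : ℝ} (hz : ∀ i, |(z i : ℝ)| + 1 / 2 + r ≤ (n : ℝ) ^ (1 / (d : ℝ)) / 2) :
    Metric.closedBall x r ⊆ window d n := by
  intro y hy i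
  have h1 := (abs_apply_sub_le_dist y x i).trans (Metric.mem_closedBall.1 hy)
  have h2 := hx i
  refine le_trans ?_ (hz i)
  rw [abs_le] at h1 ⊢
  have h3 := le_abs_self (z i : ℝ)
  have h4 := neg_abs_le (z i : ℝ)
  constructor <;> linarith

theorem tendsto_window_side (hd : 1 ≤ d) :
    Filter.Tendsto (fun n : ℕ => (n : ℝ) ^ (1 / (d : ℝ)) / 2) Filter.atTop Filter.atTop := by
  have h0 : 0 < 1 / (d : ℝ) := by
    have : (0 : ℝ) < d := by exact_mod_cast hd
    positivity
  exact ((tendsto_rpow_atTop h0).comp tendsto_natCast_atTop_atTop).atTop_div_const (by norm_num)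

theorem exists_window (hd : 1 ≤ d) (z : Fin d → ℤ) (r : ℝ) :
    ∃ n : ℕ, 1 ≤ n ∧ ∀ x ∈ cell z, Metric.closedBall x r ⊆ window d n := by
  have h : ∀ i, ∀ᶠ n : ℕ in Filter.atTop, |(z i : ℝ)| + 1 / 2 + r ≤ (n : ℝ) ^ (1 / (d : ℝ)) / 2 :=
    fun i => (tendsto_window_side hd).eventually (Filter.eventually_ge_atTop _)
  obtain ⟨n, hn⟩ := ((Filter.eventually_all.2 h).and (Filter.eventually_ge_atTop 1)).exists
  exact ⟨n, hn.2, fun x hx => closedBall_subset_window hx hn.1⟩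

end Windows

/-! ### Moments of scores, in windows and in the whole space -/

section Moments

variable {d : ℕ} {P : Measure (PointConfig d)} {ξ : EuclideanSpace ℝ (Fin d) → PointConfig d → ℝ}
  {C β b a ahat K c : ℝ}

theorem IsMixing.lintegral_pointSum_one_le (h : IsMixing P a ahat K c) (z : Fin d → ℤ)
    {A : Set (EuclideanSpace ℝ (Fin d))} (hA : A ⊆ cell z) :
    ∫⁻ X, X.pointSum (A.indicator 1) ∂P ≤ ENNReal.ofReal K := by
  refine le_trans (lintegral_mono fun X => ?_) ((h.exp_moment z).lintegral_le fun X => by positivity)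
  have h1 : X.pointSum (A.indicator 1) ≤ X.pointSum ((cell z).indicator 1) :=
    X.pointSum_mono fun x _ => Set.indicator_le_indicator_of_subset hA (fun _ => zero_le) x
  refine h1.trans ?_
  have h2 := X.ofReal_finSum (isBounded_cell z) (g := fun _ => 1) fun _ => zero_le_one
  rw [X.finSum_const (isBounded_cell z), mul_one] at h2
  simp only [ENNReal.ofReal_one] at h2
  rw [show X.pointSum ((cell z).indicator 1) = X.pointSum ((cell z).indicator fun _ => 1) from rfl,
    ← h2]
  refine ENNReal.ofReal_le_ofReal ?_
  have h3 : (X.carrier ∩ cell z).ncard < 3 ^ (X.carrier ∩ cell z).ncard :=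
    Nat.lt_pow_self (by norm_num)
  exact_mod_cast h3.le

/-- Only the one-point Palm bounds are needed: the Palm expectation is uniformly bounded, and the
mean number of points in a cube is at most K. -/
theorem exists_hasScoreMoments_window (h : IsMixing P a ahat K c) (hK : 1 ≤ K)
    {ρ : (p : ℕ) → (Fin p → EuclideanSpace ℝ (Fin d)) → ℝ}
    {Q : (p : ℕ) → Kernel (Fin p → EuclideanSpace ℝ (Fin d)) (PointConfig d)} (hQ : IsPalm P ρ Q)
    (hρ : IsCorrelationFunction P ρ) (hξ : Measurable (Function.uncurry ξ))
    (hR : Measurable (Function.uncurry (stabRadius ξ))) (hST : CondST ρ Q ξ b)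
    (hMG : CondMG ρ Q ξ β) :
    ∃ C : ℝ, 1 ≤ C ∧ ∀ n : ℕ, 1 ≤ n → HasScoreMoments P ξ (window d n) C β b := by
  obtain ⟨C₁, hC₁, h₁⟩ := hMG
  obtain ⟨C₂, hC₂, h₂⟩ := hST
  have hC₁K : 1 ≤ C₁ * K := one_le_mul_of_one_le_of_one_le hC₁ hK
  refine ⟨C₁ * K + C₂ * K, by nlinarith, fun n hn => ⟨fun z k hk => ?_, fun z N hN => ?_⟩⟩
  · refine (lintegral_pointSum_indicator_le hQ hρ
      (F := fun x X => ENNReal.ofReal (|ξ x (X.restrict (window d n))| ^ k))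
      ((measurable_restrict_uncurry hξ (measurableSet_window d n)).abs.pow_const k).ennreal_ofReal
      ((measurableSet_cell z).inter (measurableSet_window d n))
      (c := ENNReal.ofReal (C₁ ^ k * (k ! : ℝ) ^ β)) ?_).trans ?_
    · filter_upwards [h₁ n 1 k hn le_rfl hk] with x hx hxA hρx
      exact hx (fun i => by rw [Subsingleton.elim i 0]; exact hxA.2) hρx 0
    · refine (mul_le_mul_right (h.lintegral_pointSum_one_le z Set.inter_subset_left) _).trans ?_
      rw [← ENNReal.ofReal_mul (by positivity)]
      refine ENNReal.ofReal_le_ofReal ?_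
      have hKk : K ≤ K ^ k := le_self_pow₀ hK (by omega)
      calc C₁ ^ k * (k ! : ℝ) ^ β * K ≤ C₁ ^ k * (k ! : ℝ) ^ β * K ^ k := by gcongr
        _ = (C₁ * K) ^ k * (k ! : ℝ) ^ β := by rw [mul_pow]; ring
        _ ≤ _ := by
          gcongr
          nlinarith
  · refine (lintegral_pointSum_indicator_le hQ hρ
      (F := fun x X => stabRadius ξ x (X.restrict (window d n)) ^ N)
      ((measurable_restrict_uncurry hR (measurableSet_window d n)).pow_const N)
      ((measurableSet_cell z).inter (measurableSet_window d n))
      (c := ENNReal.ofReal (C₂ ^ N * (N ! : ℝ) ^ b)) ?_).trans ?_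
    · filter_upwards [h₂ n 1 N hn le_rfl hN] with x hx hxA hρx
      exact hx (fun i => by rw [Subsingleton.elim i 0]; exact hxA.2) hρx 0
    · refine (mul_le_mul_right (h.lintegral_pointSum_one_le z Set.inter_subset_left) _).trans ?_
      rw [← ENNReal.ofReal_mul (by positivity)]
      refine ENNReal.ofReal_le_ofReal ?_
      have hKk : K ≤ K ^ N := le_self_pow₀ hK (by omega)
      calc C₂ ^ N * (N ! : ℝ) ^ b * K ≤ C₂ ^ N * (N ! : ℝ) ^ b * K ^ N := by gcongr
        _ = (C₂ * K) ^ N * (N ! : ℝ) ^ b := by rw [mul_pow]; ring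
        _ ≤ _ := by
          gcongr
          nlinarith

theorem lintegral_pointSum_iSup_le {F : ℕ → EuclideanSpace ℝ (Fin d) → PointConfig d → ℝ≥0∞}
    (hF : ∀ n, Measurable (Function.uncurry (F n))) (hmono : ∀ x X, Monotone fun n => F n x X)
    {A : Set (EuclideanSpace ℝ (Fin d))} (hA : MeasurableSet A) (hAb : Bornology.IsBounded A)
    {c : ℝ≥0∞} (h : ∀ n, ∫⁻ X, X.pointSum (A.indicator fun x => F n x X) ∂P ≤ c) :
    ∫⁻ X, X.pointSum (A.indicator fun x => ⨆ n, F n x X) ∂P ≤ c := by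
  have h1 : ∀ X : PointConfig d, X.pointSum (A.indicator fun x => ⨆ n, F n x X) =
      ⨆ n, X.pointSum (A.indicator fun x => F n x X) := by
    intro X
    rw [X.pointSum_indicator hA, lintegral_iSup]
    · simp only [X.pointSum_indicator hA]
    · exact fun n => (hF n).comp measurable_prodMk_right
    · exact fun m n hmn x => hmono x X hmn
  simp only [h1]
  rw [lintegral_iSup]
  · exact iSup_le h
  · exact fun n => measurable_indicator_uncurry (hF n) hA hAb
  · exact fun m n hmn X => X.pointSum_mono fun x _ => Set.indicator_le_indicator (hmono x X hmn)

theorem min_stabRadius_le {x : EuclideanSpace ℝ (Fin d)} {X X' : PointConfig d} {r : ℕ}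
    (h : X.restrict (Metric.closedBall x r) = X'.restrict (Metric.closedBall x r)) :
    min (stabRadius ξ x X) r ≤ stabRadius ξ x X' := by
  refine le_iInf₂ fun j hj => ?_
  rcases le_total j r with hjr | hjr
  · refine (min_le_left _ _).trans (iInf₂_le j ?_)
    exact (stabilizesAt_congr (restrict_closedBall_mono (by exact_mod_cast hjr) h)).2 hj
  · exact (min_le_right _ _).trans (by exact_mod_cast hjr)

/-- The hypotheses speak about windows only. The radius cut off at r, and the score on the event
that the radius is at most r, are determined by the ball of radius r and so agree with those in a
large window. Monotone convergence in r transfers the bounds, and for the scores the first moment of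
the radius ensures that it is finite at almost surely all points. -/
theorem HasScoreMoments.univ (hd : 1 ≤ d) (hξ : Measurable (Function.uncurry ξ))
    (hR : Measurable (Function.uncurry (stabRadius ξ)))
    (h : ∀ n : ℕ, 1 ≤ n → HasScoreMoments P ξ (window d n) C β b) :
    HasScoreMoments P ξ Set.univ C β b := by
  have hrestr : ∀ X : PointConfig d, X.restrict Set.univ = X := fun X =>
    PointConfig.ext_carrier (Set.inter_univ _)
  have hwin : ∀ (z : Fin d → ℤ) (r : ℕ), ∃ n : ℕ, 1 ≤ n ∧ cell z ⊆ window d n ∧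
      ∀ x ∈ cell z, ∀ X : PointConfig d, X.restrict (Metric.closedBall x r) =
        (X.restrict (window d n)).restrict (Metric.closedBall x r) := by
    intro z r
    obtain ⟨n, hn1, hn⟩ := exists_window hd z r
    refine ⟨n, hn1, fun x hx => hn x hx (Metric.mem_closedBall_self (by positivity)),
      fun x hx X => ?_⟩
    rw [X.restrict_restrict_of_subset (hn x hx)]
  have hstab : ∀ z, ∀ N : ℕ, 1 ≤ N → ∫⁻ X, X.pointSum ((cell z).indicator fun x =>
      stabRadius ξ x X ^ N) ∂P ≤ ENNReal.ofReal (C ^ N * (N ! : ℝ) ^ b) := by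
    intro z N hN
    have h1 : ∀ x X, stabRadius ξ x X ^ N = ⨆ r : ℕ, (min (stabRadius ξ x X) r) ^ N := by
      intro x X
      rw [← ENNReal.iSup_pow, ← inf_iSup_eq, ENNReal.iSup_natCast, inf_top_eq]
    simp only [h1]
    refine lintegral_pointSum_iSup_le (F := fun r x X => (min (stabRadius ξ x X) r) ^ N)
      (fun r => (hR.min measurable_const).pow_const N) (fun x X r s hrs => ?_)
      (measurableSet_cell z) (isBounded_cell z) fun r => ?_
    · have : (r : ℝ≥0∞) ≤ s := by exact_mod_cast hrs
      dsimp only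
      gcongr
    · obtain ⟨n, hn1, hsub, hn⟩ := hwin z r
      refine le_trans (lintegral_mono fun X => X.pointSum_mono fun x _ => ?_) ((h n hn1).stab z N hN)
      rw [Set.inter_eq_self_of_subset_left hsub]
      by_cases hx : x ∈ cell z
      · rw [Set.indicator_of_mem hx, Set.indicator_of_mem hx]
        exact pow_le_pow_left' (min_stabRadius_le (hn x hx X)) N
      · rw [Set.indicator_of_notMem hx]
        exact zero_le
  refine ⟨fun z k hk => ?_, fun z N hN => ?_⟩
  swap
  · simpa only [hrestr, Set.inter_univ] using hstab z N hN
  simp only [hrestr, Set.inter_univ]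
  classical
  let F : ℕ → EuclideanSpace ℝ (Fin d) → PointConfig d → ℝ≥0∞ := fun r x X =>
    if stabRadius ξ x X ≤ r then ENNReal.ofReal (|ξ x X| ^ k) else 0
  have hF := lintegral_pointSum_iSup_le (P := P) (F := F)
    (fun r => Measurable.ite (measurableSet_le hR measurable_const)
      (hξ.abs.pow_const k).ennreal_ofReal measurable_const) (fun x X r s hrs => ?_)
      (measurableSet_cell z) (isBounded_cell z) (c := ENNReal.ofReal (C ^ k * (k ! : ℝ) ^ β))
      fun r => ?_
  · refine le_trans (lintegral_mono_ae ?_) hF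
    have hfin : ∫⁻ X, X.pointSum ((cell z).indicator fun x => stabRadius ξ x X) ∂P ≠ ∞ := by
      have := hstab z 1 le_rfl
      simp only [pow_one] at this
      exact (this.trans_lt ENNReal.ofReal_lt_top).ne
    filter_upwards [ae_lt_top (measurable_indicator_uncurry hR (measurableSet_cell z)
      (isBounded_cell z)) hfin] with X hX
    refine X.pointSum_mono fun x hxX => ?_
    by_cases hx : x ∈ cell z
    · rw [Set.indicator_of_mem hx, Set.indicator_of_mem hx]
      have h1 : stabRadius ξ x X ≠ ∞ := by
        have h2 := ENNReal.ne_top_of_tsum_ne_top hX.ne ⟨x, hxX⟩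
        simpa only [Set.indicator_of_mem hx] using h2
      obtain ⟨r, hr⟩ := ENNReal.exists_nat_gt h1
      refine le_trans ?_ (le_iSup _ r)
      simp only [F, if_pos hr.le]
      exact le_rfl
    · rw [Set.indicator_of_notMem hx]
      exact zero_le
  · have : (r : ℝ≥0∞) ≤ s := by exact_mod_cast hrs
    simp only [F]
    split_ifs with h1 h2
    · exact le_rfl
    · exact absurd (h1.trans this) h2
    · exact zero_le
    · exact le_rfl
  · obtain ⟨n, hn1, hsub, hn⟩ := hwin z r
    refine le_trans (lintegral_mono fun X => X.pointSum_mono fun x _ => ?_) ((h n hn1).moment z k hk)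
    rw [Set.inter_eq_self_of_subset_left hsub]
    by_cases hx : x ∈ cell z
    · rw [Set.indicator_of_mem hx, Set.indicator_of_mem hx]
      simp only [F]
      split_ifs with h1
      · rw [score_congr_of_stabRadius_le (hn x hx X) h1]
      · exact zero_le
    · rw [Set.indicator_of_notMem hx]
      exact zero_le

end Moments

/-! ### Palm expectations: translation invariance and the Campbell formula for real functions -/

section PalmMean

variable {d : ℕ} {P : Measure (PointConfig d)}
  {ρ : (p : ℕ) → (Fin p → EuclideanSpace ℝ (Fin d)) → ℝ}
  {Q : (p : ℕ) → Kernel (Fin p → EuclideanSpace ℝ (Fin d)) (PointConfig d)} {p : ℕ}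

/-- The Palm expectation of `G ≥ 0` times the correlation function. -/
noncomputable def palmLMean (ρ : (p : ℕ) → (Fin p → EuclideanSpace ℝ (Fin d)) → ℝ)
    (Q : (p : ℕ) → Kernel (Fin p → EuclideanSpace ℝ (Fin d)) (PointConfig d))
    (G : (Fin p → EuclideanSpace ℝ (Fin d)) → PointConfig d → ℝ≥0∞)
    (x : Fin p → EuclideanSpace ℝ (Fin d)) : ℝ≥0∞ :=
  (∫⁻ X, G x X ∂(Q p x)) * ENNReal.ofReal (ρ p x)

/-- The Palm expectation of `G` times the correlation function. -/
noncomputable def palmMean (ρ : (p : ℕ) → (Fin p → EuclideanSpace ℝ (Fin d)) → ℝ)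
    (Q : (p : ℕ) → Kernel (Fin p → EuclideanSpace ℝ (Fin d)) (PointConfig d))
    (G : (Fin p → EuclideanSpace ℝ (Fin d)) → PointConfig d → ℝ)
    (x : Fin p → EuclideanSpace ℝ (Fin d)) : ℝ :=
  (∫ X, G x X ∂(Q p x)) * ρ p x

theorem measurable_palmLMean (hQ : IsPalm P ρ Q) (hρ : IsCorrelationFunction P ρ)
    {G : (Fin p → EuclideanSpace ℝ (Fin d)) → PointConfig d → ℝ≥0∞}
    (hG : Measurable (Function.uncurry G)) : Measurable (palmLMean ρ Q G) := by
  have := hQ.isMarkovKernel p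
  exact hG.lintegral_kernel_prod_right.mul (hρ.measurable p).ennreal_ofReal

theorem measurable_palmMean (hQ : IsPalm P ρ Q) (hρ : IsCorrelationFunction P ρ)
    {G : (Fin p → EuclideanSpace ℝ (Fin d)) → PointConfig d → ℝ}
    (hG : Measurable (Function.uncurry G)) : Measurable (palmMean ρ Q G) := by
  have := hQ.isMarkovKernel p
  exact (hG.stronglyMeasurable.integral_kernel_prod_right').measurable.mul (hρ.measurable p)

theorem distinctSum_translate (X : PointConfig d) (u : EuclideanSpace ℝ (Fin d))
    (F : (Fin p → EuclideanSpace ℝ (Fin d)) → ℝ≥0∞) :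
    distinctSum (X.translate u) F = distinctSum X fun x => F fun i => x i + u := by
  let e : {x : Fin p → EuclideanSpace ℝ (Fin d) // Function.Injective x ∧ ∀ i, x i ∈ X.carrier} ≃
      {x : Fin p → EuclideanSpace ℝ (Fin d) //
        Function.Injective x ∧ ∀ i, x i ∈ (X.translate u).carrier} :=
    { toFun := fun x => ⟨fun i => x.1 i + u, fun i j h => x.2.1 (add_right_cancel h),
        fun i => ⟨x.1 i, x.2.2 i, rfl⟩⟩
      invFun := fun x => ⟨fun i => x.1 i - u, fun i j h => x.2.1 (sub_left_injective h), fun i => by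
        obtain ⟨y, hy, h⟩ := x.2.2 i
        change x.1 i - u ∈ X.carrier
        rw [← h]
        simpa using hy⟩
      left_inv := fun x => by simp
      right_inv := fun x => by simp }
  rw [distinctSum, distinctSum, ← e.tsum_eq]
  rfl

/-- Palm expectations are determined almost everywhere by the Campbell formula, so invariance is
checked by integrating over Borel sets of tuples, where stationarity applies. The function need only
be equivariant at tuples of points of the configuration. -/
theorem palmLMean_translate (hP : IsStationaryLaw P) (hQ : IsPalm P ρ Q)
    (hρ : IsCorrelationFunction P ρ)
    {G : (Fin p → EuclideanSpace ℝ (Fin d)) → PointConfig d → ℝ≥0∞}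
    (hG : Measurable (Function.uncurry G)) (u : EuclideanSpace ℝ (Fin d))
    (hGu : ∀ x (X : PointConfig d), (∀ i, x i ∈ X.carrier) →
      G (fun i => x i + u) (X.translate u) = G x X) :
    ∀ᵐ x : Fin p → EuclideanSpace ℝ (Fin d),
      palmLMean ρ Q G (x + fun _ => u) = palmLMean ρ Q G x := by
  have hM := measurable_palmLMean hQ hρ hG
  refine ae_eq_of_forall_setLIntegral_eq_of_sigmaFinite (hM.comp (measurable_id.add_const _)) hM
    fun s hs _ => ?_
  have hind : ∀ v : EuclideanSpace ℝ (Fin d), Measurable (Function.uncurry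
      fun (x : Fin p → EuclideanSpace ℝ (Fin d)) (X : PointConfig d) =>
        s.indicator 1 (x + fun _ => v) * G x X) := fun v =>
    (((measurable_one.indicator hs).comp (measurable_id.add_const _)).comp measurable_fst).mul hG
  have hc : ∀ v : EuclideanSpace ℝ (Fin d),
      ∫⁻ X, distinctSum X (fun x => s.indicator 1 (x + fun _ => v) * G x X) ∂P =
        ∫⁻ x, s.indicator 1 (x + fun _ => v) * palmLMean ρ Q G x := by
    intro v
    rw [hQ.campbell p _ (hind v)]
    refine lintegral_congr fun x => ?_
    have hGx : Measurable (G x) := hG.comp measurable_prodMk_left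
    rw [lintegral_const_mul _ hGx, palmLMean, mul_assoc]
  have h1 : ∫⁻ X, distinctSum X (fun x => s.indicator 1 (x + fun _ => -u) * G x X) ∂P =
      ∫⁻ X, distinctSum X (fun x => s.indicator 1 (x + fun _ => 0) * G x X) ∂P := by
    have hm := measurable_distinctSum measurable_id
      (F := fun X x => s.indicator 1 (x + fun _ => -u) * G x X) ((hind (-u)).comp measurable_swap)
    refine ((hP u).lintegral_comp hm).symm.trans (lintegral_congr fun X => ?_)
    simp only [id]
    rw [distinctSum_translate]
    refine tsum_congr fun x => ?_
    dsimp only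
    rw [hGu x.1 X x.2.2]
    congr 2
    ext i : 1
    simp
  rw [hc, hc, ← lintegral_add_right_eq_self _ (fun _ => u : Fin p → EuclideanSpace ℝ (Fin d))] at h1
  rw [← lintegral_indicator hs, ← lintegral_indicator hs]
  refine (lintegral_congr fun x => ?_).trans (h1.trans (lintegral_congr fun x => ?_))
  · have : (x + fun _ => u) + (fun _ => -u : Fin p → EuclideanSpace ℝ (Fin d)) = x := by
      ext i : 1
      simp
    rw [this]
    by_cases h : x ∈ s <;> simp [h]
  · have : (x + fun _ => 0 : Fin p → EuclideanSpace ℝ (Fin d)) = x := by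
      ext i : 1
      simp
    rw [this]
    by_cases h : x ∈ s <;> simp [h]

-- Expresses the Bochner integral, including its value 0 in the non-integrable case, through two
-- extended-real Palm means. Translation invariance then transfers without any integrability
-- assumption.
open Classical in
theorem palmMean_eq (hρ : IsCorrelationFunction P ρ)
    {G : (Fin p → EuclideanSpace ℝ (Fin d)) → PointConfig d → ℝ}
    (hG : Measurable (Function.uncurry G)) (x : Fin p → EuclideanSpace ℝ (Fin d)) :
    palmMean ρ Q G x =
      if palmLMean ρ Q (fun x X => ENNReal.ofReal (G x X)) x ≠ ∞ ∧
        palmLMean ρ Q (fun x X => ENNReal.ofReal (-G x X)) x ≠ ∞ then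
      (palmLMean ρ Q (fun x X => ENNReal.ofReal (G x X)) x).toReal -
        (palmLMean ρ Q (fun x X => ENNReal.ofReal (-G x X)) x).toReal else 0 := by
  have hGx : Measurable (G x) := hG.comp measurable_prodMk_left
  rcases (hρ.nonneg p x).eq_or_lt with h0 | h0
  · simp [palmMean, palmLMean, ← h0]
  have h1 : ENNReal.ofReal (ρ p x) ≠ 0 := by simpa using h0
  have h2 : ∀ y : ℝ≥0∞, y * ENNReal.ofReal (ρ p x) ≠ ∞ ↔ y ≠ ∞ := fun y => by
    rw [ne_eq, ENNReal.mul_eq_top]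
    simp [h1]
  simp only [palmMean, palmLMean, h2]
  split_ifs with h
  · have hi : Integrable (G x) (Q p x) := by
      refine ⟨hGx.aestronglyMeasurable, ?_⟩
      rw [hasFiniteIntegral_iff_norm]
      have h4 := ENNReal.add_lt_top.2 ⟨h.1.lt_top, h.2.lt_top⟩
      rw [← lintegral_add_left hGx.ennreal_ofReal] at h4
      refine lt_of_le_of_lt (lintegral_mono fun X => ?_) h4
      rw [Real.norm_eq_abs]
      rcases abs_choice (G x X) with h3 | h3 <;> rw [h3]
      · exact le_self_add
      · exact le_add_self
    rw [integral_eq_lintegral_pos_part_sub_lintegral_neg_part hi, sub_mul, ENNReal.toReal_mul,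
      ENNReal.toReal_mul, ENNReal.toReal_ofReal h0.le]
  · rw [integral_undef, zero_mul]
    intro hi
    refine h ⟨?_, ?_⟩
    · refine ((lintegral_mono fun X => ?_).trans_lt (hasFiniteIntegral_iff_norm _ |>.1 hi.2)).ne
      exact ENNReal.ofReal_le_ofReal (le_abs_self _)
    · refine ((lintegral_mono fun X => ?_).trans_lt (hasFiniteIntegral_iff_norm _ |>.1 hi.2)).ne
      exact ENNReal.ofReal_le_ofReal (neg_le_abs _)

theorem palmMean_translate (hP : IsStationaryLaw P) (hQ : IsPalm P ρ Q)
    (hρ : IsCorrelationFunction P ρ)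
    {G : (Fin p → EuclideanSpace ℝ (Fin d)) → PointConfig d → ℝ}
    (hG : Measurable (Function.uncurry G)) (u : EuclideanSpace ℝ (Fin d))
    (hGu : ∀ x (X : PointConfig d), (∀ i, x i ∈ X.carrier) →
      G (fun i => x i + u) (X.translate u) = G x X) :
    ∀ᵐ x : Fin p → EuclideanSpace ℝ (Fin d),
      palmMean ρ Q G (x + fun _ => u) = palmMean ρ Q G x := by
  filter_upwards [palmLMean_translate hP hQ hρ hG.ennreal_ofReal
      (G := fun x X => ENNReal.ofReal (G x X)) u fun x X hx => by rw [hGu x X hx],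
    palmLMean_translate hP hQ hρ hG.neg.ennreal_ofReal
      (G := fun x X => ENNReal.ofReal (-G x X)) u fun x X hx => by rw [hGu x X hx]] with x h1 h2
  rw [palmMean_eq hρ hG, palmMean_eq hρ hG, h1, h2]

/-- The Campbell formula for integrable functions. -/
theorem integral_palmMean (hQ : IsPalm P ρ Q) (hρ : IsCorrelationFunction P ρ)
    {G : (Fin p → EuclideanSpace ℝ (Fin d)) → PointConfig d → ℝ}
    (hG : Measurable (Function.uncurry G))
    (hfin : ∫⁻ X, distinctSum X (fun x => ENNReal.ofReal (G x X)) ∂P ≠ ∞)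
    (hfin' : ∫⁻ X, distinctSum X (fun x => ENNReal.ofReal (-G x X)) ∂P ≠ ∞) :
    Integrable (palmMean ρ Q G) ∧ ∫ x, palmMean ρ Q G x =
      (∫⁻ X, distinctSum X (fun x => ENNReal.ofReal (G x X)) ∂P).toReal -
        (∫⁻ X, distinctSum X (fun x => ENNReal.ofReal (-G x X)) ∂P).toReal := by
  rw [hQ.campbell p (fun x X => ENNReal.ofReal (G x X)) hG.ennreal_ofReal] at hfin ⊢
  rw [hQ.campbell p (fun x X => ENNReal.ofReal (-G x X)) hG.neg.ennreal_ofReal] at hfin' ⊢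
  have hm : Measurable (palmLMean ρ Q fun x X => ENNReal.ofReal (G x X)) :=
    measurable_palmLMean hQ hρ hG.ennreal_ofReal
  have hm' : Measurable (palmLMean ρ Q fun x X => ENNReal.ofReal (-G x X)) :=
    measurable_palmLMean hQ hρ hG.neg.ennreal_ofReal
  have h1 := ae_lt_top hm hfin
  have h2 := ae_lt_top hm' hfin'
  have hae : palmMean ρ Q G =ᵐ[volume] fun x =>
      (palmLMean ρ Q (fun x X => ENNReal.ofReal (G x X)) x).toReal -
        (palmLMean ρ Q (fun x X => ENNReal.ofReal (-G x X)) x).toReal := by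
    filter_upwards [h1, h2] with x hx1 hx2
    rw [palmMean_eq hρ hG, if_pos ⟨hx1.ne, hx2.ne⟩]
  have i1 := integrable_toReal_of_lintegral_ne_top hm.aemeasurable hfin
  have i2 := integrable_toReal_of_lintegral_ne_top hm'.aemeasurable hfin'
  refine ⟨(i1.sub i2).congr hae.symm, ?_⟩
  rw [integral_congr_ae hae, integral_sub i1 i2, integral_toReal hm.aemeasurable h1,
    integral_toReal hm'.aemeasurable h2]
  rfl

end PalmMean

/-! ### First and second moments of score sums in terms of weighted correlations -/

section PairSums

variable {d : ℕ} {P : Measure (PointConfig d)}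
  {ρ : (p : ℕ) → (Fin p → EuclideanSpace ℝ (Fin d)) → ℝ}
  {Q : (p : ℕ) → Kernel (Fin p → EuclideanSpace ℝ (Fin d)) (PointConfig d)}
  {ξ : EuclideanSpace ℝ (Fin d) → PointConfig d → ℝ} {A : Set (EuclideanSpace ℝ (Fin d))}

theorem ENNReal.tsum_eq_tsum_indicator_compl_add {α : Type*} (F : α → ℝ≥0∞) (a : α) :
    ∑' b, F b = (∑' b, ({a}ᶜ : Set α).indicator F b) + F a := by
  have h : ∑' b, ({a} : Set α).indicator F b = F a := by
    rw [tsum_eq_single a fun b hb => by simp [hb]]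
    simp
  rw [← h, ← ENNReal.tsum_add]
  refine tsum_congr fun b => ?_
  by_cases hb : b = a <;> simp [hb]

/-- Off-diagonal pairs plus the diagonal; the diagonal is the source of the term m_(2) in the
variance. -/
theorem PointConfig.pointSum_pointSum (X : PointConfig d)
    (H : EuclideanSpace ℝ (Fin d) → EuclideanSpace ℝ (Fin d) → ℝ≥0∞) :
    X.pointSum (fun x => X.pointSum (H x)) =
      distinctSum X (fun x : Fin 2 → EuclideanSpace ℝ (Fin d) => H (x 0) (x 1)) +
        X.pointSum fun x => H x x := by
  rw [distinctSum_succ, ← X.pointSum_add]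
  refine tsum_congr fun x => (ENNReal.tsum_eq_tsum_indicator_compl_add _ x).trans ?_
  dsimp only
  rw [distinctSum_one]
  refine congrArg (· + H x x) (tsum_congr fun y => ?_)
  dsimp only
  by_cases hy : y = x
  · rw [Set.indicator_of_notMem (by simpa using hy), Set.indicator_of_notMem]
    exact fun h => h 0 (congrArg Subtype.val hy)
  · rw [Set.indicator_of_mem (by simpa using hy), Set.indicator_of_mem]
    · rfl
    · intro i h
      rw [Subsingleton.elim i 0] at h
      exact hy (Subtype.ext h)

theorem PointConfig.finSum_indicator (X : PointConfig d) {B : Set (EuclideanSpace ℝ (Fin d))}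
    (hBA : B ⊆ A) (g : EuclideanSpace ℝ (Fin d) → ℝ) :
    X.finSum A (B.indicator g) = X.finSum B g := by
  rw [finSum, finSum, finsum_mem_def, finsum_mem_def, Set.indicator_indicator, Set.inter_assoc,
    Set.inter_eq_self_of_subset_right hBA]

theorem measurable_prod_score (hξ : Measurable (Function.uncurry ξ)) {p : ℕ} (k : Fin p → ℕ) :
    Measurable (Function.uncurry fun (x : Fin p → EuclideanSpace ℝ (Fin d)) (X : PointConfig d) =>
      ∏ i, ξ (x i) X ^ k i) := by
  refine Finset.measurable_prod _ fun i _ => Measurable.pow_const ?_ _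
  exact hξ.comp (((measurable_pi_apply i).comp measurable_fst).prodMk measurable_snd :
    Measurable fun q : (Fin p → EuclideanSpace ℝ (Fin d)) × PointConfig d => (q.1 i, q.2))

theorem weightedCorrelation_translate (hP : IsStationaryLaw P) (hQ : IsPalm P ρ Q)
    (hρ : IsCorrelationFunction P ρ) (hξ : IsScore ξ) {p : ℕ} (k : Fin p → ℕ)
    (u : EuclideanSpace ℝ (Fin d)) :
    ∀ᵐ x : Fin p → EuclideanSpace ℝ (Fin d),
      weightedCorrelation ρ Q ξ k (x + fun _ => u) = weightedCorrelation ρ Q ξ k x :=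
  palmMean_translate hP hQ hρ (measurable_prod_score hξ.measurable k) u fun x X hx =>
    Finset.prod_congr rfl fun i _ => by rw [hξ.translate u (x i) X (hx i)]

theorem measurable_weightedCorrelation (hQ : IsPalm P ρ Q) (hρ : IsCorrelationFunction P ρ)
    (hξ : Measurable (Function.uncurry ξ)) {p : ℕ} (k : Fin p → ℕ) :
    Measurable (weightedCorrelation ρ Q ξ k) :=
  measurable_palmMean hQ hρ (measurable_prod_score hξ k)

theorem integral_toReal_sub {Ω : Type*} [MeasurableSpace Ω] {μ : Measure Ω} {F G : Ω → ℝ≥0∞}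
    (hF : Measurable F) (hG : Measurable G) (hF' : ∫⁻ ω, F ω ∂μ ≠ ∞) (hG' : ∫⁻ ω, G ω ∂μ ≠ ∞) :
    ∫ ω, ((F ω).toReal - (G ω).toReal) ∂μ = (∫⁻ ω, F ω ∂μ).toReal - (∫⁻ ω, G ω ∂μ).toReal := by
  rw [integral_sub (integrable_toReal_of_lintegral_ne_top hF.aemeasurable hF')
    (integrable_toReal_of_lintegral_ne_top hG.aemeasurable hG'),
    integral_toReal hF.aemeasurable (ae_lt_top hF hF'),
    integral_toReal hG.aemeasurable (ae_lt_top hG hG')]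

theorem PointConfig.toReal_pointSum (X : PointConfig d) (hA : Bornology.IsBounded A)
    {g : EuclideanSpace ℝ (Fin d) → ℝ} (hg : ∀ x ∉ A, g x = 0) :
    X.pointSum (fun x => ENNReal.ofReal (g x)) = ENNReal.ofReal (X.finSum A fun x => max (g x) 0) := by
  rw [X.ofReal_finSum hA fun x => le_max_right _ _]
  refine tsum_congr fun x => ?_
  by_cases hx : x.1 ∈ A
  · rw [Set.indicator_of_mem hx, ENNReal.ofReal_max, ENNReal.ofReal_zero, max_eq_left zero_le]
  · rw [Set.indicator_of_notMem hx]
    simp only [hg _ hx, ENNReal.ofReal_zero]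

theorem integral_finSum_mul (hQ : IsPalm P ρ Q) (hρ : IsCorrelationFunction P ρ)
    (hξ : Measurable (Function.uncurry ξ)) (hA : Bornology.IsBounded A)
    (hI : Integrable (fun X => X.finSum A fun x => |ξ x X|) P)
    {k : EuclideanSpace ℝ (Fin d) → ℝ} (hk : Measurable k) (hkA : ∀ x ∉ A, k x = 0) {M : ℝ}
    (hkM : ∀ x, |k x| ≤ M) :
    Integrable (fun x => k x * weightedCorrelation ρ Q ξ ![1] ![x]) ∧
      ∫ X, X.finSum A (fun x => k x * ξ x X) ∂P =
        ∫ x, k x * weightedCorrelation ρ Q ξ ![1] ![x] := by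
  have hM : 0 ≤ M := (abs_nonneg _).trans (hkM 0)
  let G : (Fin 1 → EuclideanSpace ℝ (Fin d)) → PointConfig d → ℝ := fun x X =>
    k (x 0) * ∏ i, ξ (x i) X ^ (![1] : Fin 1 → ℕ) i
  have hG : Measurable (Function.uncurry G) :=
    ((hk.comp (measurable_pi_apply 0)).comp measurable_fst).mul (measurable_prod_score hξ _)
  have hkξ : Measurable (Function.uncurry fun x X => k x * ξ x X) :=
    (hk.comp measurable_fst).mul hξ
  have hs : ∀ s : ℝ, |s| ≤ 1 → ∀ X : PointConfig d,
      X.pointSum (fun x => ENNReal.ofReal (s * (k x * ξ x X))) =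
        ENNReal.ofReal (X.finSum A fun x => max (s * (k x * ξ x X)) 0) := fun s _ X =>
    X.toReal_pointSum hA fun x hx => by rw [hkA x hx]; simp
  -- The sign s = ±1 handles the positive and the negative part together.
  have hfin : ∀ s : ℝ, |s| ≤ 1 →
      ∫⁻ X, X.pointSum (fun x => ENNReal.ofReal (s * (k x * ξ x X))) ∂P ≠ ∞ := by
    intro s hs1
    refine ((lintegral_mono fun X => ?_).trans_lt (hI.const_mul M).lintegral_lt_top).ne
    rw [hs s hs1]
    refine ENNReal.ofReal_le_ofReal ?_
    rw [← X.finSum_const_mul hA]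
    refine X.finSum_mono hA fun x _ => max_le ?_ (by positivity)
    refine (le_abs_self _).trans ?_
    rw [abs_mul, abs_mul]
    have := mul_le_mul hs1 (mul_le_mul_of_nonneg_right (hkM x) (abs_nonneg (ξ x X)))
      (by positivity) zero_le_one
    linarith
  have h1 := hfin 1 (by simp)
  have h2 := hfin (-1) (by simp)
  simp only [one_mul, neg_mul] at h1 h2
  have hGF : ∀ X : PointConfig d, distinctSum X (fun x => ENNReal.ofReal (G x X)) =
      X.pointSum (fun x => ENNReal.ofReal (k x * ξ x X)) := fun X => by
    rw [distinctSum_one]; simp [G]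
  have hGF' : ∀ X : PointConfig d, distinctSum X (fun x => ENNReal.ofReal (-G x X)) =
      X.pointSum (fun x => ENNReal.ofReal (-(k x * ξ x X))) := fun X => by
    rw [distinctSum_one]; simp [G]
  have hmain := integral_palmMean hQ hρ hG (by simpa only [hGF] using h1)
    (by simpa only [hGF'] using h2)
  have hpm : ∀ x, palmMean ρ Q G x = k (x 0) * weightedCorrelation ρ Q ξ ![1] x := fun x => by
    rw [palmMean, weightedCorrelation, ← mul_assoc, ← integral_const_mul]
  simp only [hGF, hGF'] at hmain
  have hfs : ∀ X : PointConfig d, X.finSum A (fun x => k x * ξ x X) =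
      (X.pointSum fun x => ENNReal.ofReal (k x * ξ x X)).toReal -
        (X.pointSum fun x => ENNReal.ofReal (-(k x * ξ x X))).toReal := by
    intro X
    have e1 := hs 1 (by simp) X
    have e2 := hs (-1) (by simp) X
    simp only [one_mul, neg_mul] at e1 e2
    rw [e1, e2, ENNReal.toReal_ofReal (X.finSum_nonneg fun _ => le_max_right _ _),
      ENNReal.toReal_ofReal (X.finSum_nonneg fun _ => le_max_right _ _), ← X.finSum_sub hA]
    refine X.finSum_congr fun x _ => ?_
    rw [max_zero_sub_max_neg_zero_eq_self]
  have hvp := (volume_preserving_funUnique (Fin 1) (EuclideanSpace ℝ (Fin d))).symm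
  have hx : ∀ x : EuclideanSpace ℝ (Fin d),
      (MeasurableEquiv.funUnique (Fin 1) (EuclideanSpace ℝ (Fin d))).symm x = ![x] := fun x => by
    ext i; fin_cases i; rfl
  have hfun : (fun x => k x * weightedCorrelation ρ Q ξ ![1] ![x]) =
      palmMean ρ Q G ∘ (MeasurableEquiv.funUnique (Fin 1) (EuclideanSpace ℝ (Fin d))).symm := by
    ext x
    simp only [Function.comp, hx, hpm]
    rfl
  rw [hfun]
  refine ⟨(hvp.integrable_comp_emb (MeasurableEquiv.measurableEmbedding _)).2 hmain.1, ?_⟩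
  refine Eq.trans ?_ (hmain.2.symm.trans
    (hvp.integral_comp (MeasurableEquiv.measurableEmbedding _) (palmMean ρ Q G)).symm)
  simp only [hfs]
  exact integral_toReal_sub (PointConfig.measurable_pointSum measurable_id
      (F := fun X x => ENNReal.ofReal (k x * ξ x X)) (hkξ.ennreal_ofReal.comp measurable_swap))
    (PointConfig.measurable_pointSum measurable_id
      (F := fun X x => ENNReal.ofReal (-(k x * ξ x X)))
      (hkξ.neg.ennreal_ofReal.comp measurable_swap)) h1 h2

/-- The kernel k need not be a product: products give variances, while kernels with signs detect the
L¹ norm of the pair correlation. -/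
theorem integral_finSum_finSum_mul (hQ : IsPalm P ρ Q) (hρ : IsCorrelationFunction P ρ)
    (hξ : Measurable (Function.uncurry ξ)) (hA : Bornology.IsBounded A)
    (hI : Integrable (fun X => (X.finSum A fun x => |ξ x X|) ^ 2) P)
    {k : EuclideanSpace ℝ (Fin d) → EuclideanSpace ℝ (Fin d) → ℝ}
    (hk : Measurable (Function.uncurry k)) (hkA : ∀ x y, x ∉ A ∨ y ∉ A → k x y = 0) {M : ℝ}
    (hkM : ∀ x y, |k x y| ≤ M) :
    Integrable (fun z : EuclideanSpace ℝ (Fin d) × EuclideanSpace ℝ (Fin d) =>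
      k z.1 z.2 * weightedCorrelation ρ Q ξ ![1, 1] ![z.1, z.2]) ∧
    ∫ X, X.finSum A (fun x => X.finSum A fun y => k x y * (ξ x X * ξ y X)) ∂P =
      (∫ z : EuclideanSpace ℝ (Fin d) × EuclideanSpace ℝ (Fin d),
        k z.1 z.2 * weightedCorrelation ρ Q ξ ![1, 1] ![z.1, z.2]) +
      ∫ x, k x x * weightedCorrelation ρ Q ξ ![2] ![x] := by
  have hM : 0 ≤ M := (abs_nonneg _).trans (hkM 0 0)
  let G : (Fin 2 → EuclideanSpace ℝ (Fin d)) → PointConfig d → ℝ := fun x X =>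
    k (x 0) (x 1) * ∏ i, ξ (x i) X ^ (![1, 1] : Fin 2 → ℕ) i
  let G₁ : (Fin 1 → EuclideanSpace ℝ (Fin d)) → PointConfig d → ℝ := fun x X =>
    k (x 0) (x 0) * ∏ i, ξ (x i) X ^ (![2] : Fin 1 → ℕ) i
  have hG : Measurable (Function.uncurry G) :=
    ((hk.comp ((measurable_pi_apply (0 : Fin 2)).prodMk (measurable_pi_apply (1 : Fin 2)))).comp
      measurable_fst).mul (measurable_prod_score hξ _)
  have hG₁ : Measurable (Function.uncurry G₁) :=
    ((hk.comp ((measurable_pi_apply (0 : Fin 1)).prodMk (measurable_pi_apply (0 : Fin 1)))).comp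
      measurable_fst).mul (measurable_prod_score hξ _)
  let H : ℝ → PointConfig d → EuclideanSpace ℝ (Fin d) → EuclideanSpace ℝ (Fin d) → ℝ :=
    fun s X x y => s * (k x y * (ξ x X * ξ y X))
  let L : ℝ → PointConfig d → ℝ≥0∞ := fun s X =>
    X.pointSum fun x => X.pointSum fun y => ENNReal.ofReal (H s X x y)
  have hs : ∀ (s : ℝ) (X : PointConfig d), L s X =
      ENNReal.ofReal (X.finSum A fun x => X.finSum A fun y => max (H s X x y) 0) := by
    intro s X
    simp only [L]
    rw [X.ofReal_finSum hA fun x => X.finSum_nonneg fun y => le_max_right _ _]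
    refine tsum_congr fun x => ?_
    dsimp only
    rw [X.toReal_pointSum hA fun y hy => by simp only [H, hkA x y (Or.inr hy)]; simp]
    by_cases hx : x.1 ∈ A
    · rw [Set.indicator_of_mem hx]
    · rw [Set.indicator_of_notMem hx]
      have : ∀ y, max (H s X x y) 0 = 0 := fun y => by simp [H, hkA x y (Or.inl hx)]
      simp only [this]
      rw [X.finSum_const hA, mul_zero, ENNReal.ofReal_zero]
  have hfin : ∀ s : ℝ, |s| ≤ 1 → ∫⁻ X, L s X ∂P ≠ ∞ := by
    intro s hs1
    refine ((lintegral_mono fun X => ?_).trans_lt (hI.const_mul M).lintegral_lt_top).ne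
    rw [hs]
    refine ENNReal.ofReal_le_ofReal ?_
    set S := X.finSum A fun x => |ξ x X| with hS
    rw [show M * S ^ 2 = M * S * S by ring, hS, ← X.finSum_const_mul hA, ← hS]
    refine X.finSum_mono hA fun x _ => ?_
    rw [show M * S * |ξ x X| = M * |ξ x X| * S by ring, hS, ← X.finSum_const_mul hA]
    refine X.finSum_mono hA fun y _ => max_le ?_ (by positivity)
    refine (le_abs_self _).trans ?_
    simp only [H]
    rw [abs_mul, abs_mul, abs_mul]
    have := mul_le_mul hs1 (mul_le_mul_of_nonneg_right (hkM x y)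
      (mul_nonneg (abs_nonneg (ξ x X)) (abs_nonneg (ξ y X)))) (by positivity) zero_le_one
    linarith
  have hLG : ∀ X, L 1 X = distinctSum X (fun x => ENNReal.ofReal (G x X)) +
      distinctSum X (fun x => ENNReal.ofReal (G₁ x X)) := fun X => by
    simp only [L]
    rw [X.pointSum_pointSum, distinctSum_one]
    simp [G, G₁, H, Fin.prod_univ_two, sq]
  have hLG' : ∀ X, L (-1) X = distinctSum X (fun x => ENNReal.ofReal (-G x X)) +
      distinctSum X (fun x => ENNReal.ofReal (-G₁ x X)) := fun X => by
    simp only [L]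
    rw [X.pointSum_pointSum, distinctSum_one]
    simp [G, G₁, H, Fin.prod_univ_two, sq]
  have hmG : ∀ {p : ℕ} {F : (Fin p → EuclideanSpace ℝ (Fin d)) → PointConfig d → ℝ},
      Measurable (Function.uncurry F) →
      Measurable fun X => distinctSum X fun x => ENNReal.ofReal (F x X) := fun {p F} hF =>
    measurable_distinctSum measurable_id (F := fun X x => ENNReal.ofReal (F x X))
      (hF.ennreal_ofReal.comp measurable_swap)
  have hL : ∫⁻ X, L 1 X ∂P = ∫⁻ X, distinctSum X (fun x => ENNReal.ofReal (G x X)) ∂P +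
      ∫⁻ X, distinctSum X (fun x => ENNReal.ofReal (G₁ x X)) ∂P := by
    simp only [hLG]
    exact lintegral_add_left (hmG hG) _
  have hL' : ∫⁻ X, L (-1) X ∂P = ∫⁻ X, distinctSum X (fun x => ENNReal.ofReal (-G x X)) ∂P +
      ∫⁻ X, distinctSum X (fun x => ENNReal.ofReal (-G₁ x X)) ∂P := by
    simp only [hLG']
    exact lintegral_add_left (hmG hG.neg) _
  have hLm : Measurable (L 1) := by
    rw [funext hLG]
    exact (hmG hG).add (hmG hG₁)
  have hLm' : Measurable (L (-1)) := by
    rw [funext hLG']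
    exact (hmG hG.neg).add (hmG hG₁.neg)
  have h1 := hfin 1 (by simp)
  have h2 := hfin (-1) (by simp)
  have h1' := h1
  have h2' := h2
  rw [hL, ENNReal.add_ne_top] at h1'
  rw [hL', ENNReal.add_ne_top] at h2'
  have hmain := integral_palmMean hQ hρ hG h1'.1 h2'.1
  have hmain₁ := integral_palmMean hQ hρ hG₁ h1'.2 h2'.2
  have hpm : ∀ x, palmMean ρ Q G x = k (x 0) (x 1) * weightedCorrelation ρ Q ξ ![1, 1] x :=
    fun x => by rw [palmMean, weightedCorrelation, ← mul_assoc, ← integral_const_mul]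
  have hpm₁ : ∀ x, palmMean ρ Q G₁ x = k (x 0) (x 0) * weightedCorrelation ρ Q ξ ![2] x :=
    fun x => by rw [palmMean, weightedCorrelation, ← mul_assoc, ← integral_const_mul]
  have hfs : ∀ X : PointConfig d,
      X.finSum A (fun x => X.finSum A fun y => k x y * (ξ x X * ξ y X)) =
      (L 1 X).toReal - (L (-1) X).toReal := by
    intro X
    rw [hs, hs, ENNReal.toReal_ofReal (X.finSum_nonneg fun _ => X.finSum_nonneg fun _ =>
        le_max_right _ _), ENNReal.toReal_ofReal (X.finSum_nonneg fun _ => X.finSum_nonneg fun _ =>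
        le_max_right _ _), ← X.finSum_sub hA]
    refine X.finSum_congr fun x _ => ?_
    rw [← X.finSum_sub hA]
    refine X.finSum_congr fun y _ => ?_
    simp only [H, one_mul, neg_mul, max_zero_sub_max_neg_zero_eq_self]
  have hvp := (volume_preserving_funUnique (Fin 1) (EuclideanSpace ℝ (Fin d))).symm
  have hvp₂ := (volume_preserving_finTwoArrow (EuclideanSpace ℝ (Fin d))).symm
  have hx : ∀ x : EuclideanSpace ℝ (Fin d),
      (MeasurableEquiv.funUnique (Fin 1) (EuclideanSpace ℝ (Fin d))).symm x = ![x] := fun x => by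
    ext i; fin_cases i; rfl
  have hfun : (fun z : EuclideanSpace ℝ (Fin d) × EuclideanSpace ℝ (Fin d) =>
      k z.1 z.2 * weightedCorrelation ρ Q ξ ![1, 1] ![z.1, z.2]) =
      palmMean ρ Q G ∘ (MeasurableEquiv.finTwoArrow (α := EuclideanSpace ℝ (Fin d))).symm := by
    ext z
    simp only [Function.comp, hpm]
    rfl
  have hfun₁ : (fun x => k x x * weightedCorrelation ρ Q ξ ![2] ![x]) =
      palmMean ρ Q G₁ ∘ (MeasurableEquiv.funUnique (Fin 1) (EuclideanSpace ℝ (Fin d))).symm := by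
    ext x
    simp only [Function.comp, hx, hpm₁]
    rfl
  rw [hfun, hfun₁]
  refine ⟨(hvp₂.integrable_comp_emb (MeasurableEquiv.measurableEmbedding _)).2 hmain.1, ?_⟩
  have e1 := (hmain.2.symm.trans
    (hvp₂.integral_comp (MeasurableEquiv.measurableEmbedding _) (palmMean ρ Q G)).symm)
  have e2 := (hmain₁.2.symm.trans
    (hvp.integral_comp (MeasurableEquiv.measurableEmbedding _) (palmMean ρ Q G₁)).symm)
  refine Eq.trans ?_ (congrArg₂ (· + ·) e1 e2)
  simp only [hfs]
  rw [integral_toReal_sub hLm hLm' h1 h2, hL, hL', ENNReal.toReal_add h1'.1 h1'.2,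
    ENNReal.toReal_add h2'.1 h2'.2]
  ring

end PairSums

/-! ### Stationary covariance density and the variance formula -/

section CovarianceDensity

variable {d : ℕ} {P : Measure (PointConfig d)}
  {ρ : (p : ℕ) → (Fin p → EuclideanSpace ℝ (Fin d)) → ℝ}
  {Q : (p : ℕ) → Kernel (Fin p → EuclideanSpace ℝ (Fin d)) (PointConfig d)}
  {ξ : EuclideanSpace ℝ (Fin d) → PointConfig d → ℝ} {A : Set (EuclideanSpace ℝ (Fin d))}

/-- For almost every z the function of x is almost everywhere constant, by Fubini. Averaging over a
cube of volume one recovers the constant in a form that is measurable in z. -/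
theorem ae_eq_setIntegral_cell_of_translate
    {F : EuclideanSpace ℝ (Fin d) × EuclideanSpace ℝ (Fin d) → ℝ} (hF : Measurable F)
    (h : ∀ u, ∀ᵐ p : EuclideanSpace ℝ (Fin d) × EuclideanSpace ℝ (Fin d),
      F (p.1, p.2 + u) = F p) :
    ∀ᵐ z, ∀ᵐ x, F (z, x) = ∫ y in cell 0, F (z, y) := by
  have h1 : ∀ᵐ q : EuclideanSpace ℝ (Fin d) × (EuclideanSpace ℝ (Fin d) × EuclideanSpace ℝ (Fin d)),
      F (q.2.1, q.2.2 + q.1) = F q.2 := by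
    refine (Measure.ae_prod_iff_ae_ae ?_).2 (Filter.Eventually.of_forall h)
    exact measurableSet_eq_fun (by fun_prop) (by fun_prop)
  have h2 : ∀ᵐ p : EuclideanSpace ℝ (Fin d) × EuclideanSpace ℝ (Fin d),
      ∀ᵐ u, F (p.1, p.2 + u) = F p :=
    Measure.ae_ae_of_ae_prod (μ := volume) (ν := volume)
      (p := fun q : (EuclideanSpace ℝ (Fin d) × EuclideanSpace ℝ (Fin d)) ×
        EuclideanSpace ℝ (Fin d) => F (q.1.1, q.1.2 + q.2) = F q.1)
      (Measure.measurePreserving_swap.quasiMeasurePreserving.ae h1)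
  filter_upwards [Measure.ae_ae_of_ae_prod (μ := volume) (ν := volume) h2] with z hz
  filter_upwards [hz] with x hx
  have h3 : ∀ᵐ y, y ∈ cell 0 → F (z, y) = F (z, x) := by
    filter_upwards [(measurePreserving_add_right volume (-x)).quasiMeasurePreserving.ae hx]
      with y hy _
    rw [← hy]
    congr 2
    abel
  rw [setIntegral_congr_ae (measurableSet_cell 0) h3, setIntegral_const, measureReal_def,
    volume_cell]
  simp

/-- The map `(z, x) ↦ (x, x + z)`. -/
noncomputable def shearEquiv (d : ℕ) :
    EuclideanSpace ℝ (Fin d) × EuclideanSpace ℝ (Fin d) ≃ᵐ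
      EuclideanSpace ℝ (Fin d) × EuclideanSpace ℝ (Fin d) :=
  MeasurableEquiv.prodComm.trans (MeasurableEquiv.shearAddRight (EuclideanSpace ℝ (Fin d)))

theorem shearEquiv_apply (p : EuclideanSpace ℝ (Fin d) × EuclideanSpace ℝ (Fin d)) :
    shearEquiv d p = (p.2, p.2 + p.1) := rfl

theorem measurePreserving_shearEquiv : MeasurePreserving (shearEquiv d) :=
  (measurePreserving_prod_add (volume : Measure (EuclideanSpace ℝ (Fin d))) volume).comp
    Measure.measurePreserving_swap

theorem ae_weightedCorrelation_one (hP : IsStationaryLaw P) (hQ : IsPalm P ρ Q)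
    (hρ : IsCorrelationFunction P ρ) (hξ : IsScore ξ) (k : ℕ) :
    ∃ κ : ℝ, ∀ᵐ x, weightedCorrelation ρ Q ξ ![k] ![x] = κ := by
  have hvp := (volume_preserving_funUnique (Fin 1) (EuclideanSpace ℝ (Fin d))).symm
  have hx : ∀ x : EuclideanSpace ℝ (Fin d),
      (MeasurableEquiv.funUnique (Fin 1) (EuclideanSpace ℝ (Fin d))).symm x = ![x] := fun x => by
    ext i; fin_cases i; rfl
  have hm := measurable_weightedCorrelation hQ hρ hξ.measurable ![k]
  have h := ae_eq_setIntegral_cell_of_translate (d := d)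
    (F := fun p => weightedCorrelation ρ Q ξ ![k] ![p.2])
    ((hm.comp measurable_vecOne).comp measurable_snd) fun u => ?_
  · obtain ⟨z, hz⟩ := h.exists
    exact ⟨_, hz⟩
  · have h1 := hvp.quasiMeasurePreserving.ae (weightedCorrelation_translate hP hQ hρ hξ ![k] u)
    have h2 := Measure.quasiMeasurePreserving_snd
      (μ := (volume : Measure (EuclideanSpace ℝ (Fin d)))).ae h1
    filter_upwards [h2] with p hp
    rw [hx] at hp
    rw [← hp]
    congr 1
    ext i : 1
    fin_cases i
    rfl

theorem ae_weightedCorrelation_two (hP : IsStationaryLaw P) (hQ : IsPalm P ρ Q)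
    (hρ : IsCorrelationFunction P ρ) (hξ : IsScore ξ) :
    ∀ᵐ z, ∀ᵐ x, weightedCorrelation ρ Q ξ ![1, 1] ![x, x + z] =
      ∫ y in cell 0, weightedCorrelation ρ Q ξ ![1, 1] ![y, y + z] := by
  have hvp := (volume_preserving_finTwoArrow (EuclideanSpace ℝ (Fin d))).symm.comp
    measurePreserving_shearEquiv
  have hm := measurable_weightedCorrelation hQ hρ hξ.measurable ![1, 1]
  refine ae_eq_setIntegral_cell_of_translate (d := d)
    (F := fun p => weightedCorrelation ρ Q ξ ![1, 1] ![p.2, p.2 + p.1])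
    (hm.comp hvp.measurable) fun u => ?_
  filter_upwards [hvp.quasiMeasurePreserving.ae
    (weightedCorrelation_translate hP hQ hρ hξ ![1, 1] u)] with p hp
  refine Eq.trans ?_ (hp.trans rfl)
  congr 1
  ext i : 1
  fin_cases i
  · rfl
  · exact add_right_comm _ _ _

/-- The density of the truncated pair correlation of the scores at distance `z`, where `κ` is the
mean of the scores per unit volume. -/
noncomputable def covDensity (ρ : (p : ℕ) → (Fin p → EuclideanSpace ℝ (Fin d)) → ℝ)
    (Q : (p : ℕ) → Kernel (Fin p → EuclideanSpace ℝ (Fin d)) (PointConfig d))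
    (ξ : EuclideanSpace ℝ (Fin d) → PointConfig d → ℝ) (κ : ℝ) (z : EuclideanSpace ℝ (Fin d)) : ℝ :=
  (∫ y in cell 0, weightedCorrelation ρ Q ξ ![1, 1] ![y, y + z]) - κ ^ 2

theorem measurable_weightedCorrelation_two (hQ : IsPalm P ρ Q) (hρ : IsCorrelationFunction P ρ)
    (hξ : Measurable (Function.uncurry ξ)) :
    Measurable fun z : EuclideanSpace ℝ (Fin d) × EuclideanSpace ℝ (Fin d) =>
      weightedCorrelation ρ Q ξ ![1, 1] ![z.1, z.2] :=
  (measurable_weightedCorrelation hQ hρ hξ ![1, 1]).comp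
    (volume_preserving_finTwoArrow (EuclideanSpace ℝ (Fin d))).symm.measurable

theorem measurable_covDensity (hQ : IsPalm P ρ Q) (hρ : IsCorrelationFunction P ρ)
    (hξ : Measurable (Function.uncurry ξ)) (κ : ℝ) : Measurable (covDensity ρ Q ξ κ) := by
  have h := (measurable_weightedCorrelation_two hQ hρ hξ).comp
    (measurePreserving_shearEquiv (d := d)).measurable
  exact (h.stronglyMeasurable.integral_prod_right' (ν := volume.restrict (cell 0))).measurable.sub_const _

theorem ae_eq_covDensity (hP : IsStationaryLaw P) (hQ : IsPalm P ρ Q)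
    (hρ : IsCorrelationFunction P ρ) (hξ : IsScore ξ) (κ : ℝ) :
    ∀ᵐ z, ∀ᵐ x, weightedCorrelation ρ Q ξ ![1, 1] ![x, x + z] - κ ^ 2 = covDensity ρ Q ξ κ z := by
  filter_upwards [ae_weightedCorrelation_two hP hQ hρ hξ] with z hz
  filter_upwards [hz] with x hx
  rw [hx, covDensity]

/-- All integrands over the unit window are almost everywhere constant in the base point. The volume
of the window is left as a factor, as only positivity is drawn from this identity. -/
theorem asympVariance_eq (hP : IsStationaryLaw P) (hQ : IsPalm P ρ Q)
    (hρ : IsCorrelationFunction P ρ) (hξ : IsScore ξ) {κ₁ κ₂ : ℝ}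
    (h₁ : ∀ᵐ x, weightedCorrelation ρ Q ξ ![1] ![x] = κ₁)
    (h₂ : ∀ᵐ x, weightedCorrelation ρ Q ξ ![2] ![x] = κ₂) :
    asympVariance ρ Q ξ =
      volume.real (window d 1) * (κ₂ + ∫ z, covDensity ρ Q ξ κ₁ z) := by
  have h3 : ∀ᵐ p : EuclideanSpace ℝ (Fin d) × EuclideanSpace ℝ (Fin d),
      weightedCorrelation ρ Q ξ ![1, 1] ![p.2, p.2 + p.1] - κ₁ ^ 2 = covDensity ρ Q ξ κ₁ p.1 := by
    refine (Measure.ae_prod_iff_ae_ae (measurableSet_eq_fun ?_ ?_)).2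
      (ae_eq_covDensity hP hQ hρ hξ κ₁)
    · exact ((measurable_weightedCorrelation_two hQ hρ hξ.measurable).comp
        (measurePreserving_shearEquiv (d := d)).measurable).sub_const _
    · exact (measurable_covDensity hQ hρ hξ.measurable κ₁).comp measurable_fst
  have h4 := Measure.ae_ae_of_ae_prod (μ := volume) (ν := volume)
    (Measure.measurePreserving_swap.quasiMeasurePreserving.ae h3)
  rw [asympVariance, mul_add]
  congr 1
  · rw [setIntegral_congr_ae (measurableSet_window d 1) (h₂.mono fun x hx _ => hx),
      setIntegral_const, smul_eq_mul]
  · rw [setIntegral_congr_ae (g := fun _ => ∫ z, covDensity ρ Q ξ κ₁ z) (measurableSet_window d 1),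
      setIntegral_const, smul_eq_mul]
    filter_upwards [h₁, h4] with x hx hx4 _
    rw [← integral_add_left_eq_self _ x]
    refine integral_congr_ae ?_
    have h5 := (measurePreserving_add_left volume x).quasiMeasurePreserving.ae h₁
    filter_upwards [hx4, h5] with z hz hz5
    rw [hx, hz5, ← sq]
    exact hz

/-- The change of variables y = x + z makes the truncated pair correlation a function of z alone, so
the weights enter through their autocorrelation. -/
theorem variance_finSum_mul [IsProbabilityMeasure P] (hP : IsStationaryLaw P) (hQ : IsPalm P ρ Q)
    (hρ : IsCorrelationFunction P ρ) (hξ : IsScore ξ) {κ₁ κ₂ : ℝ}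
    (h₁ : ∀ᵐ x, weightedCorrelation ρ Q ξ ![1] ![x] = κ₁)
    (h₂ : ∀ᵐ x, weightedCorrelation ρ Q ξ ![2] ![x] = κ₂)
    (hA : Bornology.IsBounded A)
    (hI : Integrable (fun X => X.finSum A fun x => |ξ x X|) P)
    (hI2 : Integrable (fun X => (X.finSum A fun x => |ξ x X|) ^ 2) P)
    {w : EuclideanSpace ℝ (Fin d) → ℝ} (hw : Measurable w) (hwA : ∀ x ∉ A, w x = 0) {M : ℝ}
    (hwM : ∀ x, |w x| ≤ M) (hwi : Integrable w) :
    ∫ X, (X.finSum A fun x => w x * ξ x X) ^ 2 ∂P - (∫ X, X.finSum A fun x => w x * ξ x X ∂P) ^ 2 =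
      (∫ z, covDensity ρ Q ξ κ₁ z * ∫ x, w x * w (x + z)) + κ₂ * ∫ x, w x ^ 2 := by
  have hsq : ∀ X : PointConfig d, (X.finSum A fun x => w x * ξ x X) ^ 2 =
      X.finSum A (fun x => X.finSum A fun y => (w x * w y) * (ξ x X * ξ y X)) := by
    intro X
    rw [sq, ← X.finSum_const_mul hA]
    refine X.finSum_congr fun x _ => ?_
    rw [mul_comm, ← X.finSum_const_mul hA]
    exact X.finSum_congr fun y _ => by ring
  have hmean := integral_finSum_mul hQ hρ hξ.measurable hA hI hw hwA hwM
  have hpair := integral_finSum_finSum_mul hQ hρ hξ.measurable hA hI2 (k := fun x y => w x * w y)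
    ((hw.comp measurable_fst).mul (hw.comp measurable_snd))
    (fun x y h => by
      rcases h with h | h
      · rw [hwA x h, zero_mul]
      · rw [hwA y h, mul_zero]) (M := M * M)
    (fun x y => by
      rw [abs_mul]
      exact mul_le_mul (hwM x) (hwM y) (abs_nonneg _) ((abs_nonneg _).trans (hwM x)))
  simp only [hsq]
  rw [hpair.2, hmean.2]
  have e1 : ∫ x, w x * weightedCorrelation ρ Q ξ ![1] ![x] = ∫ x, w x * κ₁ :=
    integral_congr_ae (h₁.mono fun x hx => by simp only [hx])
  have e2 : ∫ x, w x * w x * weightedCorrelation ρ Q ξ ![2] ![x] = κ₂ * ∫ x, w x ^ 2 := by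
    rw [← integral_const_mul]
    exact integral_congr_ae (h₂.mono fun x hx => by simp only [hx]; ring)
  have e3 : (∫ x, w x * κ₁) ^ 2 = ∫ z : EuclideanSpace ℝ (Fin d) × EuclideanSpace ℝ (Fin d),
      w z.1 * w z.2 * κ₁ ^ 2 := by
    rw [sq, ← integral_prod_mul]
    rw [← Measure.volume_eq_prod]
    exact integral_congr_ae (.of_forall fun z => by ring)
  have hi3 : Integrable fun z : EuclideanSpace ℝ (Fin d) × EuclideanSpace ℝ (Fin d) =>
      w z.1 * w z.2 * κ₁ ^ 2 := (hwi.mul_prod hwi).mul_const _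
  have hi4 := hpair.1.sub hi3
  have hi5 := ((measurePreserving_shearEquiv (d := d)).integrable_comp_emb
    (shearEquiv d).measurableEmbedding).2 hi4
  rw [e1, e2, e3, add_sub_right_comm, ← integral_sub hpair.1 hi3]
  congr 1
  refine ((measurePreserving_shearEquiv (d := d)).integral_comp
    (shearEquiv d).measurableEmbedding _).symm.trans ?_
  refine (integral_prod _ hi5).trans (integral_congr_ae ?_)
  filter_upwards [ae_eq_covDensity hP hQ hρ hξ κ₁] with z hz
  rw [← integral_const_mul]
  refine integral_congr_ae (hz.mono fun x hx => ?_)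
  simp only [Function.comp, Pi.sub_apply, shearEquiv_apply]
  rw [← hx]
  ring

end CovarianceDensity

/-! ### Summability of stretched exponential decay on the lattice -/

section LatticeSums

variable {d : ℕ}

theorem summable_pi_prod_of_nonneg {F : ℤ → ℝ} (h0 : ∀ n, 0 ≤ F n) (h : Summable F) :
    Summable fun v : Fin d → ℤ => ∏ i, F (v i) := by
  classical
  refine summable_of_sum_le (c := (∑' n, F n) ^ d)
    (fun v => Finset.prod_nonneg fun i _ => h0 _) fun u => ?_
  let s : Finset ℤ := u.biUnion fun v => Finset.univ.image v
  calc ∑ v ∈ u, ∏ i, F (v i) ≤ ∑ v ∈ Fintype.piFinset fun _ : Fin d => s, ∏ i, F (v i) := by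
        refine Finset.sum_le_sum_of_subset_of_nonneg (fun v hv => ?_) fun v _ _ =>
          Finset.prod_nonneg fun i _ => h0 _
        rw [Fintype.mem_piFinset]
        exact fun i => Finset.mem_biUnion.2 ⟨v, hv, Finset.mem_image_of_mem _ (Finset.mem_univ i)⟩
    _ = (∑ n ∈ s, F n) ^ d := by
        rw [Finset.sum_prod_piFinset s fun _ => F]
        simp
    _ ≤ _ := pow_le_pow_left₀ (Finset.sum_nonneg fun n _ => h0 n) (h.sum_le_tsum s fun n _ => h0 n) d

theorem summable_int_inv_sq : Summable fun n : ℤ => ((|(n : ℝ)| + 1) ^ 2)⁻¹ := by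
  have h : Summable fun n : ℕ => (((n : ℝ) + 1) ^ 2)⁻¹ := by
    have := (summable_nat_add_iff 1).2 (Real.summable_nat_pow_inv.2 one_lt_two)
    simpa using this
  refine Summable.of_nat_of_neg (by simpa using h) (by simpa using h)

/-- A summable function on the lattice that dominates everything which decays exponentially on the
scale `N ^ w`. -/
theorem exists_summable_decay (d : ℕ) {Γ w B : ℝ} (hΓ : 1 ≤ Γ) (hw : 0 < w) (hB : 0 ≤ B) :
    ∃ D : (Fin d → ℤ) → ℝ, Summable D ∧ (∀ v, 0 ≤ D v) ∧ ∀ (v : Fin d → ℤ) (t : ℝ),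
      (‖v‖ < Γ → t ≤ B) →
      (∀ N : ℕ, 1 ≤ N → Γ * (N : ℝ) ^ w ≤ ‖v‖ → t ≤ B * Real.exp (-(N / 2))) → t ≤ D v := by
  set m : ℕ := ⌈w⌉₊ * (2 * d) with hm
  set M : ℝ := (2 * Γ) ^ (2 * d) * (2 ^ m * m ! * Real.exp (1 / 2)) with hM
  refine ⟨fun v => B * M * ∏ i, ((|(v i : ℝ)| + 1) ^ 2)⁻¹,
    (summable_pi_prod_of_nonneg (fun n => by positivity) summable_int_inv_sq).mul_left _,
    fun v => by positivity, fun v t h0 h1 => ?_⟩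
  -- The largest level whose correlation length fits below ‖v‖; N = 0 is the case ‖v‖ < Γ. By
  -- maximality ‖v‖ ≤ Γ (N+1)^w, so e^(-N/2) beats every power of ‖v‖, in particular the product of
  -- inverse squares.
  set N : ℕ := ⌊(‖v‖ / Γ) ^ (1 / w)⌋₊ with hN
  have hv : 0 ≤ ‖v‖ / Γ := by positivity
  have ht : t ≤ B * Real.exp (-(N / 2)) := by
    rcases Nat.eq_zero_or_pos N with h2 | h2
    · rw [h2]
      simp only [Nat.cast_zero, zero_div, neg_zero, Real.exp_zero, mul_one]
      refine h0 ?_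
      rw [hN, Nat.floor_eq_zero] at h2
      by_contra h3
      have : 1 ≤ ‖v‖ / Γ := (one_le_div (by positivity)).2 (not_lt.1 h3)
      exact absurd h2 (not_lt.2 (Real.one_le_rpow this (by positivity)))
    · refine h1 N h2 ?_
      have h3 : (N : ℝ) ≤ (‖v‖ / Γ) ^ (1 / w) := Nat.floor_le (by positivity)
      have h4 := Real.rpow_le_rpow (by positivity) h3 hw.le
      rw [← Real.rpow_mul hv, one_div_mul_cancel hw.ne', Real.rpow_one,
        le_div_iff₀ (by positivity)] at h4
      linarith
  have hvN : ‖v‖ ≤ Γ * ((N : ℝ) + 1) ^ w := by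
    have h3 : (‖v‖ / Γ) ^ (1 / w) ≤ N + 1 := (Nat.lt_floor_add_one _).le
    have h4 := Real.rpow_le_rpow (by positivity) h3 hw.le
    rw [← Real.rpow_mul hv, one_div_mul_cancel hw.ne', Real.rpow_one,
      div_le_iff₀ (by positivity)] at h4
    linarith
  have hN1 : (1 : ℝ) ≤ (N : ℝ) + 1 := by linarith [N.cast_nonneg (α := ℝ)]
  have hprod : ∏ i, (|(v i : ℝ)| + 1) ^ 2 ≤ (2 * Γ) ^ (2 * d) * ((N : ℝ) + 1) ^ m := by
    have h3 : ((N : ℝ) + 1) ^ w ≤ ((N : ℝ) + 1) ^ ⌈w⌉₊ := by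
      rw [← Real.rpow_natCast]
      exact Real.rpow_le_rpow_of_exponent_le hN1 (Nat.le_ceil w)
    have h4 : (1 : ℝ) ≤ ((N : ℝ) + 1) ^ ⌈w⌉₊ := one_le_pow₀ hN1
    have h5 : ∀ i, |(v i : ℝ)| + 1 ≤ 2 * Γ * ((N : ℝ) + 1) ^ ⌈w⌉₊ := by
      intro i
      have h6 := norm_le_pi_norm v i
      rw [Int.norm_eq_abs] at h6
      have h7 : Γ * ((N : ℝ) + 1) ^ w ≤ Γ * ((N : ℝ) + 1) ^ ⌈w⌉₊ := by gcongr
      have h8 : 1 ≤ Γ * ((N : ℝ) + 1) ^ ⌈w⌉₊ := one_le_mul_of_one_le_of_one_le hΓ h4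
      linarith
    calc ∏ i, (|(v i : ℝ)| + 1) ^ 2 ≤ ∏ _i : Fin d, (2 * Γ * ((N : ℝ) + 1) ^ ⌈w⌉₊) ^ 2 :=
          Finset.prod_le_prod (fun i _ => by positivity) fun i _ =>
            pow_le_pow_left₀ (by positivity) (h5 i) 2
      _ = _ := by
          rw [Finset.prod_const, Finset.card_univ, Fintype.card_fin, ← pow_mul, mul_pow, ← pow_mul]
  have hexp : ((N : ℝ) + 1) ^ m ≤ 2 ^ m * m ! * Real.exp (1 / 2) * Real.exp (N / 2) := by
    have h3 := Real.pow_div_factorial_le_exp (x := ((N : ℝ) + 1) / 2) (by positivity) m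
    rw [div_le_iff₀ (by positivity), div_pow, div_le_iff₀ (by positivity)] at h3
    refine h3.trans_eq ?_
    rw [add_div, Real.exp_add]
    ring
  have hpos : 0 < ∏ i, (|(v i : ℝ)| + 1) ^ 2 := Finset.prod_pos fun i _ => by positivity
  refine ht.trans ?_
  dsimp only
  rw [Finset.prod_inv_distrib, mul_assoc]
  refine mul_le_mul_of_nonneg_left ?_ hB
  rw [← div_eq_mul_inv, le_div_iff₀ hpos, Real.exp_neg, inv_mul_le_iff₀ (Real.exp_pos _), hM]
  calc _ ≤ (2 * Γ) ^ (2 * d) * ((N : ℝ) + 1) ^ m := hprod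
    _ ≤ (2 * Γ) ^ (2 * d) * (2 ^ m * m ! * Real.exp (1 / 2) * Real.exp (N / 2)) := by gcongr
    _ = _ := by ring

theorem norm_sub_le_dist_latticePoint (z z' : Fin d → ℤ) :
    ‖z' - z‖ ≤ dist (latticePoint z) (latticePoint z') := by
  rw [pi_norm_le_iff_of_nonneg dist_nonneg]
  intro i
  have h := abs_apply_sub_le_dist (latticePoint z') (latticePoint z) i
  rw [dist_comm, latticePoint_apply, latticePoint_apply] at h
  rw [Int.norm_eq_abs]
  simpa using h

end LatticeSums

/-! ### Square integrability of score sums over bounded sets -/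

section Integrability

variable {d : ℕ} {P : Measure (PointConfig d)} {g : EuclideanSpace ℝ (Fin d) → PointConfig d → ℝ}
  {C β b K : ℝ} {A : Set (EuclideanSpace ℝ (Fin d))}

theorem exists_latticeBox_cover (hA : Bornology.IsBounded A) :
    ∃ G : ℕ, A ⊆ ⋃ z ∈ latticeBox d G, cell z := by
  obtain ⟨R, hR⟩ := hA.subset_closedBall 0
  refine ⟨⌈R⌉₊ + 1, fun x hx => ?_⟩
  refine Set.mem_biUnion (x := cellIndex x) ?_ (mem_cell_iff.2 rfl)
  rw [Finset.mem_coe, mem_latticeBox]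
  intro i
  have h1 := (abs_apply_sub_le_dist x 0 i).trans (Metric.mem_closedBall.1 (hR hx))
  have h2 := (mem_cell_iff.2 (rfl : cellIndex x = cellIndex x)) i
  have h3 := Nat.le_ceil R
  simp only [PiLp.zero_apply, sub_zero] at h1
  have h4 : |(cellIndex x i : ℝ)| ≤ (⌈R⌉₊ : ℝ) + 1 := by
    rw [abs_le] at h1 ⊢
    constructor <;> linarith
  exact_mod_cast h4

theorem IsLocalizable.integrable_sq_finSum_abs [IsProbabilityMeasure P]
    (hg : IsLocalizable P g C β b) (hC : 1 ≤ C) (hβ : 0 ≤ β) (hK1 : 1 ≤ K)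
    (hK : ∀ z, MeanLE P (fun X => (3 : ℝ) ^ (X.carrier ∩ cell z).ncard) K)
    (hA : Bornology.IsBounded A) (hAm : MeasurableSet A) :
    Integrable (fun X => X.finSum A fun x => |g x X|) P ∧
      Integrable (fun X => (X.finSum A fun x => |g x X|) ^ 2) P := by
  obtain ⟨G, hG⟩ := exists_latticeBox_cover hA
  have hm : Measurable fun X : PointConfig d => X.finSum A fun x => |g x X| :=
    PointConfig.measurable_finSum measurable_id (F := fun X x => |g x X|)
      (hg.measurable.abs.comp measurable_swap) hAm hA
  have h2 : Integrable (fun X => (X.finSum A fun x => |g x X|) ^ 2) P := by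
    have hi := integrable_finsetSum (latticeBox d G) fun z _ =>
      (hg.cellSum_moment hC hβ hK1 hK z (k := 2) (by norm_num)).1
    refine (hi.const_mul ((latticeBox d G).card : ℝ)).mono' (hm.pow_const 2).aestronglyMeasurable
      (.of_forall fun X => ?_)
    rw [Real.norm_of_nonneg (by positivity)]
    refine le_trans ?_ sq_sum_le_card_mul_sum_sq
    refine pow_le_pow_left₀ (X.finSum_nonneg fun _ => abs_nonneg _) ?_ 2
    have h3 := X.finSum_biUnion (g := A.indicator fun x => |g x X|) (latticeBox d G)
      isBounded_cell pairwise_disjoint_cell hG fun x hx => Set.indicator_of_notMem hx _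
    rw [X.finSum_indicator subset_rfl] at h3
    rw [h3]
    refine Finset.sum_le_sum fun z _ => X.finSum_mono (isBounded_cell z) fun x _ => ?_
    exact Set.indicator_le_self' (fun _ _ => abs_nonneg _) x
  refine ⟨(h2.add (integrable_const 1)).mono' hm.aestronglyMeasurable (.of_forall fun X => ?_), h2⟩
  have h0 : 0 ≤ X.finSum A fun x => |g x X| := X.finSum_nonneg fun _ => abs_nonneg _
  rw [Real.norm_of_nonneg h0, Pi.add_apply]
  nlinarith [sq_nonneg ((X.finSum A fun x => |g x X|) - 1)]

end Integrability

/-! ### Integrability of the covariance density -/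

section CovarianceIntegrable

variable {d : ℕ} {P : Measure (PointConfig d)}
  {ρ : (p : ℕ) → (Fin p → EuclideanSpace ℝ (Fin d)) → ℝ}
  {Q : (p : ℕ) → Kernel (Fin p → EuclideanSpace ℝ (Fin d)) (PointConfig d)}
  {ξ : EuclideanSpace ℝ (Fin d) → PointConfig d → ℝ} {C β b a ahat K c κ : ℝ}

/-- The sum of `h x y * g x X * g y Y` over the points of `X` and `Y` in two cells. -/
noncomputable def cellPairSum (h : EuclideanSpace ℝ (Fin d) → EuclideanSpace ℝ (Fin d) → ℝ)
    (z z' : Fin d → ℤ) (g : EuclideanSpace ℝ (Fin d) → PointConfig d → ℝ)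
    (X Y : PointConfig d) : ℝ :=
  X.finSum (cell z) fun x => Y.finSum (cell z') fun y => h x y * (g x X * g y Y)

variable {h : EuclideanSpace ℝ (Fin d) → EuclideanSpace ℝ (Fin d) → ℝ} {z z' : Fin d → ℤ}

theorem measurable_cellPairSum (hh : Measurable (Function.uncurry h))
    {g : EuclideanSpace ℝ (Fin d) → PointConfig d → ℝ} (hg : Measurable (Function.uncurry g)) :
    Measurable (Function.uncurry (cellPairSum h z z' g)) := by
  refine PointConfig.measurable_finSum (T := PointConfig d × PointConfig d) measurable_fst
    (F := fun Z x => Z.2.finSum (cell z') fun y => h x y * (g x Z.1 * g y Z.2)) ?_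
    (measurableSet_cell z) (isBounded_cell z)
  refine PointConfig.measurable_finSum
    (T := (PointConfig d × PointConfig d) × EuclideanSpace ℝ (Fin d))
    (measurable_snd.comp measurable_fst)
    (F := fun q y => h q.2 y * (g q.2 q.1.1 * g y q.1.2)) ?_
    (measurableSet_cell z') (isBounded_cell z')
  have m1 : Measurable fun q : ((PointConfig d × PointConfig d) × EuclideanSpace ℝ (Fin d)) ×
      EuclideanSpace ℝ (Fin d) => (q.1.2, q.1.1.1) := by fun_prop
  have m2 : Measurable fun q : ((PointConfig d × PointConfig d) × EuclideanSpace ℝ (Fin d)) ×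
      EuclideanSpace ℝ (Fin d) => (q.2, q.1.1.2) := by fun_prop
  have m3 : Measurable fun q : ((PointConfig d × PointConfig d) × EuclideanSpace ℝ (Fin d)) ×
      EuclideanSpace ℝ (Fin d) => (q.1.2, q.2) := by fun_prop
  exact (hh.comp m3).mul ((hg.comp m1).mul (hg.comp m2))

theorem abs_cellPairSum_le (hh1 : ∀ x y, |h x y| ≤ 1) (hC : 0 ≤ C)
    (g : EuclideanSpace ℝ (Fin d) → PointConfig d → ℝ) (X Y : PointConfig d) :
    |cellPairSum h z z' g X Y| ≤ envelope g C z X * envelope g C z' Y := by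
  have h1 : |cellPairSum h z z' g X Y| ≤
      (X.finSum (cell z) fun x => |g x X|) * Y.finSum (cell z') fun y => |g y Y| := by
    rw [mul_comm, ← X.finSum_const_mul (isBounded_cell z)]
    refine (X.abs_finSum_le (isBounded_cell z) _).trans
      (X.finSum_mono (isBounded_cell z) fun x _ => ?_)
    rw [mul_comm, ← Y.finSum_const_mul (isBounded_cell z')]
    refine (Y.abs_finSum_le (isBounded_cell z') _).trans
      (Y.finSum_mono (isBounded_cell z') fun y _ => ?_)
    rw [abs_mul, abs_mul]
    exact mul_le_of_le_one_left (by positivity) (hh1 x y)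
  refine h1.trans (mul_le_mul ?_ ?_ (Y.finSum_nonneg fun _ => abs_nonneg _)
    (envelope_nonneg hC z X)) <;> exact le_add_of_nonneg_right hC

/-- Field mixing for two cells and an arbitrary bounded kernel h. The kernel is not a product, which
is why field mixing is stated for general functionals and not only for products of cell sums. -/
theorem IsMixing.exists_cellPairSum_mixing [IsProbabilityMeasure P] (hm : IsMixing P a ahat K c)
    (ha₁ : a < 1) (hahat : 0 < ahat) (hC : 1 ≤ C) (hβ : 0 ≤ β) (hb : 0 ≤ b) (hK : 1 ≤ K)
    (hc : 0 < c) (hξ : IsLocalizable P ξ C β b) :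
    ∃ B Γ : ℝ, 0 ≤ B ∧ 1 ≤ Γ ∧
      ∀ h : EuclideanSpace ℝ (Fin d) → EuclideanSpace ℝ (Fin d) → ℝ,
      Measurable (Function.uncurry h) → (∀ x y, |h x y| ≤ 1) → ∀ N : ℕ, 1 ≤ N →
      ∀ z z' : Fin d → ℤ, Γ * (N : ℝ) ^ lengthExponent d a ahat b ≤ ‖z' - z‖ →
      Integrable (fun Z => cellPairSum h z z' ξ Z.1 Z.2) (P.prod P) ∧
      |∫ X, cellPairSum h z z' ξ X X ∂P - ∫ Z, cellPairSum h z z' ξ Z.1 Z.2 ∂(P.prod P)| ≤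
        B * Real.exp (-(N / 2)) := by
  obtain ⟨B, Γ, hB, hΓ, hmain⟩ := hm.exists_field_mixing ha₁ hahat hC hβ hb hK hc
  have h2 : (1 : ℝ) ≤ 2 ^ (1 / ((1 - a) * ahat)) :=
    Real.one_le_rpow (by norm_num) (by have : 0 < 1 - a := by linarith
                                       positivity)
  refine ⟨B ^ 2 * (2 : ℝ) ^ (β + 1), Γ * 2 ^ (1 / ((1 - a) * ahat)), by positivity,
    one_le_mul_of_one_le_of_one_le hΓ h2, fun h hh hh1 N hN z z' hzz' => ?_⟩
  obtain ⟨g', hg'm, hg'g, hg'⟩ := hmain ξ hξ N hN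
  have hC0 : 0 ≤ C := by linarith
  have key := hg' (Fin 2) {0} {1} ![z, z'] (cellPairSum h z z' ξ) (cellPairSum h z z' g')
    (Finset.singleton_nonempty _) (measurable_cellPairSum hh hξ.measurable)
    (measurable_cellPairSum hh hg'm)
    (fun X Y => by simpa using abs_cellPairSum_le hh1 hC0 ξ X Y)
    (fun X Y => by simpa using abs_cellPairSum_le hh1 hC0 g' X Y)
    (fun X Y hX hY => ?_) (fun X Y X' Y' hX hY => ?_) (fun i hi j hj => ?_)
  · refine ⟨key.2.1, key.2.2.trans_eq ?_⟩
    norm_num [Finset.card_singleton]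
  · simp only [Finset.mem_singleton, forall_eq, Matrix.cons_val_zero, Matrix.cons_val_one] at hX hY
    refine X.finSum_congr fun x hx => Y.finSum_congr fun y hy => ?_
    rw [hX x hx, hY y hy]
  · simp only [Finset.mem_singleton, forall_eq, Matrix.cons_val_zero, Matrix.cons_val_one] at hX hY
    have e1 : ∀ x ∈ X'.carrier ∩ cell z,
        (Y'.finSum (cell z') fun y => h x y * (g' x X' * g' y Y')) =
          Y.finSum (cell z') fun y => h x y * (g' x X * g' y Y) := by
      intro x hx
      rw [Y'.finSum_congr (h := fun y => h x y * (g' x X * g' y Y)) fun y hy => by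
        rw [hX.2 x hx.2, hY.2 y hy.2], PointConfig.finSum, PointConfig.finSum, hY.1]
    rw [cellPairSum, cellPairSum, X'.finSum_congr e1, PointConfig.finSum, PointConfig.finSum, hX.1]
  · rw [Finset.mem_singleton] at hi hj
    subst hi hj
    refine le_trans (le_of_eq ?_) (hzz'.trans (norm_sub_le_dist_latticePoint z z'))
    norm_num
theorem IsLocalizable.integrableOn_cov [IsProbabilityMeasure P] (hQ : IsPalm P ρ Q)
    (hρ : IsCorrelationFunction P ρ)
    (hξ : IsLocalizable P ξ C β b) (hC : 1 ≤ C) (hβ : 0 ≤ β) (hK1 : 1 ≤ K)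
    (hK : ∀ z, MeanLE P (fun X => (3 : ℝ) ^ (X.carrier ∩ cell z).ncard) K) (z z' : Fin d → ℤ) :
    IntegrableOn (fun p : EuclideanSpace ℝ (Fin d) × EuclideanSpace ℝ (Fin d) =>
      weightedCorrelation ρ Q ξ ![1, 1] ![p.1, p.2] - κ ^ 2) (cell z ×ˢ cell z') := by
  have hm := (measurableSet_cell z).prod (measurableSet_cell z')
  have h1 := integral_finSum_finSum_mul hQ hρ hξ.measurable
    ((isBounded_cell z).union (isBounded_cell z'))
    (hξ.integrable_sq_finSum_abs hC hβ hK1 hK ((isBounded_cell z).union (isBounded_cell z'))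
      ((measurableSet_cell z).union (measurableSet_cell z'))).2
    (k := fun x y => (cell z ×ˢ cell z').indicator 1 (x, y)) (measurable_one.indicator hm)
    (fun x y hxy => Set.indicator_of_notMem (by
      rw [Set.mem_prod]
      rintro ⟨h2, h3⟩
      rcases hxy with h4 | h4
      · exact h4 (Or.inl h2)
      · exact h4 (Or.inr h3)) _) (M := 1) (fun x y => by
      by_cases hxy : (x, y) ∈ cell z ×ˢ cell z'
      · rw [Set.indicator_of_mem hxy]; simp
      · rw [Set.indicator_of_notMem hxy]; simp)
  refine IntegrableOn.sub ?_ (integrableOn_const ?_)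
  · rw [← integrable_indicator_iff hm]
    refine h1.1.congr (.of_forall fun p => ?_)
    by_cases hp : p ∈ cell z ×ˢ cell z' <;> simp [hp]
  · rw [Measure.volume_eq_prod, Measure.prod_prod, volume_cell, volume_cell]
    simp

/-- The truncated pair correlation is small on distant cells. -/
theorem IsLocalizable.integral_abs_cov_eq [IsProbabilityMeasure P] (hQ : IsPalm P ρ Q)
    (hρ : IsCorrelationFunction P ρ)
    (hξ : IsLocalizable P ξ C β b) (hC : 1 ≤ C) (hβ : 0 ≤ β) (hK1 : 1 ≤ K)
    (hK : ∀ z, MeanLE P (fun X => (3 : ℝ) ^ (X.carrier ∩ cell z).ncard) K)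
    (hκ : ∀ᵐ x, weightedCorrelation ρ Q ξ ![1] ![x] = κ) {z z' : Fin d → ℤ} (hz : z ≠ z') :
    ∃ h : EuclideanSpace ℝ (Fin d) → EuclideanSpace ℝ (Fin d) → ℝ,
      Measurable (Function.uncurry h) ∧ (∀ x y, |h x y| ≤ 1) ∧
      (Integrable (fun Z => cellPairSum h z z' ξ Z.1 Z.2) (P.prod P) →
        ∫ p in cell z ×ˢ cell z', |weightedCorrelation ρ Q ξ ![1, 1] ![p.1, p.2] - κ ^ 2| =
          ∫ X, cellPairSum h z z' ξ X X ∂P - ∫ Z, cellPairSum h z z' ξ Z.1 Z.2 ∂(P.prod P)) := by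
  classical
  set A := cell z ∪ cell z' with hA
  have hAb : Bornology.IsBounded A := (isBounded_cell z).union (isBounded_cell z')
  have hAm : MeasurableSet A := (measurableSet_cell z).union (measurableSet_cell z')
  have hm := (measurableSet_cell z).prod (measurableSet_cell z')
  let F : EuclideanSpace ℝ (Fin d) × EuclideanSpace ℝ (Fin d) → ℝ := fun p =>
    weightedCorrelation ρ Q ξ ![1, 1] ![p.1, p.2] - κ ^ 2
  have hF : Measurable F := (measurable_weightedCorrelation_two hQ hρ hξ.measurable).sub_const _
  -- The sign of the truncated pair correlation serves as kernel; then the L¹ norm over the two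
  -- cells is a covariance, which mixing controls.
  let s : EuclideanSpace ℝ (Fin d) × EuclideanSpace ℝ (Fin d) → ℝ := fun p =>
    if 0 ≤ F p then 1 else -1
  let k : EuclideanSpace ℝ (Fin d) → EuclideanSpace ℝ (Fin d) → ℝ := fun x y =>
    (cell z ×ˢ cell z').indicator s (x, y)
  have hs : Measurable s := Measurable.ite (measurableSet_le measurable_const hF) measurable_const
    measurable_const
  have hkm : Measurable (Function.uncurry k) := hs.indicator hm
  have hk1 : ∀ x y, |k x y| ≤ 1 := by
    intro x y
    by_cases hxy : (x, y) ∈ cell z ×ˢ cell z'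
    · simp only [k, Set.indicator_of_mem hxy, s]
      split_ifs <;> simp
    · simp only [k, Set.indicator_of_notMem hxy]
      simp
  have hk0 : ∀ x y, (x ∉ cell z ∨ y ∉ cell z') → k x y = 0 := fun x y hxy =>
    Set.indicator_of_notMem (by rw [Set.mem_prod]; tauto) _
  have hkA : ∀ x y, x ∉ A ∨ y ∉ A → k x y = 0 := fun x y hxy => hk0 x y
    (hxy.imp (fun h1 h2 => h1 (Or.inl h2)) fun h1 h2 => h1 (Or.inr h2))
  obtain ⟨hI, hI2⟩ := hξ.integrable_sq_finSum_abs hC hβ hK1 hK hAb hAm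
  refine ⟨k, hkm, hk1, fun hint => ?_⟩
  have hpair := integral_finSum_finSum_mul hQ hρ hξ.measurable hAb hI2 hkm hkA hk1
  -- Distinct cells are disjoint, so the diagonal term of the second moment formula disappears.
  have hdiag : ∀ x, k x x = 0 := fun x => hk0 x x (by
    by_contra! h
    exact Set.disjoint_left.1 (pairwise_disjoint_cell hz) h.1 h.2)
  simp only [hdiag, zero_mul, integral_zero, add_zero] at hpair
  have hfs : ∀ X Y : PointConfig d, X.finSum A (fun x => Y.finSum A fun y =>
      k x y * (ξ x X * ξ y Y)) = cellPairSum k z z' ξ X Y := by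
    intro X Y
    rw [cellPairSum, ← X.finSum_indicator (B := cell z) Set.subset_union_left]
    refine X.finSum_congr fun x _ => ?_
    by_cases hx : x ∈ cell z
    · rw [Set.indicator_of_mem hx, ← Y.finSum_indicator (B := cell z') Set.subset_union_right]
      refine Y.finSum_congr fun y _ => ?_
      by_cases hy : y ∈ cell z'
      · rw [Set.indicator_of_mem hy]
      · rw [Set.indicator_of_notMem hy, hk0 x y (Or.inr hy), zero_mul]
    · rw [Set.indicator_of_notMem hx, Y.finSum_congr (h := fun _ => 0) fun y _ => by
        rw [hk0 x y (Or.inl hx), zero_mul], Y.finSum_const hAb, mul_zero]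
  have hki : Integrable (fun p : EuclideanSpace ℝ (Fin d) × EuclideanSpace ℝ (Fin d) =>
      k p.1 p.2) := by
    refine Integrable.mono' (g := (cell z ×ˢ cell z').indicator fun _ => (1 : ℝ)) ?_
      hkm.aestronglyMeasurable (.of_forall fun p => ?_)
    · rw [integrable_indicator_iff hm]
      refine integrableOn_const ?_
      rw [Measure.volume_eq_prod, Measure.prod_prod, volume_cell, volume_cell]
      simp
    · by_cases hp : p ∈ cell z ×ˢ cell z'
      · rw [Set.indicator_of_mem hp]
        exact hk1 p.1 p.2
      · rw [Set.indicator_of_notMem hp]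
        simp only [k, Set.indicator_of_notMem (show (p.1, p.2) ∉ cell z ×ˢ cell z' from hp)]
        simp
  let q : EuclideanSpace ℝ (Fin d) → ℝ := fun x => κ * ∫ y, k x y
  have hq : Measurable q :=
    (hkm.stronglyMeasurable.integral_prod_right' (ν := volume)).measurable.const_mul κ
  have hqA : ∀ x ∉ A, q x = 0 := fun x hx => by
    simp only [q, hkA x _ (Or.inl hx), integral_zero, mul_zero]
  have hqM : ∀ x, |q x| ≤ |κ| * volume.real A := by
    intro x
    simp only [q]
    rw [abs_mul]
    refine mul_le_mul_of_nonneg_left ?_ (abs_nonneg κ)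
    have e1 : ∫ y, k x y = ∫ y in A, k x y :=
      (setIntegral_eq_integral_of_forall_compl_eq_zero fun y hy => hkA x y (Or.inr hy)).symm
    rw [e1]
    exact (norm_setIntegral_le_of_norm_le_const (f := fun y => k x y) (C := 1) hAb.measure_lt_top
      fun y _ => hk1 x y).trans_eq (one_mul _)
  -- Integrating out the independent copy replaces its scores by their intensity κ; a second
  -- application of the first moment formula gives κ² times the integral of the kernel.
  have hinner : ∀ X : PointConfig d,
      ∫ Y, cellPairSum k z z' ξ X Y ∂P = X.finSum A fun x => q x * ξ x X := by
    intro X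
    simp only [← hfs]
    simp only [X.finSum_eq_sum hAb]
    have e1 : ∀ x, Measurable fun y => k x y := fun x => hkm.comp measurable_prodMk_left
    have e2 : ∀ x (Y : PointConfig d), (Y.finSum A fun y => k x y * (ξ x X * ξ y Y)) =
        ξ x X * Y.finSum A fun y => k x y * ξ y Y := fun x Y => by
      rw [← Y.finSum_const_mul hAb]
      exact Y.finSum_congr fun y _ => by ring
    simp only [e2]
    rw [integral_finsetSum]
    · refine Finset.sum_congr rfl fun x _ => ?_
      rw [integral_const_mul, (integral_finSum_mul hQ hρ hξ.measurable hAb hI (e1 x)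
        (fun y hy => hkA x y (Or.inr hy)) (hk1 x)).2, mul_comm]
      congr 1
      simp only [q]
      rw [← integral_const_mul]
      exact integral_congr_ae (hκ.mono fun y hy => by simp only [hy]; ring)
    · intro x _
      refine Integrable.const_mul ?_ _
      refine hI.mono' (PointConfig.measurable_finSum measurable_id
        (F := fun Y y => k x y * ξ y Y) (((e1 x).comp measurable_snd).mul
          (hξ.measurable.comp measurable_swap)) hAm hAb).aestronglyMeasurable
        (.of_forall fun Y => ?_)
      refine (Y.abs_finSum_le hAb _).trans (Y.finSum_mono hAb fun y _ => ?_)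
      rw [abs_mul]
      exact mul_le_of_le_one_left (abs_nonneg _) (hk1 x y)
  have hprod : ∫ Z, cellPairSum k z z' ξ Z.1 Z.2 ∂(P.prod P) =
      ∫ p : EuclideanSpace ℝ (Fin d) × EuclideanSpace ℝ (Fin d), k p.1 p.2 * κ ^ 2 := by
    rw [integral_prod _ hint]
    simp only [hinner]
    rw [(integral_finSum_mul hQ hρ hξ.measurable hAb hI hq hqA hqM).2, integral_mul_const,
      Measure.volume_eq_prod, integral_prod _ hki, ← integral_mul_const]
    refine integral_congr_ae (hκ.mono fun x hx => ?_)
    simp only [hx, q]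
    ring
  simp only [hfs] at hpair
  rw [hpair.2, hprod, ← integral_sub hpair.1 (hki.mul_const _), ← integral_indicator hm]
  refine integral_congr_ae (.of_forall fun p => ?_)
  dsimp only
  by_cases hp : p ∈ cell z ×ˢ cell z'
  · rw [Set.indicator_of_mem hp, ← mul_sub]
    simp only [k, Set.indicator_of_mem (show (p.1, p.2) ∈ cell z ×ˢ cell z' from hp), s, F]
    split_ifs with h1
    · rw [abs_of_nonneg h1, one_mul]
    · rw [abs_of_neg (not_le.1 h1)]
      ring
  · rw [Set.indicator_of_notMem hp]
    simp only [k, Set.indicator_of_notMem (show (p.1, p.2) ∉ cell z ×ˢ cell z' from hp)]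
    simp

/-- The density is constant in the base point, so its L¹ norm is the integral of the truncated pair
correlation over the product of the unit cell at 0 with the whole space. This is a sum over lattice
offsets v of the L¹ norms on pairs of cells, which decay summably. -/
theorem IsMixing.integrable_covDensity [IsProbabilityMeasure P] (hm : IsMixing P a ahat K c)
    (hP : IsStationaryLaw P) (hQ : IsPalm P ρ Q) (hρ : IsCorrelationFunction P ρ)
    (hs : IsScore ξ) (ha₁ : a < 1) (hahat : 0 < ahat) (hC : 1 ≤ C) (hβ : 0 ≤ β) (hb : 0 ≤ b)
    (hK : 1 ≤ K) (hc : 0 < c) (hξ : IsLocalizable P ξ C β b)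
    (hκ : ∀ᵐ x, weightedCorrelation ρ Q ξ ![1] ![x] = κ) :
    Integrable (covDensity ρ Q ξ κ) := by
  obtain ⟨B, Γ, hB, hΓ, hmix⟩ := hm.exists_cellPairSum_mixing ha₁ hahat hC hβ hb hK hc hξ
  let F : EuclideanSpace ℝ (Fin d) × EuclideanSpace ℝ (Fin d) → ℝ := fun p =>
    weightedCorrelation ρ Q ξ ![1, 1] ![p.1, p.2] - κ ^ 2
  have hF : Measurable F := (measurable_weightedCorrelation_two hQ hρ hξ.measurable).sub_const _
  have hFi : ∀ v, IntegrableOn F (cell 0 ×ˢ cell v) := fun v =>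
    hξ.integrableOn_cov hQ hρ hC hβ hK hm.exp_moment 0 v
  set I : (Fin d → ℤ) → ℝ := fun v => ∫ p in cell 0 ×ˢ cell v, |F p| with hI
  have hI0 : ∀ v, 0 ≤ I v := fun v => integral_nonneg fun p => abs_nonneg _
  -- Covers the finitely many offsets below the correlation length, where only finiteness is known.
  set B₀ : ℝ := ∑ v ∈ latticeBox d ⌈Γ⌉₊, I v with hB₀
  have hB₀0 : 0 ≤ B₀ := Finset.sum_nonneg fun v _ => hI0 v
  have hw : 0 < lengthExponent d a ahat b := by
    rw [lengthExponent]
    have h1 : 0 ≤ b * max 1 (d / ((1 - a) * ahat)) :=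
      mul_nonneg hb (zero_le_one.trans (le_max_left _ _))
    positivity
  obtain ⟨D, hDs, hD0, hD⟩ := exists_summable_decay d hΓ hw (add_nonneg hB hB₀0)
  have hID : ∀ v, I v ≤ D v := by
    intro v
    refine hD v _ (fun hv => ?_) fun N hN hv => ?_
    · have h1 : v ∈ latticeBox d ⌈Γ⌉₊ := by
        rw [mem_latticeBox]
        intro i
        have h2 := (norm_le_pi_norm v i).trans hv.le
        rw [Int.norm_eq_abs] at h2
        have h3 : |(v i : ℝ)| ≤ (⌈Γ⌉₊ : ℝ) := h2.trans (Nat.le_ceil Γ)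
        exact_mod_cast h3
      have := Finset.single_le_sum (f := I) (fun v _ => hI0 v) h1
      linarith
    · have hv0 : (0 : Fin d → ℤ) ≠ v := by
        rintro rfl
        have h1 : (1 : ℝ) ≤ (N : ℝ) ^ lengthExponent d a ahat b :=
          Real.one_le_rpow (by exact_mod_cast hN) hw.le
        rw [norm_zero] at hv
        nlinarith
      obtain ⟨h, hhm, hh1, hh⟩ := hξ.integral_abs_cov_eq hQ hρ hC hβ hK hm.exp_moment hκ hv0
      obtain ⟨hint, hbound⟩ := hmix h hhm hh1 N hN 0 v (by rwa [sub_zero])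
      calc I v = _ := hh hint
        _ ≤ _ := le_abs_self _
        _ ≤ _ := hbound
        _ ≤ _ := by gcongr; linarith
  have hsh := measurePreserving_shearEquiv (d := d)
  have hFs : Measurable fun p => F (shearEquiv d p) := hF.comp hsh.measurable
  have hind : Measurable fun p : EuclideanSpace ℝ (Fin d) × EuclideanSpace ℝ (Fin d) =>
      (cell (0 : Fin d → ℤ) ×ˢ Set.univ).indicator (fun p => ENNReal.ofReal |F p|) p :=
    hF.abs.ennreal_ofReal.indicator ((measurableSet_cell 0).prod MeasurableSet.univ)
  refine ⟨(measurable_covDensity hQ hρ hξ.measurable κ).aestronglyMeasurable, ?_⟩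
  rw [hasFiniteIntegral_iff_norm]
  have h1 : ∫⁻ z, ENNReal.ofReal ‖covDensity ρ Q ξ κ z‖ =
      ∫⁻ z, ∫⁻ x, (cell (0 : Fin d → ℤ) ×ˢ Set.univ).indicator (fun p => ENNReal.ofReal |F p|)
        (shearEquiv d (z, x)) := by
    refine lintegral_congr_ae ?_
    filter_upwards [ae_eq_covDensity hP hQ hρ hs κ] with z hz
    have h2 : ∀ x, (cell (0 : Fin d → ℤ) ×ˢ Set.univ).indicator (fun p => ENNReal.ofReal |F p|)
        (shearEquiv d (z, x)) = (cell (0 : Fin d → ℤ)).indicator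
          (fun x => ENNReal.ofReal |F (shearEquiv d (z, x))|) x := by
      intro x
      by_cases hx : x ∈ cell (0 : Fin d → ℤ)
      · rw [Set.indicator_of_mem hx, Set.indicator_of_mem]
        rw [shearEquiv_apply]
        exact ⟨hx, trivial⟩
      · rw [Set.indicator_of_notMem hx, Set.indicator_of_notMem]
        rw [shearEquiv_apply]
        exact fun h => hx h.1
    simp only [h2]
    rw [lintegral_indicator (measurableSet_cell 0)]
    have h3 : ∀ᵐ x, x ∈ cell (0 : Fin d → ℤ) → ENNReal.ofReal |F (shearEquiv d (z, x))| =
        ENNReal.ofReal ‖covDensity ρ Q ξ κ z‖ := by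
      filter_upwards [hz] with x hx _
      rw [← hx, shearEquiv_apply, Real.norm_eq_abs]
    rw [setLIntegral_congr_fun_ae (measurableSet_cell 0) h3, setLIntegral_const, volume_cell,
      mul_one]
  have h4 := (lintegral_prod (μ := volume) (ν := volume) (fun p =>
    (cell (0 : Fin d → ℤ) ×ˢ Set.univ).indicator (fun p => ENNReal.ofReal |F p|) (shearEquiv d p))
    (hind.comp hsh.measurable).aemeasurable).symm
  refine lt_of_eq_of_lt (h1.trans (h4.trans (hsh.lintegral_comp hind))) ?_
  rw [lintegral_indicator ((measurableSet_cell 0).prod MeasurableSet.univ), ← iUnion_cell,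
    Set.prod_iUnion, lintegral_iUnion (fun v => (measurableSet_cell 0).prod (measurableSet_cell v))
      fun v v' hv => Set.disjoint_prod.2 (Or.inr (pairwise_disjoint_cell hv))]
  refine lt_of_le_of_lt (ENNReal.tsum_le_tsum fun v => ?_) hDs.tsum_ofReal_lt_top
  rw [← ofReal_integral_eq_lintegral_ofReal (hFi v).abs (.of_forall fun p => abs_nonneg _)]
  exact ENNReal.ofReal_le_ofReal (hID v)

end CovarianceIntegrable

/-! ### Scaling of windows and continuity of autocorrelations -/

section Scaling

variable {d : ℕ}

theorem isBounded_window (d n : ℕ) : Bornology.IsBounded (window d n) := by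
  refine (Metric.isBounded_closedBall (x := 0) (r := d * ((n : ℝ) ^ (1 / (d : ℝ)) / 2))).subset
    fun x hx => Metric.mem_closedBall.2 (dist_le_of_abs_le (by positivity) fun i => ?_)
  simpa using hx i

theorem smul_mem_window_iff {n : ℕ} (hn : 1 ≤ n) {x : EuclideanSpace ℝ (Fin d)} :
    (n : ℝ) ^ (-(1 / (d : ℝ))) • x ∈ window d 1 ↔ x ∈ window d n := by
  have h0 : (0 : ℝ) < (n : ℝ) ^ (1 / (d : ℝ)) := by
    have : (0 : ℝ) < n := by exact_mod_cast hn
    positivity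
  refine forall_congr' fun i => ?_
  rw [PiLp.smul_apply, smul_eq_mul, abs_mul, Real.rpow_neg (by positivity),
    abs_of_pos (inv_pos.2 h0), inv_mul_le_iff₀ h0, Nat.cast_one, Real.one_rpow]
  ring_nf

/-- The autocorrelation is the L² inner product of F with its translates, and translations act
continuously on L². -/
theorem continuousAt_integral_mul_translate {F : EuclideanSpace ℝ (Fin d) → ℝ}
    (hF : MemLp F 2) : ContinuousAt (fun u => ∫ x, F x * F (x + u)) 0 := by
  let τ : EuclideanSpace ℝ (Fin d) → C(EuclideanSpace ℝ (Fin d), EuclideanSpace ℝ (Fin d)) :=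
    ContinuousMap.curry ⟨fun p => p.2 + p.1, by fun_prop⟩
  have hτ : Continuous τ := ContinuousMap.continuous _
  have hτm : ∀ u, MeasurePreserving (τ u) := fun u => measurePreserving_add_right volume u
  have h1 : Continuous fun u => inner ℝ (hF.toLp F)
      (Lp.compMeasurePreserving (τ u) (hτm u) (hF.toLp F)) :=
    continuous_const.inner (Continuous.compMeasurePreservingLp continuous_const hτ hτm (by simp))
  refine (h1.congr fun u => ?_).continuousAt
  rw [L2.inner_def, Lp.toLp_compMeasurePreserving]
  refine integral_congr_ae ?_
  filter_upwards [hF.coeFn_toLp, (hF.comp_measurePreserving (hτm u)).coeFn_toLp] with x hx hxu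
  rw [hx, hxu]
  exact mul_comm _ _

theorem integral_comp_scale (hd : 1 ≤ d) {n : ℕ} (hn : 1 ≤ n)
    (G : EuclideanSpace ℝ (Fin d) → ℝ) :
    ∫ x, G ((n : ℝ) ^ (-(1 / (d : ℝ))) • x) = n * ∫ x, G x := by
  have hn0 : (0 : ℝ) < n := by exact_mod_cast hn
  have hd0 : (d : ℝ) ≠ 0 := by positivity
  rw [Measure.integral_comp_smul, finrank_euclideanSpace, Fintype.card_fin, ← Real.rpow_natCast,
    ← Real.rpow_mul hn0.le, neg_mul, one_div_mul_cancel hd0, Real.rpow_neg_one, inv_inv,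
    abs_of_pos hn0, smul_eq_mul]

end Scaling

/-! ### Limit of the variance for scores of the whole configuration -/

section LimitVariance

variable {d : ℕ} {P : Measure (PointConfig d)}
  {ρ : (p : ℕ) → (Fin p → EuclideanSpace ℝ (Fin d)) → ℝ}
  {Q : (p : ℕ) → Kernel (Fin p → EuclideanSpace ℝ (Fin d)) (PointConfig d)}
  {ξ : EuclideanSpace ℝ (Fin d) → PointConfig d → ℝ} {C β b K κ₁ κ₂ : ℝ}

/-- The weights of the points in the `n`-th window. -/
noncomputable def windowWeight (f : EuclideanSpace ℝ (Fin d) → ℝ) (n : ℕ)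
    (x : EuclideanSpace ℝ (Fin d)) : ℝ :=
  (window d 1).indicator f ((n : ℝ) ^ (-(1 / (d : ℝ))) • x)

theorem windowWeight_of_notMem {f : EuclideanSpace ℝ (Fin d) → ℝ} {n : ℕ} (hn : 1 ≤ n)
    {x : EuclideanSpace ℝ (Fin d)} (hx : x ∉ window d n) : windowWeight f n x = 0 :=
  Set.indicator_of_notMem (fun h => hx ((smul_mem_window_iff hn).1 h)) _

theorem windowWeight_of_mem {f : EuclideanSpace ℝ (Fin d) → ℝ} {n : ℕ} (hn : 1 ≤ n)
    {x : EuclideanSpace ℝ (Fin d)} (hx : x ∈ window d n) :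
    windowWeight f n x = f ((n : ℝ) ^ (-(1 / (d : ℝ))) • x) :=
  Set.indicator_of_mem ((smul_mem_window_iff hn).2 hx) _

theorem abs_indicator_window_le {f : EuclideanSpace ℝ (Fin d) → ℝ} {M : ℝ} (hM : ∀ x, |f x| ≤ M)
    (x : EuclideanSpace ℝ (Fin d)) : |(window d 1).indicator f x| ≤ M := by
  by_cases hx : x ∈ window d 1
  · rw [Set.indicator_of_mem hx]
    exact hM x
  · rw [Set.indicator_of_notMem hx, abs_zero]
    exact (abs_nonneg _).trans (hM 0)

theorem measurable_windowWeight {f : EuclideanSpace ℝ (Fin d) → ℝ} (hf : Measurable f) (n : ℕ) :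
    Measurable (windowWeight f n) :=
  (hf.indicator (measurableSet_window d 1)).comp (measurable_const_smul _)

/-- After rescaling, the variance per volume is κ₂ Aut(0) plus the integral of the covariance
density against Aut(n^(-1/d) z), where Aut is the autocorrelation of f on the unit window. As Aut is
bounded and continuous at 0, dominated convergence replaces it by Aut(0) = ∫ f². -/
theorem tendsto_variance_finSum [IsProbabilityMeasure P] (hd : 1 ≤ d) (hP : IsStationaryLaw P)
    (hQ : IsPalm P ρ Q) (hρ : IsCorrelationFunction P ρ) (hs : IsScore ξ)
    (hξ : IsLocalizable P ξ C β b) (hC : 1 ≤ C) (hβ : 0 ≤ β) (hK1 : 1 ≤ K)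
    (hK : ∀ z, MeanLE P (fun X => (3 : ℝ) ^ (X.carrier ∩ cell z).ncard) K)
    (h₁ : ∀ᵐ x, weightedCorrelation ρ Q ξ ![1] ![x] = κ₁)
    (h₂ : ∀ᵐ x, weightedCorrelation ρ Q ξ ![2] ![x] = κ₂)
    (hint : Integrable (covDensity ρ Q ξ κ₁)) {f : EuclideanSpace ℝ (Fin d) → ℝ}
    (hf : Measurable f) {M : ℝ} (hM : ∀ x, |f x| ≤ M) :
    Filter.Tendsto (fun n : ℕ =>
      (∫ X, (X.finSum (window d n) fun x => windowWeight f n x * ξ x X) ^ 2 ∂P -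
        (∫ X, X.finSum (window d n) fun x => windowWeight f n x * ξ x X ∂P) ^ 2) / n)
      Filter.atTop
      (nhds ((κ₂ + ∫ z, covDensity ρ Q ξ κ₁ z) * ∫ x in window d 1, f x ^ 2)) := by
  set F : EuclideanSpace ℝ (Fin d) → ℝ := (window d 1).indicator f with hF
  have hFm : Measurable F := hf.indicator (measurableSet_window d 1)
  have hFM : ∀ x, |F x| ≤ M := abs_indicator_window_le hM
  have hM0 : 0 ≤ M := (abs_nonneg _).trans (hM 0)
  have hfin : volume (window d 1) < ∞ := (isBounded_window d 1).measure_lt_top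
  have hF2 : MemLp F 2 := by
    have : IsFiniteMeasure (volume.restrict (window d 1)) := ⟨by simpa using hfin⟩
    rw [hF, memLp_indicator_iff_restrict (measurableSet_window d 1)]
    exact MemLp.of_bound hf.aestronglyMeasurable M (.of_forall hM)
  have hF1 : Integrable F := by
    have : IsFiniteMeasure (volume.restrict (window d 1)) := ⟨by simpa using hfin⟩
    rw [hF, integrable_indicator_iff (measurableSet_window d 1)]
    exact Integrable.of_bound hf.aestronglyMeasurable M (.of_forall hM)
  let Aut : EuclideanSpace ℝ (Fin d) → ℝ := fun u => ∫ x, F x * F (x + u)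
  have hAm : Measurable Aut := by
    have : Measurable fun p : EuclideanSpace ℝ (Fin d) × EuclideanSpace ℝ (Fin d) =>
        F p.2 * F (p.2 + p.1) := by fun_prop
    exact (this.stronglyMeasurable.integral_prod_right' (ν := volume)).measurable
  have hA0 : Aut 0 = ∫ x in window d 1, f x ^ 2 := by
    rw [← integral_indicator (measurableSet_window d 1)]
    refine integral_congr_ae (.of_forall fun x => ?_)
    by_cases hx : x ∈ window d 1 <;> simp [F, hx, sq]
  have hAb : ∀ u, |Aut u| ≤ M * ∫ x, |F x| := by
    intro u
    rw [← integral_const_mul]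
    refine (abs_integral_le_integral_abs).trans (integral_mono_of_nonneg
      (.of_forall fun x => abs_nonneg _) (hF1.abs.const_mul M) (.of_forall fun x => ?_))
    dsimp only
    rw [abs_mul, mul_comm]
    exact mul_le_mul_of_nonneg_right (hFM _) (abs_nonneg _)
  have hscale : Filter.Tendsto (fun n : ℕ => (n : ℝ) ^ (-(1 / (d : ℝ)))) Filter.atTop (nhds 0) :=
    (tendsto_rpow_neg_atTop (by
      have : (0 : ℝ) < d := by exact_mod_cast hd
      positivity)).comp tendsto_natCast_atTop_atTop
  have hlim : Filter.Tendsto (fun n : ℕ => ∫ z, covDensity ρ Q ξ κ₁ z *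
      Aut ((n : ℝ) ^ (-(1 / (d : ℝ))) • z)) Filter.atTop
      (nhds (∫ z, covDensity ρ Q ξ κ₁ z * Aut 0)) := by
    refine tendsto_integral_of_dominated_convergence
      (fun z => |covDensity ρ Q ξ κ₁ z| * (M * ∫ x, |F x|)) (fun n => ?_) (hint.abs.mul_const _)
      (fun n => .of_forall fun z => ?_) (.of_forall fun z => ?_)
    · exact ((measurable_covDensity hQ hρ hs.measurable κ₁).mul
        (hAm.comp (measurable_const_smul _))).aestronglyMeasurable
    · rw [Real.norm_eq_abs, abs_mul]
      exact mul_le_mul_of_nonneg_left (hAb _) (abs_nonneg _)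
    · refine Filter.Tendsto.const_mul _ ?_
      have h3 := (continuousAt_integral_mul_translate hF2).tendsto
      refine h3.comp ?_
      simpa using hscale.smul_const z
  have hlim' := hlim.add_const (κ₂ * Aut 0)
  rw [integral_mul_const, ← add_mul, hA0, add_comm (∫ z, covDensity ρ Q ξ κ₁ z)] at hlim'
  refine hlim'.congr' ?_
  filter_upwards [Filter.eventually_ge_atTop 1] with n hn
  have hn0 : (0 : ℝ) < n := by exact_mod_cast hn
  obtain ⟨hI, hI2⟩ := hξ.integrable_sq_finSum_abs hC hβ hK1 hK (isBounded_window d n)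
    (measurableSet_window d n)
  have hwm := measurable_windowWeight hf n
  have hwi : Integrable (windowWeight f n) := by
    refine hF1.comp_smul (R := (n : ℝ) ^ (-(1 / (d : ℝ)))) ?_
    positivity
  rw [variance_finSum_mul hP hQ hρ hs h₁ h₂ (isBounded_window d n) hI hI2 hwm
    (fun x hx => windowWeight_of_notMem hn hx) (fun x => hFM _) hwi, eq_div_iff hn0.ne', add_mul,
    ← integral_mul_const]
  congr 1
  · refine integral_congr_ae (.of_forall fun z => ?_)
    have h4 := integral_comp_scale hd hn fun x => F x * F (x + (n : ℝ) ^ (-(1 / (d : ℝ))) • z)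
    dsimp only
    simp only [windowWeight, smul_add]
    rw [h4]
    ring
  · have h4 := integral_comp_scale hd hn fun x => F x ^ 2
    simp only [windowWeight]
    rw [h4, ← hA0]
    simp only [Aut, add_zero, sq]
    ring

end LimitVariance

/-! ### Covering the window by cells -/

section WindowBox

variable {d : ℕ}

/-- The indices of the cells that meet the `n`-th window. -/
noncomputable def windowBox (d n : ℕ) : Finset (Fin d → ℤ) :=
  latticeBox d ⌊(n : ℝ) ^ (1 / (d : ℝ)) / 2 + 1 / 2⌋₊

theorem window_subset_iUnion_cell (d n : ℕ) : window d n ⊆ ⋃ z ∈ windowBox d n, cell z := by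
  intro x hx
  refine Set.mem_biUnion (x := cellIndex x) ?_ (mem_cell_iff.2 rfl)
  rw [Finset.mem_coe, windowBox, mem_latticeBox]
  intro i
  have h1 := hx i
  have h2 := (mem_cell_iff.2 (rfl : cellIndex x = cellIndex x)) i
  have h4 : ((cellIndex x i).natAbs : ℝ) ≤ (n : ℝ) ^ (1 / (d : ℝ)) / 2 + 1 / 2 := by
    rw [Nat.cast_natAbs, Int.cast_abs]
    rw [abs_le] at h1 ⊢
    constructor <;> linarith
  have h5 := Nat.le_floor h4
  rw [Int.abs_eq_natAbs]
  exact_mod_cast h5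

theorem finSum_window {n : ℕ} (X : PointConfig d) {g : EuclideanSpace ℝ (Fin d) → ℝ}
    (hg : ∀ x ∉ window d n, g x = 0) :
    X.finSum (window d n) g = ∑ z ∈ windowBox d n, X.finSum (cell z) g :=
  X.finSum_biUnion _ isBounded_cell pairwise_disjoint_cell (window_subset_iUnion_cell d n) hg

theorem card_windowBox_le (hd : 1 ≤ d) {n : ℕ} (hn : 1 ≤ n) :
    ((windowBox d n).card : ℝ) ≤ 3 ^ d * n := by
  have hd0 : (d : ℝ) ≠ 0 := by positivity
  have h1 : (1 : ℝ) ≤ (n : ℝ) ^ (1 / (d : ℝ)) :=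
    Real.one_le_rpow (by exact_mod_cast hn) (by positivity)
  have h2 := Nat.floor_le (show (0 : ℝ) ≤ (n : ℝ) ^ (1 / (d : ℝ)) / 2 + 1 / 2 by positivity)
  rw [windowBox, card_latticeBox]
  push_cast
  calc (2 * (⌊(n : ℝ) ^ (1 / (d : ℝ)) / 2 + 1 / 2⌋₊ : ℝ) + 1) ^ d
      ≤ (3 * (n : ℝ) ^ (1 / (d : ℝ))) ^ d := by
        refine pow_le_pow_left₀ (by positivity) ?_ d
        linarith
    _ = 3 ^ d * n := by
        rw [mul_pow, ← Real.rpow_natCast ((n : ℝ) ^ _), ← Real.rpow_mul (by positivity),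
          one_div_mul_cancel hd0, Real.rpow_one]

/-- The limit does not depend on the fixed shift q, so cells within a bounded distance of the
boundary are negligible. -/
theorem tendsto_card_latticeBox (hd : 1 ≤ d) (q : ℝ) :
    Filter.Tendsto (fun n : ℕ =>
      ((latticeBox d ⌊(n : ℝ) ^ (1 / (d : ℝ)) / 2 + q⌋₊).card : ℝ) / n) Filter.atTop (nhds 1) := by
  have hd0 : (d : ℝ) ≠ 0 := by positivity
  have hs := tendsto_window_side hd
  have h1 : Filter.Tendsto (fun s : ℝ => (⌊s + q⌋₊ : ℝ) / (s + q) * ((s + q) / s) + (2 * s)⁻¹)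
      Filter.atTop (nhds (1 * 1 + 0)) := by
    refine Filter.Tendsto.add (Filter.Tendsto.mul ?_ ?_) ?_
    · exact (tendsto_nat_floor_div_atTop (R := ℝ)).comp (Filter.tendsto_atTop_add_const_right _ q
        Filter.tendsto_id)
    · have h2 : Filter.Tendsto (fun s : ℝ => 1 + q * s⁻¹) Filter.atTop (nhds (1 + q * 0)) :=
        (tendsto_inv_atTop_zero.const_mul q).const_add 1
      rw [mul_zero, add_zero] at h2
      refine h2.congr' ?_
      filter_upwards [Filter.eventually_gt_atTop 0] with s hs0
      field_simp
    · exact tendsto_inv_atTop_zero.comp (Filter.Tendsto.const_mul_atTop two_pos Filter.tendsto_id)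
  have h3 := (h1.comp hs).pow d
  rw [mul_one, add_zero, one_pow] at h3
  refine h3.congr' ?_
  have h4 := hs.eventually (Filter.eventually_gt_atTop (max 0 (-q)))
  filter_upwards [h4, Filter.eventually_ge_atTop 1] with n hn hn1
  have hn0 : (0 : ℝ) < n := by exact_mod_cast hn1
  set s : ℝ := (n : ℝ) ^ (1 / (d : ℝ)) / 2 with hsdef
  have hs0 : 0 < s := (le_max_left _ _).trans_lt hn
  have hsq : 0 < s + q := by
    have := (le_max_right 0 (-q)).trans_lt hn
    linarith
  have hnd : (n : ℝ) = (2 * s) ^ d := by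
    rw [hsdef, mul_div_cancel₀ _ two_ne_zero, ← Real.rpow_natCast, ← Real.rpow_mul (by positivity),
      one_div_mul_cancel hd0, Real.rpow_one]
  rw [card_latticeBox, hnd]
  push_cast
  rw [← div_pow]
  simp only [Function.comp]
  congr 1
  rw [← hsdef]
  field_simp

end WindowBox

/-! ### Covariances of cell sums -/

section CellCovariance

variable {d : ℕ} {P : Measure (PointConfig d)} {g : EuclideanSpace ℝ (Fin d) → PointConfig d → ℝ}
  {a ahat C β b K c : ℝ}

/-- The covariance of the sums of `g` over two cells. -/
noncomputable def cellCov (P : Measure (PointConfig d))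
    (g : EuclideanSpace ℝ (Fin d) → PointConfig d → ℝ) (z z' : Fin d → ℤ) : ℝ :=
  ∫ X, X.finSum (cell z) (fun x => g x X) * X.finSum (cell z') (fun x => g x X) ∂P -
    cellMean P g z * cellMean P g z'

theorem IsLocalizable.memLp_cellSum [IsProbabilityMeasure P] (hg : IsLocalizable P g C β b)
    (hC : 1 ≤ C) (hβ : 0 ≤ β) (hK1 : 1 ≤ K)
    (hK : ∀ z, MeanLE P (fun X => (3 : ℝ) ^ (X.carrier ∩ cell z).ncard) K) (z : Fin d → ℤ) :
    MemLp (fun X : PointConfig d => X.finSum (cell z) fun x => g x X) 2 P := by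
  have hm := measurable_cellSum hg.measurable z
  refine (memLp_two_iff_integrable_sq hm.aestronglyMeasurable).2 ?_
  refine (hg.cellSum_moment hC hβ hK1 hK z (k := 2) (by norm_num)).1.mono'
    (hm.pow_const 2).aestronglyMeasurable (.of_forall fun X => ?_)
  rw [Real.norm_of_nonneg (by positivity), ← sq_abs]
  exact pow_le_pow_left₀ (abs_nonneg _) (X.abs_finSum_le (isBounded_cell z) _) 2

theorem IsLocalizable.sq_sub_sq_eq_sum_cellCov [IsProbabilityMeasure P]
    (hg : IsLocalizable P g C β b) (hC : 1 ≤ C) (hβ : 0 ≤ β) (hK1 : 1 ≤ K)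
    (hK : ∀ z, MeanLE P (fun X => (3 : ℝ) ^ (X.carrier ∩ cell z).ncard) K)
    (Z : Finset (Fin d → ℤ)) :
    ∫ X, (∑ z ∈ Z, X.finSum (cell z) fun x => g x X) ^ 2 ∂P -
      (∫ X, ∑ z ∈ Z, X.finSum (cell z) (fun x => g x X) ∂P) ^ 2 =
      ∑ z ∈ Z, ∑ z' ∈ Z, cellCov P g z z' := by
  have hL := hg.memLp_cellSum hC hβ hK1 hK
  have hI : ∀ z z', Integrable (fun X : PointConfig d =>
      X.finSum (cell z) (fun x => g x X) * X.finSum (cell z') (fun x => g x X)) P :=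
    fun z z' => (hL z).integrable_mul (hL z')
  simp only [sq, Finset.sum_mul_sum, cellCov, Finset.sum_sub_distrib]
  rw [integral_finsetSum _ fun z _ => integrable_finsetSum _ fun z' _ => hI z z',
    integral_finsetSum _ fun z _ => (hL z).integrable (by norm_num), Finset.sum_mul_sum]
  congr 1
  exact Finset.sum_congr rfl fun z _ => integral_finsetSum _ fun z' _ => hI z z'

/-- One summable dominating function works for all fields with the same localization constants,
hence for all windows at once. Mixing is used with centering e = 0, for which the bound is already
one on covariances. -/
theorem IsMixing.exists_cellCov_bound [IsProbabilityMeasure P] (h : IsMixing P a ahat K c)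
    (ha₁ : a < 1) (hahat : 0 < ahat) (hC : 1 ≤ C) (hβ : 0 ≤ β) (hb : 0 ≤ b) (hK : 1 ≤ K)
    (hc : 0 < c) :
    ∃ D : (Fin d → ℤ) → ℝ, Summable D ∧ (∀ v, 0 ≤ D v) ∧
      ∀ g : EuclideanSpace ℝ (Fin d) → PointConfig d → ℝ, IsLocalizable P g C β b →
      ∀ z z', |cellCov P g z z'| ≤ D (z' - z) := by
  obtain ⟨B, Γ, hB, hΓ, hmain⟩ := h.exists_prod_mixing (β := β) (b := b) ha₁ hahat hC hβ hb hK hc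
  have h2 : (1 : ℝ) ≤ 2 ^ (1 / ((1 - a) * ahat)) :=
    Real.one_le_rpow (by norm_num) (by have : 0 < 1 - a := by linarith
                                       positivity)
  have hw : 0 < lengthExponent d a ahat b := by
    rw [lengthExponent]
    have h1 : 0 ≤ b * max 1 (d / ((1 - a) * ahat)) :=
      mul_nonneg hb (zero_le_one.trans (le_max_left _ _))
    positivity
  set B₀ : ℝ := (2 * envelopeConst K C β * 2 ^ (β + 1)) ^ 2 * (2 ! : ℝ) ^ (β + 1) with hB₀
  have hB₀0 : 0 ≤ B₀ := by positivity
  obtain ⟨D, hDs, hD0, hD⟩ := exists_summable_decay d (one_le_mul_of_one_le_of_one_le hΓ h2) hw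
    (B := B ^ 2 * (2 ! : ℝ) ^ (β + 1) + (B₀ + C ^ 2)) (by positivity)
  refine ⟨D, hDs, hD0, fun g hg z z' => hD _ _ (fun _ => ?_) fun N hN hv => ?_⟩
  · have h3 := hg.prod_centeredCellSum hC hβ hK h.exp_moment (Finset.univ : Finset (Fin 2)) ![z, z']
      (e := 0) fun z => by simp; linarith
    simp only [centeredCellSum, Fin.prod_univ_two, Matrix.cons_val_zero, Matrix.cons_val_one,
      Pi.zero_apply, sub_zero, Finset.card_univ, Fintype.card_fin] at h3
    have h4 := (abs_integral_le_integral_abs).trans h3.2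
    have h5 := mul_le_mul (hg.abs_cellMean_le z) (hg.abs_cellMean_le z') (abs_nonneg _) (by linarith)
    rw [← abs_mul, ← sq] at h5
    rw [cellCov]
    refine (abs_sub _ _).trans ?_
    have : 0 ≤ B ^ 2 * (2 ! : ℝ) ^ (β + 1) := by positivity
    linarith
  · have h3 := hmain g hg 0 (fun z => by simp; linarith) N hN (Fin 2) {0} {1} ![z, z']
      fun i hi j hj => by
        rw [Finset.mem_singleton] at hi hj
        subst hi hj
        refine le_trans (le_of_eq ?_) (hv.trans (norm_sub_le_dist_latticePoint z z'))
        norm_num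
    simp only [centeredCellSum, Finset.prod_singleton, Matrix.cons_val_zero, Matrix.cons_val_one,
      Pi.zero_apply, sub_zero, Finset.card_singleton] at h3
    refine (le_of_eq rfl).trans (h3.trans ?_)
    norm_num
    have : 0 ≤ (B₀ + C ^ 2) * Real.exp (-(N / 2)) := by positivity
    rw [add_mul]
    linarith

end CellCovariance

/-! ### Window scores versus whole-space scores in interior cells -/

section Comparison

variable {d : ℕ} {P : Measure (PointConfig d)} {ξ : EuclideanSpace ℝ (Fin d) → PointConfig d → ℝ}
  {W : Set (EuclideanSpace ℝ (Fin d))} {w f : EuclideanSpace ℝ (Fin d) → ℝ}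
  {C C₀ β b a ahat K c : ℝ}

/-- The scores in cells well inside of a window hardly depend on the window. -/
theorem abs_integral_prod_cellSum_sub_le [IsProbabilityMeasure P] (hC : 1 ≤ C) (hβ : 0 ≤ β)
    (hK1 : 1 ≤ K) (hK : ∀ z, MeanLE P (fun X => (3 : ℝ) ^ (X.carrier ∩ cell z).ncard) K)
    (hR : Measurable (Function.uncurry (stabRadius ξ))) (hC₀ : 1 ≤ C₀)
    (hstab : ∀ z, ∫⁻ X, X.pointSum ((cell z).indicator fun x => stabRadius ξ x X) ∂P ≤
      ENNReal.ofReal C₀)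
    (hY : IsLocalizable P (scoreField ξ W w) C β b)
    (hV : IsLocalizable P (scoreField ξ Set.univ w) C β b) {ι : Type*} (T : Finset ι)
    (u : ι → Fin d → ℤ) {r : ℕ} (hr : 1 ≤ r)
    (hW : ∀ i ∈ T, ∀ x ∈ cell (u i), Metric.closedBall x r ⊆ W) :
    |∫ X, ∏ i ∈ T, X.finSum (cell (u i)) (fun x => scoreField ξ W w x X) ∂P -
      ∫ X, ∏ i ∈ T, X.finSum (cell (u i)) (fun x => scoreField ξ Set.univ w x X) ∂P| ≤
      4 * ((2 * envelopeConst K C β * 2 ^ (β + 1)) ^ T.card * (T.card ! : ℝ) ^ (β + 1)) *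
        √(T.card * C₀ / r) := by
  have hC0 : 0 ≤ C := by linarith
  have hE := one_le_envelopeConst (β := β) hC hK1
  rcases T.eq_empty_or_nonempty with rfl | hT
  · simp
  have hT1 : (0 : ℝ) < T.card := by exact_mod_cast hT.card_pos
  have hr0 : (0 : ℝ) < r := by exact_mod_cast hr
  have hbd : ∀ g : EuclideanSpace ℝ (Fin d) → PointConfig d → ℝ, ∀ X : PointConfig d,
      |∏ i ∈ T, X.finSum (cell (u i)) (fun x => g x X)| ≤ ∏ i ∈ T, envelope g C (u i) X := by
    intro g X
    rw [Finset.abs_prod]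
    refine Finset.prod_le_prod (fun i _ => abs_nonneg _) fun i _ => ?_
    exact (X.abs_finSum_le (isBounded_cell _) _).trans (le_add_of_nonneg_right hC0)
  have hm : ∀ g : EuclideanSpace ℝ (Fin d) → PointConfig d → ℝ, Measurable (Function.uncurry g) →
      Measurable fun X : PointConfig d => ∏ i ∈ T, X.finSum (cell (u i)) (fun x => g x X) :=
    fun g hg => Finset.measurable_prod T fun i _ => measurable_cellSum hg (u i)
  have hme : ∀ g : EuclideanSpace ℝ (Fin d) → PointConfig d → ℝ, Measurable (Function.uncurry g) →
      Measurable fun X : PointConfig d => ∏ i ∈ T, envelope g C (u i) X :=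
    fun g hg => Finset.measurable_prod T fun i _ => measurable_envelope hg (u i)
  have hnn : ∀ (g : EuclideanSpace ℝ (Fin d) → PointConfig d → ℝ) (X : PointConfig d),
      0 ≤ ∏ i ∈ T, envelope g C (u i) X := fun g X =>
    Finset.prod_nonneg fun i _ => envelope_nonneg hC0 _ _
  set A := (2 * envelopeConst K C β * 2 ^ (β + 1)) ^ T.card * (T.card ! : ℝ) ^ (β + 1) with hA
  have hA0 : 0 < A := by positivity
  let G : PointConfig d → ℝ := fun X => (∏ i ∈ T, envelope (scoreField ξ W w) C (u i) X) +
    ∏ i ∈ T, envelope (scoreField ξ Set.univ w) C (u i) X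
  have hGm : Measurable G := (hme _ hY.measurable).add (hme _ hV.measurable)
  have hG2 : MeanLE P (fun X => G X ^ 2) ((2 * A) ^ 2) := by
    have h1 := ((hY.prod_envelope_sq hC hβ hK1 hK T u).add
      (hV.prod_envelope_sq hC hβ hK1 hK T u)).const_mul (show (0 : ℝ) ≤ 2 by norm_num)
    refine (h1.mono (hGm.pow_const 2) fun X => ?_).le (by rw [← hA]; ring_nf; rfl)
    rw [abs_of_nonneg (sq_nonneg _)]
    exact add_sq_le
  have hG1 : Integrable G P :=
    (integrable_norm_iff hGm.aestronglyMeasurable).1 (MeanLE.of_sq (by positivity) hGm hG2).1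
  let N : PointConfig d → ℝ≥0∞ := fun X =>
    ∑ i ∈ T, X.pointSum ((cell (u i)).indicator fun x => stabRadius ξ x X)
  have hNm : Measurable N := Finset.measurable_fun_sum T fun i _ =>
    measurable_indicator_uncurry hR (measurableSet_cell _) (isBounded_cell _)
  have hN : ∫⁻ X, N X ∂P ≤ ENNReal.ofReal (T.card * C₀) := by
    rw [lintegral_finsetSum _ fun i _ =>
      measurable_indicator_uncurry hR (measurableSet_cell _) (isBounded_cell _)]
    refine (Finset.sum_le_sum fun i _ => hstab (u i)).trans_eq ?_
    rw [Finset.sum_const, nsmul_eq_mul, ENNReal.ofReal_mul hT1.le, ENNReal.ofReal_natCast]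
  -- Unless the radii in the cells sum to at least r, every one of them is at most r, and the scores
  -- agree because the r-balls lie in W. Markov's inequality for the first moment suffices.
  have hD : P.real {X | (r : ℝ≥0∞) ≤ N X} ≤ √(T.card * C₀ / r) ^ 2 := by
    rw [Real.sq_sqrt (by positivity), measureReal_def]
    refine ENNReal.toReal_le_of_le_ofReal (by positivity) ?_
    refine (meas_ge_le_lintegral_div hNm.aemeasurable (by exact_mod_cast hr0.ne') (by simp)).trans ?_
    rw [ENNReal.ofReal_div_of_pos hr0, ENNReal.ofReal_natCast]
    gcongr
  refine (abs_integral_sub_le_of_eq_off (a := 2 * A) (by positivity)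
    (Real.sqrt_pos.2 (by positivity)) (hm _ hY.measurable) (hm _ hV.measurable)
    (fun X => (hbd _ X).trans (le_add_of_nonneg_right (hnn _ X)))
    (fun X => (hbd _ X).trans (le_add_of_nonneg_left (hnn _ X))) hG1 hG2
    (measurableSet_le measurable_const hNm) hD fun X hX => ?_).trans_eq (by ring)
  refine Finset.prod_congr rfl fun i hi => X.finSum_congr fun x hx => ?_
  have h1 : stabRadius ξ x X ≤ r := by
    refine le_trans ?_ (not_le.1 hX).le
    refine le_trans ?_ (Finset.single_le_sum
      (f := fun i => X.pointSum ((cell (u i)).indicator fun x => stabRadius ξ x X))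
      (fun i _ => zero_le) hi)
    refine le_trans ?_ (ENNReal.le_tsum (⟨x, hx.1⟩ : X.carrier))
    rw [Set.indicator_of_mem hx.2]
  have hball := hW i hi x hx.2
  have hxW : x ∈ W := hball (Metric.mem_closedBall_self (by positivity))
  rw [scoreField, scoreField, Set.indicator_of_mem hxW, Set.indicator_of_mem (Set.mem_univ x),
    show X.restrict Set.univ = X from PointConfig.ext_carrier (Set.inter_univ _),
    score_congr_of_stabRadius_le (X.restrict_restrict_of_subset hball).symm h1]

theorem exists_abs_cellCov_sub_le [IsProbabilityMeasure P] (hC : 1 ≤ C) (hβ : 0 ≤ β)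
    (hK1 : 1 ≤ K) (hK : ∀ z, MeanLE P (fun X => (3 : ℝ) ^ (X.carrier ∩ cell z).ncard) K)
    (hR : Measurable (Function.uncurry (stabRadius ξ))) (hC₀ : 1 ≤ C₀)
    (hstab : ∀ z, ∫⁻ X, X.pointSum ((cell z).indicator fun x => stabRadius ξ x X) ∂P ≤
      ENNReal.ofReal C₀) {ε : ℝ} (hε : 0 < ε) :
    ∃ r : ℕ, ∀ (W : Set (EuclideanSpace ℝ (Fin d))) (w : EuclideanSpace ℝ (Fin d) → ℝ),
      IsLocalizable P (scoreField ξ W w) C β b → IsLocalizable P (scoreField ξ Set.univ w) C β b →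
      ∀ z z', (∀ x ∈ cell z, Metric.closedBall x r ⊆ W) →
        (∀ x ∈ cell z', Metric.closedBall x r ⊆ W) →
        |cellCov P (scoreField ξ W w) z z' - cellCov P (scoreField ξ Set.univ w) z z'| ≤ ε := by
  set A : ℕ → ℝ := fun k => (2 * envelopeConst K C β * 2 ^ (β + 1)) ^ k * (k ! : ℝ) ^ (β + 1)
    with hA
  have hE := one_le_envelopeConst (β := β) hC hK1
  have hA0 : ∀ k, 0 ≤ A k := fun k => by positivity
  have hlim : Filter.Tendsto (fun r : ℕ => (4 * A 2 + 8 * C * A 1) * √(2 * C₀ / r)) Filter.atTop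
      (nhds ((4 * A 2 + 8 * C * A 1) * √0)) :=
    ((tendsto_const_div_atTop_nhds_zero_nat (2 * C₀)).sqrt).const_mul _
  rw [Real.sqrt_zero, mul_zero] at hlim
  obtain ⟨r, hr, hr1⟩ := ((hlim.eventually (eventually_lt_nhds hε)).and
    (Filter.eventually_ge_atTop 1)).exists
  refine ⟨r, fun W w hY hV z z' hz hz' => ?_⟩
  have hr0 : (0 : ℝ) < r := by exact_mod_cast hr1
  have hmean : ∀ z, (∀ x ∈ cell z, Metric.closedBall x r ⊆ W) →
      |cellMean P (scoreField ξ W w) z - cellMean P (scoreField ξ Set.univ w) z| ≤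
        4 * A 1 * √(2 * C₀ / r) := by
    intro z hz
    have h1 := abs_integral_prod_cellSum_sub_le hC hβ hK1 hK hR hC₀ hstab hY hV
      ({0} : Finset (Fin 1)) ![z] hr1 fun i hi x hx => by
        rw [Finset.mem_singleton] at hi
        subst hi
        exact hz x hx
    simp only [Finset.prod_singleton, Matrix.cons_val_zero, Finset.card_singleton] at h1
    refine h1.trans ?_
    have : 0 ≤ 4 * A 1 := by have := hA0 1; positivity
    refine mul_le_mul_of_nonneg_left (Real.sqrt_le_sqrt ?_) this
    push_cast
    gcongr
    norm_num
  have h2 := abs_integral_prod_cellSum_sub_le hC hβ hK1 hK hR hC₀ hstab hY hV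
    (Finset.univ : Finset (Fin 2)) ![z, z'] hr1 fun i _ => by
      fin_cases i
      · exact hz
      · exact hz'
  simp only [Fin.prod_univ_two, Matrix.cons_val_zero, Matrix.cons_val_one, Finset.card_univ,
    Fintype.card_fin] at h2
  have m1 := hmean z hz
  have m2 := hmean z' hz'
  have c1 := hY.abs_cellMean_le z
  have c2 := hV.abs_cellMean_le z'
  rw [cellCov, cellCov]
  generalize cellMean P (scoreField ξ W w) z = y at *
  generalize cellMean P (scoreField ξ Set.univ w) z = v at *
  generalize cellMean P (scoreField ξ W w) z' = y' at *
  generalize cellMean P (scoreField ξ Set.univ w) z' = v' at *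
  -- The product of the means is compared factor by factor; the means are bounded by C.
  have h3 : |y * y' - v * v'| ≤ C * (4 * A 1 * √(2 * C₀ / r)) + (4 * A 1 * √(2 * C₀ / r)) * C := by
    rw [show y * y' - v * v' = y * (y' - v') + (y - v) * v' by ring]
    refine (abs_add_le _ _).trans ?_
    rw [abs_mul, abs_mul]
    have := hA0 1
    exact add_le_add (mul_le_mul c1 m2 (abs_nonneg _) (by linarith))
      (mul_le_mul m1 c2 (abs_nonneg _) (by positivity))
  push_cast at h2
  rw [sub_sub_sub_comm]
  refine (abs_sub _ _).trans ((add_le_add h2 h3).trans (le_trans (le_of_eq ?_) hr.le))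
  simp only [hA]
  ring

end Comparison

/-! ### Boundary cells are negligible -/

section BoundaryCells

variable {d : ℕ}

/-- A sum over pairs of cells of the window is `o(n)` if the terms are dominated by a summable
function of the offset and are small for pairs of cells far from the boundary. -/
theorem tendsto_sum_windowBox_div (hd : 1 ≤ d) {Δ : ℕ → (Fin d → ℤ) → (Fin d → ℤ) → ℝ}
    {D : (Fin d → ℤ) → ℝ} (hD : Summable D) (hD0 : ∀ v, 0 ≤ D v)
    (hΔ0 : ∀ n z z', 0 ≤ Δ n z z') (hΔD : ∀ n, 1 ≤ n → ∀ z z', Δ n z z' ≤ D (z' - z))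
    (hΔ : ∀ ε : ℝ, 0 < ε → ∃ r : ℕ, ∀ n : ℕ, 1 ≤ n → ∀ z z',
      (∀ i, |(z i : ℝ)| + 1 / 2 + r ≤ (n : ℝ) ^ (1 / (d : ℝ)) / 2) →
      (∀ i, |(z' i : ℝ)| + 1 / 2 + r ≤ (n : ℝ) ^ (1 / (d : ℝ)) / 2) → Δ n z z' ≤ ε) :
    Filter.Tendsto (fun n : ℕ => (∑ z ∈ windowBox d n, ∑ z' ∈ windowBox d n, Δ n z z') / (n : ℝ))
      Filter.atTop (nhds 0) := by
  have hinj : ∀ z : Fin d → ℤ, Function.Injective fun z' : Fin d → ℤ => z' - z :=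
    fun z => sub_left_injective
  have hrow : ∀ n, 1 ≤ n → ∀ z, ∑ z' ∈ windowBox d n, Δ n z z' ≤ ∑' v, D v := fun n hn z => by
    refine (Finset.sum_le_sum fun z' _ => hΔD n hn z z').trans ?_
    rw [← Finset.sum_image (f := D) (g := fun z' => z' - z) (hinj z).injOn]
    exact hD.sum_le_tsum _ fun v _ => hD0 v
  rw [Metric.tendsto_atTop']
  suffices h : ∀ ε : ℝ, 0 < ε → ∀ᶠ n : ℕ in Filter.atTop,
      (∑ z ∈ windowBox d n, ∑ z' ∈ windowBox d n, Δ n z z') / (n : ℝ) < 3 * ε by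
    intro ε hε
    obtain ⟨N, hN⟩ := Filter.eventually_atTop.1 (h (ε / 3) (by positivity))
    refine ⟨N, fun n hn => ?_⟩
    rw [Real.dist_eq, sub_zero, abs_of_nonneg (div_nonneg (Finset.sum_nonneg fun z _ =>
      Finset.sum_nonneg fun z' _ => hΔ0 n z z') n.cast_nonneg)]
    linarith [hN n hn.le]
  intro ε hε
  -- Offsets outside the finite set V contribute at most ε to each row. The finitely many offsets in
  -- V are handled by the smallness far from the boundary, and rows near the boundary by their
  -- number.
  obtain ⟨V, hV⟩ := summable_iff_vanishing_norm.1 hD ε hε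
  obtain ⟨R, hR⟩ : ∃ R : ℕ, ∀ v ∈ V, ∀ i, |v i| ≤ R := by
    refine ⟨V.sup fun v => Finset.univ.sup fun i => (v i).natAbs, fun v hv i => ?_⟩
    rw [Int.abs_eq_natAbs, Nat.cast_le]
    exact (Finset.le_sup (f := fun i => (v i).natAbs) (Finset.mem_univ i)).trans
      (Finset.le_sup (f := fun v => Finset.univ.sup fun i => (v i).natAbs) hv)
  obtain ⟨r, hr⟩ := hΔ (ε / (V.card + 1)) (by positivity)
  -- The inner box: its cells keep distance r from the boundary even after a shift by an offset in
  -- V, whose coordinates are at most R.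
  set q : ℝ := -1 / 2 - r - R with hq
  set I : ℕ → Finset (Fin d → ℤ) := fun n => latticeBox d ⌊(n : ℝ) ^ (1 / (d : ℝ)) / 2 + q⌋₊ with hI
  have hIB : ∀ n, I n ⊆ windowBox d n := fun n z hz => by
    rw [windowBox, mem_latticeBox]
    rw [hI, mem_latticeBox] at hz
    refine fun i => (hz i).trans ?_
    have : (0 : ℝ) ≤ r + R := by positivity
    exact_mod_cast Nat.floor_le_floor (by rw [hq]; linarith)
  have hside := ((tendsto_window_side hd).eventually_ge_atTop (1 / 2 + r + R))
  have hlim := ((tendsto_card_latticeBox hd q).mul_const (2 * ε)).add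
    (((tendsto_card_latticeBox hd (1 / 2)).sub (tendsto_card_latticeBox hd q)).mul_const (∑' v, D v))
  rw [sub_self, zero_mul, one_mul, add_zero] at hlim
  filter_upwards [hlim.eventually_lt_const (by linarith : 2 * ε < 3 * ε), hside,
    Filter.eventually_ge_atTop 1] with n hn hsn hn1
  refine lt_of_le_of_lt ?_ hn
  have hn0 : (0 : ℝ) < n := by exact_mod_cast hn1
  rw [← sub_div, div_mul_eq_mul_div, div_mul_eq_mul_div, ← add_div]
  refine div_le_div_of_nonneg_right ?_ hn0.le
  rw [← Finset.sum_sdiff (hIB n), add_comm]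
  have hcard : ((windowBox d n \ I n).card : ℝ) = (windowBox d n).card - (I n).card := by
    rw [Finset.card_sdiff_of_subset (hIB n), Nat.cast_sub (Finset.card_le_card (hIB n))]
  refine add_le_add ?_ ?_
  · rw [← nsmul_eq_mul]
    refine Finset.sum_le_card_nsmul _ _ _ fun z hz => ?_
    have hz' : ∀ i, |(z i : ℝ)| ≤ (n : ℝ) ^ (1 / (d : ℝ)) / 2 + q := fun i => by
      rw [hI, mem_latticeBox] at hz
      have h1 : (|z i| : ℝ) ≤ (⌊(n : ℝ) ^ (1 / (d : ℝ)) / 2 + q⌋₊ : ℝ) := by exact_mod_cast hz i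
      exact h1.trans (Nat.floor_le (by rw [hq]; linarith))
    rw [← Finset.sum_filter_add_sum_filter_not _ (fun z' => z' - z ∈ V), two_mul]
    refine add_le_add ?_ ?_
    · refine (Finset.sum_le_card_nsmul _ _ (ε / (V.card + 1)) fun z' hz2 => ?_).trans ?_
      · rw [Finset.mem_filter] at hz2
        have hR0 : (0 : ℝ) ≤ R := R.cast_nonneg
        refine hr n hn1 z z' (fun i => by linarith [hz' i]) fun i => ?_
        have h2 : |(z' i : ℝ) - z i| ≤ R := by exact_mod_cast hR _ hz2.2 i
        have h3 := abs_add_le ((z' i : ℝ) - z i) (z i)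
        rw [sub_add_cancel] at h3
        linarith [hz' i]
      · have hc : ((windowBox d n).filter fun z' => z' - z ∈ V).card ≤ V.card :=
          Finset.card_le_card_of_injOn (fun z' => z' - z)
            (fun z' hz' => (Finset.mem_filter.1 hz').2) (hinj z).injOn
        rw [nsmul_eq_mul]
        have hc' : (((windowBox d n).filter fun z' => z' - z ∈ V).card : ℝ) ≤ V.card := by
          exact_mod_cast hc
        calc _ ≤ ((V.card : ℝ) + 1) * (ε / (V.card + 1)) := by gcongr; linarith
          _ = ε := by field_simp
    · refine (Finset.sum_le_sum fun z' _ => hΔD n hn1 z z').trans ?_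
      rw [← Finset.sum_image (f := D) (g := fun z' => z' - z) (hinj z).injOn]
      refine (le_abs_self _).trans (hV _ ?_).le
      rw [Finset.disjoint_left]
      intro v hv hvV
      obtain ⟨z', hz2, rfl⟩ := Finset.mem_image.1 hv
      exact (Finset.mem_filter.1 hz2).2 hvV
  · rw [show (latticeBox d ⌊(n : ℝ) ^ (1 / (d : ℝ)) / 2 + 1 / 2⌋₊) = windowBox d n from rfl, ← hcard,
      ← nsmul_eq_mul]
    exact Finset.sum_le_card_nsmul _ _ _ fun z _ => hrow n hn1 z

end BoundaryCells

/-! ### Linear growth of the variance -/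

section VarianceLowerBound

variable {d : ℕ} {P : Measure (PointConfig d)}
  {ρ : (p : ℕ) → (Fin p → EuclideanSpace ℝ (Fin d)) → ℝ}
  {Q : (p : ℕ) → Kernel (Fin p → EuclideanSpace ℝ (Fin d)) (PointConfig d)}
  {ξ : EuclideanSpace ℝ (Fin d) → PointConfig d → ℝ} {f : EuclideanSpace ℝ (Fin d) → ℝ}
  {a ahat K c C β b M : ℝ}

theorem scoreField_univ (w : EuclideanSpace ℝ (Fin d) → ℝ) (x : EuclideanSpace ℝ (Fin d))
    (X : PointConfig d) : scoreField ξ Set.univ w x X = ξ x X * w x := by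
  rw [scoreField, Set.indicator_univ,
    show X.restrict Set.univ = X from PointConfig.ext_carrier (Set.inter_univ _)]

theorem geomStat_eq_sum_cell {n : ℕ} (hn : 1 ≤ n) (X : PointConfig d) :
    geomStat ξ f n X = ∑ z ∈ windowBox d n,
      X.finSum (cell z) fun x => scoreField ξ (window d n) (windowWeight f n) x X := by
  rw [← finSum_window X (g := fun x => scoreField ξ (window d n) (windowWeight f n) x X)
    fun x hx => Set.indicator_of_notMem hx _]
  refine finsum_mem_congr rfl fun x hx => ?_
  rw [scoreField, Set.indicator_of_mem hx.2, windowWeight_of_mem hn hx.2]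

/-- The variance of the statistic of the finite windows differs by `o(n)` from the variance of the
statistic whose scores are computed from the whole configuration. -/
theorem IsMixing.tendsto_sum_cellCov_sub [IsProbabilityMeasure P] (h : IsMixing P a ahat K c)
    (hd : 1 ≤ d) (ha₁ : a < 1) (hahat : 0 < ahat) (hK : 1 ≤ K) (hc : 0 < c)
    (hR : Measurable (Function.uncurry (stabRadius ξ))) (hC : 1 ≤ C) (hβ : 0 ≤ β) (hb : 0 ≤ b)
    {w : ℕ → EuclideanSpace ℝ (Fin d) → ℝ} {L : ℝ} (hL : 1 ≤ L)
    (hU : HasScoreMoments P ξ Set.univ C β b)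
    (hY : ∀ n, 1 ≤ n → IsLocalizable P (scoreField ξ (window d n) (w n)) L β b)
    (hV : ∀ n, IsLocalizable P (scoreField ξ Set.univ (w n)) L β b) :
    Filter.Tendsto (fun n : ℕ => (∑ z ∈ windowBox d n, ∑ z' ∈ windowBox d n,
      |cellCov P (scoreField ξ (window d n) (w n)) z z' -
        cellCov P (scoreField ξ Set.univ (w n)) z z'|) / (n : ℝ)) Filter.atTop (nhds 0) := by
  obtain ⟨D, hDs, hD0, hD⟩ := h.exists_cellCov_bound ha₁ hahat hL hβ hb hK hc
  have hstab : ∀ z, ∫⁻ X, X.pointSum ((cell z).indicator fun x => stabRadius ξ x X) ∂P ≤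
      ENNReal.ofReal C := fun z => by
    have h1 := hU.stab z 1 le_rfl
    simp only [Set.inter_univ, pow_one, Nat.factorial_one, Nat.cast_one, Real.one_rpow,
      mul_one] at h1
    refine le_trans (le_of_eq (lintegral_congr fun X => ?_)) h1
    rw [show X.restrict Set.univ = X from PointConfig.ext_carrier (Set.inter_univ _)]
  refine tendsto_sum_windowBox_div hd (hDs.mul_left 2) (fun v => by have := hD0 v; positivity)
    (fun n z z' => abs_nonneg _) (fun n hn z z' => ?_) fun ε hε => ?_
  · refine (abs_sub _ _).trans ?_
    linarith [hD _ (hY n hn) z z', hD _ (hV n) z z']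
  · obtain ⟨r, hr⟩ := exists_abs_cellCov_sub_le (b := b) hL hβ hK h.exp_moment hR hC hstab hε
    exact ⟨r, fun n hn z z' hz hz' => hr _ _ (hY n hn) (hV n) z z'
      (fun x hx => closedBall_subset_window hx hz) fun x hx => closedBall_subset_window hx hz'⟩

/-- For whole-space scores the variance per volume converges to a limit v, which is positive because
both the asymptotic variance and ∫ f² are. It eventually exceeds v/2, and passing to window scores
costs less than v/4. -/
theorem IsMixing.exists_variance_lower_bound [IsProbabilityMeasure P] (h : IsMixing P a ahat K c)
    (hd : 1 ≤ d) (hP : IsStationaryLaw P) (hQ : IsPalm P ρ Q) (hρ : IsCorrelationFunction P ρ)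
    (hξ : IsScore ξ) (hR : Measurable (Function.uncurry (stabRadius ξ)))
    (ha₁ : a < 1) (hahat : 0 < ahat) (hK : 1 ≤ K) (hc : 0 < c) (hC : 1 ≤ C) (hβ : 0 ≤ β)
    (hb : 0 ≤ b) (hmom : ∀ n : ℕ, 1 ≤ n → HasScoreMoments P ξ (window d n) C β b)
    (hσ : 0 < asympVariance ρ Q ξ) (hf : Measurable f) (hM : 1 ≤ M) (hfM : ∀ x, |f x| ≤ M)
    (hf_pos : 0 < ∫ x in window d 1, f x ^ 2) :
    ∃ v : ℝ, 0 < v ∧ ∃ n₀ : ℕ, ∀ n : ℕ, n₀ ≤ n →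
      v * n ≤ ∫ X, geomStat ξ f n X ^ 2 ∂P - (∫ X, geomStat ξ f n X ∂P) ^ 2 := by
  have hL : 1 ≤ 4 * C * M := by nlinarith
  have hU := HasScoreMoments.univ hd hξ.measurable hR hmom
  have hwM : ∀ n x, |windowWeight f n x| ≤ M := fun n x => abs_indicator_window_le hfM _
  have hY : ∀ n, 1 ≤ n → IsLocalizable P (scoreField ξ (window d n) (windowWeight f n))
      (4 * C * M) β b := fun n hn => (hmom n hn).isLocalizable hC hβ hb
    (measurableSet_window d n) hξ.measurable hR (measurable_windowWeight hf n) hM (hwM n)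
  have hV : ∀ n, IsLocalizable P (scoreField ξ Set.univ (windowWeight f n)) (4 * C * M) β b :=
    fun n => hU.isLocalizable hC hβ hb MeasurableSet.univ hξ.measurable hR
      (measurable_windowWeight hf n) hM (hwM n)
  have hL0 : IsLocalizable P ξ (4 * C * M) β b := by
    have h1 := hU.isLocalizable hC hβ hb MeasurableSet.univ hξ.measurable hR
      (w := fun _ => 1) measurable_const hM (fun x => by simpa using hM)
    have h2 : scoreField ξ Set.univ (fun _ => 1) = ξ := by
      funext x X
      rw [scoreField_univ, mul_one]
    rwa [h2] at h1
  obtain ⟨κ₁, h₁⟩ := ae_weightedCorrelation_one hP hQ hρ hξ 1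
  obtain ⟨κ₂, h₂⟩ := ae_weightedCorrelation_one hP hQ hρ hξ 2
  have hint := h.integrable_covDensity hP hQ hρ hξ ha₁ hahat hL hβ hb hK hc hL0 h₁
  have hlim := tendsto_variance_finSum hd hP hQ hρ hξ hL0 hL hβ hK h.exp_moment h₁ h₂ hint hf hfM
  rw [asympVariance_eq hP hQ hρ hξ h₁ h₂] at hσ
  have hpos := mul_pos (pos_of_mul_pos_right hσ measureReal_nonneg) hf_pos
  set v := (κ₂ + ∫ z, covDensity ρ Q ξ κ₁ z) * ∫ x in window d 1, f x ^ 2 with hv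
  have hcmp := h.tendsto_sum_cellCov_sub hd ha₁ hahat hK hc hR hC hβ hb hL hU hY hV
  obtain ⟨n₀, hn₀⟩ := Filter.eventually_atTop.1 ((hlim.eventually_const_lt
    (show v / 2 < v by linarith)).and ((hcmp.eventually_lt_const
    (show 0 < v / 4 by linarith)).and (Filter.eventually_ge_atTop 1)))
  refine ⟨v / 4, by linarith, n₀, fun n hn => ?_⟩
  obtain ⟨e1, e2, hn1⟩ := hn₀ n hn
  have hn0 : (0 : ℝ) < n := by exact_mod_cast hn1
  rw [lt_div_iff₀ hn0] at e1
  rw [div_lt_iff₀ hn0] at e2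
  have e3 : ∀ X : PointConfig d, X.finSum (window d n) (fun x => windowWeight f n x * ξ x X) =
      ∑ z ∈ windowBox d n,
        X.finSum (cell z) fun x => scoreField ξ Set.univ (windowWeight f n) x X := fun X => by
    rw [finSum_window X fun x hx => by rw [windowWeight_of_notMem hn1 hx, zero_mul]]
    simp only [scoreField_univ, mul_comm]
  simp only [e3] at e1
  rw [(hV n).sq_sub_sq_eq_sum_cellCov hL hβ hK h.exp_moment] at e1
  simp only [geomStat_eq_sum_cell hn1]
  rw [(hY n hn1).sq_sub_sq_eq_sum_cellCov hL hβ hK h.exp_moment]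
  have e4 := (Finset.abs_sum_le_sum_abs _ _).trans (Finset.sum_le_sum fun z (_ : z ∈ windowBox d n) =>
    Finset.abs_sum_le_sum_abs (fun z' => cellCov P (scoreField ξ (window d n) (windowWeight f n)) z z'
      - cellCov P (scoreField ξ Set.univ (windowWeight f n)) z z') (windowBox d n))
  simp only [Finset.sum_sub_distrib] at e4
  have e5 := abs_le.1 (e4.trans e2.le)
  linarith [e5.1]

end VarianceLowerBound

/-! ### Comparison of exponents and the concentration inequality -/

section Concentration

variable {d : ℕ} {a ahat b β γ₂ : ℝ}

/-- With D = d/((1-a) ahat) the two branches of γ are D ≥ 1 and D < 1, the cases of the maximum in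
`lengthExponent`. In the second one a D ≤ a accounts for the summand a. -/
theorem le_gammaExponent (hd : 1 ≤ d) (ha₀ : 0 ≤ a) (ha₁ : a < 1) (hahat : 0 < ahat) (hb : 0 ≤ b)
    (hβ : 0 ≤ β) : 1 ≤ gammaExponent d a ahat b β γ₂ ∧
      β + 1 + 1 + d / ((1 - a) * ahat) + lengthExponent d a ahat b * d ≤
        1 + 2 * gammaExponent d a ahat b β γ₂ := by
  have h1a : 0 < 1 - a := by linarith
  have hm : β ≤ max γ₂ β := le_max_right _ _
  have hm0 : 0 ≤ max γ₂ β := hβ.trans hm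
  have hd0 : (0 : ℝ) < d := by exact_mod_cast hd
  set D := (d : ℝ) / ((1 - a) * ahat) with hD
  have hD0 : 0 < D := by positivity
  have hDa : d / ahat = (1 - a) * D := by rw [hD]; field_simp
  have hDinv : (1 - a) * ahat / d = D⁻¹ := by rw [hD, inv_div]
  have hquad : b * (d : ℝ) ^ 2 / ((1 - a) * ahat) = b * D * d := by rw [hD]; ring
  have hlen : lengthExponent d a ahat b * d = b * max 1 D * d + (1 - a) * D := by
    rw [lengthExponent, ← hDa, ← hD]; ring
  have haD : 0 ≤ a * D := by positivity
  rw [hlen, gammaExponent, hDinv, hquad, hDa, ← hD]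
  have hbd : 0 ≤ b * d := by positivity
  split_ifs with h
  · have h1 : 1 ≤ D := by
      rw [inv_le_one₀ hD0] at h
      exact h
    have : 0 ≤ b * D * d := by positivity
    rw [max_eq_right h1]
    constructor <;> nlinarith
  · have h1 : D < 1 := by
      rw [not_le, one_lt_inv₀ hD0] at h
      exact h
    have h2 : a * D ≤ a := mul_le_of_le_one_right ha₀ h1.le
    have h3 : 0 ≤ (1 - a) * D := by positivity
    rw [max_eq_left h1.le]
    constructor <;> nlinarith

/-- Two of the j powers of A, together with the number of cells, are traded for t² ≥ v n at the cost
of the factor G. As j - 2 ≥ 1, this factor is absorbed by putting G into the denominator of Δ. -/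
theorem card_mul_pow_le_div {N A v n m : ℝ} (hA : 1 ≤ A) (hv : 0 < v) (hn : 0 < n)
    (hN : N ≤ m * n) {t : ℝ} (ht : 0 < t) (htv : v * n ≤ t ^ 2) {j : ℕ} (hj : 3 ≤ j) :
    N * A ^ j ≤ t ^ j / (√v / (max 1 (m * A ^ 2 / v) * A) * √n) ^ (j - 2) := by
  set G := max 1 (m * A ^ 2 / v) with hG
  have hG1 : 1 ≤ G := le_max_left _ _
  have hA0 : 0 < A := by linarith
  have hG0 : 0 < G := by linarith
  obtain ⟨i, rfl⟩ : ∃ i, j = i + 2 := ⟨j - 2, by omega⟩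
  rw [Nat.add_sub_cancel]
  have hsn : 0 < √n := Real.sqrt_pos.2 hn
  have hsv : 0 < √v := Real.sqrt_pos.2 hv
  rw [le_div_iff₀ (by positivity)]
  have h1 : √v * √n ≤ t := by
    rw [← Real.sqrt_mul hv.le]
    exact Real.sqrt_le_iff.2 ⟨ht.le, htv⟩
  have h2 : (√v / (G * A) * √n) ^ i ≤ t ^ i / (G * A ^ i) := by
    have h3 : √v / (G * A) * √n = √v * √n / (G * A) := by ring
    rw [h3, div_pow, mul_pow G]
    gcongr
    exact le_self_pow₀ hG1 (by omega)
  have h4 : m * A ^ 2 ≤ G * v := by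
    rw [← div_le_iff₀ hv]
    exact le_max_right _ _
  have h5 : N * A ^ 2 ≤ G * t ^ 2 := calc
    N * A ^ 2 ≤ m * n * A ^ 2 := by gcongr
    _ = m * A ^ 2 * n := by ring
    _ ≤ G * v * n := by gcongr
    _ = G * (v * n) := by ring
    _ ≤ G * t ^ 2 := by gcongr
  calc N * A ^ (i + 2) * (√v / (G * A) * √n) ^ i
      = N * A ^ 2 * (A ^ i * (√v / (G * A) * √n) ^ i) := by ring
    _ ≤ G * t ^ 2 * (A ^ i * (t ^ i / (G * A ^ i))) := by gcongr
    _ = t ^ (i + 2) := by field_simp; ring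

end Concentration

theorem mainTheorem4 (d : ℕ) (hd : 1 ≤ d)
    (P : Measure (PointConfig d)) [IsProbabilityMeasure P] (hP : IsStationaryLaw P)
    (ρ : (p : ℕ) → (Fin p → EuclideanSpace ℝ (Fin d)) → ℝ) (hρ : IsCorrelationFunction P ρ)
    (Q : (p : ℕ) → Kernel (Fin p → EuclideanSpace ℝ (Fin d)) (PointConfig d))
    (hQ : IsPalm P ρ Q)
    (ξ : EuclideanSpace ℝ (Fin d) → PointConfig d → ℝ) (hξ : IsScore ξ)
    (hR : Measurable (Function.uncurry (stabRadius ξ)))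
    (a ahat b β γ₁ γ₂ : ℝ) (ha₀ : 0 ≤ a) (ha₁ : a < 1) (hahat : 0 < ahat) (hb : 0 ≤ b)
    (hβ : 0 ≤ β) (hγ₁ : 0 ≤ γ₁) (hγ₂ : 0 ≤ γ₂)
    (hEDC : CondEDC ρ a ahat) (hST : CondST ρ Q ξ b) (hMG : CondMG ρ Q ξ β) (hPG : CondPG ξ γ₁ γ₂)
    (hσ : 0 < asympVariance ρ Q ξ)
    (f : EuclideanSpace ℝ (Fin d) → ℝ) (hf : Measurable f) (hf_bdd : ∃ M : ℝ, ∀ x, |f x| ≤ M)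
    (hf_pos : 0 < ∫ x in window d 1, f x ^ 2)
    (γ : ℝ) (hγ : γ = gammaExponent d a ahat b β γ₂) :
    ∃ c : ℝ, 0 < c ∧ ∃ n₀ : ℕ, ∀ n : ℕ, n₀ ≤ n →
      MemLp (geomStat ξ f n) 2 P ∧ 0 < variance (geomStat ξ f n) P ∧
      ∀ s : ℝ, 0 ≤ s →
        P.real {X | s ≤ |normStat P ξ f n X|} ≤
          2 * Real.exp (-(1 / 4) *
            min (s ^ 2 / 2 ^ (1 + γ)) ((s * (c * √(n : ℝ))) ^ (1 / (1 + 2 * γ)))) := by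
  obtain ⟨K, c, hK, hc, h⟩ := exists_isMixing hd hP hρ ha₀ ha₁ hEDC
  obtain ⟨C, hC, hmom⟩ := exists_hasScoreMoments_window h hK hQ hρ hξ.measurable hR hST hMG
  obtain ⟨M, hM, hfM⟩ : ∃ M : ℝ, 1 ≤ M ∧ ∀ x, |f x| ≤ M := by
    obtain ⟨M, hM⟩ := hf_bdd
    exact ⟨max 1 M, le_max_left _ _, fun x => (hM x).trans (le_max_right _ _)⟩
  have hL : 1 ≤ 4 * C * M := by nlinarith
  have hY : ∀ n, 1 ≤ n → IsLocalizable P (scoreField ξ (window d n) (windowWeight f n))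
      (4 * C * M) β b := fun n hn => (hmom n hn).isLocalizable hC hβ hb
    (measurableSet_window d n) hξ.measurable hR (measurable_windowWeight hf n) hM
    fun x => abs_indicator_window_le hfM _
  obtain ⟨v, hv, n₀, hvar⟩ := h.exists_variance_lower_bound hd hP hQ hρ hξ hR ha₁ hahat hK hc hC hβ
    hb hmom hσ hf hM hfM hf_pos
  obtain ⟨A, hA, hcum⟩ := h.exists_cumulant_bound ha₁ hahat hL hβ hb hK hc
  obtain ⟨hγ1, hγ2⟩ := le_gammaExponent (γ₂ := γ₂) hd ha₀ ha₁ hahat hb hβ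
  rw [← hγ] at hγ1 hγ2
  set G := max 1 (3 ^ d * A ^ 2 / v) with hG
  have hA0 : 0 < A := by linarith
  have hG0 : 0 < G := lt_of_lt_of_le one_pos (le_max_left _ _)
  have hsv : 0 < √v := Real.sqrt_pos.2 hv
  -- The first factor is the loss in the tail bound with ν = 2γ; the second is the Statulevičius
  -- constant Δ / √n from `card_mul_pow_le_div` with m = 3^d.
  refine ⟨(2 ^ (2 * γ) * 24)⁻¹ * (√v / (G * A)), by positivity, max n₀ 1, fun n hn => ?_⟩
  have hn1 : 1 ≤ n := (le_max_right _ _).trans hn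
  have hn0 : (0 : ℝ) < n := by exact_mod_cast hn1
  have hYn := hY n hn1
  have hgeom : geomStat ξ f n = fun X => ∑ z ∈ windowBox d n,
      X.finSum (cell z) fun x => scoreField ξ (window d n) (windowWeight f n) x X :=
    funext fun X => geomStat_eq_sum_cell hn1 X
  have hL2 : MemLp (geomStat ξ f n) 2 P := by
    rw [hgeom]
    exact memLp_finsetSum _ fun z _ => hYn.memLp_cellSum hL hβ hK h.exp_moment z
  have hVeq : variance (geomStat ξ f n) P =
      ∫ X, geomStat ξ f n X ^ 2 ∂P - (∫ X, geomStat ξ f n X ∂P) ^ 2 := variance_eq_sub hL2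
  have hVn : v * n ≤ variance (geomStat ξ f n) P := by
    rw [hVeq]
    exact hvar n ((le_max_left _ _).trans hn)
  have hV0 : 0 < variance (geomStat ξ f n) P := lt_of_lt_of_le (by positivity) hVn
  refine ⟨hL2, hV0, fun s hs => ?_⟩
  set t := √(variance (geomStat ξ f n) P) with ht
  have ht0 : 0 < t := Real.sqrt_pos.2 hV0
  have ht2 : t ^ 2 = variance (geomStat ξ f n) P := Real.sq_sqrt hV0.le
  set S : PointConfig d → ℝ := fun X => geomStat ξ f n X - ∫ Y, geomStat ξ f n Y ∂P with hS
  have hmean : ∫ X, geomStat ξ f n X ∂P = ∑ z ∈ windowBox d n,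
      cellMean P (scoreField ξ (window d n) (windowWeight f n)) z := by
    rw [hgeom]
    exact integral_finsetSum _ fun z _ =>
      (hYn.memLp_cellSum hL hβ hK h.exp_moment z).integrable (by norm_num)
  have hScell : ∀ X, S X = ∑ z ∈ windowBox d n,
      centeredCellSum (scoreField ξ (window d n) (windowWeight f n))
        (cellMean P (scoreField ξ (window d n) (windowWeight f n))) z X := fun X => by
    simp only [centeredCellSum, Finset.sum_sub_distrib]
    rw [← hmean, ← geomStat_eq_sum_cell hn1]
  have hSint : ∀ k : ℕ, Integrable (fun X => S X ^ k) P := fun k => by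
    simp only [hScell]
    exact hYn.integrable_pow_sum hL hβ hK h.exp_moment hYn.abs_cellMean_le _ k
  have hS0 : ∫ X, S X ∂P = 0 := by
    rw [hS, integral_sub (hL2.integrable (by norm_num)) (integrable_const _)]
    simp
  have hS2 : ∫ X, S X ^ 2 ∂P = t ^ 2 := by
    rw [ht2, variance_eq_integral hL2.aestronglyMeasurable.aemeasurable]
  have hset : {X | s ≤ |normStat P ξ f n X|} = {X | s * t ≤ |S X|} := by
    ext X
    simp only [Set.mem_ofPred_eq]
    rw [normStat, abs_div, abs_of_pos ht0, le_div_iff₀ ht0]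
  rw [hset]
  refine (measureReal_le_of_cumulantSeq_le hSint hS0 ht0 hS2
    (Δ := √v / (G * A) * √(n : ℝ)) (ν := 2 * γ) (by positivity) (by linarith) (fun j hj => ?_)
    hs).trans ?_
  · have h1 := hcum _ hYn _ hYn.abs_cellMean_le (windowBox d n) j (by omega)
    simp only [← hScell] at h1
    have h2 := card_mul_pow_le_div hA hv hn0 (card_windowBox_le hd hn1) ht0 (hVn.trans ht2.ge) hj
    have hj1 : (1 : ℝ) ≤ (j ! : ℝ) := by exact_mod_cast j.factorial_pos
    refine h1.trans ?_
    rw [← mul_assoc, mul_div_right_comm]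
    exact mul_le_mul h2 (Real.rpow_le_rpow_of_exponent_le hj1 hγ2) (by positivity) (by positivity)
  · have h4 : (4 : ℝ) ≤ 2 ^ (1 + γ) := by
      calc (4 : ℝ) = 2 ^ (2 : ℝ) := by norm_num
        _ ≤ _ := Real.rpow_le_rpow_of_exponent_le (by norm_num) (by linarith)
    rw [mul_assoc _ (√v / (G * A))]
    refine mul_le_mul_of_nonneg_left (Real.exp_le_exp.2 ?_) (by norm_num)
    refine mul_le_mul_of_nonpos_left (min_le_min ?_ le_rfl) (by norm_num)
    gcongr
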